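/- **Objects.** A CGS over $AP$, agents $Ag$, actions $Ac$ consists of a set of states, an initial state $s_0$, a labeling of states by subsets of $AP$, and a partial transition function $\tau$ on pairs (state, full decision $d\in Ac^{Ag}$), such that at each state some full decision is defined. A decision of a set of agents is available at a state if it extends to a full decision at which $\tau$ is defined. A state is controlled by agent $a$ if exactly one decision of $Ag\setminus\{a\}$ is available there; $a$ is passive in it if exactly one decision of $a$ is available. The CGS is open if every state is controlled by $env$ (environment state) or $env$ is passive in it (system state). An environment strategy tree in $exec(\mathcal G)$ is a tree obtained from the unwinding of $\mathcal G$ by pruning at each environment state some, but not all, successors; it is again a CGS on its nodes (a transition leading to a pruned node is undefined). A PMS $\mathcal S$ has finite sets of control states $Q$ and stack symbols $\Gamma$, a bottom symbol $\gamma_0\notin\Gamma$, an initial state, a labeling $Q\to 2^{AP}$, and a partial function $\Delta$ from $Q\times(\Gamma\cup\{\gamma_0\})\times Ac^{Ag}$ to $Q\times\Gamma^*$ that for each (state, top) is defined for some decision; $\mathcal G(\mathcal S)$ is the CGS on its configurations $(q,\beta\gamma_0)$, starting from $(q_0,\gamma_0)$, where a transition replaces the top by the pushed word ($\gamma_0$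 is never removed). It is open if $\mathcal G(\mathcal S)$ is. An ATM $\mathcal M$ has an alphabet $\Sigma$ with a blank, states partitioned into universal and existential ones, an initial state, accepting states and $\delta:Q\times\Sigma\to(Q\times\Sigma\times\{\leftarrow,\rightarrow\})^2$. Configurations are words in $\Sigma^*(Q\times\Sigma)\Sigma^*$. Let $\Lambda$ be the set of triples $(u_p,u,u_s)$ with $u\in\Sigma\cup(Q\times\Sigma)$ and $u_p,u_s\in\Sigma\cup(Q\times\Sigma)\cup\{\vdash\}$, and $$AP=\Lambda\cup\{0,1,\forall,\exists,l,r,f,s_1,s_2,s_3,e_1,e_2,e_3,check_1,check_2,check_3,\widehat{check_3}\}.$$ **Codes.** A $0$-block is $\{b\}$ with $b\in\{0,1\}$. For $h=1,2,3$ an $h$-block is a word $\{s_h\}\,bl_0\cdots bl_t\,\{\tau\}\{e_h\}$ with $t\ge1$, $bl_i$ being $(h-1)$-blocks, and content $\tau\in\{0,1\}$ if $h\neq3$, $\tau\in\Lambda$ if $h=3$. A code of a configuration $C=u_1\cdots u_k$ is $tag_1\,bl_1\cdots bl_k\,tag_2$ with $tag_1\in\{\{l\},\{r\}\}$, $bl_i$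 a $3$-block with content $(u_{i-1},u_i,u_{i+1})$ ($u_0=u_{k+1}=\vdash$), and $tag_2=\{f\}$ if $C$ is accepting, $\{\exists\}$ if $C$ is non-accepting and existential, $\{\forall\}$ otherwise. **Trees.** Trees are labeled by $2^{AP}$ and identified up to isomorphism. A tree is minimal if the children of each node have distinct labels; a branching node is a node with at least two children. A tree-code is a finite minimal tree with root labeled $\{l\}$ such that the labels along each maximal path from the root form a sequence of configuration codes, a node is labeled $\{f\}$ iff it is a leaf, and each $\{\forall\}$-node has exactly two children, labeled $\{l\}$ and $\{r\}$. The check $2$-block-tree of a $2$-block $bl_2$ with content $b$ is the minimal infinite tree whose infinite branches are labeled by: the reverse of $bl_2$, with its content label replaced by $\{b,check_2\}$, followed by $\emptyset^\omega$; and, for each $1$-sub-block $bl_1$ of $bl_2$ with content $c$, the same word up to and including the $\{s_1\}$ of $bl_1$, with the content label of $bl_1$ replaced by $\{c,check_1\}$, followed by $\emptyset^\omega$. A partial check $2$-block-tree is obtained from it by pruning some, but not all, choices at $\{e_1\}$-branching nodes. A simple check-tree for a sequence $\nu$ of codes is a minimal infinite tree such that: (i) each infinite path from the root is labeled by the reverse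 of $\nu$ followed by $\emptyset^\omega$, where in addition the content of exactly one $3$-block $bl_3$ is marked by $check_3$, and, if $bl_3$ is not in the first code of $\nu$, the content of exactly one $3$-block is marked by $\widehat{check_3}$, this block being in the code immediately preceding that of $bl_3$ in $\nu$ (if $bl_3$ is in the first code, there is no $\widehat{check_3}$ mark); (ii) each $3$-block of $\nu$ is marked by $check_3$ on some path; (iii) each branching node is labeled $\{e_3\}$ and has exactly two children, labeled $\{\lambda\}$ and $\{\lambda,tag\}$ with $\lambda\in\Lambda$, $tag\in\{check_3,\widehat{check_3}\}$ (a $tag$-branching node). A check-tree for $\nu$ is a minimal tree obtained from a simple check-tree $T'$ for $\nu$ by adding to each $\{e_2\}$-node $x$ of $T'$ one further child with a subtree, so that $x$ together with this new subtree is a partial check $2$-block-tree for the $2$-block of $\nu$ whose reverse starts at $x$. An extended tree-code is a minimal tree obtained from a tree-code by replacing each leaf $x$ by a check-tree for the sequence of codes on the path from the root to $x$. A strategy tree is accepting if each infinite path from its root visits an $\{f\}$-node. Its check-subtrees are the subtrees rooted at its $\{f\}$-nodes. **Lemma.** There is a polynomial-time (Turing machine) construction which, given an ATM $\mathcal M$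 (as an explicit table of its states, alphabet and transitions), outputs an explicit description of an open PMS $\mathcal S$ over $AP$ and $Ag=\{env,sys\}$ such that: 1. the set of $2^{AP}$-labeled trees underlying the accepting strategy trees in $exec(\mathcal G(\mathcal S))$ coincides with the set of extended tree-codes; 2. for each accepting strategy tree in $exec(\mathcal G(\mathcal S))$, the nodes of its check-subtrees that are controlled by the system in that strategy tree are exactly the $check_3$-branching nodes and the $\{e_2\}$-branching nodes. -/

import Mathlib

namespace PushdownGames

/-! ## Labeled trees -/

/-- A nonempty (finite or infinite) tree over the set `Υ` of directions, whose nodes are labeled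
in `A`; the root is `[]`, and a child of a node `x` has the form `x ++ [a]`.
Only the values of `lab` on nodes matter. -/
structure LTree (Υ : Type) (A : Type) where
  nodes : Set (List Υ)
  lab : List Υ → A
  root_mem : [] ∈ nodes
  prefix_closed : ∀ x a, x ++ [a] ∈ nodes → x ∈ nodes

namespace LTree

variable {Υ Υ' A : Type}

/-- `y` is a child of `x` in `T`. -/
def IsChild (T : LTree Υ A) (x y : List Υ) : Prop :=
  y ∈ T.nodes ∧ ∃ a, y = x ++ [a]

/-- Every node has a child. -/
def IsInfinite (T : LTree Υ A) : Prop :=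
  ∀ x ∈ T.nodes, ∃ y, T.IsChild x y

def IsLeaf (T : LTree Υ A) (x : List Υ) : Prop :=
  x ∈ T.nodes ∧ ∀ y, ¬ T.IsChild x y

/-- The children of each node have distinct labels. -/
def IsMinimal (T : LTree Υ A) : Prop :=
  ∀ x y z, T.IsChild x y → T.IsChild x z → T.lab y = T.lab z → y = z

/-- `x` has at least two distinct children. -/
def IsBranching (T : LTree Υ A) (x : List Υ) : Prop :=
  ∃ y z, T.IsChild x y ∧ T.IsChild x z ∧ y ≠ z

/-- An infinite path from the root. -/
def IsPath (T : LTree Υ A) (π : ℕ → List Υ) : Prop :=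
  π 0 = [] ∧ ∀ n, T.IsChild (π n) (π (n + 1))

/-- The sequence of labels on the path from the root to `x` (both included). -/
def pathLabels (T : LTree Υ A) (x : List Υ) : List A :=
  x.inits.map T.lab

/-- The subtree of `T` rooted at the node `x`. -/
def subtree (T : LTree Υ A) (x : List Υ) (hx : x ∈ T.nodes) : LTree Υ A where
  nodes := {z | x ++ z ∈ T.nodes}
  lab z := T.lab (x ++ z)
  root_mem := by simpa using hx
  prefix_closed z a h := T.prefix_closed (x ++ z) a (by simpa [List.append_assoc] using h)

/-- The subtree of `T` rooted at `x`, without the children of `x` that belong to the set `N`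
and without the subtrees rooted at these children. -/
def subtreeWithout (T : LTree Υ A) (N : Set (List Υ)) (x : List Υ) (hx : x ∈ T.nodes) :
    LTree Υ A where
  nodes := {z | x ++ z ∈ T.nodes ∧ ∀ a z', z = a :: z' → x ++ [a] ∉ N}
  lab z := T.lab (x ++ z)
  root_mem := by simpa using hx
  prefix_closed z a h := by
    refine ⟨T.prefix_closed (x ++ z) a (by simpa [List.append_assoc] using h.1), ?_⟩
    rintro b z' rfl
    exact h.2 b (z' ++ [a]) (by simp)

/-- Two labeled trees, possibly over different sets of directions, are the same up to the names
of the nodes. -/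
def Iso (T : LTree Υ A) (T' : LTree Υ' A) : Prop :=
  ∃ φ : T.nodes ≃ T'.nodes,
    (∀ x y : T.nodes, T.IsChild x y ↔ T'.IsChild (φ x) (φ y)) ∧ ∀ x, T'.lab (φ x) = T.lab x

end LTree

/-! ## Concurrent game structures -/

/-- A concurrent game structure with set of states `S`; full decisions are functions `Ag → Ac`,
and `none` stands for "undefined". -/
structure CGS (AP Ag Ac S : Type) where
  start : S
  lab : S → Set AP
  trans : S → (Ag → Ac) → Option S
  serial : ∀ s, ∃ d, (trans s d).isSome

namespace CGS

variable {AP Ag Ac S : Type}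

/-- The decision `dA` of the agents in `A` is available at `s`: it extends to a full decision at
which the transition function is defined. -/
def Available (G : CGS AP Ag Ac S) (A : Set Ag) (dA : A → Ac) (s : S) : Prop :=
  ∃ d : Ag → Ac, (∀ a : A, d a = dA a) ∧ (G.trans s d).isSome

/-- `s` is controlled by `a`: exactly one decision of the agents other than `a` is available. -/
def ControlledBy (G : CGS AP Ag Ac S) (a : Ag) (s : S) : Prop :=
  ∃! d : ({a}ᶜ : Set Ag) → Ac, G.Available {a}ᶜ d s

/-- `a` is passive in `s`: exactly one decision of `a` is available. -/
def Passive (G : CGS AP Ag Ac S) (a : Ag) (s : S) : Prop :=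
  ∃! d : ({a} : Set Ag) → Ac, G.Available {a} d s

/-- `G` is open for the environment `env`. -/
def IsOpen (G : CGS AP Ag Ac S) (env : Ag) : Prop :=
  ∀ s, G.ControlledBy env s ∨ G.Passive env s

/-- `s'` is a successor of `s`. -/
def Succ (G : CGS AP Ag Ac S) (s s' : S) : Prop :=
  ∃ d, G.trans s d = some s'

/-- The last state of the track `start · ν`. -/
def lst (G : CGS AP Ag Ac S) (ν : List S) : S :=
  ν.getLastD G.start

end CGS

/-- An environment strategy tree of `G`: a set of nodes of the unwinding of `G` (a node `ν`
stands for the track `G.start · ν`) that is prefix closed, contains with a system state all the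
successors of that state, and contains with an environment state a nonempty set of successors of
that state. -/
structure StrategyTree {AP Ag Ac S : Type} (G : CGS AP Ag Ac S) (env : Ag) where
  nodes : Set (List S)
  root_mem : [] ∈ nodes
  prefix_closed : ∀ ν s, ν ++ [s] ∈ nodes → ν ∈ nodes
  track : ∀ ν ∈ nodes, List.IsChain G.Succ (G.start :: ν)
  system : ∀ ν ∈ nodes, G.Passive env (G.lst ν) → ∀ s, G.Succ (G.lst ν) s → ν ++ [s] ∈ nodes
  nonblocking : ∀ ν ∈ nodes, ∃ s, ν ++ [s] ∈ nodes

namespace StrategyTree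

variable {AP Ag Ac S : Type} {G : CGS AP Ag Ac S} {env : Ag}

/-- The underlying labeled tree. -/
def toLTree (𝒯 : StrategyTree G env) : LTree S (Set AP) where
  nodes := 𝒯.nodes
  lab ν := G.lab (G.lst ν)
  root_mem := 𝒯.root_mem
  prefix_closed := 𝒯.prefix_closed

theorem succ_of_mem (𝒯 : StrategyTree G env) {ν : List S} {s : S} (h : ν ++ [s] ∈ 𝒯.nodes) :
    G.Succ (G.lst ν) s := by
  have hc := 𝒯.track _ h
  rw [← List.cons_append, List.isChain_append] at hc
  exact hc.2.2 _ (by simp [CGS.lst, List.getLast?_cons, List.getLastD_eq_getLast?]) _ (by simp)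

open Classical in
/-- The concurrent game tree: the game structure on the nodes in which the transitions of `G`
to pruned nodes are undefined. -/
noncomputable def toCGS (𝒯 : StrategyTree G env) : CGS AP Ag Ac 𝒯.nodes where
  start := ⟨[], 𝒯.root_mem⟩
  lab ν := G.lab (G.lst ν)
  trans ν d := (G.trans (G.lst ν) d).bind fun s =>
    if h : (ν : List S) ++ [s] ∈ 𝒯.nodes then some ⟨ν ++ [s], h⟩ else none
  serial := by
    rintro ⟨ν, hν⟩
    obtain ⟨s, hs⟩ := 𝒯.nonblocking ν hν
    obtain ⟨d, hd⟩ := 𝒯.succ_of_mem hs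
    exact ⟨d, by simp [hd, hs]⟩

end StrategyTree

/-! ## Pushdown multi-agent systems -/

/-- A pushdown multi-agent system with finite sets `Ac` of actions, `Q` of control states and `Γ`
of stack symbols other than the bottom symbol. A top of the stack is an element of `Option Γ`,
where `none` is the bottom symbol; the value `none` of `Δ` stands for "undefined". -/
structure PMS (AP Ag Ac Q Γ : Type) [Finite AP] [Finite Ag] [Finite Ac] [Finite Q] [Finite Γ] where
  start : Q
  lab : Q → Set AP
  Δ : Q → Option Γ → (Ag → Ac) → Option (Q × List Γ)
  total : ∀ q γ, ∃ d, (Δ q γ d).isSome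

/-- The game structure induced by a pushdown system. The configuration with control state `q`
and stack content `β · bottom` is the pair `(q, β)`; the top of the stack comes first. -/
def PMS.toCGS {AP Ag Ac Q Γ : Type} [Finite AP] [Finite Ag] [Finite Ac] [Finite Q] [Finite Γ]
    (S : PMS AP Ag Ac Q Γ) : CGS AP Ag Ac (Q × List Γ) where
  start := (S.start, [])
  lab c := S.lab c.1
  trans c d := (S.Δ c.1 c.2.head? d).map fun r => (r.1, r.2 ++ c.2.tail)
  serial c := by simpa using S.total c.1 c.2.head?

/-- The two agents. -/
inductive Agent
  | env
  | sys
  deriving DecidableEq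

instance : Fintype Agent := ⟨{.env, .sys}, fun a => by cases a <;> simp⟩

/-! ## Alternating Turing machines -/

/-- An alternating Turing machine with binary branching degree. Its input alphabet and its set of
states are initial segments of `ℕ`; the existential states are the states outside `universal`. In
`δ`, the first triple is the left one, and `false`, `true` are the moves to the left, to the
right. -/
structure ATM where
  numSym : ℕ
  numState : ℕ
  blank : Fin numSym
  start : Fin numState
  universal : Finset (Fin numState)
  accepting : Finset (Fin numState)
  δ : Fin numState → Fin numSym →
    (Fin numState × Fin numSym × Bool) × (Fin numState × Fin numSym × Bool)

namespace ATM

abbrev Sym (M : ATM) : Type := Fin M.numSym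

abbrev State (M : ATM) : Type := Fin M.numState

/-- The letters of the words that represent configurations: tape symbols, and pairs of the
current state and the scanned symbol. -/
abbrev Cell (M : ATM) : Type := M.Sym ⊕ (M.State × M.Sym)

/-- `C` is a configuration with current state `q`. -/
def IsConfig (M : ATM) (q : M.State) (C : List M.Cell) : Prop :=
  ∃ (η η' : List M.Sym) (σ : M.Sym), C = η.map Sum.inl ++ [Sum.inr (q, σ)] ++ η'.map Sum.inl

/-- The list of the triples (previous letter, letter, next letter) at the positions of `C`, where
`none` is the end marker. -/
def windows (M : ATM) (C : List M.Cell) : List (Option M.Cell × M.Cell × Option M.Cell) :=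
  List.zip (none :: C.map some) (List.zip C (C.tail.map some ++ [none]))

end ATM

/-- The atomic propositions: the set `Λ` of triples `lam u_p u u_s` (where `none` is the end
marker), the other elements of `Main`, and the four marks. -/
inductive Prp (M : ATM)
  | lam (p : Option M.Cell) (u : M.Cell) (s : Option M.Cell)
  | zero | one
  | all | ex
  | l | r | f
  | start1 | start2 | start3
  | end1 | end2 | end3
  | check1 | check2 | check3 | checkHat3
  deriving DecidableEq, Fintype

/-! ## Blocks and codes of configurations -/

section Codes

variable {M : ATM}

/-- Words over the labels `2^AP`. -/
abbrev Word (M : ATM) : Type := List (Set (Prp M))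

def IsBit (p : Prp M) : Prop := p = .zero ∨ p = .one

/-- `w = {s} · bl_0 ⋯ bl_t · {c} · {e}` with `t ≥ 1`, where the sub-blocks satisfy `Sub`. -/
def IsBlockOver (s e : Prp M) (Sub : Word M → Prop) (c : Prp M) (w : Word M) : Prop :=
  ∃ bs : List (Word M), 2 ≤ bs.length ∧ (∀ b ∈ bs, Sub b) ∧
    w = [{s}] ++ bs.flatten ++ [{c}, {e}]

def IsBlock0 (w : Word M) : Prop := ∃ b, IsBit b ∧ w = [{b}]

/-- `w` is a 1-block with content `c`. -/
def IsBlock1 (c : Prp M) (w : Word M) : Prop :=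
  IsBit c ∧ IsBlockOver .start1 .end1 IsBlock0 c w

/-- `w` is a 2-block with content `c`. -/
def IsBlock2 (c : Prp M) (w : Word M) : Prop :=
  IsBit c ∧ IsBlockOver .start2 .end2 (fun b => ∃ c', IsBlock1 c' b) c w

/-- `w` is a 3-block with content the triple `t`. -/
def IsBlock3 (t : Option M.Cell × M.Cell × Option M.Cell) (w : Word M) : Prop :=
  IsBlockOver .start3 .end3 (fun b => ∃ c', IsBlock2 c' b) (.lam t.1 t.2.1 t.2.2) w

open Classical in
/-- The closing tag of the code of a configuration with state `q`. -/
noncomputable def closingTag (q : M.State) : Prp M :=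
  if q ∈ M.accepting then .f else if q ∈ M.universal then .all else .ex

/-- `w` is a code of a configuration of `M`. -/
def IsConfigCode (w : Word M) : Prop :=
  ∃ (q : M.State) (C : List M.Cell) (tag : Prp M) (bs : List (Word M)),
    M.IsConfig q C ∧ (tag = .l ∨ tag = .r) ∧ List.Forall₂ IsBlock3 (M.windows C) bs ∧
    w = [{tag}] ++ bs.flatten ++ [{closingTag q}]

/-- `ν` is a sequence of codes of configurations; the word itself is `ν.flatten`. -/
def IsCodeSeq (ν : List (Word M)) : Prop := ∀ w ∈ ν, IsConfigCode w

/-! ## Tree-codes -/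

/-- `T` is a tree-code; its root, which belongs to the code of the initial configuration, has
label `{l}`. -/
def IsTreeCode {Υ : Type} (T : LTree Υ (Set (Prp M))) : Prop :=
  T.nodes.Finite ∧ T.IsMinimal ∧ T.lab [] = {.l} ∧
  (∀ x, T.IsLeaf x → ∃ ν, IsCodeSeq ν ∧ ν.flatten = T.pathLabels x) ∧
  (∀ x ∈ T.nodes, T.lab x = {.f} ↔ T.IsLeaf x) ∧
  (∀ x ∈ T.nodes, T.lab x = {.all} → ∃ y z, T.IsChild x y ∧ T.IsChild x z ∧
    T.lab y = {.l} ∧ T.lab z = {.r} ∧ ∀ w, T.IsChild x w → w = y ∨ w = z)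

/-! ## Check-trees -/

/-- The infinite word `w · ∅^ω`. -/
def padOmega (w : Word M) : ℕ → Set (Prp M) := fun d => w[d]?.getD ∅

/-- The labels of the infinite branches of the check 2-block-tree for the 2-block `bl`. Either
the branch is the reverse of `bl`, with the content of `bl` marked by `check2`; or it follows the
same word up to the content of some 1-sub-block, marks this content by `check1`, and stops at the
beginning of this sub-block. In both cases it goes on with `∅^ω`. -/
def IsCheckTwoBranch (bl : Word M) (L : ℕ → Set (Prp M)) : Prop :=
  ∃ (bs : List (Word M)) (c : Prp M), IsBit c ∧ 2 ≤ bs.length ∧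
    (∀ b ∈ bs, ∃ c', IsBlock1 c' b) ∧ bl = [{.start2}] ++ bs.flatten ++ [{c}, {.end2}] ∧
    (L = padOmega ([{Prp.start2}] ++ bs.flatten ++ [{c, Prp.check2}, {Prp.end2}]).reverse ∨
      ∃ (bs₁ bs₂ : List (Word M)) (u : Word M) (c' : Prp M),
        bs = bs₁ ++ [u ++ [{c'}, {.end1}]] ++ bs₂ ∧
        L = padOmega
          (u ++ [{c', Prp.check1}, {Prp.end1}] ++ bs₂.flatten ++
            [{c, Prp.check2}, {Prp.end2}]).reverse)

/-- `T` is a partial check 2-block-tree for `bl`. The check 2-block-tree is the minimal infinite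
tree whose branches are exactly those described by `IsCheckTwoBranch`; its branching nodes are
labeled by `{end1}`, and to prune some (not all) of the choices at these nodes is to keep a
nonempty part of its branches. -/
def IsPartialCheckTwoTree {Υ : Type} (bl : Word M) (T : LTree Υ (Set (Prp M))) : Prop :=
  T.IsMinimal ∧ T.IsInfinite ∧ ∀ π, T.IsPath π → IsCheckTwoBranch bl fun d => T.lab (π d)

/-- The position `i` of `ν.flatten` carries the content of a 3-block of `ν` (elements of `Λ`
occur in codes only as contents of 3-blocks). A 3-block of `ν` is identified with this
position. -/
def IsContentPos (ν : List (Word M)) (i : ℕ) : Prop :=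
  ∃ p u s, ν.flatten[i]? = some {.lam p u s}

/-- The position `i` of `ν.flatten` belongs to the code `ν[k]`. -/
def InCode (ν : List (Word M)) (k i : ℕ) : Prop :=
  (ν.take k).flatten.length ≤ i ∧ i < (ν.take (k + 1)).flatten.length

/-- An admissible choice of the 3-block `i` marked by `check3` and of the 3-block, if any, marked
by `checkHat3`: if `i` is in the first code, there is no second one; otherwise the second one is
in the code immediately before that of `i`. -/
def IsMarking (ν : List (Word M)) (i : ℕ) (j : Option ℕ) : Prop :=
  IsContentPos ν i ∧
    ((InCode ν 0 i ∧ j = none) ∨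
      ∃ k i', InCode ν (k + 1) i ∧ j = some i' ∧ IsContentPos ν i' ∧ InCode ν k i')

/-- The reverse of `ν`, with the marks at the positions `i` and `j` of `ν.flatten`, followed by
`∅^ω`. -/
def markedReverse (ν : List (Word M)) (i : ℕ) (j : Option ℕ) : ℕ → Set (Prp M) :=
  padOmega (ν.flatten.mapIdx fun n a =>
    a ∪ {p | p = .check3 ∧ n = i} ∪ {p | p = .checkHat3 ∧ some n = j}).reverse

/-- `x` is labeled by `{end3}` and has exactly two children, one labeled by `{λ}` and one labeled
by `{λ, tag}`, for some `λ ∈ Λ`. -/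
def IsTagBranching {Υ : Type} (T : LTree Υ (Set (Prp M))) (tag : Prp M) (x : List Υ) : Prop :=
  T.lab x = {.end3} ∧ ∃ p u s y z, T.IsChild x y ∧ T.IsChild x z ∧
    T.lab y = {.lam p u s} ∧ T.lab z = {.lam p u s, tag} ∧ ∀ w, T.IsChild x w → w = y ∨ w = z

/-- `T` is a simple check-tree for the sequence `ν` of codes. -/
def IsSimpleCheckTree {Υ : Type} (ν : List (Word M)) (T : LTree Υ (Set (Prp M))) : Prop :=
  T.IsMinimal ∧ T.IsInfinite ∧
  (∀ π, T.IsPath π → ∃ i j, IsMarking ν i j ∧ ∀ d, T.lab (π d) = markedReverse ν i j d) ∧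
  (∀ i, IsContentPos ν i → ∃ π j, T.IsPath π ∧ IsMarking ν i j ∧
    ∀ d, T.lab (π d) = markedReverse ν i j d) ∧
  (∀ x ∈ T.nodes, T.IsBranching x → IsTagBranching T .check3 x ∨ IsTagBranching T .checkHat3 x)

/-- `T` is a check-tree for the sequence `ν` of codes: it is obtained from a simple check-tree
`T'` by the addition, at each `{end2}`-node `x` of `T'`, of one child and a subtree rooted at it,
so that `x` with this new subtree is a partial check 2-block-tree for the 2-block associated with
`x`. As `x` has depth `x.length`, this is the 2-block whose reverse starts at the position
`x.length` of the reverse of `ν`. -/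
def IsCheckTree {Υ : Type} (ν : List (Word M)) (T : LTree Υ (Set (Prp M))) : Prop :=
  T.IsMinimal ∧ ∃ T' : LTree Υ (Set (Prp M)), IsSimpleCheckTree ν T' ∧
    (∀ x ∈ T'.nodes, T.lab x = T'.lab x) ∧
    (∀ x ∈ T'.nodes, T'.lab x ≠ {.end2} → ∀ y, T.IsChild x y → y ∈ T'.nodes) ∧
    ∀ x ∈ T'.nodes, ∃ hx : x ∈ T.nodes, T'.lab x = {.end2} →
      (∃! y, T.IsChild x y ∧ y ∉ T'.nodes) ∧
      ∃ bl c, IsBlock2 c bl ∧ bl.reverse <+: ν.flatten.reverse.drop x.length ∧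
        IsPartialCheckTwoTree bl (T.subtreeWithout T'.nodes x hx)

/-- `T` is an extended tree-code: a minimal tree obtained from a tree-code `T₀` by the replacement
of each leaf by a check-tree for the sequence of codes on the path to this leaf. -/
def IsExtendedTreeCode {Υ : Type} (T : LTree Υ (Set (Prp M))) : Prop :=
  T.IsMinimal ∧ ∃ T₀ : LTree Υ (Set (Prp M)), IsTreeCode T₀ ∧
    (∀ x ∈ T₀.nodes, T.lab x = T₀.lab x) ∧
    (∀ x ∈ T₀.nodes, ¬ T₀.IsLeaf x → ∀ y, T.IsChild x y → y ∈ T₀.nodes) ∧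
    ∀ x ∈ T₀.nodes, ∃ hx : x ∈ T.nodes, T₀.IsLeaf x →
      ∃ ν, IsCodeSeq ν ∧ ν.flatten = T₀.pathLabels x ∧ IsCheckTree ν (T.subtree x hx)

/-- Each infinite path from the root visits a node labeled by `{f}`. -/
def IsAccepting {Υ : Type} (T : LTree Υ (Set (Prp M))) : Prop :=
  ∀ π, T.IsPath π → ∃ n, T.lab (π n) = {.f}

/-- `x` is a node of a check-subtree of `T`, that is, of a subtree rooted at an `{f}`-node. -/
def InCheckSubtree {Υ : Type} (T : LTree Υ (Set (Prp M))) (x : List Υ) : Prop :=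
  x ∈ T.nodes ∧ ∃ y, y <+: x ∧ T.lab y = {.f}

end Codes

/-! ## Descriptions of machines and pushdown systems as strings -/

/-- The alphabet of the descriptions. -/
inductive Token
  | tick
  | comma
  | semicolon
  | newline
  deriving DecidableEq

instance : Fintype Token :=
  ⟨{.tick, .comma, .semicolon, .newline}, fun a => by cases a <;> simp⟩

/-- A table: a list of records, whose fields are lists of natural numbers. -/
abbrev Table : Type := List (List (List ℕ))

/-- A table as a string: numbers are written in unary and end with a comma, fields end with a
semicolon, records end with a newline. Unary notation does not change the meaning of "polynomial":
the numbers in the description of an alternating machine are at most the numbers of its states and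
symbols, and its transition table lists all pairs of a state and a symbol. -/
def Table.write (t : Table) : List Token :=
  t.flatMap fun rec =>
    (rec.flatMap fun fld =>
      (fld.flatMap fun n => List.replicate n Token.tick ++ [Token.comma]) ++
        [Token.semicolon]) ++ [Token.newline]

namespace ATM

/-- The description of an alternating machine: sizes, blank symbol and initial state; then the
flags of each state; then the transition table. -/
def table (M : ATM) : Table :=
  [[[M.numSym], [M.numState], [M.blank.val], [M.start.val]]] ++
  (List.finRange M.numState).map (fun q =>
    [[q.val], [if q ∈ M.universal then 1 else 0], [if q ∈ M.accepting then 1 else 0]]) ++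
  (List.finRange M.numState).flatMap fun q => (List.finRange M.numSym).map fun σ =>
    let t := M.δ q σ
    [[q.val, σ.val], [t.1.1.val, t.1.2.1.val, t.1.2.2.toNat],
      [t.2.1.val, t.2.2.1.val, t.2.2.2.toNat]]

/-- The description of an alternating machine as a string; its length is the size of `M`. -/
def write (M : ATM) : List Token := M.table.write

/-- The name of a letter or of the end marker. -/
def cellName (M : ATM) : Option M.Cell → List ℕ
  | none => [0, 0]
  | some (Sum.inl σ) => [0, σ.val + 1]
  | some (Sum.inr (q, σ)) => [q.val + 1, σ.val + 1]

end ATM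

/-- The name of an atomic proposition. -/
def Prp.name {M : ATM} : Prp M → List ℕ
  | lam p u s => [0] ++ M.cellName p ++ M.cellName (some u) ++ M.cellName s
  | zero => [1] | one => [2] | all => [3] | ex => [4] | l => [5] | r => [6] | f => [7]
  | start1 => [8] | start2 => [9] | start3 => [10] | end1 => [11] | end2 => [12] | end3 => [13]
  | check1 => [14] | check2 => [15] | check3 => [16] | checkHat3 => [17]

section Describes

variable {M : ATM} {Ac Q Γ : Type} [Finite Ac] [Finite Q] [Finite Γ]

/-- The records of a description of the two-agent system `S`, where actions, control states and
stack symbols are denoted by names: the actions, the control states, the stack symbols, the initial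
state, the pairs of a control state and an atomic proposition that holds in it, and the defined
transitions. A stack symbol with name `a` is written `1 :: a`, the bottom symbol is written `[0]`;
the names in the pushed word are written one per field. -/
inductive IsRecord (S : PMS (Prp M) Agent Ac Q Γ) (nAc : Ac → List ℕ) (nQ : Q → List ℕ)
    (nΓ : Γ → List ℕ) : List (List ℕ) → Prop
  | action (a : Ac) : IsRecord S nAc nQ nΓ [[0], nAc a]
  | state (q : Q) : IsRecord S nAc nQ nΓ [[1], nQ q]
  | symbol (γ : Γ) : IsRecord S nAc nQ nΓ [[2], nΓ γ]
  | start : IsRecord S nAc nQ nΓ [[3], nQ S.start]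
  | label (q : Q) (p : Prp M) (h : p ∈ S.lab q) : IsRecord S nAc nQ nΓ [[4], nQ q, p.name]
  | trans (q : Q) (γ : Option Γ) (d : Agent → Ac) (q' : Q) (β : List Γ)
      (h : S.Δ q γ d = some (q', β)) :
      IsRecord S nAc nQ nΓ
        ([[5], nQ q, γ.elim [0] (fun g => 1 :: nΓ g), nAc (d .env), nAc (d .sys), nQ q'] ++
          β.map nΓ)

/-- The table `t` describes `S`: for some choice of pairwise distinct names it consists of the
records of `S`, in any order. -/
def Describes (t : Table) (S : PMS (Prp M) Agent Ac Q Γ) : Prop :=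
  ∃ (nAc : Ac → List ℕ) (nQ : Q → List ℕ) (nΓ : Γ → List ℕ),
    Function.Injective nAc ∧ Function.Injective nQ ∧ Function.Injective nΓ ∧
    ∀ rec, rec ∈ t ↔ IsRecord S nAc nQ nΓ rec

end Describes

end PushdownGames

open PushdownGames

/-! The pushdown system is a writer followed by a reader. While writing, the environment spells out
codes of configurations letter by letter, and every letter goes on the stack when its control state
is left. Saturated counters enforce the shape of the blocks. The control also keeps the last two
letters of the configuration, so that consecutive triples overlap without any comparison of letters.
The system moves only at `all`, so neither child can be pruned there. As soon as a code is closed by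
`f`, the stack is popped, which reproduces the sequence of codes in reverse.

The reader passes through the modes `A`, `B`, `C`, `D`. In mode `A` the system decides at each
triple whether it gets `check3`, so every 3-block is marked on some branch; the mark is forced only
at the first triple of the first code, which is recognised by a flag on the stack and by the end
marker on its left. In mode `C` the environment places `checkHat3`, at the latest at the first
triple of the preceding code. After each `end2` the system may branch into a check 2-block-tree
(modes `E`, `F`), in which the environment chooses after `end1` whether to mark `check1`. The
pruning of these choices yields the partial check 2-block-trees.

The successors of a configuration have distinct labels (`succ_det`), so a word of labels determines
the configuration that it leads to. Hence a minimal infinite tree comes from a strategy as soon as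
its paths follow runs and its system nodes have all their successors (`exists_strategyTree`). What
remains is to compute the label sequences of runs: `gen_seq` for the writer, `srun_topConf` for
simple check-trees, `check_runs` for check 2-block-trees. The two inclusions of the first claim are
then `Follows.isExtendedTreeCode` and `IsExtendedTreeCode.exists_strategyTree`.

For the second claim, every action exists in two copies and an agent that does not control a state
has one default action. The controlling agent thus has at least two decisions even where a single
successor is left, and pruning never changes who controls a node
(`StrategyTree.controlledBy_sys_iff`). `Follows.isSys_iff` identifies the nodes of the system.

For polynomial time, note that tree-codes need not respect the transitions of the alternating
machine: the pushdown system depends only on the letters of configurations and on their kinds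
(symbol, or head in an accepting, universal or other state). Its transitions commute with renamings
of letters that preserve kinds (`Ctl.delta_map`), and a record is determined by at most four objects
with at most three letters each. All records are therefore instances of a finite list of templates
in twelve variables, which does not depend on the machine (`exists_templates`,
`isRec_iff_isInstance`). Nested loops over these variables print the instances in polynomial time.
They are written in a small command language that compiles to stack machines. -/

set_option linter.unusedSimpArgs false
set_option linter.unusedSectionVars false

namespace PushdownGames

/-! ## A structured language for stack machines -/

open Turing

/-- Structured commands acting on stacks of tokens. `case` and `loop` pop a token first. -/
inductive Cmd (K : Type) : Type
  | skip : Cmd K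
  | push (k : K) (t : Token) : Cmd K
  | seq (a b : Cmd K) : Cmd K
  | case (k : K) (f : Option Token → Cmd K) : Cmd K
  | loop (k : K) (p : Option Token → Bool) (f : Option Token → Cmd K) : Cmd K

namespace Cmd

variable {K : Type}

/-- The program points of a command. -/
def Lbl : Cmd K → Type
  | skip => Unit
  | push _ _ => Unit
  | seq a b => a.Lbl ⊕ b.Lbl
  | case _ f => Option (Σ v, (f v).Lbl)
  | loop _ _ f => Option (Σ v, (f v).Lbl)

/-- The first program point of a command. -/
def entry : (c : Cmd K) → c.Lbl
  | skip => ()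
  | push _ _ => ()
  | seq a _ => .inl a.entry
  | case _ _ => none
  | loop _ _ _ => none

noncomputable instance lblFintype : (c : Cmd K) → Fintype c.Lbl
  | skip => inferInstanceAs (Fintype Unit)
  | push _ _ => inferInstanceAs (Fintype Unit)
  | seq a b =>
    letI := lblFintype a
    letI := lblFintype b
    inferInstanceAs (Fintype (a.Lbl ⊕ b.Lbl))
  | case _ f =>
    letI := fun v => lblFintype (f v)
    inferInstanceAs (Fintype (Option (Σ v, (f v).Lbl)))
  | loop _ _ f =>
    letI := fun v => lblFintype (f v)
    inferInstanceAs (Fintype (Option (Σ v, (f v).Lbl)))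

/-- Statements of a stack machine whose register holds the last token that was popped. -/
abbrev St (K Λ : Type) : Type := TM2.Stmt (fun _ : K => Token) Λ (Option Token)

/-- The machine code of a command, for an embedding of its program points into the set of labels
of a machine and for a label at which the execution continues. -/
def code {Λ : Type} : (c : Cmd K) → (c.Lbl → Λ) → Λ → c.Lbl → St K Λ
  | skip, _, exit, _ => .goto fun _ => exit
  | push k t, _, exit, _ => .push k (fun _ => t) (.goto fun _ => exit)
  | seq a b, emb, exit, l =>
    match l with
    | .inl l => a.code (fun l => emb (.inl l)) (emb (.inr b.entry)) l
    | .inr l => b.code (fun l => emb (.inr l)) exit l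
  | case k f, emb, exit, l =>
    match l with
    | none => .pop k (fun _ x => x) (.goto fun v => emb (some ⟨v, (f v).entry⟩))
    | some ⟨v, l⟩ => (f v).code (fun l => emb (some ⟨v, l⟩)) exit l
  | loop k p f, emb, exit, l =>
    match l with
    | none => .pop k (fun _ x => x)
        (.goto fun v => if p v then emb (some ⟨v, (f v).entry⟩) else exit)
    | some ⟨v, l⟩ => (f v).code (fun l => emb (some ⟨v, l⟩)) (emb none) l

variable [DecidableEq K]

/-- In every machine that contains the code of `c`, the execution of `c` transforms the stacks
`S` into `S'` in at most `n` steps. -/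
def Runs (c : Cmd K) (S S' : K → List Token) (n : ℕ) : Prop :=
  ∀ (Λ : Type) (m : Λ → St K Λ) (emb : c.Lbl → Λ) (exit : Λ),
    (∀ l, m (emb l) = c.code emb exit l) →
    ∀ v, ∃ v', ∃ k ≤ n, (flip bind (TM2.step m))^[k] (some ⟨some (emb c.entry), v, S⟩) =
      some ⟨some exit, v', S'⟩

theorem Runs.mono {c : Cmd K} {S S' : K → List Token} {n n' : ℕ} (h : Runs c S S' n)
    (hn : n ≤ n') : Runs c S S' n' := by
  intro Λ m emb exit hm v
  obtain ⟨v', k, hk, e⟩ := h Λ m emb exit hm v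
  exact ⟨v', k, hk.trans hn, e⟩

theorem runs_skip (S : K → List Token) : Runs skip S S 1 := by
  intro Λ m emb exit hm v
  refine ⟨v, 1, le_rfl, ?_⟩
  change some (TM2.stepAux (m (emb ())) v S) = _
  rw [show m (emb ()) = .goto fun _ => exit from hm ()]
  rfl

theorem runs_push (k : K) (t : Token) (S : K → List Token) :
    Runs (push k t) S (Function.update S k (t :: S k)) 1 := by
  intro Λ m emb exit hm v
  refine ⟨v, 1, le_rfl, ?_⟩
  change some (TM2.stepAux (m (emb ())) v S) = _
  rw [show m (emb ()) = .push k (fun _ => t) (.goto fun _ => exit) from hm ()]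
  rfl

theorem Runs.seq {a b : Cmd K} {S S' S'' : K → List Token} {n n' : ℕ} (h : Runs a S S' n)
    (h' : Runs b S' S'' n') : Runs (a.seq b) S S'' (n + n') := by
  intro Λ m emb exit hm v
  obtain ⟨v', k, hk, e⟩ := h Λ m (fun l => emb (.inl l)) (emb (.inr b.entry))
    (fun l => hm (.inl l)) v
  obtain ⟨v'', k', hk', e'⟩ := h' Λ m (fun l => emb (.inr l)) exit (fun l => hm (.inr l)) v'
  refine ⟨v'', k' + k, by omega, ?_⟩
  rw [Function.iterate_add_apply]
  exact (congrArg _ e).trans e'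

theorem Runs.case {k : K} {f : Option Token → Cmd K} {S S' : K → List Token} {n : ℕ}
    (h : Runs (f (S k).head?) (Function.update S k (S k).tail) S' n) :
    Runs (case k f) S S' (n + 1) := by
  intro Λ m emb exit hm v
  obtain ⟨v', j, hj, e⟩ := h Λ m (fun l => emb (some ⟨_, l⟩)) exit
    (fun l => hm (some ⟨_, l⟩)) (S k).head?
  refine ⟨v', j + 1, by omega, ?_⟩
  rw [Function.iterate_add_apply, ← e]
  change _^[j] (some (TM2.stepAux (m (emb none)) v S)) = _
  rw [show m (emb none) = .pop k (fun _ x => x)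
    (.goto fun v => emb (some ⟨v, (f v).entry⟩)) from hm none]
  rfl

theorem Runs.loop_exit {k : K} {p : Option Token → Bool} {f : Option Token → Cmd K}
    {S : K → List Token} (h : p (S k).head? = false) :
    Runs (loop k p f) S (Function.update S k (S k).tail) 1 := by
  intro Λ m emb exit hm v
  refine ⟨(S k).head?, 1, le_rfl, ?_⟩
  change some (TM2.stepAux (m (emb none)) v S) = _
  rw [show m (emb none) = .pop k (fun _ x => x)
    (.goto fun v => if p v then emb (some ⟨v, (f v).entry⟩) else exit) from hm none]
  simp [h]

theorem Runs.loop_step {k : K} {p : Option Token → Bool} {f : Option Token → Cmd K}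
    {S S' S'' : K → List Token} {n n' : ℕ} (h : p (S k).head? = true)
    (h1 : Runs (f (S k).head?) (Function.update S k (S k).tail) S' n)
    (h2 : Runs (loop k p f) S' S'' n') : Runs (loop k p f) S S'' (n + n' + 1) := by
  intro Λ m emb exit hm v
  obtain ⟨v', j, hj, e⟩ := h1 Λ m (fun l => emb (some ⟨_, l⟩)) (emb none)
    (fun l => hm (some ⟨_, l⟩)) (S k).head?
  obtain ⟨v'', j', hj', e'⟩ := h2 Λ m emb exit hm v'
  refine ⟨v'', j' + (j + 1), by omega, ?_⟩
  rw [Function.iterate_add_apply, Function.iterate_add_apply]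
  have : (flip bind (TM2.step m))^[1] (some ⟨some (emb (loop k p f).entry), v, S⟩) =
      some ⟨some (emb (some ⟨(S k).head?, (f (S k).head?).entry⟩)), (S k).head?,
        Function.update S k (S k).tail⟩ := by
    change some (TM2.stepAux (m (emb none)) v S) = _
    rw [show m (emb none) = .pop k (fun _ x => x)
      (.goto fun v => if p v then emb (some ⟨v, (f v).entry⟩) else exit) from hm none]
    simp [h]
  rw [this]
  exact (congrArg _ e).trans e'

/-- The machine that executes a command. -/
noncomputable def machine [Fintype K] (c : Cmd K) (inp out : K) : FinTM2 where
  K := K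
  k₀ := inp
  k₁ := out
  Γ _ := Token
  Λ := Option c.Lbl
  main := some c.entry
  σ := Option Token
  initialState := none
  m l := match l with
    | some l => c.code some none l
    -- A halting configuration must have the initial value in its register, so the register is
    -- cleared.
    | none => .load (fun _ => none) .halt

/-- A command that computes `f` within polynomial time yields a polynomial time machine. -/
theorem nonempty_polyTime [Fintype K] {α β : Type} {inp out : K} {c : Cmd K}
    {ea : α → List Token} {eb : β → List Token} {f : α → β} {p : Polynomial ℕ}
    (h : ∀ a, Runs c (Function.update (fun _ => []) inp (ea a))
      (Function.update (fun _ => []) out (eb (f a))) (p.eval (ea a).length)) :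
    Nonempty (TM2ComputableInPolyTime ea eb f) := by
  refine ⟨{ tm := c.machine inp out, inputAlphabet := Equiv.refl Token,
            outputAlphabet := Equiv.refl Token, time := p + 1, outputsFun := fun a => ?_ }⟩
  have H := h a (Option c.Lbl) (c.machine inp out).m some none (fun l => rfl) none
  -- The goal is data, so the witnesses are extracted by choice and not by case analysis.
  choose v' k hk e using H
  -- The additional step is the one from the exit label `none` to the halt; it accounts for the `+
  -- 1` in the time bound.
  refine ⟨⟨k + 1, ?_⟩, by simpa using hk⟩
  have hs : (initList (c.machine inp out) (List.map (Equiv.refl Token).invFun (ea a))) =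
      ⟨some (some c.entry), none, Function.update (fun _ => []) inp (ea a)⟩ := by
    have : (fun k : K => @dite (List Token) (k = inp) _
        (fun _ => List.map (Equiv.refl Token).invFun (ea a)) fun _ => []) =
        Function.update (fun _ => []) inp (ea a) := by
      funext k
      by_cases h : k = inp <;> simp [h]
    exact congrArg (TM2.Cfg.mk (some (some c.entry)) none) this
  have ht : (haltList (c.machine inp out) (List.map (Equiv.refl Token).invFun (eb (f a)))) =
      ⟨none, none, Function.update (fun _ => []) out (eb (f a))⟩ := by
    have : (fun k : K => @dite (List Token) (k = out) _
        (fun _ => List.map (Equiv.refl Token).invFun (eb (f a))) fun _ => []) =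
        Function.update (fun _ => []) out (eb (f a)) := by
      funext k
      by_cases h : k = out <;> simp [h]
    exact congrArg (TM2.Cfg.mk none none) this
  refine Eq.trans ?_ (congrArg some ht).symm
  rw [add_comm, Function.iterate_add_apply]
  exact (congrArg (fun x => (flip bind (TM2.step (c.machine inp out).m))^[1]
    ((flip bind (TM2.step (c.machine inp out).m))^[k] (some x))) hs).trans
    (congrArg (flip bind (TM2.step (c.machine inp out).m))^[1] e)

end Cmd

end PushdownGames

namespace PushdownGames

/-! ## Machines that write tables given by templates -/

/-- The kinds of the letters of configurations: symbols, and heads with an accepting state, a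
non-accepting universal state, another state. -/
inductive Kd
  | sym | acc | uni | exi
  deriving DecidableEq

instance : Fintype Kd := ⟨{.sym, .acc, .uni, .exi}, fun a => by cases a <;> simp⟩

/-- The token that stands for a kind of states. -/
def Kd.tok : Kd → Token
  | sym => .newline
  | acc => .tick
  | uni => .comma
  | exi => .semicolon

/-- The numbers of a template: constants, and the two numbers in the name of a letter. -/
inductive Tok (I : Type)
  | nat (k : ℕ)
  | A (i : I)
  | B (i : I)

/-- The stacks of the machines that write tables; `ctr i b false` and `ctr i b true` contain the
remaining and the processed part of a list over which a variable ranges. -/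
inductive Stk (I : Type)
  | inp | out | tmp | aux
  | ctr (i : I) (b s : Bool)
  deriving DecidableEq, Fintype

namespace Cmd

/-- The contents of the stacks. -/
def contents {I : Type} (inp out tmp aux : List Token) (rem cnt : I × Bool → List Token) :
    Stk I → List Token
  | .inp => inp
  | .out => out
  | .tmp => tmp
  | .aux => aux
  | .ctr i b s => if s then cnt (i, b) else rem (i, b)

section

variable {I : Type} [DecidableEq I] (inp out tmp aux l : List Token)
  (rem cnt : I × Bool → List Token) (i : I) (b : Bool)

@[simp] theorem update_inp : Function.update (contents inp out tmp aux rem cnt) .inp l =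
    contents l out tmp aux rem cnt := by
  funext k; cases k <;> simp [contents, Function.update_apply]

@[simp] theorem update_out : Function.update (contents inp out tmp aux rem cnt) .out l =
    contents inp l tmp aux rem cnt := by
  funext k; cases k <;> simp [contents, Function.update_apply]

@[simp] theorem update_tmp : Function.update (contents inp out tmp aux rem cnt) .tmp l =
    contents inp out l aux rem cnt := by
  funext k; cases k <;> simp [contents, Function.update_apply]

@[simp] theorem update_aux : Function.update (contents inp out tmp aux rem cnt) .aux l =
    contents inp out tmp l rem cnt := by
  funext k; cases k <;> simp [contents, Function.update_apply]

@[simp] theorem update_rem : Function.update (contents inp out tmp aux rem cnt) (.ctr i b false) l =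
    contents inp out tmp aux (Function.update rem (i, b) l) cnt := by
  funext k
  cases k with
  | ctr j c s => cases s <;> by_cases h : j = i <;> by_cases h' : c = b <;>
      simp [contents, Function.update_apply, h, h']
  | _ => simp [contents, Function.update_apply]

@[simp] theorem update_cnt : Function.update (contents inp out tmp aux rem cnt) (.ctr i b true) l =
    contents inp out tmp aux rem (Function.update cnt (i, b) l) := by
  funext k
  cases k with
  | ctr j c s => cases s <;> by_cases h : j = i <;> by_cases h' : c = b <;>
      simp [contents, Function.update_apply, h, h']
  | _ => simp [contents, Function.update_apply]

@[simp] theorem contents_inp : contents inp out tmp aux rem cnt .inp = inp := rfl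
@[simp] theorem contents_out : contents inp out tmp aux rem cnt .out = out := rfl
@[simp] theorem contents_tmp : contents inp out tmp aux rem cnt .tmp = tmp := rfl
@[simp] theorem contents_aux : contents inp out tmp aux rem cnt .aux = aux := rfl
@[simp] theorem contents_rem : contents inp out tmp aux rem cnt (.ctr i b false) = rem (i, b) := rfl
@[simp] theorem contents_cnt : contents inp out tmp aux rem cnt (.ctr i b true) = cnt (i, b) := rfl

end

theorem Runs.congr {K : Type} [DecidableEq K] {c : Cmd K} {S S' S'' : K → List Token} {n : ℕ}
    (h : Runs c S S' n) (e : S' = S'') : Runs c S S'' n := e ▸ h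

/-- A loop that consumes the list `l` and the first token after it. -/
theorem runs_loop_list {K : Type} [DecidableEq K] {k : K} {p : Option Token → Bool}
    {f : Option Token → Cmd K} {n : ℕ} {sentinel : List Token} (hs : p sentinel.head? = false)
    (F : List Token → K → List Token) (l : List Token) (hF : ∀ r, F r k = r ++ sentinel)
    (h : ∀ pre t r, l = pre ++ t :: r →
      p (some t) = true ∧ Runs (f (some t)) (Function.update (F (t :: r)) k (r ++ sentinel)) (F r) n) :
    Runs (loop k p f) (F l) (Function.update (F []) k sentinel.tail) (l.length * (n + 1) + 1) := by
  -- `F r` is the loop invariant: the contents of the stacks when the part `r` of the list is still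
  -- unread.
  induction l with
  | nil =>
    have := Runs.loop_exit (f := f) (p := p) (k := k) (S := F []) (by simpa [hF] using hs)
    simpa [hF] using this
  | cons t r ih =>
    obtain ⟨h1, h2⟩ := h [] t r rfl
    have h3 := ih fun pre t' r' e => h (t :: pre) t' r' (by simp [e])
    refine (Runs.loop_step (n := n) (n' := r.length * (n + 1) + 1) (S' := F r)
      (by simpa [hF] using h1) (by simpa [hF] using h2) h3).mono ?_
    simp only [List.length_cons]
    ring_nf
    omega

/-- Pops all tokens of `k` and executes a command for each of them. -/
def drain {K : Type} (k : K) (f : Token → Cmd K) : Cmd K :=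
  loop k Option.isSome fun v => f (v.getD .tick)

/-- The case of an empty sentinel: the loop stops when the pop returns `none`, and this pop leaves
the empty stack as it is. -/
theorem runs_drain {K : Type} [DecidableEq K] {k : K} {f : Token → Cmd K} {n : ℕ}
    (F : List Token → K → List Token) (l : List Token) (hF : ∀ r, F r k = r)
    (h : ∀ pre t r, l = pre ++ t :: r → Runs (f t) (Function.update (F (t :: r)) k r) (F r) n) :
    Runs (drain k f) (F l) (F []) (l.length * (n + 1) + 1) := by
  have := runs_loop_list (k := k) (p := Option.isSome) (f := fun v => f (v.getD .tick)) (n := n)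
    (sentinel := []) rfl F l (by simpa using hF) (fun pre t r e => ⟨rfl, by simpa using h pre t r e⟩)
  have e : Function.update (F []) k [] = F [] := by
    rw [Function.update_eq_self_iff, hF]
  simpa [e, drain] using this

variable {I : Type} [DecidableEq I]

/-- Moves the processed part of a list back to the remaining part. -/
def restore (i : I) (b : Bool) : Cmd (Stk I) :=
  drain (.ctr i b true) fun t => push (.ctr i b false) t

theorem runs_restore (inp out tmp aux : List Token) (rem cnt : I × Bool → List Token) (i : I)
    (b : Bool) : Runs (restore i b) (contents inp out tmp aux rem cnt)
      (contents inp out tmp aux (Function.update rem (i, b) ((cnt (i, b)).reverse ++ rem (i, b)))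
        (Function.update cnt (i, b) [])) ((cnt (i, b)).length * 2 + 1) := by
  obtain ⟨l, hl⟩ : ∃ l, l = cnt (i, b) := ⟨_, rfl⟩
  -- Invariant: when `r` is left on the processed stack, the tokens already moved form a prefix of
  -- `l`, and they lie in reverse order on the other stack.
  have := runs_drain (k := Stk.ctr i b true) (f := fun t => push (.ctr i b false) t) (n := 1)
    (fun r => contents inp out tmp aux
      (Function.update rem (i, b) ((l.take (l.length - r.length)).reverse ++ rem (i, b)))
      (Function.update cnt (i, b) r)) l (fun r => by simp) (by
        intro pre t r e
        convert runs_push (K := Stk I) _ _ _ using 1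
        simp only [update_cnt, Function.update_idem, update_rem, contents_rem, Function.update_self]
        congr 2
        subst e
        simp [List.take_append, Nat.sub_eq_zero_iff_le, List.take_of_length_le,
          show pre.length + (r.length + 1) - r.length = pre.length + 1 by omega])
  have e0 : Function.update cnt (i, b) l = cnt := by rw [hl]; exact Function.update_eq_self _ _
  simpa [← hl, restore, e0] using this

/-- Writes a number, followed by a comma, in front of the output. -/
def emitTok : Tok I → Cmd (Stk I)
  | .nat k => seq (push .out .comma) (Nat.rec skip (fun _ c => seq c (push .out .tick)) k)
  | .A i => emitCtr i true
  | .B i => emitCtr i false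
where
  emitCtr (i : I) (b : Bool) : Cmd (Stk I) :=
    seq (push .out .comma)
      (seq (drain (.ctr i b true) fun t => seq (push .tmp t) (push .out .tick))
        (drain .tmp fun t => push (.ctr i b true) t))

/-- The value of a number, if the processed parts of the lists have the lengths `pos`. -/
def _root_.PushdownGames.Tok.val (pos : I × Bool → ℕ) : Tok I → ℕ
  | .nat k => k
  | .A i => pos (i, true)
  | .B i => pos (i, false)

/-- The length of a stack can only be found by emptying it. Its tokens move to `tmp` while one tick
is written for each of them, and then move back; the two passes cost three and two steps per token.
-/
theorem runs_emitCtr (out : List Token) (rem cnt : I × Bool → List Token) (i : I) (b : Bool) :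
    Runs (emitTok.emitCtr i b) (contents [] out [] [] rem cnt)
      (contents [] (List.replicate (cnt (i, b)).length Token.tick ++ Token.comma :: out) [] [] rem cnt)
      (5 * (cnt (i, b)).length + 3) := by
  obtain ⟨l, hl⟩ : ∃ l, l = cnt (i, b) := ⟨_, rfl⟩
  have h1 := runs_push Stk.out .comma (contents [] out [] [] rem cnt)
  have h2 := runs_drain (k := Stk.ctr i b true)
    (f := fun t => seq (push .tmp t) (push .out .tick)) (n := 2)
    (fun r => contents [] (List.replicate (l.length - r.length) Token.tick ++ Token.comma :: out)
      (l.take (l.length - r.length)).reverse [] rem (Function.update cnt (i, b) r)) l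
      (fun r => by simp) (by
        intro pre t r e
        refine Runs.seq (n := 1) (n' := 1) (runs_push _ _ _) ?_
        convert runs_push (K := Stk I) _ _ _ using 1
        subst e
        simp [List.take_append, Nat.sub_eq_zero_iff_le, List.take_of_length_le,
          show pre.length + (r.length + 1) - r.length = pre.length + 1 by omega,
          List.replicate_succ])
  have h3 := runs_drain (k := Stk.tmp) (f := fun t => push (.ctr i b true) t) (n := 1)
    (fun r => contents [] (List.replicate l.length Token.tick ++ Token.comma :: out)
      r [] rem (Function.update cnt (i, b) (l.drop r.length))) l.reverse
      (fun r => by simp) (by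
        intro pre t r e
        convert runs_push (K := Stk I) _ _ _ using 1
        have e' : l = r.reverse ++ t :: pre.reverse := by
          simpa using congrArg List.reverse e
        subst e'
        simp [List.drop_append, show List.drop (r.length + 1) r.reverse = [] from List.drop_eq_nil_of_le (by simp)])
  have e0 : Function.update cnt (i, b) l = cnt := by rw [hl]; exact Function.update_eq_self _ _
  simp only [update_out, contents_out] at h1
  simp only [List.length_nil, Nat.sub_zero, Nat.sub_self, List.replicate_zero, List.take_zero,
    List.reverse_nil, List.nil_append, e0, List.take_length] at h2
  simp only [List.length_reverse, List.drop_length, List.length_nil, List.drop_zero, e0] at h3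
  rw [← hl]
  exact (h1.seq (h2.seq h3)).mono (by omega)

/-- The contents of the stacks, if `L` are the lists over which the variables range and `pos` are the lengths of
their processed parts. -/
def zipped (L : Bool → List Token) (pos : I × Bool → ℕ) (out : List Token) :
    Stk I → List Token :=
  contents [] out [] [] (fun x => (L x.2).drop (pos x)) (fun x => ((L x.2).take (pos x)).reverse)

theorem zipped_push (L : Bool → List Token) (pos : I × Bool → ℕ) (out : List Token) (t : Token) :
    Function.update (zipped L pos out) .out (t :: zipped L pos out .out) =
      zipped L pos (t :: out) := by
  simp [zipped]

/-- The total length of the lists over which the variables range. -/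
def size (L : Bool → List Token) : ℕ := (L true).length + (L false).length

theorem length_le_size (L : Bool → List Token) (b : Bool) : (L b).length ≤ size L := by
  cases b <;> simp [size]

/-- The polynomial may depend on the token but not on the lists: a constant takes constant time, and
a variable takes time linear in the length of its list. -/
theorem runs_emitTok (a : Tok I) : ∃ p : Polynomial ℕ, ∀ (L : Bool → List Token)
    (pos : I × Bool → ℕ), (∀ x, pos x ≤ (L x.2).length) → ∀ out,
    Runs (emitTok a) (zipped L pos out)
      (zipped L pos (List.replicate (a.val pos) Token.tick ++ Token.comma :: out))
      (p.eval (size L)) := by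
  have key : ∀ (i : I) (b : Bool) (L : Bool → List Token)
      (pos : I × Bool → ℕ), (∀ x, pos x ≤ (L x.2).length) → ∀ out,
      Runs (emitTok.emitCtr i b) (zipped L pos out)
        (zipped L pos (List.replicate (pos (i, b)) Token.tick ++ Token.comma :: out))
        ((5 * Polynomial.X + 3 : Polynomial ℕ).eval (size L)) := by
    intro i b L pos hpos out
    have := runs_emitCtr out (fun x => (L x.2).drop (pos x))
      (fun x => ((L x.2).take (pos x)).reverse) i b
    have hl : ((fun x : I × Bool => ((L x.2).take (pos x)).reverse) (i, b)).length =
        pos (i, b) := by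
      simpa using hpos (i, b)
    rw [hl] at this
    refine this.mono ?_
    have h1 := hpos (i, b)
    have h2 := length_le_size L b
    simp only [Polynomial.eval_add, Polynomial.eval_mul, Polynomial.eval_X,
      Polynomial.eval_ofNat]
    simp only at h1
    omega
  cases a with
  | nat k =>
    have hk : ∀ L (pos : I × Bool → ℕ) out, Runs (Nat.rec skip (fun _ c => seq c (push .out .tick)) k)
        (zipped L pos out) (zipped L pos (List.replicate k Token.tick ++ out)) (k + 1) := by
      intro L pos out
      induction k with
      | zero => exact runs_skip _
      | succ k ih =>
        refine ih.seq ?_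
        convert runs_push Stk.out .tick (zipped L pos (List.replicate k Token.tick ++ out)) using 1
        simp [zipped, List.replicate_succ]
    refine ⟨Polynomial.C (1 + (k + 1)), fun L pos _ out => ?_⟩
    rw [Polynomial.eval_C]
    have h1 := runs_push Stk.out .comma (zipped L pos out)
    have h2 := hk L pos (.comma :: out)
    simp only [zipped, update_out, contents_out] at h1
    exact h1.seq h2
  | A i => exact ⟨_, key i true⟩
  | B i => exact ⟨_, key i false⟩

/-- Writes a field without its semicolon in front of the output. -/
def emitField : List (Tok I) → Cmd (Stk I)
  | [] => skip
  | a :: r => seq (emitField r) (emitTok a)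

/-- The output is a stack, so the numbers are written from the last one to the first one. -/
theorem runs_emitField (fld : List (Tok I)) : ∃ p : Polynomial ℕ, ∀ (L : Bool → List Token)
    (pos : I × Bool → ℕ), (∀ x, pos x ≤ (L x.2).length) → ∀ out,
    Runs (emitField fld) (zipped L pos out)
      (zipped L pos (((fld.map (Tok.val pos)).flatMap fun n =>
        List.replicate n Token.tick ++ [Token.comma]) ++ out)) (p.eval (size L)) := by
  induction fld with
  | nil => exact ⟨1, fun L pos _ out => by simpa [emitField] using runs_skip _⟩
  | cons a r ih =>
    obtain ⟨p, hp⟩ := ih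
    obtain ⟨q, hq⟩ := runs_emitTok a
    refine ⟨p + q, fun L pos h out => ?_⟩
    rw [Polynomial.eval_add]
    exact ((hp L pos h out).seq (hq L pos h _)).congr (by simp)

/-- Writes fields in front of the output. -/
def emitFields : List (List (Tok I)) → Cmd (Stk I)
  | [] => skip
  | a :: r => seq (emitFields r) (seq (push .out .semicolon) (emitField a))

theorem runs_emitFields (R : List (List (Tok I))) : ∃ p : Polynomial ℕ,
    ∀ (L : Bool → List Token) (pos : I × Bool → ℕ), (∀ x, pos x ≤ (L x.2).length) → ∀ out,
    Runs (emitFields R) (zipped L pos out)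
      (zipped L pos (((R.map (List.map (Tok.val pos))).flatMap fun fld => (fld.flatMap fun n =>
        List.replicate n Token.tick ++ [Token.comma]) ++ [Token.semicolon]) ++ out))
      (p.eval (size L)) := by
  induction R with
  | nil => exact ⟨1, fun L pos _ out => by simpa [emitFields] using runs_skip _⟩
  | cons a r ih =>
    obtain ⟨p, hp⟩ := ih
    obtain ⟨q, hq⟩ := runs_emitField a
    refine ⟨p + (1 + q), fun L pos h out => ?_⟩
    rw [Polynomial.eval_add, Polynomial.eval_add, Polynomial.eval_one]
    refine (hp L pos h out).seq ((runs_push _ _ _).seq ?_)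
    rw [zipped_push]
    exact (hq L pos h _).congr (by simp)

/-- Writes a record in front of the output. -/
def emitRecord (R : List (List (Tok I))) : Cmd (Stk I) :=
  seq (push .out .newline) (emitFields R)

theorem write_append (t t' : Table) : (t ++ t').write = t.write ++ t'.write := by
  simp [Table.write]

/-- The command writes, in front of the output, a table that consists of the records with the
property `P`. The variables in `Z` have not yet a value. -/
def Emits (Z : Set (I × Bool)) (c : Cmd (Stk I))
    (P : (Bool → List Token) → (I × Bool → ℕ) → List (List ℕ) → Prop) : Prop :=
  ∃ p : Polynomial ℕ, ∀ (L : Bool → List Token) (pos : I × Bool → ℕ),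
    (∀ x, pos x ≤ (L x.2).length) → (∀ x ∈ Z, pos x = 0) →
    ∃ t : Table, (∀ rec, rec ∈ t ↔ P L pos rec) ∧
      ∀ out, Runs c (zipped L pos out) (zipped L pos (t.write ++ out)) (p.eval (size L))

theorem emits_emitRecord (Z : Set (I × Bool)) (R : List (List (Tok I))) :
    Emits Z (emitRecord R) fun _ pos rec => rec = R.map (List.map (Tok.val pos)) := by
  obtain ⟨p, hp⟩ := runs_emitFields R
  refine ⟨1 + p, fun L pos h _ => ⟨[R.map (List.map (Tok.val pos))], by simp, fun out => ?_⟩⟩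
  rw [Polynomial.eval_add, Polynomial.eval_one]
  refine (runs_push _ _ _).seq ?_
  rw [zipped_push]
  exact (hp L pos h _).congr (by simp [Table.write])

theorem emits_skip (Z : Set (I × Bool)) : Emits (I := I) Z skip fun _ _ _ => False :=
  ⟨1, fun _ _ _ _ => ⟨[], by simp, fun out => by
    simpa [Table.write] using runs_skip _⟩⟩

theorem Emits.seq {Z : Set (I × Bool)} {c c' : Cmd (Stk I)}
    {P P' : (Bool → List Token) → (I × Bool → ℕ) → List (List ℕ) → Prop} (h : Emits Z c P)
    (h' : Emits Z c' P') : Emits Z (c.seq c') fun L pos rec => P L pos rec ∨ P' L pos rec := by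
  obtain ⟨p, hp⟩ := h
  obtain ⟨p', hp'⟩ := h'
  refine ⟨p + p', fun L pos h hZ => ?_⟩
  obtain ⟨t, ht, ht'⟩ := hp L pos h hZ
  obtain ⟨u, hu, hu'⟩ := hp' L pos h hZ
  refine ⟨u ++ t, fun rec => by rw [List.mem_append, hu, ht, or_comm], fun out => ?_⟩
  rw [Polynomial.eval_add, write_append, List.append_assoc]
  exact (ht' out).seq (hu' _)

/-- Executes `c` for all values of a variable. -/
def forVar (i : I) (b : Bool) (p : Token → Bool) (c : Cmd (Stk I)) : Cmd (Stk I) :=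
  seq (drain (.ctr i b false) fun t => seq (push (.ctr i b true) t) (if p t then c else skip))
    (restore i b)

theorem zipped_update (L : Bool → List Token) (pos : I × Bool → ℕ) (out : List Token) (i : I)
    (b : Bool) (j : ℕ) : zipped L (Function.update pos (i, b) j) out =
      contents [] out [] [] (Function.update (fun x => (L x.2).drop (pos x)) (i, b) ((L b).drop j))
        (Function.update (fun x => ((L x.2).take (pos x)).reverse) (i, b)
          ((L b).take j).reverse) := by
  simp only [zipped]
  congr 1 <;>
  · funext x
    by_cases h : x = (i, b)
    · subst h; simp
    · simp [h]

/-- A token is moved to the processed part before the body runs, so the round for position `j` sees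
the value `j + 1`. This fits the names of letters, in which 0 is reserved for a missing state. The
body runs at most once per token, which multiplies its time bound by the length of the list. -/
theorem Emits.forVar {Z : Set (I × Bool)} {c : Cmd (Stk I)}
    {P : (Bool → List Token) → (I × Bool → ℕ) → List (List ℕ) → Prop} {i : I} {b : Bool}
    (h : Emits (Z \ {(i, b)}) c P) (hZ : (i, b) ∈ Z) (p : Token → Bool) :
    Emits Z (forVar i b p c) fun L pos rec =>
      ∃ (j : ℕ) (t : Token), (L b)[j]? = some t ∧ p t = true ∧
        P L (Function.update pos (i, b) (j + 1)) rec := by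
  obtain ⟨q, hq⟩ := h
  -- One round consists of the pop, the push, and either the body or `skip`; `q + 1` bounds both of
  -- the latter. The second summand pays for the restoring pass.
  refine ⟨(Polynomial.X * (1 + (q + 1) + 1) + 1) + (Polynomial.X * 2 + 1),
    fun L pos hpos hz => ?_⟩
  have hq' : ∀ j : ℕ, j < (L b).length → _ := fun j hj =>
    hq L (Function.update pos (i, b) (j + 1)) (by
      intro x
      by_cases hx : x = (i, b)
      · subst hx; simpa using hj
      · simpa [hx] using hpos x) (by
      intro x hx
      rw [Function.update_of_ne (by simpa using hx.2)]
      exact hz x hx.1)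
  -- Induction on the unread part `l`, where `pre` is the part already processed.
  have main : ∀ (l pre : List Token), L b = pre ++ l → ∃ t : Table, (∀ rec, rec ∈ t ↔
      ∃ (j : ℕ) (t : Token), pre.length ≤ j ∧ (L b)[j]? = some t ∧ p t = true ∧
        P L (Function.update pos (i, b) (j + 1)) rec) ∧ ∀ out,
      Runs (drain (.ctr i b false) fun t => .seq (push (.ctr i b true) t)
        (if p t then c else skip))
        (zipped L (Function.update pos (i, b) pre.length) out)
        (zipped L (Function.update pos (i, b) (L b).length) (t.write ++ out))
        (l.length * (1 + (q.eval (size L) + 1) + 1) + 1) := by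
    intro l
    induction l with
    | nil =>
      intro pre e
      refine ⟨[], fun rec => ?_, fun out => ?_⟩
      · simp only [List.not_mem_nil, false_iff]
        rintro ⟨j, t, h1, h2, -⟩
        rw [e, List.append_nil, List.getElem?_eq_none h1] at h2
        cases h2
      · have := Runs.loop_exit (p := Option.isSome) (k := Stk.ctr i b false)
          (f := fun v => .seq (push (.ctr i b true) (v.getD .tick))
            (if p (v.getD .tick) then c else skip))
          (S := zipped L (Function.update pos (i, b) pre.length) out)
          (by simp [zipped, e])
        rw [List.length_nil, Nat.zero_mul, Nat.zero_add]
        refine Runs.congr this ?_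
        simp [zipped_update, e, Table.write]
    | cons t l ih =>
      intro pre e
      obtain ⟨T, hT, hT'⟩ := ih (pre ++ [t]) (by simp [e])
      obtain ⟨T₁, hT₁, hT₁'⟩ := hq' pre.length (by simp [e])
      have hget : (L b)[pre.length]? = some t := by simp [e]
      have step : ∀ out T₁' c', (∀ out, Runs c'
          (zipped L (Function.update pos (i, b) (pre.length + 1)) out)
          (zipped L (Function.update pos (i, b) (pre.length + 1)) (T₁' ++ out))
          (q.eval (size L) + 1)) → c' = (if p t then c else skip) →
          Runs (drain (.ctr i b false) fun t => .seq (push (.ctr i b true) t)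
            (if p t then c else skip))
            (zipped L (Function.update pos (i, b) pre.length) out)
            (zipped L (Function.update pos (i, b) (L b).length) (T.write ++ (T₁' ++ out)))
            ((l.length + 1) * (1 + (q.eval (size L) + 1) + 1) + 1) := by
        intro out T₁' c' hc' ec
        have h2 := hT' (T₁' ++ out)
        rw [List.length_append, List.length_singleton] at h2
        refine (Runs.loop_step (n := 1 + (q.eval (size L) + 1)) (by simp [zipped, e]) ?_ h2).mono
          (by ring_nf; omega)
        have hh : (zipped L (Function.update pos (i, b) pre.length) out
            (.ctr i b false)).head? = some t := by simp [zipped, e]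
        rw [hh]
        simp only [Option.getD_some, ← ec]
        refine Runs.seq (runs_push _ _ _) ?_
        convert hc' out using 1
        simp [zipped_update, e, List.take_append, List.take_of_length_le]
      by_cases hp : p t = true
      -- The output grows at its front, so the records of later tokens precede those of the current
      -- one.
      · refine ⟨T ++ T₁, fun rec => ?_, fun out => ?_⟩
        · rw [List.mem_append, hT, hT₁]
          constructor
          · rintro (⟨j, t', h1, h2⟩ | h1)
            · exact ⟨j, t', by simp at h1; omega, h2⟩
            · exact ⟨pre.length, t, le_rfl, hget, hp, h1⟩
          · rintro ⟨j, t', h1, h2, h3⟩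
            rcases h1.eq_or_lt with rfl | h1
            · exact .inr h3.2
            · exact .inl ⟨j, t', by simpa using h1, h2, h3⟩
        · rw [write_append, List.append_assoc, List.length_cons]
          exact step out T₁.write c (fun out => (hT₁' out).mono (by omega)) (by simp [hp])
      · refine ⟨T, fun rec => ?_, fun out => ?_⟩
        · rw [hT]
          constructor
          · rintro ⟨j, t', h1, h2⟩
            exact ⟨j, t', by simp at h1; omega, h2⟩
          · rintro ⟨j, t', h1, h2, h3⟩
            rcases h1.eq_or_lt with rfl | h1
            · rw [hget] at h2; cases h2; exact absurd h3.1 hp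
            · exact ⟨j, t', by simpa using h1, h2, h3⟩
        · rw [List.length_cons]
          exact step out [] skip (fun out => (runs_skip _).mono (by omega)) (by simp [hp])
  obtain ⟨T, hT, hT'⟩ := main (L b) [] rfl
  refine ⟨T, fun rec => by simpa using hT rec, fun out => ?_⟩
  have h1 := hT' out
  have e0 : Function.update pos (i, b) 0 = pos := by
    rw [Function.update_eq_self_iff, hz _ hZ]
  rw [List.length_nil, e0] at h1
  have h2 := runs_restore [] (T.write ++ out) [] [] (Function.update (fun x : I × Bool => (L x.2).drop (pos x)) (i, b) ((L b).drop (L b).length))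
        (Function.update (fun x : I × Bool => ((L x.2).take (pos x)).reverse) (i, b)
          ((L b).take (L b).length).reverse) i b
  rw [← zipped_update] at h2
  have e1 := zipped_update L pos (T.write ++ out) i b 0
  rw [e0] at e1
  simp only [Function.update_self, List.take_length, List.reverse_reverse, List.drop_length,
    List.append_nil, List.length_reverse, Function.update_idem] at h2
  simp only [List.drop_zero, List.take_zero, List.reverse_nil] at e1
  rw [← e1] at h2
  refine (h1.seq h2).mono ?_
  simp only [Polynomial.eval_add, Polynomial.eval_mul, Polynomial.eval_X, Polynomial.eval_one,
    Polynomial.eval_ofNat]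
  have := length_le_size L b
  gcongr

end Cmd

end PushdownGames

/-! ### Letters of an alternating machine as values of template variables -/

namespace PushdownGames

namespace ATM

open Classical in
/-- The kind of a state. -/
noncomputable def stateKd (M : ATM) (q : M.State) : Kd :=
  if q ∈ M.accepting then .acc else if q ∈ M.universal then .uni else .exi

/-- The kind of a letter. -/
noncomputable def kd (M : ATM) : M.Cell → Kd
  | .inl _ => .sym
  | .inr (q, _) => M.stateKd q

theorem stateKd_ne_sym (M : ATM) (q : M.State) : M.stateKd q ≠ .sym := by
  unfold stateKd
  split_ifs <;> simp

/-- The two numbers in the name of a letter. -/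
def cellPos (M : ATM) : M.Cell → Bool → ℕ
  | .inl _, true => 0
  | .inr (q, _), true => q.val + 1
  | .inl σ, false => σ.val + 1
  | .inr (_, σ), false => σ.val + 1

theorem cellName_some (M : ATM) (c : M.Cell) :
    M.cellName (some c) = [M.cellPos c true, M.cellPos c false] := by
  rcases c with σ | ⟨q, σ⟩ <;> rfl

/-- The first number is 0 for a tape symbol and positive for a head, which separates the two sorts
of letters. -/
theorem cellPos_injective (M : ATM) : Function.Injective M.cellPos := by
  rintro (σ | ⟨q, σ⟩) (σ' | ⟨q', σ'⟩) h
  · have := congrFun h false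
    simp only [cellPos, Nat.add_right_cancel_iff] at this
    rw [Fin.ext this]
  · have := congrFun h true
    simp [cellPos] at this
  · have := congrFun h true
    simp [cellPos] at this
  · have h1 := congrFun h true
    have h2 := congrFun h false
    simp only [cellPos, Nat.add_right_cancel_iff] at h1 h2
    rw [Fin.ext h1, Fin.ext h2]

/-- The lists over which the two numbers of a letter range. -/
noncomputable def lists (M : ATM) (b : Bool) : List Token :=
  if b then (List.finRange M.numState).map fun q => (M.stateKd q).tok
  else List.replicate M.numSym .tick

end ATM

namespace Cmd

variable {I : Type} [DecidableEq I]

/-- Executes `c` for all values of a variable that ranges over the letters of a kind. -/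
def forCell (i : I) (k : Kd) (c : Cmd (Stk I)) : Cmd (Stk I) :=
  if k = .sym then forVar i false (fun _ => true) c
  else forVar i true (fun t => t = k.tok) (forVar i false (fun _ => true) c)

/-- `x` and `y` are the numbers of a letter of kind `k`. -/
def IsCellPos (L : Bool → List Token) (k : Kd) (x y : ℕ) : Prop :=
  (if k = .sym then x = 0 else ∃ j, x = j + 1 ∧ (L true)[j]? = some k.tok) ∧
    ∃ j < (L false).length, y = j + 1

/-- For tape symbols only the second number has to run through a list. For heads the outer loop runs
over all states and keeps those whose token shows the right kind. -/
theorem Emits.forCell {Z : Set (I × Bool)} {c : Cmd (Stk I)}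
    {P : (Bool → List Token) → (I × Bool → ℕ) → List (List ℕ) → Prop} {i : I}
    (h : Emits (Z \ {(i, true), (i, false)}) c P) (hZ : ∀ b, (i, b) ∈ Z) (k : Kd) :
    Emits Z (forCell i k c) fun L pos rec =>
      ∃ x y, IsCellPos L k x y ∧
        P L (Function.update (Function.update pos (i, true) x) (i, false) y) rec := by
  by_cases hk : k = .sym
  · rw [Cmd.forCell, if_pos hk]
    have h' : Emits (Z \ {(i, false)}) c fun L pos rec =>
        P L (Function.update pos (i, true) 0) rec := by
      obtain ⟨p, hp⟩ := h
      refine ⟨p, fun L pos h1 h2 => ?_⟩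
      -- No loop runs over the first number of a tape symbol: it is 0 because the variable has no
      -- value yet.
      have : Function.update pos (i, true) 0 = pos := by
        rw [Function.update_eq_self_iff, h2]
        exact ⟨hZ true, by simp⟩
      simp only [this]
      exact hp L pos h1 fun x hx => h2 x ⟨hx.1, fun h => hx.2 (by simp_all)⟩
    obtain ⟨p, hp⟩ := h'.forVar (hZ false) (fun _ => true)
    refine ⟨p, fun L pos h1 h2 => ?_⟩
    obtain ⟨t, ht, ht'⟩ := hp L pos h1 h2
    refine ⟨t, fun rec => (ht rec).trans ?_, ht'⟩
    simp only [IsCellPos, hk, if_true]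
    constructor
    · rintro ⟨j, t, h3, -, h4⟩
      refine ⟨0, j + 1, ⟨rfl, j, (List.getElem?_eq_some_iff.1 h3).1, rfl⟩, ?_⟩
      rwa [Function.update_comm (by simp)]
    · rintro ⟨_, _, ⟨rfl, j, h3, rfl⟩, h4⟩
      refine ⟨j, _, List.getElem?_eq_getElem h3, trivial, ?_⟩
      rwa [Function.update_comm (by simp)]
  · rw [Cmd.forCell, if_neg hk]
    have h' : Emits ((Z \ {(i, true)}) \ {(i, false)}) c P := by
      convert h using 1
      ext x
      simp [and_assoc]
    obtain ⟨p, hp⟩ := (h'.forVar ⟨hZ false, by simp⟩ (fun _ => true)).forVar (hZ true)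
      (fun t => t = k.tok)
    refine ⟨p, fun L pos h1 h2 => ?_⟩
    obtain ⟨t, ht, ht'⟩ := hp L pos h1 h2
    refine ⟨t, fun rec => (ht rec).trans ?_, ht'⟩
    simp only [IsCellPos, hk, if_false, decide_eq_true_eq]
    constructor
    · rintro ⟨j, t, h3, rfl, j', t', h4, -, h5⟩
      exact ⟨j + 1, j' + 1, ⟨⟨j, rfl, h3⟩, j', (List.getElem?_eq_some_iff.1 h4).1, rfl⟩, h5⟩
    · rintro ⟨_, _, ⟨⟨j, rfl, h3⟩, j', h4, rfl⟩, h5⟩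
      exact ⟨j, _, h3, rfl, j', _, List.getElem?_eq_getElem h4, trivial, h5⟩

/-- Distinct kinds have distinct tokens, so the filter on the token of a state selects exactly the
states of kind `k`. -/
theorem isCellPos_lists (M : ATM) (k : Kd) (x y : ℕ) :
    IsCellPos M.lists k x y ↔
      ∃ c : M.Cell, M.kd c = k ∧ x = M.cellPos c true ∧ y = M.cellPos c false := by
  have tok_inj : ∀ k k' : Kd, k.tok = k'.tok → k = k' := by
    intro k k'
    cases k <;> cases k' <;> simp [Kd.tok]
  simp only [IsCellPos, ATM.lists, if_true, Bool.false_eq_true, if_false,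
    List.length_replicate, List.getElem?_map, Option.map_eq_some_iff]
  constructor
  · rintro ⟨h, j, hj, rfl⟩
    split_ifs at h with hk
    · exact ⟨.inl ⟨j, hj⟩, hk.symm, h, rfl⟩
    · obtain ⟨n, rfl, q, hq, e⟩ := h
      refine ⟨.inr (q, ⟨j, hj⟩), tok_inj _ _ e, ?_, rfl⟩
      obtain ⟨h1, h2⟩ := List.getElem?_eq_some_iff.1 hq
      simp [ATM.cellPos, ← h2]
  · rintro ⟨σ | ⟨q, σ⟩, rfl, rfl, rfl⟩
    · exact ⟨by simp [ATM.kd, ATM.cellPos], σ.val, σ.isLt, rfl⟩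
    · refine ⟨?_, σ.val, σ.isLt, rfl⟩
      rw [if_neg (by exact M.stateKd_ne_sym q)]
      exact ⟨q.val, rfl, q, by simp, rfl⟩

/-- Executes `c` for all values of the variables in a list. -/
def forCells (κ : I → Kd) (c : Cmd (Stk I)) : List I → Cmd (Stk I)
  | [] => c
  | i :: is => forCell i (κ i) (forCells κ c is)

/-- The predicate stays existential because it describes letters only when the lists are those of a
machine. Variables outside `is` keep the values that outer loops gave them. -/
theorem emits_forCells (κ : I → Kd) (R : List (List (Tok I))) (is : List I) (hd : is.Nodup)
    (Z : Set (I × Bool)) (hZ : ∀ i ∈ is, ∀ b, (i, b) ∈ Z) :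
    ∃ P, Emits Z (forCells κ (emitRecord R) is) P ∧ ∀ (M : ATM) pos rec, P M.lists pos rec ↔
      ∃ v : I → M.Cell, (∀ i ∈ is, M.kd (v i) = κ i) ∧
        rec = R.map (List.map (Tok.val fun x =>
          if x.1 ∈ is then M.cellPos (v x.1) x.2 else pos x)) := by
  induction is generalizing Z with
  | nil => exact ⟨_, emits_emitRecord Z R, fun M pos rec =>
      ⟨fun h => ⟨fun _ => .inl M.blank, by simp, by simpa using h⟩,
        fun ⟨_, _, h⟩ => by simpa using h⟩⟩
  | cons i is ih =>
    rw [List.nodup_cons] at hd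
    obtain ⟨P, hP, hP'⟩ := ih hd.2 (Z \ {(i, true), (i, false)}) (by
      intro j hj b
      refine ⟨hZ j (by simp [hj]) b, ?_⟩
      have : j ≠ i := fun h => hd.1 (h ▸ hj)
      simp [this])
    refine ⟨_, hP.forCell (hZ i (by simp)) (κ i), fun M pos rec => ?_⟩
    simp only [isCellPos_lists, hP']
    constructor
    · rintro ⟨x, y, ⟨c, h1, rfl, rfl⟩, v, h2, h3⟩
      refine ⟨Function.update v i c, ?_, ?_⟩
      · intro j hj
        by_cases h : j = i
        · subst h; simpa using h1
        · rw [Function.update_of_ne h]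
          exact h2 j (by simpa [h] using hj)
      · rw [h3]
        congr 3
        funext ⟨j, b⟩
        by_cases h : j = i
        · subst h
          cases b <;> simp [hd.1]
        · cases b <;> simp [h]
    · rintro ⟨v, h1, h2⟩
      refine ⟨_, _, ⟨v i, h1 i (by simp), rfl, rfl⟩, v, fun j hj => h1 j (by simp [hj]), ?_⟩
      rw [h2]
      congr 3
      funext ⟨j, b⟩
      by_cases h : j = i
      · subst h
        cases b <;> simp [hd.1]
      · cases b <;> simp [h]

/-- A template of records: the kinds of its variables, and a record that contains variables. -/
abbrev Template (I : Type) : Type := (I → Kd) × List (List (Tok I))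

/-- The record is an instance of one of the templates. -/
def IsInstance (T : List (Template I)) (M : ATM) (rec : List (List ℕ)) : Prop :=
  ∃ t ∈ T, ∃ v : I → M.Cell, (∀ i, M.kd (v i) = t.1 i) ∧
    rec = t.2.map (List.map (Tok.val fun x => M.cellPos (v x.1) x.2))

theorem emits_templates [Fintype I] (T : List (Template I)) :
    ∃ c P, Emits (I := I) Set.univ c P ∧
      ∀ (M : ATM) rec, P M.lists (fun _ => 0) rec ↔ IsInstance T M rec := by
  induction T with
  | nil => exact ⟨skip, _, emits_skip _, fun M rec => by simp [IsInstance]⟩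
  | cons t T ih =>
    obtain ⟨c, P, h, h'⟩ := ih
    obtain ⟨Q, hQ, hQ'⟩ := emits_forCells t.1 t.2 Finset.univ.toList (Finset.nodup_toList _)
      Set.univ (by simp)
    refine ⟨_, _, hQ.seq h, fun M rec => ?_⟩
    rw [h', hQ']
    simp [IsInstance]

/-! ## Reading the description of an alternating machine -/

/-- Removes the top of a stack. -/
def pop {K : Type} (k : K) : Cmd K := case k fun _ => skip

theorem runs_pop {K : Type} [DecidableEq K] (k : K) (S : K → List Token) :
    Runs (pop k) S (Function.update S k (S k).tail) 2 :=
  Runs.case (runs_skip _)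

/-- Pushes a token on the stacks of all variables in a list. -/
def pushAll (b : Bool) (t : Token) : List I → Cmd (Stk I)
  | [] => skip
  | i :: is => seq (push (.ctr i b false) t) (pushAll b t is)

theorem runs_pushAll (b : Bool) (t : Token) (is : List I) (hd : is.Nodup)
    (inp out tmp aux : List Token) (rem cnt : I × Bool → List Token) :
    Runs (pushAll b t is) (contents inp out tmp aux rem cnt)
      (contents inp out tmp aux
        (fun x => if x.2 = b ∧ x.1 ∈ is then t :: rem x else rem x) cnt) (is.length + 1) := by
  induction is generalizing rem with
  | nil => simpa [pushAll] using runs_skip _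
  | cons i is ih =>
    rw [List.nodup_cons] at hd
    have h1 := runs_push (Stk.ctr i b false) t (contents inp out tmp aux rem cnt)
    rw [update_rem, contents_rem] at h1
    refine ((h1.seq (ih hd.2 _)).congr ?_).mono (by simp only [List.length_cons]; omega)
    congr 1
    funext x
    obtain ⟨j, c⟩ := x
    by_cases h : j = i
    · subst h
      by_cases h' : c = b
      · subst h'; simp [hd.1]
      · simp [hd.1, h']
    · simp [h]

/-- The part of a description that belongs to a state. -/
def stateRecord (q u a : ℕ) : List Token :=
  List.replicate q .tick ++ .comma :: .semicolon :: (List.replicate u .tick ++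
    .comma :: .semicolon :: (List.replicate a .tick ++ [.comma, .semicolon, .newline]))

/-- Reads the last flag of a state. -/
def readAccepting (u : Bool) : Cmd (Stk I) :=
  case .inp fun v =>
    if v = some .tick then
      seq (pop .inp) (seq (pop .inp) (seq (pop .inp) (push .tmp Kd.acc.tok)))
    else seq (pop .inp) (seq (pop .inp) (push .tmp (if u then Kd.uni else Kd.exi).tok))

/-- Reads the part of a description that belongs to a state, and pushes the kind of the state. -/
def readState : Cmd (Stk I) :=
  seq (loop .inp (fun v => v = some .tick) fun _ => skip)
    (seq (pop .inp)
      (case .inp fun v =>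
        if v = some .tick then seq (pop .inp) (seq (pop .inp) (readAccepting true))
        else seq (pop .inp) (readAccepting false)))

/-- The flag for universal states comes first in the description. It is remembered in the program
point, here as the parameter `u`, until the accepting flag settles the kind. -/
theorem runs_readAccepting (u a : Bool) (l tmp aux : List Token) (rem cnt : I × Bool → List Token) :
    Runs (readAccepting u) (contents (List.replicate a.toNat .tick ++
        .comma :: .semicolon :: .newline :: l) [] tmp aux rem cnt)
      (contents l [] ((if a then Kd.acc else if u then Kd.uni else Kd.exi).tok :: tmp) aux rem cnt)
      8 := by
  cases a
  · refine Runs.mono (n := 5 + 1) (Runs.case ?_) (by omega)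
    refine Runs.seq (n := 2) (n' := 3) (runs_pop _ _) (Runs.seq (n := 2) (n' := 1)
      (runs_pop _ _) ?_)
    refine (runs_push _ _ _).congr ?_
    simp
  · refine Runs.mono (n := 7 + 1) (Runs.case ?_) (by omega)
    refine Runs.seq (n := 2) (n' := 5) (runs_pop _ _) (Runs.seq (n := 2) (n' := 3)
      (runs_pop _ _) (Runs.seq (n := 2) (n' := 1) (runs_pop _ _) ?_))
    refine (runs_push _ _ _).congr ?_
    simp

theorem runs_skipTicks (n : ℕ) (l out tmp aux : List Token) (rem cnt : I × Bool → List Token) :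
    Runs (loop .inp (fun v => v = some .tick) fun _ => skip)
      (contents (List.replicate n .tick ++ .comma :: l) out tmp aux rem cnt)
      (contents l out tmp aux rem cnt) (n * 2 + 1) := by
  have := runs_loop_list (k := Stk.inp) (p := fun v => v = some .tick) (f := fun _ => skip)
    (n := 1) (sentinel := .comma :: l) (by simp)
    (fun r => contents (r ++ .comma :: l) out tmp aux rem cnt) (List.replicate n .tick)
    (fun r => rfl) (by
      intro pre t r e
      have : t = .tick := by
        have : t ∈ List.replicate n Token.tick := by rw [e]; simp
        exact List.eq_of_mem_replicate this
      subst this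
      refine ⟨by simp, ?_⟩
      rw [update_inp]
      exact runs_skip _)
  simpa using this

theorem runs_readState (q : ℕ) (u a : Bool) (l tmp aux : List Token)
    (rem cnt : I × Bool → List Token) :
    Runs readState (contents (stateRecord q u.toNat a.toNat ++ l) [] tmp aux rem cnt)
      (contents l [] ((if a then Kd.acc else if u then Kd.uni else Kd.exi).tok :: tmp) aux rem cnt)
      (2 * q + 16) := by
  have h1 := runs_skipTicks q (.semicolon :: (List.replicate u.toNat .tick ++
    .comma :: .semicolon :: (List.replicate a.toNat .tick ++
      [.comma, .semicolon, .newline] ++ l))) [] tmp aux rem cnt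
  have h2 : Runs (K := Stk I) (case .inp fun v =>
        if v = some .tick then seq (pop .inp) (seq (pop .inp) (readAccepting true))
        else seq (pop .inp) (readAccepting false)) (contents (List.replicate u.toNat .tick ++
      .comma :: .semicolon :: (List.replicate a.toNat .tick ++
      [.comma, .semicolon, .newline] ++ l)) [] tmp aux rem cnt)
      (contents l [] ((if a then Kd.acc else if u then Kd.uni else Kd.exi).tok :: tmp) aux rem cnt)
      13 := by
    have h3 := runs_readAccepting u a l tmp aux rem cnt
    cases u
    · refine Runs.mono (n := 10 + 1) (Runs.case ?_) (by omega)
      refine Runs.seq (n := 2) (n' := 8) (runs_pop _ _) ?_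
      simpa using h3
    · refine Runs.mono (n := 12 + 1) (Runs.case ?_) (by omega)
      refine Runs.seq (n := 2) (n' := 10) (runs_pop _ _) (Runs.seq (n := 2) (n' := 8)
        (runs_pop _ _) ?_)
      simpa using h3
  have h4 := runs_pop Stk.inp (contents (.semicolon :: (List.replicate u.toNat .tick ++
    .comma :: .semicolon :: (List.replicate a.toNat .tick ++
      [.comma, .semicolon, .newline] ++ l))) [] tmp aux rem cnt)
  rw [update_inp] at h4
  have := (h1.seq (h4.seq h2)).mono (n' := 2 * q + 16) (by omega)
  simpa [stateRecord, readState] using this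

end Cmd

end PushdownGames

/-! ### Polynomial-time production of all instances of the templates -/

namespace PushdownGames

namespace Cmd

variable {I : Type} [DecidableEq I]

theorem polynomial_eval_mono (p : Polynomial ℕ) {m n : ℕ} (h : m ≤ n) : p.eval m ≤ p.eval n := by
  induction p using Polynomial.induction_on' with
  | add p q hp hq => simpa using Nat.add_le_add hp hq
  | monomial k a => simpa using Nat.mul_le_mul_left a (Nat.pow_le_pow_left h k)

/-- Isolates the part of the input that matters, namely the two sizes and the flags of the states.
The blank, the initial state and the transition table, which is `rest`, are skipped by the reading
command. -/
theorem write_eq (M : ATM) : ∃ rest : List Token, M.write =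
    List.replicate M.numSym .tick ++ .comma :: .semicolon ::
      (List.replicate M.numState .tick ++ .comma :: .semicolon ::
        (List.replicate M.blank.val .tick ++ .comma :: .semicolon ::
          (List.replicate M.start.val .tick ++ .comma :: .semicolon :: .newline ::
            (((List.finRange M.numState).flatMap fun q => stateRecord q.val
              (decide (q ∈ M.universal)).toNat (decide (q ∈ M.accepting)).toNat) ++ rest)))) := by
  refine ⟨Table.write ((List.finRange M.numState).flatMap fun q =>
    (List.finRange M.numSym).map fun σ =>
      let t := M.δ q σ
      [[q.val, σ.val], [t.1.1.val, t.1.2.1.val, t.1.2.2.toNat],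
        [t.2.1.val, t.2.2.1.val, t.2.2.2.toNat]]), ?_⟩
  rw [ATM.write, ATM.table, write_append, write_append]
  have : Table.write ((List.finRange M.numState).map fun q =>
      [[q.val], [if q ∈ M.universal then 1 else 0], [if q ∈ M.accepting then 1 else 0]]) =
      (List.finRange M.numState).flatMap fun q => stateRecord q.val
        (decide (q ∈ M.universal)).toNat (decide (q ∈ M.accepting)).toNat := by
    rw [Table.write, List.flatMap_map]
    congr 1
    funext q
    by_cases h : q ∈ M.universal <;> by_cases h' : q ∈ M.accepting <;>
      simp [stateRecord, h, h']
  rw [this]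
  simp [Table.write]

/-- Reads the description of an alternating machine, and prepares the lists over which the
variables range. -/
def readMachine (is : List I) : Cmd (Stk I) :=
  seq (loop .inp (fun v => v = some .tick) fun _ => pushAll false .tick is)
    (seq (pop .inp)
      (seq (loop .inp (fun v => v = some .tick) fun _ => push .aux .tick)
        (seq (pop .inp)
          (seq (loop .inp (fun v => v = some .tick) fun _ => skip)
            (seq (pop .inp)
              (seq (loop .inp (fun v => v = some .tick) fun _ => skip)
                (seq (pop .inp)
                  (seq (pop .inp)
                    (seq (drain .aux fun _ => readState)
                      (seq (drain .tmp fun t => pushAll true t is)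
                        (drain .inp fun _ => skip)))))))))))

theorem stateKd_eq (M : ATM) (q : M.State) : M.stateKd q = if decide (q ∈ M.accepting) = true
    then Kd.acc else if decide (q ∈ M.universal) = true then Kd.uni else Kd.exi := by
  simp [ATM.stateKd]

/-- Reading of a unary number; `F j` is the invariant with `j` ticks left before the comma. -/
theorem runs_loop_ticks {f : Cmd (Stk I)} {n m : ℕ} {l : List Token}
    (F : ℕ → Stk I → List Token) (hF : ∀ j ≤ m, F j .inp = List.replicate j .tick ++ .comma :: l)
    (h : ∀ j < m, Runs f (Function.update (F (j + 1)) .inp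
      (List.replicate j .tick ++ .comma :: l)) (F j) n) :
    Runs (loop .inp (fun v => v = some .tick) fun _ => f) (F m)
      (Function.update (F 0) .inp l) (m * (n + 1) + 1) := by
  have := runs_loop_list (k := Stk.inp) (p := fun v => v = some .tick) (f := fun _ => f)
    (n := n) (sentinel := .comma :: l) (by simp)
    (fun r => Function.update (F r.length) .inp (r ++ .comma :: l)) (List.replicate m .tick)
    (fun r => by simp) (by
      intro pre t r e
      have ht : t = .tick := by
        have : t ∈ List.replicate m Token.tick := by rw [e]; simp
        exact List.eq_of_mem_replicate this
      subst ht
      have hr : r = List.replicate r.length .tick := by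
        refine List.eq_replicate_of_mem fun b hb => ?_
        have : b ∈ List.replicate m Token.tick := by rw [e]; simp [hb]
        exact List.eq_of_mem_replicate this
      have hm : r.length < m := by
        have := congrArg List.length e
        simp at this
        omega
      refine ⟨by simp, ?_⟩
      have h1 := h r.length hm
      have h2 := hF r.length hm.le
      rw [← hr] at h1 h2
      have h3 : Function.update (F r.length) .inp (r ++ .comma :: l) = F r.length := by
        rw [Function.update_eq_self_iff, h2]
      simpa [h3] using h1)
  have h3 : Function.update (F m) .inp (List.replicate m .tick ++ .comma :: l) = F m := by
    rw [Function.update_eq_self_iff, hF m le_rfl]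
  simpa [h3] using this

/-- The products of variables are estimated by hand; everything else is linear. -/
theorem readMachine_time {n m a b c s N : ℕ} (hlen : n + m + a + b + c + 9 ≤ N) :
    n * (s + 1 + 1) + 1 + (2 + (m * (1 + 1) + 1 + (2 + (a * 2 + 1 + (2 + (b * 2 + 1 +
      (2 + (2 + (m * (2 * m + 16 + 1) + 1 + (m * (s + 1 + 1) + 1 +
        (c * (1 + 1) + 1))))))))))) ≤ (N + 1) * (2 * N + (s + 40)) := by
  have i1 : n * (s + 1 + 1) + m * (s + 1 + 1) ≤ N * (s + 2) := by
    rw [← Nat.add_mul]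
    exact Nat.mul_le_mul (by omega) le_rfl
  have i2 : m * (2 * m + 16 + 1) ≤ N * (2 * N + 17) := Nat.mul_le_mul (by omega) (by omega)
  have i3 : (N + 1) * (2 * N + (s + 40)) = N * (s + 2) + N * (2 * N + 17) + N * 21 +
    (2 * N + (s + 40)) := by ring
  rw [i3]
  omega

/-- The number of states is kept in unary on `aux`, so that the command knows how many state records
follow. Their kinds are collected on `tmp`, with the last state on top, and emptying `tmp` onto the
lists of the variables restores the original order. -/
theorem runs_readMachine (M : ATM) (is : List I) (hd : is.Nodup) (his : ∀ i, i ∈ is) :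
    Runs (readMachine is) (Function.update (fun _ => []) .inp M.write)
      (zipped M.lists (fun _ => 0) [])
      (((Polynomial.X + 1) * (2 * Polynomial.X + Polynomial.C (is.length + 40)) : Polynomial ℕ).eval
        M.write.length) := by
  obtain ⟨rest, e⟩ := write_eq M
  set recs : List Token := (List.finRange M.numState).flatMap fun q => stateRecord q.val
    (decide (q ∈ M.universal)).toNat (decide (q ∈ M.accepting)).toNat with hrecs
  set n := M.numSym with hn
  set m := M.numState with hm
  have hlen : n + m + M.blank.val + M.start.val + rest.length + 9 ≤ M.write.length := by
    rw [e]
    simp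
    omega
  have hstart : (Function.update (fun _ => []) Stk.inp M.write : Stk I → List Token) =
      contents M.write [] [] [] (fun _ => []) (fun _ => []) := by
    funext k
    cases k <;> simp [contents]
  set l4 := List.replicate M.start.val Token.tick ++ .comma :: .semicolon :: .newline ::
    (recs ++ rest) with hl4
  set l3 := List.replicate M.blank.val Token.tick ++ .comma :: .semicolon :: l4 with hl3
  set l2 := List.replicate m Token.tick ++ .comma :: .semicolon :: l3 with hl2
  set R : I × Bool → List Token := fun x => if x.2 then [] else List.replicate n .tick with hR
  have h1 := runs_loop_ticks (I := I) (f := pushAll false .tick is) (n := is.length + 1) (m := n)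
    (l := .semicolon :: l2)
    (fun j => contents (List.replicate j .tick ++ .comma :: .semicolon :: l2) [] [] []
      (fun x => if x.2 then [] else List.replicate (n - j) .tick) (fun _ => []))
    (fun j _ => rfl) (by
      intro j hj
      rw [update_inp]
      refine (runs_pushAll false .tick is hd _ _ _ _ _ _).congr ?_
      congr 1
      funext x
      cases h : x.2 <;>
        simp [his, h, show n - j = (n - (j + 1)) + 1 by omega, List.replicate_succ])
  rw [update_inp, Nat.sub_self, Nat.sub_zero] at h1
  have h2 := runs_pop Stk.inp (contents (.semicolon :: l2) [] [] [] R (fun _ => []))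
  have h3 := runs_loop_ticks (I := I) (f := push .aux .tick) (n := 1) (m := m)
    (l := .semicolon :: l3)
    (fun j => contents (List.replicate j .tick ++ .comma :: .semicolon :: l3) [] []
      (List.replicate (m - j) .tick) R (fun _ => []))
    (fun j _ => rfl) (by
      intro j hj
      rw [update_inp]
      refine (runs_push _ _ _).congr ?_
      simp [show m - j = (m - (j + 1)) + 1 by omega, List.replicate_succ])
  rw [update_inp, Nat.sub_self, Nat.sub_zero] at h3
  have h4 := runs_pop Stk.inp (contents (.semicolon :: l3) [] [] (List.replicate m .tick) R
    (fun _ => []))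
  have h5 := runs_skipTicks M.blank.val (.semicolon :: l4) [] [] (List.replicate m .tick) R
    (fun _ => [])
  have h6 := runs_pop Stk.inp (contents (.semicolon :: l4) [] [] (List.replicate m .tick) R
    (fun _ => []))
  have h7 := runs_skipTicks M.start.val (.semicolon :: .newline :: (recs ++ rest)) [] []
    (List.replicate m .tick) R (fun _ => [])
  have h8 := runs_pop Stk.inp (contents (.semicolon :: .newline :: (recs ++ rest)) [] []
    (List.replicate m .tick) R (fun _ => []))
  have h9 := runs_pop Stk.inp (contents (.newline :: (recs ++ rest)) [] []
    (List.replicate m .tick) R (fun _ => []))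
  -- When `r` is left on `aux`, the first `m - r.length` state records have been read. The longest
  -- of them determines the quadratic contribution to the time.
  have h10 := runs_drain (K := Stk I) (k := .aux) (f := fun _ => readState) (n := 2 * m + 16)
    (fun r => contents ((((List.finRange m).drop (m - r.length)).flatMap fun q =>
      stateRecord q.val (decide (q ∈ M.universal)).toNat (decide (q ∈ M.accepting)).toNat) ++ rest)
      [] (((List.finRange m).take (m - r.length)).map fun q => (M.stateKd q).tok).reverse r R
      (fun _ => [])) (List.replicate m .tick) (fun r => rfl) (by
        intro pre t r e
        have hm' : r.length < m := by
          have := congrArg List.length e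
          simp at this
          omega
        obtain ⟨j, hj⟩ : ∃ j, j = m - (r.length + 1) := ⟨_, rfl⟩
        have hjm : j < m := by omega
        have hj' : m - r.length = j + 1 := by omega
        have hd : (List.finRange m).drop j = ⟨j, hjm⟩ :: (List.finRange m).drop (j + 1) := by
          rw [List.drop_eq_getElem_cons (by simpa using hjm)]
          simp
        rw [update_aux, List.length_cons, ← hj, hj', hd, List.flatMap_cons, List.append_assoc]
        refine ((runs_readState _ _ _ _ _ _ _ _).congr ?_).mono
          (n := 2 * j + 16) (by omega)
        congr 1
        rw [← stateKd_eq, List.take_succ]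
        simp [hjm])
  rw [List.length_replicate, List.length_nil, Nat.sub_self, Nat.sub_zero, List.drop_zero,
    List.take_zero, List.drop_of_length_le (by simp), List.take_of_length_le (by simp)] at h10
  have h11 := runs_drain (K := Stk I) (k := .tmp) (f := fun t => pushAll true t is)
    (n := is.length + 1)
    (fun r => contents rest [] r [] (fun x => if x.2 then (M.lists true).drop r.length
      else List.replicate n .tick) (fun _ => []))
    (M.lists true).reverse (fun r => rfl) (by
      intro pre t r e
      have e' : M.lists true = r.reverse ++ t :: pre.reverse := by
        simpa using congrArg List.reverse e
      rw [update_tmp]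
      refine (runs_pushAll true t is hd _ _ _ _ _ _).congr ?_
      congr 1
      funext x
      cases h : x.2
      · simp [his, h]
      · simp only [his, h, e', List.length_cons, and_self, if_true]
        simp [List.drop_append, show List.drop (r.length + 1) r.reverse = [] from
          List.drop_eq_nil_of_le (by simp)])
  have h12 := runs_drain (K := Stk I) (k := .inp) (f := fun _ => skip) (n := 1)
    (fun r => contents r [] [] [] (fun x => M.lists x.2) (fun _ => [])) rest (fun r => rfl) (by
      intro pre t r e
      rw [update_inp]
      exact runs_skip _)
  simp only [update_inp, contents_inp, List.tail_cons] at h2 h4 h6 h8 h9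
  simp only [List.flatMap_nil, List.nil_append] at h10
  have e1 : (fun x : I × Bool => if x.2 = true then (M.lists true).drop
      (M.lists true).reverse.length else List.replicate n Token.tick) = R := by
    funext x
    simp only [List.length_reverse, List.drop_length, hR]
  have e2 : (fun x : I × Bool => if x.2 = true then (M.lists true).drop
      ([] : List Token).length else List.replicate n Token.tick) = fun x => M.lists x.2 := by
    funext x
    cases h : x.2 <;> simp [ATM.lists, h, hn]
  have e3 : ((List.finRange m).map fun q => (M.stateKd q).tok) = M.lists true := by
    simp only [ATM.lists, if_true]
    rfl
  have e4 : (fun x : I × Bool => if x.2 = true then [] else List.replicate 0 Token.tick) =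
      fun _ => [] := by
    funext x
    simp
  rw [e4] at h1
  rw [e1, e2] at h11
  rw [e3] at h10
  have hfin : contents [] [] [] [] (fun x : I × Bool => M.lists x.2) (fun _ => []) =
      zipped M.lists (fun _ => 0) [] := by
    simp [zipped]
  have hlen2 : (M.lists true).length = m := by simp [ATM.lists, hm]
  rw [hstart, e, ← hfin]
  refine (h1.seq (h2.seq (h3.seq (h4.seq (h5.seq (h6.seq (h7.seq (h8.seq (h9.seq
    (h10.seq (h11.seq h12))))))))))).mono ?_
  rw [← e, List.length_reverse, hlen2]
  simp only [Polynomial.eval_add, Polynomial.eval_mul, Polynomial.eval_X, Polynomial.eval_one,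
    Polynomial.eval_ofNat, Polynomial.eval_C]
  exact readMachine_time hlen

/-- Removes the remaining parts of all lists. -/
def clear : List (I × Bool) → Cmd (Stk I)
  | [] => skip
  | x :: xs => seq (drain (.ctr x.1 x.2 false) fun _ => skip) (clear xs)

theorem runs_clear (xs : List (I × Bool)) (out : List Token) (N : ℕ)
    (rem : I × Bool → List Token) (hN : ∀ x, (rem x).length ≤ N) :
    Runs (clear xs) (contents [] out [] [] rem (fun _ => []))
      (contents [] out [] [] (fun x => if x ∈ xs then [] else rem x) (fun _ => []))
      (xs.length * (2 * N + 1) + 1) := by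
  induction xs generalizing rem with
  | nil => simpa [clear] using runs_skip _
  | cons x xs ih =>
    have h1 := runs_drain (K := Stk I) (k := .ctr x.1 x.2 false) (f := fun _ => skip) (n := 1)
      (fun r => contents [] out [] [] (Function.update rem x r) (fun _ => [])) (rem x)
      (fun r => by simp) (by
        intro pre t r e
        rw [update_rem]
        simpa using runs_skip _)
    rw [Function.update_eq_self] at h1
    have h2 := ih (Function.update rem x []) (by
      intro y
      by_cases h : y = x
      · subst h; simp
      · simpa [h] using hN y)
    refine ((h1.seq h2).congr ?_).mono ?_
    · congr 1
      funext y
      by_cases h : y = x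
      · subst h; simp
      · simp [h]
    · have := hN x
      simp only [List.length_cons, Nat.add_mul]
      omega

/-- For each list of templates there is a polynomial-time computable function that yields the
list of their instances. -/
theorem exists_polyTime_instances [Fintype I] (T : List (Template I)) :
    ∃ build : ATM → Table,
      Nonempty (Turing.TM2ComputableInPolyTime ATM.write Table.write build) ∧
      ∀ M rec, rec ∈ build M ↔ IsInstance T M rec := by
  obtain ⟨c, P, ⟨p, hp⟩, hP⟩ := emits_templates T
  choose build hb hb' using fun M : ATM => hp M.lists (fun _ => 0) (fun _ => Nat.zero_le _)
    (fun _ _ => rfl)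
  refine ⟨build, ?_, fun M rec => (hb M rec).trans (hP M rec)⟩
  have hsize : ∀ M : ATM, size M.lists ≤ M.write.length := by
    intro M
    obtain ⟨rest, e⟩ := write_eq M
    rw [e]
    simp [size, ATM.lists]
    omega
  -- At the end every stack other than the output has to be empty, which is why the lists of the
  -- variables are cleared last.
  refine nonempty_polyTime (inp := Stk.inp) (out := Stk.out)
    (c := seq (readMachine (Finset.univ : Finset I).toList)
      (seq c (clear (Finset.univ : Finset (I × Bool)).toList)))
    (p := (Polynomial.X + 1) * (2 * Polynomial.X +
      Polynomial.C ((Finset.univ : Finset I).toList.length + 40)) +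
      (p + (Polynomial.C (Finset.univ : Finset (I × Bool)).toList.length *
        (2 * Polynomial.X + 1) + 1))) fun M => ?_
  rw [Polynomial.eval_add, Polynomial.eval_add]
  refine (runs_readMachine M _ (Finset.nodup_toList _) (by simp)).seq
    (Runs.seq (((hb' M []).congr (by rw [List.append_nil])).mono
      (polynomial_eval_mono p (hsize M))) ?_)
  have h := runs_clear (Finset.univ : Finset (I × Bool)).toList (build M).write M.write.length
    (fun x => M.lists x.2) (fun x => (length_le_size _ _).trans (hsize M))
  have e : contents [] (build M).write [] [] (fun x => M.lists x.2) (fun _ => []) =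
      zipped (I := I) M.lists (fun _ => 0) (build M).write := by
    simp [zipped]
  rw [e] at h
  refine (h.congr ?_).mono (by simp)
  funext k
  cases k <;> simp [contents]

end Cmd

end PushdownGames

namespace PushdownGames

/-! ## The pushdown system, for an arbitrary set of letters -/

/-- The atomic propositions other than triples and marks. -/
inductive Bas
  | zero | one | all | ex | l | r | f
  | start1 | start2 | start3 | end1 | end2 | end3
  deriving DecidableEq

instance : Fintype Bas := ⟨{.zero, .one, .all, .ex, .l, .r, .f, .start1, .start2, .start3, .end1,
  .end2, .end3}, fun a => by cases a <;> simp⟩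

/-- The marks. -/
inductive Mark
  | check1 | check2 | check3 | checkHat3
  deriving DecidableEq

instance : Fintype Mark := ⟨{.check1, .check2, .check3, .checkHat3}, fun a => by cases a <;> simp⟩

/-- The atomic propositions other than marks. -/
inductive Letter (C : Type)
  | bas (b : Bas)
  | lam (p : Option C) (u : C) (s : Option C)
  deriving Fintype

/-- The stack symbols: a flag tells whether the symbol belongs to the first code. -/
abbrev Sym (C : Type) : Type := Bool × Letter C

/-- The positions within a 3-block, with saturated counters of the completed sub-blocks. -/
inductive Phase
  | start3
  | start2 (c2 : Fin 3)
  | start1 (c2 c1 : Fin 3)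
  | bit (c2 c1 : Fin 3) (c0 : Fin 4) (v : Bool)
  | end1 (c2 c1 : Fin 3)
  | bit2 (c2 : Fin 3) (v : Bool)
  | end2 (c2 : Fin 3)
  deriving DecidableEq, Fintype

/-- The modes of the phase in which the stack is read: no mark so far; `check3` in the current
code; a mark `checkHat3` is due; all marks done; in a check 2-block-tree without or with a
mark `check1`. -/
inductive Mode
  | A | B | C | D | E | F
  deriving DecidableEq

instance : Fintype Mode := ⟨{.A, .B, .C, .D, .E, .F}, fun a => by cases a <;> simp⟩

set_option synthInstance.maxSize 1000 in
/-- The control states. In the first five cases a code is generated: `fst` tells whether it is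
the first one, `hd` is the kind of the head that occurred, `last` the two last letters. -/
inductive Ctl (C : Type)
  | tag (b fst : Bool)
  | clos (b fst : Bool)
  | blk (ph : Phase) (fst : Bool) (hd : Option Kd) (last : Option (C × C))
  | lam (fst : Bool) (hd : Option Kd) (p : Option C) (u : C) (s : Option C)
  | end3 (fst : Bool) (hd : Option Kd) (u : C) (s : Option C)
  | pop (md : Mode) (mk : Option Mark) (x : Letter C)
  | sink (b : Bool)
  deriving Fintype

/-- The choices of an agent; they determine the label of the next configuration. -/
inductive Act (C : Type)
  | one
  | bas (b : Bas)
  | win0 (u : C) (s : Option C)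
  | win1 (x : Option C)
  | mark (m : Option Mark)
  deriving Fintype

/-- The actions: choices in two copies. -/
abbrev Action (C : Type) : Type := Act C × Bool

def Bas.ofBool (v : Bool) : Bas := if v then one else zero

def Phase.bas : Phase → Bas
  | start3 => .start3
  | start2 _ => .start2
  | start1 _ _ => .start1
  | bit _ _ _ v => .ofBool v
  | end1 _ _ => .end1
  | bit2 _ v => .ofBool v
  | end2 _ => .end2

/-- Saturated increment. -/
def incr {n : ℕ} (c : Fin (n + 1)) : Fin (n + 1) := ⟨min n (c.val + 1), by omega⟩

def Bas.toBool : Bas → Option Bool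
  | zero => some false
  | one => some true
  | _ => none

/-- The next position within a 3-block. -/
def Phase.next : Phase → Bas → Option Phase
  | start3, b => if b = .start2 then some (.start2 0) else none
  | start2 c2, b => if b = .start1 then some (.start1 c2 0) else none
  | start1 c2 c1, b => b.toBool.map (.bit c2 c1 1)
  | bit c2 c1 c0 _, b =>
    if b = .end1 then (if c0 = 3 then some (.end1 c2 (incr c1)) else none)
    else b.toBool.map (.bit c2 c1 (incr c0))
  | end1 c2 c1, b =>
    if b = .start1 then some (.start1 c2 c1)
    else if c1 = 2 then b.toBool.map (.bit2 c2) else none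
  | bit2 c2 _, b => if b = .end2 then some (.end2 (incr c2)) else none
  | end2 c2, b => if b = .start2 then some (.start2 c2) else none

/-- The outer `none` is a refusal: a second head is never accepted. -/
def addHead (hd : Option Kd) (k : Kd) : Option (Option Kd) :=
  if k = .sym then some hd else if hd = none then some (some k) else none

section

variable {C : Type}

/-- The kind of the head after the next letter, or the end marker, has been chosen. -/
def commit (kd : C → Kd) (hd : Option Kd) : Option C → Option (Option Kd)
  | none => if hd.isSome then some hd else none
  | some c => addHead hd (kd c)

/-- The value at `none` is irrelevant, because a code is closed only after a head has occurred. -/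
def closing (hd : Option Kd) : Bas :=
  if hd = some .acc then .f else if hd = some .uni then .all else .ex

/-- The next control state while codes are generated. -/
def Ctl.next (kd : C → Kd) : Ctl C → Act C → Option (Ctl C)
  | tag _ fst, .bas b => if b = .start3 then some (blk .start3 fst none none) else none
  | clos _ _, .bas b =>
    if b = .l then some (tag false false) else if b = .r then some (tag true false) else none
  | blk ph fst hd last, .bas b => (ph.next b).map (blk · fst hd last)
  | blk ph fst _ none, .win0 u s =>
    if ph = .end2 2 then
      ((addHead none (kd u)).bind fun h => commit kd h s).map (lam fst · none u s)
    else none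
  | blk ph fst hd (some (u, s)), .win1 x =>
    if ph = .end2 2 then (commit kd hd x).map (lam fst · (some u) s x) else none
  | lam fst hd _ u s, .bas b => if b = .end3 then some (end3 fst hd u s) else none
  | end3 fst hd u (some s), .bas b =>
    if b = .start3 then some (blk .start3 fst hd (some (u, s))) else none
  | end3 fst hd _ none, .bas b =>
    if b = closing hd then
      some (if b = .f then pop .A none (.bas .f) else clos (b = .all) fst)
    else none
  | _, _ => none

/-- The atomic proposition, other than a mark, that holds in a control state. -/
def Ctl.letter : Ctl C → Letter C
  | tag b _ => .bas (if b then .r else .l)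
  | clos b _ => .bas (if b then .all else .ex)
  | blk ph _ _ _ => .bas ph.bas
  | lam _ _ p u s => .lam p u s
  | end3 _ _ _ _ => .bas .end3
  | pop _ _ x => x
  | sink _ => .bas .f

def Ctl.fst : Ctl C → Bool
  | tag _ fst => fst
  | clos _ fst => fst
  | blk _ fst _ _ => fst
  | lam fst _ _ _ _ => fst
  | end3 fst _ _ _ => fst
  | _ => false

/-- Codes are generated. -/
def Ctl.isGen : Ctl C → Bool
  | pop _ _ _ => false
  | sink _ => false
  | _ => true

/-- The atomic propositions that hold in a control state. -/
def Ctl.props : Ctl C → List (Letter C ⊕ Mark)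
  | pop _ mk x => .inl x :: mk.toList.map .inr
  | sink _ => []
  | q => [.inl q.letter]

/-- What is relevant of a letter while the stack is read. -/
inductive Cls
  | bit | tag | win (b : Bool) | start1 | start2 | end1 | end2 | other
  deriving DecidableEq

def Letter.cls : Letter C → Cls
  | bas .zero => .bit
  | bas .one => .bit
  | bas .l => .tag
  | bas .r => .tag
  | bas .start1 => .start1
  | bas .start2 => .start2
  | bas .end1 => .end1
  | bas .end2 => .end2
  | bas _ => .other
  | lam p _ _ => .win p.isNone

/-- The nodes of simple check-trees. -/
def Mode.isSimple : Mode → Bool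
  | .E => false
  | .F => false
  | _ => true

/-- The next mode after a step from a symbol of class `x` to a symbol of class `y` with flag `fl`
and mark `m`. -/
def Mode.next (md : Mode) (x : Cls) (fl : Bool) (y : Cls) (m : Option Mark) : Option Mode :=
  match md, y with
  | .A, .win b =>
    if m = some .check3 then some .B else if m = none ∧ ¬ (fl ∧ b) then some .A else none
  | .C, .win b =>
    if m = some .checkHat3 then some .D else if m = none ∧ ¬ b then some .C else none
  | .B, .tag => if m = none then some .C else none
  | .E, .bit =>
    if m = none then some .E else if m = some .check1 ∧ x = .end1 then some .F else none
  | .F, _ => if m = none then some .F else none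
  | .E, _ => if m = none then some .E else none
  | md, .bit =>
    if m = none then some md else if m = some .check2 ∧ x = .end2 then some .E else none
  | md, _ => if m = none then some md else none

/-- The check 2-block-tree ends here. -/
def Mode.isFinal (md : Mode) (x : Cls) : Bool :=
  (md = .E ∧ x = .start2) ∨ (md = .F ∧ x = .start1)

/-- The system chooses the next symbol. -/
def Mode.isSys (md : Mode) (x : Cls) (fl : Bool) (y : Cls) : Bool :=
  match md, y with
  | .A, .win b => ¬ (fl ∧ b)
  | md, .bit => md.isSimple ∧ x = .end2
  | _, _ => false

/-- The transitions, for the choice of the agent that controls the state. -/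
def Ctl.step (kd : C → Kd) (q : Ctl C) (γ : Option (Sym C)) (a : Act C) :
    Option (Ctl C × List (Sym C)) :=
  match q with
  | sink b => match a with
    | .one => some (sink b, γ.toList)
    | _ => none
  | pop md _ x =>
    if md.isFinal x.cls then
      match a with
      | .one => some (sink true, γ.toList)
      | _ => none
    else match γ, a with
      | none, .one => some (sink (!md.isSimple), [])
      | some y, .mark m => (md.next x.cls y.1 y.2.cls m).map fun md' => (pop md' m y.2, [])
      | _, _ => none
  | q => (q.next kd a).map fun q' => (q', (q.fst, q.letter) :: γ.toList)

/-- The system controls the state. -/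
def Ctl.isSys : Ctl C → Option (Sym C) → Bool
  | clos b _, _ => b
  | pop md _ x, some y => md.isSys x.cls y.1 y.2.cls
  | _, _ => false

/-- The default action is the only one available to the agent that does not control the state; only
one of the two copies of `one` qualifies. -/
def Action.isDefault : Action C → Bool
  | (.one, false) => true
  | _ => false

/-- The transitions. -/
def Ctl.delta (kd : C → Kd) (q : Ctl C) (γ : Option (Sym C)) (d : Agent → Action C) :
    Option (Ctl C × List (Sym C)) :=
  if q.isSys γ then
    if Action.isDefault (d .env) then q.step kd γ (d .sys).1 else none
  else
    if Action.isDefault (d .sys) then q.step kd γ (d .env).1 else none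

/-- A pushdown system must have a transition for every control state and every top. A basic letter
suffices in each case: at the end of a sub-block, for instance, a further one can always be opened.
-/
theorem Ctl.exists_next (kd : C → Kd) (q : Ctl C) (h : q.isGen = true) :
    ∃ b, (q.next kd (.bas b)).isSome := by
  cases q with
  | tag b fst => exact ⟨.start3, by simp [Ctl.next]⟩
  | clos b fst => exact ⟨.l, by simp [Ctl.next]⟩
  | blk ph fst hd last =>
    cases ph with
    | start3 => exact ⟨.start2, by cases last <;> simp [Ctl.next, Phase.next]⟩
    | start2 => exact ⟨.start1, by cases last <;> simp [Ctl.next, Phase.next]⟩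
    | start1 => exact ⟨.zero, by cases last <;> simp [Ctl.next, Phase.next, Bas.toBool]⟩
    | bit => exact ⟨.zero, by cases last <;> simp [Ctl.next, Phase.next, Bas.toBool]⟩
    | end1 => exact ⟨.start1, by cases last <;> simp [Ctl.next, Phase.next]⟩
    | bit2 => exact ⟨.end2, by cases last <;> simp [Ctl.next, Phase.next]⟩
    | end2 => exact ⟨.start2, by cases last <;> simp [Ctl.next, Phase.next]⟩
  | lam => exact ⟨.end3, by simp [Ctl.next]⟩
  | end3 fst hd u s =>
    cases s with
    | none => exact ⟨closing hd, by simp [Ctl.next]⟩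
    | some s => exact ⟨.start3, by simp [Ctl.next]⟩
  | pop => cases h
  | sink => cases h

/-- The unmarked step is refused only where a mark is due, and then this mark is possible. -/
theorem Mode.exists_next (md : Mode) (x : Cls) (fl : Bool) (y : Cls) :
    ∃ m, (md.next x fl y m).isSome := by
  by_cases h : (md.next x fl y none).isSome
  · exact ⟨_, h⟩
  · cases y with
    | win b =>
      cases md with
      | A => exact ⟨some .check3, by simp [Mode.next]⟩
      | C => exact ⟨some .checkHat3, by simp [Mode.next]⟩
      | _ => simp [Mode.next] at h
    | _ => cases md <;> simp [Mode.next] at h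

theorem Ctl.exists_step (kd : C → Kd) (q : Ctl C) (γ : Option (Sym C)) :
    ∃ a, (q.step kd γ a).isSome := by
  by_cases h : q.isGen = true
  · obtain ⟨b, hb⟩ := q.exists_next kd h
    refine ⟨.bas b, ?_⟩
    cases q <;> first | cases h; done | simpa [Ctl.step] using hb
  · cases q with
    | pop md mk x =>
      by_cases hf : md.isFinal x.cls = true
      · exact ⟨.one, by simp [Ctl.step, hf]⟩
      · cases γ with
        | none => exact ⟨.one, by simp [Ctl.step, hf]⟩
        | some y =>
          obtain ⟨m, hm⟩ := md.exists_next x.cls y.1 y.2.cls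
          exact ⟨.mark m, by simpa [Ctl.step, hf] using hm⟩
    | sink b => exact ⟨.one, by simp [Ctl.step]⟩
    | _ => simp [Ctl.isGen] at h

theorem Ctl.delta_total (kd : C → Kd) (q : Ctl C) (γ : Option (Sym C)) :
    ∃ d, (q.delta kd γ d).isSome := by
  obtain ⟨a, ha⟩ := q.exists_step kd γ
  by_cases h : q.isSys γ = true
  · exact ⟨fun | .env => (.one, false) | .sys => (a, false),
      by simpa [Ctl.delta, h, Action.isDefault] using ha⟩
  · exact ⟨fun | .sys => (.one, false) | .env => (a, false),
      by simpa [Ctl.delta, h, Action.isDefault] using ha⟩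

end

end PushdownGames

namespace PushdownGames

/-! ## Renaming of letters, and names -/

section

variable {C C' C'' : Type}

def Letter.map (g : C → C') : Letter C → Letter C'
  | bas b => bas b
  | lam p u s => lam (p.map g) (g u) (s.map g)

def Sym.map (g : C → C') (x : Sym C) : Sym C' := (x.1, x.2.map g)

def Ctl.map (g : C → C') : Ctl C → Ctl C'
  | tag b fst => tag b fst
  | clos b fst => clos b fst
  | blk ph fst hd last => blk ph fst hd (last.map (Prod.map g g))
  | lam fst hd p u s => lam fst hd (p.map g) (g u) (s.map g)
  | end3 fst hd u s => end3 fst hd (g u) (s.map g)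
  | pop md mk x => pop md mk (x.map g)
  | sink b => sink b

def Act.map (g : C → C') : Act C → Act C'
  | one => one
  | bas b => bas b
  | win0 u s => win0 (g u) (s.map g)
  | win1 x => win1 (x.map g)
  | mark m => mark m

def Action.map (g : C → C') (x : Action C) : Action C' := (x.1.map g, x.2)

def Letter.cells : Letter C → List C
  | bas _ => []
  | lam p u s => p.toList ++ [u] ++ s.toList

def Ctl.cells : Ctl C → List C
  | tag _ _ => []
  | clos _ _ => []
  | blk _ _ _ last => last.toList.flatMap fun x => [x.1, x.2]
  | lam _ _ p u s => p.toList ++ [u] ++ s.toList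
  | end3 _ _ u s => [u] ++ s.toList
  | pop _ _ x => x.cells
  | sink _ => []

def Act.cells : Act C → List C
  | win0 u s => [u] ++ s.toList
  | win1 x => x.toList
  | _ => []

theorem Letter.map_map (g : C → C') (h : C' → C'') (x : Letter C) :
    (x.map g).map h = x.map (h ∘ g) := by
  cases x <;> simp [Letter.map]

theorem Ctl.map_map (g : C → C') (h : C' → C'') (x : Ctl C) :
    (x.map g).map h = x.map (h ∘ g) := by
  cases x <;> simp [Ctl.map, Letter.map_map, Prod.map_comp_map]

theorem Act.map_map (g : C → C') (h : C' → C'') (x : Act C) :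
    (x.map g).map h = x.map (h ∘ g) := by
  cases x <;> simp [Act.map]

theorem option_toList_map (g : C → C') (x : Option C) : (x.map g).toList = x.toList.map g := by
  cases x <;> rfl

theorem Letter.cells_map (g : C → C') (x : Letter C) : (x.map g).cells = x.cells.map g := by
  cases x <;> simp [Letter.map, Letter.cells, option_toList_map]

theorem Ctl.cells_map (g : C → C') (x : Ctl C) : (x.map g).cells = x.cells.map g := by
  cases x with
  | blk ph fst hd last => cases last <;> simp [Ctl.map, Ctl.cells]
  | _ => simp [Ctl.map, Ctl.cells, Letter.cells_map, option_toList_map]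

theorem Act.cells_map (g : C → C') (x : Act C) : (x.map g).cells = x.cells.map g := by
  cases x <;> simp [Act.map, Act.cells, option_toList_map]

/-- The image under a constant renaming keeps the shape, including which optional letters are
present, and the list of letters restores the rest. The injectivity of names rests on this
separation of shape and letters. -/
theorem Letter.ext_cells {x y : Letter C} (h : x.map (fun _ => ()) = y.map (fun _ => ()))
    (h' : x.cells = y.cells) : x = y := by
  cases x with
  | bas b => cases y <;> simp_all [Letter.map]
  | lam p u s =>
    cases y with
    | bas b => simp [Letter.map] at h
    | lam p' u' s' =>
      cases p <;> cases p' <;> cases s <;> cases s' <;> simp_all [Letter.map, Letter.cells]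

theorem Ctl.ext_cells {x y : Ctl C} (h : x.map (fun _ => ()) = y.map (fun _ => ()))
    (h' : x.cells = y.cells) : x = y := by
  cases x with
  | tag => cases y <;> simp_all [Ctl.map]
  | clos => cases y <;> simp_all [Ctl.map]
  | blk ph fst hd last =>
    cases y with
    | blk ph' fst' hd' last' =>
      rcases last with _ | ⟨a, b⟩ <;> rcases last' with _ | ⟨a', b'⟩ <;>
        simp_all [Ctl.map, Ctl.cells]
    | _ => simp [Ctl.map] at h
  | lam fst hd p u s =>
    cases y with
    | lam fst' hd' p' u' s' =>
      cases p <;> cases p' <;> cases s <;> cases s' <;> simp_all [Ctl.map, Ctl.cells]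
    | _ => simp [Ctl.map] at h
  | end3 fst hd u s =>
    cases y with
    | end3 fst' hd' u' s' => cases s <;> cases s' <;> simp_all [Ctl.map, Ctl.cells]
    | _ => simp [Ctl.map] at h
  | pop md mk x =>
    cases y with
    | pop md' mk' x' =>
      simp only [Ctl.map, Ctl.pop.injEq] at h
      rw [h.1, h.2.1, Letter.ext_cells h.2.2 h']
    | _ => simp [Ctl.map] at h
  | sink => cases y <;> simp_all [Ctl.map]

theorem Act.ext_cells {x y : Act C} (h : x.map (fun _ => ()) = y.map (fun _ => ()))
    (h' : x.cells = y.cells) : x = y := by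
  cases x with
  | one => cases y <;> simp_all [Act.map]
  | bas => cases y <;> simp_all [Act.map]
  | win0 u s =>
    cases y with
    | win0 u' s' => cases s <;> cases s' <;> simp_all [Act.map, Act.cells]
    | _ => simp [Act.map] at h
  | win1 s =>
    cases y with
    | win1 s' => cases s <;> cases s' <;> simp_all [Act.map, Act.cells]
    | _ => simp [Act.map] at h
  | mark => cases y <;> simp_all [Act.map]

/-- Three variables suffice since a triple is the largest datum that occurs; variables for absent
letters receive arbitrary values. -/
theorem Letter.exists_map [Nonempty C] (x : Letter C) :
    ∃ (y : Letter (Fin 3)) (v : Fin 3 → C), y.map v = x := by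
  cases x with
  | bas b => exact ⟨.bas b, fun _ => Classical.arbitrary C, rfl⟩
  | lam p u s =>
    refine ⟨.lam (p.map fun _ => 0) 1 (s.map fun _ => 2), ![p.getD u, u, s.getD u], ?_⟩
    cases p <;> cases s <;> simp [Letter.map]

theorem Ctl.exists_map [Nonempty C] (x : Ctl C) :
    ∃ (y : Ctl (Fin 3)) (v : Fin 3 → C), y.map v = x := by
  obtain ⟨c⟩ := ‹Nonempty C›
  cases x with
  | tag b fst => exact ⟨.tag b fst, fun _ => c, rfl⟩
  | clos b fst => exact ⟨.clos b fst, fun _ => c, rfl⟩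
  | sink b => exact ⟨.sink b, fun _ => c, rfl⟩
  | blk ph fst hd last =>
    rcases last with _ | ⟨a, b⟩
    · exact ⟨.blk ph fst hd none, fun _ => c, rfl⟩
    · exact ⟨.blk ph fst hd (some (0, 1)), ![a, b, a], rfl⟩
  | lam fst hd p u s =>
    refine ⟨.lam fst hd (p.map fun _ => 0) 1 (s.map fun _ => 2), ![p.getD u, u, s.getD u], ?_⟩
    cases p <;> cases s <;> simp [Ctl.map]
  | end3 fst hd u s =>
    refine ⟨.end3 fst hd 1 (s.map fun _ => 2), ![u, u, s.getD u], ?_⟩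
    cases s <;> simp [Ctl.map]
  | pop md mk x =>
    haveI : Nonempty C := ⟨c⟩
    obtain ⟨y, v, rfl⟩ := x.exists_map
    exact ⟨.pop md mk y, v, rfl⟩

theorem Act.exists_map [Nonempty C] (x : Act C) :
    ∃ (y : Act (Fin 3)) (v : Fin 3 → C), y.map v = x := by
  obtain ⟨c⟩ := ‹Nonempty C›
  cases x with
  | one => exact ⟨.one, fun _ => c, rfl⟩
  | bas b => exact ⟨.bas b, fun _ => c, rfl⟩
  | mark b => exact ⟨.mark b, fun _ => c, rfl⟩
  | win0 u s =>
    refine ⟨.win0 1 (s.map fun _ => 2), ![u, u, s.getD u], ?_⟩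
    cases s <;> simp [Act.map]
  | win1 s =>
    refine ⟨.win1 (s.map fun _ => 2), fun _ => s.getD c, ?_⟩
    cases s <;> simp [Act.map]

/-! ### Transitions commute with renaming -/

theorem commit_map (g : C → C') (kd : C' → Kd) (hd : Option Kd) (x : Option C) :
    commit kd hd (x.map g) = commit (kd ∘ g) hd x := by
  cases x <;> rfl

/-- The transitions inspect only the kinds of letters and never compare two letters. In particular
`win1` lets the control supply the first two components of a triple instead of checking them against
a guess. For this reason `g` need not be injective. -/
theorem Ctl.next_map (g : C → C') (kd : C' → Kd) (q : Ctl C) (a : Act C) :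
    (q.map g).next kd (a.map g) = (q.next (kd ∘ g) a).map (Ctl.map g) := by
  cases q with
  | tag b fst => cases a <;> simp [Ctl.map, Act.map, Ctl.next] <;> split_ifs <;> simp [Ctl.map]
  | clos b fst => cases a <;> simp [Ctl.map, Act.map, Ctl.next] <;> split_ifs <;> simp [Ctl.map]
  | blk ph fst hd last =>
    rcases last with _ | ⟨u', s'⟩ <;> cases a <;>
      simp [Ctl.map, Act.map, Ctl.next, commit_map, Function.comp_def] <;> split_ifs <;>
      simp [Ctl.map, Function.comp_def]
  | lam fst hd p u s =>
    cases a <;> simp [Ctl.map, Act.map, Ctl.next] <;> split_ifs <;> simp [Ctl.map]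
  | end3 fst hd u s =>
    cases s <;> cases a <;> simp [Ctl.map, Act.map, Ctl.next] <;> split_ifs <;>
      simp [Ctl.map, Letter.map]
  | pop => cases a <;> rfl
  | sink => cases a <;> rfl

theorem Letter.cls_map (g : C → C') (x : Letter C) : (x.map g).cls = x.cls := by
  cases x with
  | bas b => cases b <;> rfl
  | lam p u s => cases p <;> rfl

theorem Ctl.letter_map (g : C → C') (q : Ctl C) : (q.map g).letter = q.letter.map g := by
  cases q <;> rfl

theorem Ctl.fst_map (g : C → C') (q : Ctl C) : (q.map g).fst = q.fst := by
  cases q <;> rfl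

theorem Ctl.props_map (g : C → C') (q : Ctl C) :
    (q.map g).props = q.props.map (Sum.map (Letter.map g) id) := by
  cases q with
  | pop md mk x => cases mk <;> rfl
  | _ => rfl

/-- Renaming in the target of a transition. -/
def targetMap (g : C → C') (r : Ctl C × List (Sym C)) : Ctl C' × List (Sym C') :=
  (r.1.map g, r.2.map (Sym.map g))

theorem Ctl.step_map (g : C → C') (kd : C' → Kd) (q : Ctl C) (γ : Option (Sym C)) (a : Act C) :
    (q.map g).step kd (γ.map (Sym.map g)) (a.map g) =
      (q.step (kd ∘ g) γ a).map (targetMap g) := by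
  have key : ((q.map g).next kd (a.map g)).map (fun q' => (q', ((q.map g).fst, (q.map g).letter) ::
      (γ.map (Sym.map g)).toList)) =
      ((q.next (kd ∘ g) a).map fun q' => (q', (q.fst, q.letter) :: γ.toList)).map
        (targetMap g) := by
    rw [Ctl.next_map, Ctl.letter_map, Ctl.fst_map, option_toList_map]
    simp [Function.comp_def, targetMap, Sym.map]
  cases q with
  | sink b => cases a <;> cases γ <;> rfl
  | pop md mk x =>
    cases hf : md.isFinal x.cls
    · cases γ with
      | none => cases a <;> simp [Ctl.step, Ctl.map, Act.map, Letter.cls_map, hf, targetMap]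
      | some y =>
        cases a <;> simp [Ctl.step, Ctl.map, Act.map, Letter.cls_map, hf, targetMap,
          Function.comp_def, Sym.map]
    · cases a <;> cases γ <;>
        simp [Ctl.step, Ctl.map, Act.map, Letter.cls_map, hf, targetMap]
  | _ => exact key

theorem Ctl.isSys_map (g : C → C') (q : Ctl C) (γ : Option (Sym C)) :
    (q.map g).isSys (γ.map (Sym.map g)) = q.isSys γ := by
  cases q <;> cases γ <;> simp [Ctl.map, Ctl.isSys, Letter.cls_map, Sym.map]

theorem Action.isDefault_map (g : C → C') (x : Action C) :
    Action.isDefault (Action.map g x) = Action.isDefault x := by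
  rcases x with ⟨a, b⟩
  cases a <;> cases b <;> rfl

theorem Ctl.delta_map (g : C → C') (kd : C' → Kd) (q : Ctl C) (γ : Option (Sym C))
    (d : Agent → Action C) :
    (q.map g).delta kd (γ.map (Sym.map g)) (fun i => Action.map g (d i)) =
      (q.delta (kd ∘ g) γ d).map (targetMap g) := by
  simp only [Ctl.delta, Ctl.isSys_map, Action.isDefault_map]
  have h := fun a => Ctl.step_map g kd q γ a
  split_ifs <;> first | rfl | exact h _

/-! ### Names -/

/-- An injection of a finite type into the natural numbers. -/
noncomputable def codeOf (α : Type) [Finite α] (a : α) : ℕ :=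
  (Classical.choice (Finite.exists_equiv_fin α).choose_spec a).val

theorem codeOf_injective (α : Type) [Finite α] : Function.Injective (codeOf α) :=
  fun _ _ h => (Classical.choice (Finite.exists_equiv_fin α).choose_spec).injective (Fin.ext h)

def Tok.map (g : C → C') : Tok C → Tok C'
  | nat k => nat k
  | A i => A (g i)
  | B i => B (g i)

/-- The name of an object with a given shape that contains the given letters. -/
def nameOf (k : ℕ) (cs : List C) : List (Tok C) := .nat k :: cs.flatMap fun c => [.A c, .B c]

theorem nameOf_map (g : C → C') (k : ℕ) (cs : List C) :
    nameOf k (cs.map g) = (nameOf k cs).map (Tok.map g) := by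
  simp [nameOf, Tok.map, List.flatMap_map, List.map_flatMap]

/-- The shape lives in a finite type that does not depend on the machine, so its number is a
constant of the template; only the letters are variable. -/
noncomputable def Ctl.name (q : Ctl C) : List (Tok C) :=
  nameOf (codeOf (Ctl Unit) (q.map fun _ => ())) q.cells

noncomputable def Sym.name (x : Sym C) : List (Tok C) :=
  nameOf (codeOf (Sym Unit) (Sym.map (fun _ => ()) x)) x.2.cells

noncomputable def Action.name (x : Action C) : List (Tok C) :=
  nameOf (codeOf (Action Unit) (Action.map (fun _ => ()) x)) x.1.cells

theorem Ctl.name_map (g : C → C') (q : Ctl C) : (q.map g).name = q.name.map (Tok.map g) := by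
  rw [Ctl.name, Ctl.map_map, Ctl.cells_map, nameOf_map]
  rfl

theorem Sym.name_map (g : C → C') (x : Sym C) :
    Sym.name (Sym.map g x) = (Sym.name x).map (Tok.map g) := by
  rw [Sym.name, Sym.map, Sym.map, Letter.map_map, Letter.cells_map, nameOf_map]
  rfl

theorem Action.name_map (g : C → C') (x : Action C) :
    Action.name (Action.map g x) = (Action.name x).map (Tok.map g) := by
  rw [Action.name, Action.map, Action.map, Act.map_map, Act.cells_map, nameOf_map]
  rfl

def optName : Option C → List (Tok C)
  | none => [.nat 0, .nat 0]
  | some c => [.A c, .B c]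

def Bas.code : Bas → ℕ
  | zero => 1 | one => 2 | all => 3 | ex => 4 | l => 5 | r => 6 | f => 7
  | start1 => 8 | start2 => 9 | start3 => 10 | end1 => 11 | end2 => 12 | end3 => 13

def Mark.code : Mark → ℕ
  | check1 => 14 | check2 => 15 | check3 => 16 | checkHat3 => 17

/-- The name of an atomic proposition. -/
def propName : Letter C ⊕ Mark → List (Tok C)
  | .inl (.bas b) => [.nat b.code]
  | .inl (.lam p u s) => .nat 0 :: (optName p ++ optName (some u) ++ optName s)
  | .inr m => [.nat m.code]

theorem propName_map (g : C → C') (p : Letter C ⊕ Mark) :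
    propName (p.map (Letter.map g) id) = (propName p).map (Tok.map g) := by
  rcases p with (b | ⟨p, u, s⟩) | m
  · rfl
  · cases p <;> cases s <;> rfl
  · rfl

/-- The records that describe the system, with letters in place of numbers. -/
inductive IsRec (kd : C → Kd) : List (List (Tok C)) → Prop
  | action (a : Action C) : IsRec kd [[.nat 0], Action.name a]
  | state (q : Ctl C) : IsRec kd [[.nat 1], q.name]
  | symbol (γ : Sym C) : IsRec kd [[.nat 2], Sym.name γ]
  | start : IsRec kd [[.nat 3], (Ctl.tag false true : Ctl C).name]
  | label (q : Ctl C) (p : Letter C ⊕ Mark) (h : p ∈ q.props) :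
      IsRec kd [[.nat 4], q.name, propName p]
  | trans (q : Ctl C) (γ : Option (Sym C)) (d : Agent → Action C) (r : Ctl C × List (Sym C))
      (h : q.delta kd γ d = some r) :
      IsRec kd ([[.nat 5], q.name, γ.elim [.nat 0] (fun g => .nat 1 :: Sym.name g),
        Action.name (d .env), Action.name (d .sys), r.1.name] ++ r.2.map Sym.name)

/-- If the kinds of the variables are pulled back along `g`, every instance of a record over
variables is a record over the actual letters. -/
theorem IsRec.map (g : C → C') {kd : C' → Kd} {R : List (List (Tok C))}
    (h : IsRec (kd ∘ g) R) : IsRec kd (R.map (List.map (Tok.map g))) := by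
  cases h with
  | action a => simpa [Action.name_map, Tok.map] using IsRec.action (kd := kd) (Action.map g a)
  | state q => simpa [Ctl.name_map, Tok.map] using IsRec.state (kd := kd) (q.map g)
  | symbol x => simpa [Sym.name_map, Tok.map] using IsRec.symbol (kd := kd) (Sym.map g x)
  | start => exact IsRec.start (kd := kd)
  | label q p h =>
    have := IsRec.label (kd := kd) (q.map g) (p.map (Letter.map g) id) (by
      rw [Ctl.props_map]; exact List.mem_map_of_mem h)
    simpa [Ctl.name_map, propName_map, Tok.map] using this
  | trans q γ d r h =>
    have := IsRec.trans (kd := kd) (q.map g) (γ.map (Sym.map g)) (fun i => Action.map g (d i))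
      (targetMap g r) (by rw [Ctl.delta_map, h]; rfl)
    cases γ <;> simpa [Ctl.name_map, Sym.name_map, Action.name_map, Tok.map, targetMap,
      Function.comp_def] using this

end

end PushdownGames

namespace PushdownGames

/-! ## The pushdown system of an alternating machine -/

section

variable {M : ATM}

/-- The atomic proposition of a letter. -/
def Letter.prp : Letter M.Cell → Prp M
  | bas .zero => .zero
  | bas .one => .one
  | bas .all => .all
  | bas .ex => .ex
  | bas .l => .l
  | bas .r => .r
  | bas .f => .f
  | bas .start1 => .start1
  | bas .start2 => .start2
  | bas .start3 => .start3
  | bas .end1 => .end1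
  | bas .end2 => .end2
  | bas .end3 => .end3
  | lam p u s => .lam p u s

def Mark.prp : Mark → Prp M
  | check1 => .check1
  | check2 => .check2
  | check3 => .check3
  | checkHat3 => .checkHat3

theorem Letter.prp_injective : Function.Injective (Letter.prp (M := M)) := by
  rintro (b | ⟨p, u, s⟩) (b' | ⟨p', u', s'⟩) h
  · cases b <;> cases b' <;> first | rfl | cases h
  · cases b <;> cases h
  · cases b' <;> cases h
  · cases h; rfl

theorem Mark.prp_injective : Function.Injective (Mark.prp (M := M)) := by
  intro m m' h
  cases m <;> cases m' <;> first | rfl | cases h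

theorem Letter.prp_ne_mark (x : Letter M.Cell) (m : Mark) : x.prp ≠ m.prp := by
  rcases x with b | ⟨p, u, s⟩ <;> cases m <;> first | (cases b <;> intro h <;> cases h) | intro h <;> cases h

/-- The atomic proposition of a letter or a mark. -/
def propPrp : Letter M.Cell ⊕ Mark → Prp M := Sum.elim Letter.prp Mark.prp

/-- The value of a number in a template. -/
def cellVal (M : ATM) : Tok M.Cell → ℕ := Tok.val fun x => M.cellPos x.1 x.2

theorem cellVal_map {I : Type} (v : I → M.Cell) (t : Tok I) :
    cellVal M (t.map v) = t.val fun x => M.cellPos (v x.1) x.2 := by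
  cases t <;> rfl

theorem cellVal_optName (c : Option M.Cell) : (optName c).map (cellVal M) = M.cellName c := by
  cases c with
  | none => rfl
  | some c => rw [ATM.cellName_some]; rfl

theorem cellVal_propName (p : Letter M.Cell ⊕ Mark) :
    (propName p).map (cellVal M) = (propPrp p).name := by
  rcases p with (b | ⟨p, u, s⟩) | m
  · cases b <;> rfl
  · simp only [propName, List.map_cons, List.map_append, cellVal_optName]
    rfl
  · cases m <;> rfl

/-- Each letter contributes exactly two numbers, so the concatenation can be decoded. -/
theorem nameOf_injective {k k' : ℕ} {cs cs' : List M.Cell}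
    (h : (nameOf k cs).map (cellVal M) = (nameOf k' cs').map (cellVal M)) : k = k' ∧ cs = cs' := by
  simp only [nameOf, List.map_cons, List.cons.injEq] at h
  refine ⟨h.1, ?_⟩
  replace h := h.2
  induction cs generalizing cs' with
  | nil => cases cs' <;> simp_all
  | cons c cs ih =>
    cases cs' with
    | nil => simp at h
    | cons c' cs' =>
      simp only [List.flatMap_cons, List.map_append, List.map_cons, List.map_nil,
        List.cons_append, List.nil_append, List.cons.injEq] at h
      rw [ih h.2.2]
      congr 1
      refine M.cellPos_injective (funext fun b => ?_)
      cases b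
      · exact h.2.1
      · exact h.1

theorem Ctl.name_injective :
    Function.Injective fun q : Ctl M.Cell => q.name.map (cellVal M) := by
  intro q q' h
  have := nameOf_injective h
  exact Ctl.ext_cells (codeOf_injective _ this.1) this.2

theorem Sym.name_injective :
    Function.Injective fun x : Sym M.Cell => (Sym.name x).map (cellVal M) := by
  intro x x' h
  have := nameOf_injective h
  have h1 := codeOf_injective _ this.1
  simp only [Sym.map, Prod.mk.injEq] at h1
  exact Prod.ext h1.1 (Letter.ext_cells h1.2 this.2)

theorem Action.name_injective :
    Function.Injective fun x : Action M.Cell => (Action.name x).map (cellVal M) := by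
  intro x x' h
  have := nameOf_injective h
  have h1 := codeOf_injective _ this.1
  simp only [Action.map, Prod.mk.injEq] at h1
  exact Prod.ext (Act.ext_cells h1.1 this.2) h1.2

/-- The pushdown system. -/
noncomputable def pms (M : ATM) : PMS (Prp M) Agent (Action M.Cell) (Ctl M.Cell) (Sym M.Cell) where
  start := .tag false true
  lab q := {p | ∃ x ∈ q.props, propPrp x = p}
  Δ q γ d := q.delta M.kd γ d
  total q γ := q.delta_total M.kd γ

theorem isRecord_iff (rec : List (List ℕ)) :
    IsRecord (pms M) (fun a => (Action.name a).map (cellVal M))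
      (fun q => q.name.map (cellVal M)) (fun x => (Sym.name x).map (cellVal M)) rec ↔
    ∃ R, IsRec M.kd R ∧ rec = R.map (List.map (cellVal M)) := by
  constructor
  · rintro (a | q | γ | _ | ⟨q, p, h⟩ | ⟨q, γ, d, q', β, h⟩)
    · exact ⟨_, .action a, rfl⟩
    · exact ⟨_, .state q, rfl⟩
    · exact ⟨_, .symbol γ, rfl⟩
    · exact ⟨_, .start, rfl⟩
    · obtain ⟨x, hx, rfl⟩ := h
      refine ⟨_, .label q x hx, ?_⟩
      rw [List.map_cons, List.map_cons, List.map_cons, List.map_cons, cellVal_propName]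
      rfl
    · refine ⟨_, .trans q γ d (q', β) h, ?_⟩
      cases γ <;> simp [cellVal, Tok.val, Function.comp_def]
  · rintro ⟨R, (a | q | γ | _ | ⟨q, p, h⟩ | ⟨q, γ, d, r, h⟩), rfl⟩
    · exact .action a
    · exact .state q
    · exact .symbol γ
    · exact .start
    · have := IsRecord.label (S := pms M) (nAc := fun a => (Action.name a).map (cellVal M))
        (nQ := fun q => q.name.map (cellVal M)) (nΓ := fun x => (Sym.name x).map (cellVal M))
        q (propPrp p) ⟨p, h, rfl⟩
      simpa [← cellVal_propName, cellVal, Tok.val] using this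
    · have := IsRecord.trans (S := pms M) (nAc := fun a => (Action.name a).map (cellVal M))
        (nQ := fun q => q.name.map (cellVal M)) (nΓ := fun x => (Sym.name x).map (cellVal M))
        q γ d r.1 r.2 h
      cases γ <;> simpa [cellVal, Tok.val, Function.comp_def] using this

end

/-- The variables of the templates. -/
abbrev Var : Type := Fin 4 × Fin 3

/-- With twelve variables there are finitely many assignments of kinds, and for each of them
finitely many objects from which a record can be built. -/
theorem exists_templates : ∃ T : List (Cmd.Template Var), ∀ t, t ∈ T ↔ IsRec t.1 t.2 := by
  have : {t : Cmd.Template Var | IsRec t.1 t.2}.Finite := by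
    have h : {t : Cmd.Template Var | IsRec t.1 t.2} ⊆ ⋃ κ : Var → Kd, Prod.mk κ '' (
        (Set.range fun a : Action Var => [[.nat 0], Action.name a]) ∪
        (Set.range fun q : Ctl Var => [[.nat 1], q.name]) ∪
        (Set.range fun x : Sym Var => [[.nat 2], Sym.name x]) ∪
        {[[.nat 3], (Ctl.tag false true : Ctl Var).name]} ∪
        (Set.range fun x : Ctl Var × (Letter Var ⊕ Mark) =>
          [[.nat 4], x.1.name, propName x.2]) ∪
        (⋃ (q : Ctl Var), ⋃ (γ : Option (Sym Var)), ⋃ (d : Agent → Action Var),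
          (fun r : Ctl Var × List (Sym Var) => [[.nat 5], q.name,
            γ.elim [.nat 0] (fun g => .nat 1 :: Sym.name g),
            Action.name (d .env), Action.name (d .sys), r.1.name] ++ r.2.map Sym.name) ''
            {r | q.delta κ γ d = some r})) := by
      rintro ⟨κ, R⟩ h
      simp only [Set.mem_iUnion]
      refine ⟨κ, R, ?_, rfl⟩
      rcases h with a | q | x | _ | ⟨q, p, h⟩ | ⟨q, γ, d, r, h⟩
      · exact .inl (.inl (.inl (.inl (.inl ⟨a, rfl⟩))))
      · exact .inl (.inl (.inl (.inl (.inr ⟨q, rfl⟩))))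
      · exact .inl (.inl (.inl (.inr ⟨x, rfl⟩)))
      · exact .inl (.inl (.inr rfl))
      · exact .inl (.inr ⟨(q, p), rfl⟩)
      · refine .inr ?_
        simp only [Set.mem_iUnion]
        exact ⟨q, γ, d, r, h, rfl⟩
    refine Set.Finite.subset (Set.finite_iUnion fun κ => Set.Finite.image _ ?_) h
    haveI : Finite (Agent → Action Var) := inferInstance
    refine ((((((Set.finite_range _).union (Set.finite_range _)).union (Set.finite_range _)).union
      (Set.finite_singleton _)).union (Set.finite_range _)).union
      (Set.finite_iUnion fun q => Set.finite_iUnion fun γ => Set.finite_iUnion fun d =>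
        Set.Finite.image _ ?_))
    -- The type of targets is infinite because pushed words are lists, but `delta` is a partial
    -- function, so a record has at most one target.
    refine Set.Subsingleton.finite fun r hr r' hr' => ?_
    exact Option.some.inj (hr.symm.trans hr')
  exact ⟨this.toFinset.toList, fun t => by simp⟩

/-- Each record over the letters of a machine is an instance of a template. -/
theorem isRec_iff_isInstance {M : ATM} {T : List (Cmd.Template Var)}
    (hT : ∀ t, t ∈ T ↔ IsRec t.1 t.2) (rec : List (List ℕ)) :
    Cmd.IsInstance T M rec ↔ ∃ R, IsRec M.kd R ∧ rec = R.map (List.map (cellVal M)) := by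
  constructor
  · rintro ⟨⟨κ, R⟩, hR, v, hv, rfl⟩
    have hκ : κ = M.kd ∘ v := (funext hv).symm
    subst hκ
    refine ⟨_, ((hT _).1 hR).map v, ?_⟩
    simp [cellVal_map, Function.comp_def]
  · rintro ⟨R, hR, rfl⟩
    suffices ∃ (v : Var → M.Cell) (R' : List (List (Tok Var))), IsRec (M.kd ∘ v) R' ∧
        R = R'.map (List.map (Tok.map v)) by
      obtain ⟨v, R', h, rfl⟩ := this
      refine ⟨⟨M.kd ∘ v, R'⟩, (hT _).2 h, v, fun _ => rfl, ?_⟩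
      simp [cellVal_map, Function.comp_def]
    haveI : Nonempty M.Cell := ⟨.inl M.blank⟩
    have hpair : ∀ (i : Fin 4) (v : Fin 4 → Fin 3 → M.Cell),
      (fun x : Var => v x.1 x.2) ∘ (fun j : Fin 3 => ((i, j) : Var)) = v i := fun i v => rfl
    have hq : ∀ (q : Ctl M.Cell) (i : Fin 4), ∃ (q' : Ctl Var) (w : Fin 3 → M.Cell),
        ∀ v : Fin 4 → Fin 3 → M.Cell, v i = w → q'.map (fun x => v x.1 x.2) = q := by
      intro q i
      obtain ⟨y, w, rfl⟩ := q.exists_map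
      exact ⟨y.map fun j => (i, j), w, fun v hv => by rw [Ctl.map_map, hpair, hv]⟩
    have hx : ∀ (x : Sym M.Cell) (i : Fin 4), ∃ (x' : Sym Var) (w : Fin 3 → M.Cell),
        ∀ v : Fin 4 → Fin 3 → M.Cell, v i = w → Sym.map (fun x => v x.1 x.2) x' = x := by
      rintro ⟨b, x⟩ i
      obtain ⟨y, w, rfl⟩ := x.exists_map
      exact ⟨(b, y.map fun j => (i, j)), w, fun v hv => by
        rw [Sym.map, Letter.map_map, hpair, hv]⟩
    have ha : ∀ (a : Action M.Cell) (i : Fin 4), ∃ (a' : Action Var) (w : Fin 3 → M.Cell),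
        ∀ v : Fin 4 → Fin 3 → M.Cell, v i = w → Action.map (fun x => v x.1 x.2) a' = a := by
      rintro ⟨a, b⟩ i
      obtain ⟨y, w, rfl⟩ := a.exists_map
      exact ⟨(y.map fun j => (i, j), b), w, fun v hv => by
        rw [Action.map, Act.map_map, hpair, hv]⟩
    cases hR with
    | action a =>
      obtain ⟨a', w, h⟩ := ha a 0
      refine ⟨fun x => w x.2, _, .action a', ?_⟩
      simp [← Action.name_map, h (fun _ => w) rfl, Tok.map]
    | state q =>
      obtain ⟨q', w, h⟩ := hq q 0
      refine ⟨fun x => w x.2, _, .state q', ?_⟩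
      simp [← Ctl.name_map, h (fun _ => w) rfl, Tok.map]
    | symbol x =>
      obtain ⟨x', w, h⟩ := hx x 0
      refine ⟨fun x => w x.2, _, .symbol x', ?_⟩
      simp [← Sym.name_map, h (fun _ => w) rfl, Tok.map]
    | start => exact ⟨fun _ => .inl M.blank, _, .start, rfl⟩
    | label q p hp =>
      obtain ⟨q', w, h⟩ := hq q 0
      have h' := h (fun _ => w) rfl
      rw [← h', Ctl.props_map] at hp
      obtain ⟨p', hp', rfl⟩ := List.mem_map.1 hp
      refine ⟨fun x => w x.2, _, .label q' p' hp', ?_⟩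
      simp [← Ctl.name_map, ← propName_map, h', Tok.map]
    | trans q γ d r hr =>
      obtain ⟨q', w0, h0⟩ := hq q 0
      obtain ⟨γ', w1, h1⟩ : ∃ (γ' : Option (Sym Var)) (w : Fin 3 → M.Cell),
          ∀ v : Fin 4 → Fin 3 → M.Cell, v 1 = w → γ'.map (Sym.map fun x => v x.1 x.2) = γ := by
        cases γ with
        | none => exact ⟨none, fun _ => .inl M.blank, fun _ _ => rfl⟩
        | some x =>
          obtain ⟨x', w, h⟩ := hx x 1
          exact ⟨some x', w, fun v hv => by rw [Option.map_some, h v hv]⟩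
      obtain ⟨a', w2, h2⟩ := ha (d .env) 2
      obtain ⟨b', w3, h3⟩ := ha (d .sys) 3
      -- The control state, the top of the stack and the two actions use disjoint groups of three
      -- variables, so their valuations can be combined.
      set v : Fin 4 → Fin 3 → M.Cell := ![w0, w1, w2, w3] with hv
      set d' : Agent → Action Var := fun | .env => a' | .sys => b' with hd'
      have e0 := h0 v rfl
      have e1 := h1 v rfl
      have e2 : (fun i => Action.map (fun x => v x.1 x.2) (d' i)) = d := by
        funext i
        cases i
        · exact h2 v rfl
        · exact h3 v rfl
      -- The target needs no variables of its own: the transition itself is lifted to the variables.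
      have hr' := hr
      rw [← e0, ← e1, ← e2, Ctl.delta_map] at hr'
      obtain ⟨r', hr1, rfl⟩ := Option.map_eq_some_iff.1 hr'
      refine ⟨fun x => v x.1 x.2, _, .trans q' γ' d' r' hr1, ?_⟩
      rw [← e0, ← e1, ← e2]
      cases γ' <;> simp [← Ctl.name_map, ← Sym.name_map, ← Action.name_map, Tok.map, targetMap,
        Function.comp_def]

/-- The description of the pushdown system can be computed in polynomial time. -/
theorem exists_describes : ∃ build : ATM → Table,
    Nonempty (Turing.TM2ComputableInPolyTime ATM.write Table.write build) ∧
      ∀ M, Describes (build M) (pms M) := by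
  obtain ⟨T, hT⟩ := exists_templates
  obtain ⟨build, h, h'⟩ := Cmd.exists_polyTime_instances T
  refine ⟨build, h, fun M => ⟨_, _, _, Action.name_injective, Ctl.name_injective,
    Sym.name_injective, fun rec => ?_⟩⟩
  rw [h', isRec_iff_isInstance hT, isRecord_iff]

end PushdownGames

namespace PushdownGames

/-! ## Control of the states -/

/-- A decision of a set with one agent amounts to one action. With two agents, the complement of one
agent is such a set as well. -/
theorem CGS.existsUnique_available {AP Ac S : Type} (G : CGS AP Agent Ac S) {A : Set Agent}
    {b : Agent} (hA : ∀ a, a ∈ A ↔ a = b) (s : S) :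
    (∃! d : A → Ac, G.Available A d s) ↔
      ∃! x, ∃ d : Agent → Ac, d b = x ∧ (G.trans s d).isSome := by
  have hb : b ∈ A := (hA b).2 rfl
  have key : ∀ d : A → Ac, G.Available A d s ↔
      ∃ d' : Agent → Ac, d' b = d ⟨b, hb⟩ ∧ (G.trans s d').isSome := by
    intro d
    constructor
    · rintro ⟨d', h, h'⟩
      exact ⟨d', h ⟨b, hb⟩, h'⟩
    · rintro ⟨d', h, h'⟩
      refine ⟨d', ?_, h'⟩
      rintro ⟨a, ha⟩
      obtain rfl := (hA a).1 ha
      exact h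
  have ext : ∀ d d' : A → Ac, d ⟨b, hb⟩ = d' ⟨b, hb⟩ → d = d' := by
    intro d d' h
    funext ⟨a, ha⟩
    obtain rfl := (hA a).1 ha
    exact h
  constructor
  · rintro ⟨d, h, hu⟩
    refine ⟨d ⟨b, hb⟩, (key d).1 h, fun y hy => ?_⟩
    exact congrFun (hu (fun _ => y) ((key _).2 hy)) ⟨b, hb⟩
  · rintro ⟨x, h, hu⟩
    exact ⟨fun _ => x, (key _).2 h, fun d hd => ext _ _ (hu _ ((key d).1 hd))⟩

section

variable {C : Type}

theorem Action.isDefault_iff (a : Action C) : Action.isDefault a = true ↔ a = (.one, false) := by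
  rcases a with ⟨a, b⟩
  cases a <;> cases b <;> simp [Action.isDefault]

/-- The agents' choices are unique exactly for the agent that does not control the state. -/
theorem existsUnique_env {sys : Bool} {P : Act C → Prop} (h : ∃ a, P a)
    {ok : (Agent → Action C) → Prop}
    (hok : ∀ d, ok d ↔ if sys = true then Action.isDefault (d .env) = true ∧ P (d .sys).1
      else Action.isDefault (d .sys) = true ∧ P (d .env).1) :
    ((∃! x, ∃ d : Agent → Action C, d .env = x ∧ ok d) ↔ sys = true) ∧
      (sys = false → ∃! x, ∃ d : Agent → Action C, d .sys = x ∧ ok d) := by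
  obtain ⟨a, ha⟩ := h
  cases sys
  · simp only [Bool.false_eq_true, if_false] at hok
    refine ⟨iff_of_false ?_ (by simp), fun _ => ⟨(.one, false), ?_, ?_⟩⟩
    · rintro ⟨x, -, hu⟩
      -- The two copies of the choice `a` are distinct decisions of the controlling agent.
      have h1 : ∀ b, (a, b) = x := fun b =>
        hu _ ⟨fun | .env => (a, b) | .sys => (.one, false), rfl, (hok _).2 ⟨rfl, ha⟩⟩
      have := (h1 true).trans (h1 false).symm
      simp at this
    · exact ⟨fun | .env => (a, false) | .sys => (.one, false), rfl, (hok _).2 ⟨rfl, ha⟩⟩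
    · rintro y ⟨d, rfl, hd⟩
      exact (Action.isDefault_iff _).1 ((hok d).1 hd).1
  · simp only [if_true] at hok
    refine ⟨iff_of_true ⟨(.one, false), ?_, ?_⟩ rfl, by simp⟩
    · exact ⟨fun | .sys => (a, false) | .env => (.one, false), rfl, (hok _).2 ⟨rfl, ha⟩⟩
    · rintro y ⟨d, rfl, hd⟩
      exact (Action.isDefault_iff _).1 ((hok d).1 hd).1

/-- The letter and the mark that hold in a control state. -/
def Ctl.key : Ctl C → Option (Letter C × Option Mark)
  | pop _ mk x => some (x, mk)
  | sink _ => none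
  | q => some (q.letter, none)

/-- The next control state is determined by its letter and its mark. -/
theorem Ctl.step_det {kd : C → Kd} {q : Ctl C} {γ : Option (Sym C)} {a a' : Act C}
    {r r' : Ctl C × List (Sym C)} (h : q.step kd γ a = some r) (h' : q.step kd γ a' = some r')
    (hk : r.1.key = r'.1.key) : r = r' := by
  have act : a = a' → r = r' := by
    rintro rfl
    exact Option.some.inj (h.symm.trans h')
  have next : q.isGen = true → ∀ q₁ q₂ : Ctl C, q.next kd a = some q₁ → q.next kd a' = some q₂ →
      q₁.key = q₂.key → a = a' := by
    intro _ q₁ q₂ h₁ h₂ hk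
    cases q with
    | tag b fst =>
      cases a <;> cases a' <;> simp [Ctl.next] at h₁ h₂ ⊢
      rw [h₁.1, h₂.1]
    | clos b fst =>
      cases a with
      | bas b =>
        cases a' with
        | bas b' =>
          cases b <;> simp [Ctl.next] at h₁ <;> cases b' <;> simp [Ctl.next] at h₂ ⊢ <;>
            (subst h₁ h₂; simp [Ctl.key, Ctl.letter] at hk)
        | _ => simp [Ctl.next] at h₂
      | _ => simp [Ctl.next] at h₁
    | blk ph fst hd last =>
      -- The next position shows the chosen letter, so distinct choices remain visible.
      have hph : ∀ b b' p p', ph.next b = some p → ph.next b' = some p' → p.bas = p'.bas →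
          b = b' := by
        intro b b' p p' e e' eb
        cases ph <;> cases b <;> cases b' <;>
          simp [Phase.next, Bas.toBool] at e e' ⊢ <;>
          first
          | (subst e e'; simp [Phase.bas, Bas.ofBool] at eb)
          | (obtain ⟨_, e⟩ := e; obtain ⟨_, e'⟩ := e'; subst e e'; simp [Phase.bas, Bas.ofBool] at eb)
          | (obtain ⟨_, e⟩ := e; subst e e'; simp [Phase.bas, Bas.ofBool] at eb)
          | (obtain ⟨_, e'⟩ := e'; subst e e'; simp [Phase.bas, Bas.ofBool] at eb)
      have key : ∀ a q₁, (blk ph fst hd last).next kd a = some q₁ →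
          (∃ b p, a = .bas b ∧ ph.next b = some p ∧ q₁.key = some (.bas p.bas, none)) ∨
          (∃ u s, last = none ∧ a = .win0 u s ∧ q₁.key = some (.lam none u s, none)) ∨
          ∃ u s x, last = some (u, s) ∧ a = .win1 x ∧
            q₁.key = some (.lam (some u) s x, none) := by
        intro a q₁ h
        cases a with
        | bas b =>
          obtain ⟨p, e, rfl⟩ : ∃ p, ph.next b = some p ∧ blk p fst hd last = q₁ := by
            rcases last with _ | ⟨u, s⟩ <;> simpa [Ctl.next] using h
          exact .inl ⟨b, p, rfl, e, rfl⟩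
        | win0 u s =>
          rcases last with _ | ⟨u', s'⟩
          · simp only [Ctl.next] at h
            split at h
            · obtain ⟨_, _, rfl⟩ := Option.map_eq_some_iff.1 h
              exact .inr (.inl ⟨u, s, rfl, rfl, rfl⟩)
            · simp at h
          · simp [Ctl.next] at h
        | win1 x =>
          rcases last with _ | ⟨u', s'⟩
          · simp [Ctl.next] at h
          · simp only [Ctl.next] at h
            split at h
            · obtain ⟨_, _, rfl⟩ := Option.map_eq_some_iff.1 h
              exact .inr (.inr ⟨u', s', x, rfl, rfl, rfl⟩)
            · simp at h
        | _ => cases last <;> simp [Ctl.next] at h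
      rcases key _ _ h₁ with ⟨b, p, rfl, e, k⟩ | ⟨u, s, l, rfl, k⟩ | ⟨u, s, x, l, rfl, k⟩ <;>
        rcases key _ _ h₂ with ⟨b', p', rfl, e', k'⟩ | ⟨u', s', l', rfl, k'⟩ |
          ⟨u', s', x', l', rfl, k'⟩ <;>
        simp [k, k'] at hk
      · rw [hph _ _ _ _ e e' hk]
      · rw [hk.1, hk.2]
      · rw [hk.2.2]
    | lam fst hd p u s =>
      cases a <;> cases a' <;> simp [Ctl.next] at h₁ h₂ ⊢
      rw [h₁.1, h₂.1]
    | end3 fst hd u s =>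
      cases a <;> cases a' <;> rcases s with _ | s <;> simp [Ctl.next] at h₁ h₂ ⊢
      all_goals rw [h₁.1, h₂.1]
    | pop => simp [Ctl.isGen] at *
    | sink => simp [Ctl.isGen] at *
  cases q with
  | pop md mk x =>
    by_cases hf : md.isFinal x.cls = true
    · cases a <;> cases a' <;> simp [Ctl.step, hf] at h h'
      exact act rfl
    · cases γ with
      | none =>
        cases a <;> cases a' <;> simp [Ctl.step, hf] at h h'
        exact act rfl
      | some y =>
        cases a <;> cases a' <;> simp [Ctl.step, hf] at h h'
        obtain ⟨_, _, rfl⟩ := h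
        obtain ⟨_, _, rfl⟩ := h'
        simp [Ctl.key] at hk
        exact act (by rw [hk])
  | sink b =>
    cases a <;> cases a' <;> simp [Ctl.step] at h h'
    exact act rfl
  | _ =>
    simp only [Ctl.step, Option.map_eq_some_iff] at h h'
    obtain ⟨q₁, h, rfl⟩ := h
    obtain ⟨q₂, h', rfl⟩ := h'
    exact act (next rfl _ _ h h' hk)

end

section

variable {M : ATM}

/-- The configurations of the pushdown system. -/
abbrev Conf (M : ATM) : Type := Ctl M.Cell × List (Sym M.Cell)

/-- The game structure of the pushdown system. -/
noncomputable abbrev game (M : ATM) : CGS (Prp M) Agent (Action M.Cell) (Conf M) := (pms M).toCGS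

theorem game_trans (c : Conf M) (d : Agent → Action M.Cell) :
    (game M).trans c d =
      (if c.1.isSys c.2.head? then
        if Action.isDefault (d .env) then c.1.step M.kd c.2.head? (d .sys).1 else none
      else
        if Action.isDefault (d .sys) then c.1.step M.kd c.2.head? (d .env).1 else none).map
      fun r => (r.1, r.2 ++ c.2.tail) := rfl

/-- Whoever controls the state can make every choice of `step`, with the default action of the other
agent. -/
theorem succ_iff {c c' : Conf M} : (game M).Succ c c' ↔
    ∃ a r, c.1.step M.kd c.2.head? a = some r ∧ c' = (r.1, r.2 ++ c.2.tail) := by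
  constructor
  · rintro ⟨d, hd⟩
    rw [game_trans] at hd
    split at hd <;> split at hd <;> simp at hd
    · obtain ⟨q, l, h, rfl⟩ := hd
      exact ⟨_, _, h, rfl⟩
    · obtain ⟨q, l, h, rfl⟩ := hd
      exact ⟨_, _, h, rfl⟩
  · rintro ⟨a, r, h, rfl⟩
    by_cases hs : c.1.isSys c.2.head? = true
    · exact ⟨fun | .env => (.one, false) | .sys => (a, false),
        by rw [game_trans]; simp [hs, Action.isDefault, h]⟩
    · exact ⟨fun | .sys => (.one, false) | .env => (a, false),
        by rw [game_trans]; simp [hs, Action.isDefault, h]⟩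

/-- The label of a letter. -/
def Letter.lbl (x : Letter M.Cell) : Set (Prp M) := {x.prp}

/-- The label of a letter with a mark. -/
def Letter.mlbl (x : Letter M.Cell) (m : Option Mark) : Set (Prp M) :=
  {p | p = x.prp ∨ ∃ k, m = some k ∧ p = k.prp}

theorem Letter.mlbl_none (x : Letter M.Cell) : x.mlbl none = x.lbl := by
  ext; simp [mlbl, lbl]

/-- Propositions of letters and propositions of marks are disjoint, so both parts can be read off
the label. -/
theorem Letter.mlbl_inj {x x' : Letter M.Cell} {m m' : Option Mark} :
    x.mlbl m = x'.mlbl m' ↔ x = x' ∧ m = m' := by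
  refine ⟨fun h => ?_, by rintro ⟨rfl, rfl⟩; rfl⟩
  have h1 : x = x' := by
    have : x.prp ∈ x'.mlbl m' := h ▸ Or.inl rfl
    rcases this with h | ⟨k, _, h⟩
    · exact Letter.prp_injective h
    · exact absurd h (Letter.prp_ne_mark _ _)
  refine ⟨h1, Option.ext fun k => ?_⟩
  have key : ∀ (y : Letter M.Cell) n, k.prp ∈ y.mlbl n ↔ n = some k := by
    intro y n
    constructor
    · rintro (h | ⟨k', rfl, h⟩)
      · exact absurd h.symm (Letter.prp_ne_mark _ _)
      · rw [Mark.prp_injective h]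
    · rintro rfl
      exact Or.inr ⟨k, rfl, rfl⟩
  rw [← key x m, ← key x' m', h]

theorem Letter.lbl_inj {x x' : Letter M.Cell} : x.lbl = x'.lbl ↔ x = x' := by
  rw [← mlbl_none, ← mlbl_none, mlbl_inj]; simp

theorem Letter.mlbl_ne_empty (x : Letter M.Cell) (m : Option Mark) : x.mlbl m ≠ ∅ :=
  Set.nonempty_iff_ne_empty.1 ⟨x.prp, Or.inl rfl⟩

theorem Letter.lbl_injective : Function.Injective (Letter.lbl (M := M)) :=
  fun _ _ => Letter.lbl_inj.1

theorem game_lab (c : Conf M) :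
    (game M).lab c = c.1.key.elim ∅ fun x => x.1.mlbl x.2 := by
  have h : (game M).lab c = {p | ∃ x ∈ c.1.props, propPrp x = p} := rfl
  rw [h]
  rcases c with ⟨q, l⟩
  cases q with
  | pop md mk x =>
    ext p
    cases mk <;> simp [Ctl.props, Ctl.key, Letter.mlbl, propPrp, eq_comm]
  | sink b => simp [Ctl.props, Ctl.key]
  | _ =>
    ext p
    simp [Ctl.props, Ctl.key, Letter.mlbl, propPrp, eq_comm]

theorem game_lab_gen {q : Ctl M.Cell} (h : q.isGen = true) (l : List (Sym M.Cell)) :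
    (game M).lab (q, l) = q.letter.lbl := by
  rw [game_lab, ← Letter.mlbl_none]
  cases q <;> first | rfl | cases h

@[simp] theorem game_lab_pop (md : Mode) (mk : Option Mark) (x : Letter M.Cell)
    (l : List (Sym M.Cell)) : (game M).lab (.pop md mk x, l) = x.mlbl mk := game_lab _

@[simp] theorem game_lab_sink (b : Bool) (l : List (Sym M.Cell)) :
    (game M).lab (.sink b, l) = ∅ := game_lab _

theorem key_eq_of_lab_eq {c c' : Conf M} (h : (game M).lab c = (game M).lab c') :
    c.1.key = c'.1.key := by
  rw [game_lab, game_lab] at h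
  cases hk : c.1.key with
  | none =>
    cases hk' : c'.1.key with
    | none => rfl
    | some x' =>
      rw [hk, hk'] at h
      exact absurd h.symm (Letter.mlbl_ne_empty _ _)
  | some x =>
    cases hk' : c'.1.key with
    | none =>
      rw [hk, hk'] at h
      exact absurd h (Letter.mlbl_ne_empty _ _)
    | some x' =>
      rw [hk, hk'] at h
      obtain ⟨h1, h2⟩ := Letter.mlbl_inj.1 h
      exact congrArg some (Prod.ext h1 h2)

/-- The successors of a configuration have distinct labels. -/
theorem succ_det {c c₁ c₂ : Conf M} (h₁ : (game M).Succ c c₁) (h₂ : (game M).Succ c c₂)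
    (h : (game M).lab c₁ = (game M).lab c₂) : c₁ = c₂ := by
  obtain ⟨a, r, e, rfl⟩ := succ_iff.1 h₁
  obtain ⟨a', r', e', rfl⟩ := succ_iff.1 h₂
  rw [Ctl.step_det e e' (key_eq_of_lab_eq h)]

/-- In a system state the environment has only its default action. In any other state some choice is
available, and then so are its two copies. -/
theorem passive_env_iff (c : Conf M) :
    (game M).Passive .env c ↔ c.1.isSys c.2.head? = true := by
  rw [CGS.Passive, CGS.existsUnique_available (b := .env) _ (by simp)]
  refine (existsUnique_env (P := fun a => (c.1.step M.kd c.2.head? a).isSome)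
    (c.1.exists_step M.kd c.2.head?) fun d => ?_).1
  rw [game_trans]
  split <;> simp only [Option.isSome_map] <;> split <;> simp [*]

theorem game_isOpen (M : ATM) : (game M).IsOpen .env := by
  intro c
  rw [passive_env_iff]
  by_cases h : c.1.isSys c.2.head? = true
  · exact .inr h
  · left
    rw [CGS.ControlledBy, CGS.existsUnique_available (b := .sys) _
      (by intro a; cases a <;> simp)]
    refine (existsUnique_env (sys := c.1.isSys c.2.head?)
      (P := fun a => (c.1.step M.kd c.2.head? a).isSome)
      (c.1.exists_step M.kd c.2.head?) fun d => ?_).2 (by simpa using h)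
    rw [game_trans]
    split <;> simp only [Option.isSome_map] <;> split <;> simp [*]

/-- Pruning removes successors, but some successor remains, and both copies of an action that leads
to it remain available. An environment node thus keeps two environment decisions even if a single
child is left, so control is decided by the configuration alone. -/
theorem StrategyTree.controlledBy_sys_iff (𝒯 : StrategyTree (game M) .env) (x : 𝒯.nodes) :
    𝒯.toCGS.ControlledBy .sys x ↔
      ((game M).lst x.1).1.isSys ((game M).lst x.1).2.head? = true := by
  rw [CGS.ControlledBy, CGS.existsUnique_available (b := .env) _
      (by intro a; cases a <;> simp)]
  set c := (game M).lst x.1 with hc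
  refine (existsUnique_env (P := fun a => ∃ r, c.1.step M.kd c.2.head? a = some r ∧
    x.1 ++ [(r.1, r.2 ++ c.2.tail)] ∈ 𝒯.nodes) ?_ fun d => ?_).1
  · obtain ⟨s, hs⟩ := 𝒯.nonblocking x.1 x.2
    obtain ⟨a, r, h, e⟩ := succ_iff.1 (𝒯.succ_of_mem hs)
    exact ⟨a, r, h, e ▸ hs⟩
  · have : (𝒯.toCGS.trans x d).isSome = true ↔
        ∃ s, (game M).trans c d = some s ∧ x.1 ++ [s] ∈ 𝒯.nodes := by
      simp only [StrategyTree.toCGS, ← hc]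
      cases (game M).trans c d with
      | none => simp
      | some s =>
        by_cases h : x.1 ++ [s] ∈ 𝒯.nodes <;> simp [h]
    rw [this]
    simp only [game_trans]
    split <;> split <;> simp [*]

end

end PushdownGames

namespace PushdownGames

/-! ## Infinite and finite runs, and the sequences of their labels -/

/-- Some infinite run of `R` from `c` has the sequence of labels `L`. -/
def LRun {S A : Type} (R : S → S → Prop) (lab : S → A) (c : S) (L : ℕ → A) : Prop :=
  ∃ cs : ℕ → S, cs 0 = c ∧ (∀ n, R (cs n) (cs (n + 1))) ∧ ∀ n, lab (cs n) = L n

section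

variable {S A : Type} {R : S → S → Prop} {lab : S → A}

theorem lrun_iff {c : S} {L : ℕ → A} : LRun R lab c L ↔
    L 0 = lab c ∧ ∃ c', R c c' ∧ LRun R lab c' fun n => L (n + 1) := by
  constructor
  · rintro ⟨cs, rfl, h, h'⟩
    exact ⟨(h' 0).symm, cs 1, h 0, fun n => cs (n + 1), rfl, fun n => h _, fun n => h' _⟩
  · rintro ⟨h0, c', hc, cs, rfl, h, h'⟩
    refine ⟨fun n => n.casesOn c cs, rfl, fun n => ?_, fun n => ?_⟩
    · cases n
      · exact hc
      · exact h _
    · cases n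
      · exact h0.symm
      · exact h' _

/-- A finite run of `R` from `c` to `c'`, where `w` lists the labels after that of `c`. -/
inductive Steps (R : S → S → Prop) (lab : S → A) : S → List A → S → Prop
  | nil (c : S) : Steps R lab c [] c
  | cons {c c₁ c₂ : S} {w : List A} : R c c₁ → Steps R lab c₁ w c₂ →
      Steps R lab c (lab c₁ :: w) c₂

theorem steps_nil {c c' : S} : Steps R lab c [] c' ↔ c' = c := by
  constructor
  · rintro ⟨⟩; rfl
  · rintro rfl; exact .nil _

theorem steps_cons {c c' : S} {a : A} {w : List A} : Steps R lab c (a :: w) c' ↔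
    ∃ c₁, R c c₁ ∧ lab c₁ = a ∧ Steps R lab c₁ w c' := by
  constructor
  · rintro (_ | ⟨h, h'⟩)
    exact ⟨_, h, rfl, h'⟩
  · rintro ⟨c₁, h, rfl, h'⟩
    exact .cons h h'

theorem steps_append {w w' : List A} : ∀ {c c' : S}, Steps R lab c (w ++ w') c' ↔
    ∃ c₁, Steps R lab c w c₁ ∧ Steps R lab c₁ w' c' := by
  induction w with
  | nil =>
    intro c c'
    simp [steps_nil]
  | cons a w ih =>
    intro c c'
    simp only [List.cons_append, steps_cons, ih]
    constructor
    · rintro ⟨c₁, h, h', c₂, h₁, h₂⟩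
      exact ⟨c₂, ⟨c₁, h, h', h₁⟩, h₂⟩
    · rintro ⟨c₂, ⟨c₁, h, h', h₁⟩, h₂⟩
      exact ⟨c₁, h, h', c₂, h₁, h₂⟩

theorem steps_snoc {w : List A} {a : A} {c c' : S} : Steps R lab c (w ++ [a]) c' ↔
    ∃ c₁, Steps R lab c w c₁ ∧ R c₁ c' ∧ lab c' = a := by
  simp only [steps_append, steps_cons, steps_nil]
  constructor
  · rintro ⟨c₁, h, c₂, h', h'', rfl⟩
    exact ⟨c₁, h, h', h''⟩
  · rintro ⟨c₁, h, h', h''⟩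
    exact ⟨c₁, h, c', h', h'', rfl⟩

/-- The principle behind the whole correspondence: in a game with this property, the labels along a
path determine the configuration at its end. -/
theorem steps_det (hd : ∀ c c₁ c₂, R c c₁ → R c c₂ → lab c₁ = lab c₂ → c₁ = c₂) {w : List A} :
    ∀ {c c₁ c₂ : S}, Steps R lab c w c₁ → Steps R lab c w c₂ → c₁ = c₂ := by
  induction w with
  | nil =>
    intro c c₁ c₂ h h'
    rw [steps_nil.1 h, steps_nil.1 h']
  | cons a w ih =>
    intro c c₁ c₂ h h'
    obtain ⟨d, h1, h2, h3⟩ := steps_cons.1 h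
    obtain ⟨d', h1', h2', h3'⟩ := steps_cons.1 h'
    obtain rfl := hd _ _ _ h1 h1' (h2.trans h2'.symm)
    exact ih h3 h3'

theorem steps_of_seq {cs : ℕ → S} {L : ℕ → A} (h : ∀ n, R (cs n) (cs (n + 1)))
    (h' : ∀ n, lab (cs n) = L n) (n : ℕ) :
    Steps R lab (cs 0) ((List.range n).map fun k => L (k + 1)) (cs n) := by
  induction n with
  | zero => exact .nil _
  | succ n ih =>
    rw [List.range_succ, List.map_append]
    exact steps_snoc.2 ⟨_, ih, h n, h' _⟩

end

/-! ## Paths in trees -/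

namespace LTree

variable {Υ A : Type} (T : LTree Υ A)

/-- The labels on the path from the root to `x`, without that of the root. -/
def tailLabels (x : List Υ) : List A := x.inits.tail.map T.lab

theorem pathLabels_eq (x : List Υ) : T.pathLabels x = T.lab [] :: T.tailLabels x := by
  cases x <;> simp [pathLabels, tailLabels]

@[simp] theorem tailLabels_nil : T.tailLabels [] = [] := rfl

theorem tailLabels_snoc (x : List Υ) (a : Υ) :
    T.tailLabels (x ++ [a]) = T.tailLabels x ++ [T.lab (x ++ [a])] := by
  have : (x ++ [a]).inits = x.inits ++ [x ++ [a]] := by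
    induction x with
    | nil => rfl
    | cons b x ih => simp [ih]
  have h : x.inits ≠ [] := by cases x <;> simp
  rw [tailLabels, this, List.tail_append_of_ne_nil h]
  simp [tailLabels]

theorem tailLabels_append {x : List Υ} (hx : x ∈ T.nodes) (z : List Υ) :
    T.tailLabels (x ++ z) = T.tailLabels x ++ (T.subtree x hx).tailLabels z := by
  induction z using List.reverseRecOn with
  | nil => simp
  | append_singleton z a ih =>
    rw [← List.append_assoc, tailLabels_snoc, tailLabels_snoc, ih, List.append_assoc]
    simp [subtree]

theorem length_tailLabels (x : List Υ) : (T.tailLabels x).length = x.length := by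
  simp [tailLabels]

variable {T}

theorem mem_of_append {x : List Υ} (y : List Υ) (h : x ++ y ∈ T.nodes) : x ∈ T.nodes := by
  induction y using List.reverseRecOn with
  | nil => simpa using h
  | append_singleton y a ih => exact ih (T.prefix_closed _ a (by simpa using h))

theorem mem_of_prefix {x y : List Υ} (h : x <+: y) (hy : y ∈ T.nodes) : x ∈ T.nodes := by
  obtain ⟨z, rfl⟩ := h
  exact mem_of_append z hy

theorem isChild_snoc {x : List Υ} {a : Υ} : T.IsChild x (x ++ [a]) ↔ x ++ [a] ∈ T.nodes :=
  ⟨fun h => h.1, fun h => ⟨h, a, rfl⟩⟩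

theorem subtree_isChild {x : List Υ} (hx : x ∈ T.nodes) {y z : List Υ} :
    (T.subtree x hx).IsChild y z ↔ T.IsChild (x ++ y) (x ++ z) := by
  simp [IsChild, subtree]

theorem eq_of_tailLabels (hT : T.IsMinimal) {x y : List Υ} (hx : x ∈ T.nodes) (hy : y ∈ T.nodes)
    (h : T.tailLabels x = T.tailLabels y) : x = y := by
  induction x using List.reverseRecOn generalizing y with
  | nil =>
    have := congrArg List.length h
    simp only [length_tailLabels] at this
    exact (List.length_eq_zero_iff.1 this.symm).symm
  | append_singleton x a ih =>
    rcases List.eq_nil_or_concat' y with rfl | ⟨y, b, rfl⟩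
    · have := congrArg List.length h
      simp [length_tailLabels] at this
    · rw [tailLabels_snoc, tailLabels_snoc] at h
      obtain ⟨h1, h2⟩ := List.append_inj' h rfl
      obtain rfl := ih (T.prefix_closed _ _ hx) (T.prefix_closed _ _ hy) h1
      exact hT _ _ _ ⟨hx, a, rfl⟩ ⟨hy, b, rfl⟩ (by simpa using h2)

namespace IsPath

variable {π : ℕ → List Υ}

theorem mem (h : T.IsPath π) (n : ℕ) : π n ∈ T.nodes := by
  cases n with
  | zero => rw [h.1]; exact T.root_mem
  | succ n => exact (h.2 n).1

theorem length (h : T.IsPath π) (n : ℕ) : (π n).length = n := by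
  induction n with
  | zero => rw [h.1]; rfl
  | succ n ih =>
    obtain ⟨-, a, e⟩ := h.2 n
    rw [e, List.length_append, ih]
    rfl

theorem tailLabels (h : T.IsPath π) (n : ℕ) :
    T.tailLabels (π n) = (List.range n).map fun k => T.lab (π (k + 1)) := by
  induction n with
  | zero => rw [h.1]; rfl
  | succ n ih =>
    obtain ⟨-, a, e⟩ := h.2 n
    rw [e, tailLabels_snoc, ih, List.range_succ, List.map_append, ← e]
    rfl

theorem prefix_of_le (h : T.IsPath π) {m n : ℕ} (hmn : m ≤ n) : π m <+: π n := by
  induction n, hmn using Nat.le_induction with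
  | base => exact List.prefix_rfl
  | succ n _ ih =>
    obtain ⟨-, a, e⟩ := h.2 n
    rw [e]
    exact ih.trans (List.prefix_append _ _)

end IsPath

/-- In an infinite tree each node lies on an infinite path. -/
theorem IsInfinite.exists_path (hT : T.IsInfinite) {x : List Υ} (hx : x ∈ T.nodes) :
    ∃ π, T.IsPath π ∧ π x.length = x := by
  choose! f hf using hT
  have hmem : ∀ n, f^[n] x ∈ T.nodes := by
    intro n
    induction n with
    | zero => exact hx
    | succ n ih =>
      rw [Function.iterate_succ_apply']
      exact (hf _ ih).1
  -- The path follows the prefixes of `x`, and from `x` on it follows chosen children.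
  refine ⟨fun n => if n ≤ x.length then x.take n else f^[n - x.length] x, ⟨by simp, ?_⟩, by simp⟩
  intro n
  rcases lt_trichotomy n x.length with h | h | h
  · simp only [if_pos h.le, if_pos (Nat.succ_le_of_lt h)]
    exact ⟨mem_of_prefix (List.take_prefix _ _) hx, x[n], by simp⟩
  · subst h
    simp only [le_refl, if_true, List.take_length, if_neg (Nat.not_succ_le_self _)]
    simpa using hf x hx
  · have h1 : ¬ n ≤ x.length := by omega
    have h2 : ¬ n + 1 ≤ x.length := by omega
    simp only [if_neg h1, if_neg h2]
    rw [Nat.sub_add_comm h.le, Function.iterate_succ_apply']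
    exact hf _ (hmem _)

/-- A finitely branching tree without infinite path is finite. -/
theorem finite_of_forall_not_isPath (hf : ∀ x ∈ T.nodes, {y | T.IsChild x y}.Finite)
    (hp : ∀ π, ¬ T.IsPath π) : T.nodes.Finite := by
  by_contra hinf
  -- König's argument: among the finitely many children of a node with infinitely many descendants,
  -- one has the same property.
  let B : List Υ → Prop := fun x => x ∈ T.nodes ∧ {z | z ∈ T.nodes ∧ x <+: z}.Infinite
  have step : ∀ x, B x → ∃ y, T.IsChild x y ∧ B y := by
    rintro x ⟨hx, hB⟩
    by_contra! hcon
    refine hB (((Set.finite_singleton x).union ((hf x hx).biUnion (t := fun y =>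
      {z | z ∈ T.nodes ∧ y <+: z}) fun y hy => ?_)).subset ?_)
    · by_contra hy'
      exact hcon y hy ⟨hy.1, hy'⟩
    · rintro z ⟨hz, t, rfl⟩
      cases t with
      | nil => left; simp
      | cons a t =>
        right
        have : x ++ [a] <+: x ++ a :: t := ⟨t, by simp⟩
        exact Set.mem_biUnion (x := x ++ [a]) (isChild_snoc.2 (mem_of_prefix this hz)) ⟨hz, this⟩
  choose! f hf' using step
  have h0 : B [] := ⟨T.root_mem, by simpa using hinf⟩
  have hB : ∀ n, B (f^[n] []) := by
    intro n
    induction n with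
    | zero => exact h0
    | succ n ih =>
      rw [Function.iterate_succ_apply']
      exact (hf' _ ih).2
  refine hp (fun n => f^[n] []) ⟨rfl, fun n => ?_⟩
  simp only [Function.iterate_succ_apply']
  exact (hf' _ (hB n)).1

end LTree

/-! ## Strategy trees -/

namespace StrategyTree

variable {AP Ag Ac S : Type} {G : CGS AP Ag Ac S} {env : Ag} (𝒯 : StrategyTree G env)

theorem lst_snoc (G : CGS AP Ag Ac S) (ν : List S) (s : S) : G.lst (ν ++ [s]) = s := by
  simp [CGS.lst, List.getLastD_eq_getLast?]

theorem succ_of_isChild {x y : List S} (h : 𝒯.toLTree.IsChild x y) :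
    G.Succ (G.lst x) (G.lst y) := by
  obtain ⟨h, s, rfl⟩ := h
  rw [lst_snoc]
  exact 𝒯.succ_of_mem h

theorem isInfinite : 𝒯.toLTree.IsInfinite := by
  intro x hx
  obtain ⟨s, hs⟩ := 𝒯.nonblocking x hx
  exact ⟨_, hs, s, rfl⟩

theorem isMinimal (hd : ∀ c c₁ c₂, G.Succ c c₁ → G.Succ c c₂ → G.lab c₁ = G.lab c₂ → c₁ = c₂) :
    𝒯.toLTree.IsMinimal := by
  intro x y z hy hz h
  have h1 := 𝒯.succ_of_isChild hy
  have h2 := 𝒯.succ_of_isChild hz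
  have h3 := hd _ _ _ h1 h2 h
  obtain ⟨_, s, rfl⟩ := hy
  obtain ⟨_, t, rfl⟩ := hz
  rw [lst_snoc, lst_snoc] at h3
  rw [h3]

/-- Each child is reached by one of the finitely many full decisions, which makes König's lemma
applicable to strategy trees. -/
theorem finite_children [Finite Ag] [Finite Ac] (x : List S) :
    {y | 𝒯.toLTree.IsChild x y}.Finite := by
  have : Finite (Ag → Ac) := inferInstance
  refine (Set.finite_range fun d : Ag → Ac =>
    x ++ (G.trans (G.lst x) d).toList).subset ?_
  rintro y hy
  obtain ⟨d, hd⟩ := 𝒯.succ_of_isChild hy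
  obtain ⟨_, s, rfl⟩ := hy
  refine ⟨d, ?_⟩
  rw [lst_snoc] at hd
  simp [hd]

end StrategyTree

/-- A minimal infinite tree whose labels follow the runs of `G`, and which contains all the
successors of the system states, is the tree of a strategy. -/
theorem exists_strategyTree {AP Ag Ac S : Type} {G : CGS AP Ag Ac S} {env : Ag}
    (hd : ∀ c c₁ c₂, G.Succ c c₁ → G.Succ c c₂ → G.lab c₁ = G.lab c₂ → c₁ = c₂)
    {Υ : Type} (T : LTree Υ (Set AP)) (hmin : T.IsMinimal) (hinf : T.IsInfinite)
    (hroot : T.lab [] = G.lab G.start)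
    (hreach : ∀ x ∈ T.nodes, ∃ c, Steps G.Succ G.lab G.start (T.tailLabels x) c)
    (hsys : ∀ x ∈ T.nodes, ∀ c, Steps G.Succ G.lab G.start (T.tailLabels x) c →
      G.Passive env c → ∀ c', G.Succ c c' → ∃ y, T.IsChild x y ∧ T.lab y = G.lab c')
    (F : Set AP) (hacc : ∀ π, T.IsPath π → ∃ n, T.lab (π n) = F) :
    ∃ 𝒯 : StrategyTree G env,
      (∀ π, 𝒯.toLTree.IsPath π → ∃ n, 𝒯.toLTree.lab (π n) = F) ∧ T.Iso 𝒯.toLTree := by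
  haveI : Nonempty S := ⟨G.start⟩
  choose! conf hconf using hreach
  have conf_nil : conf [] = G.start := steps_nil.1 (hconf [] T.root_mem)
  have conf_snoc : ∀ x a, x ++ [a] ∈ T.nodes → G.Succ (conf x) (conf (x ++ [a])) ∧
      G.lab (conf (x ++ [a])) = T.lab (x ++ [a]) := by
    intro x a h
    have h1 := hconf _ h
    rw [LTree.tailLabels_snoc] at h1
    obtain ⟨c, h2, h3, h4⟩ := steps_snoc.1 h1
    rw [steps_det hd h2 (hconf _ (T.prefix_closed _ _ h))] at h3
    exact ⟨h3, h4⟩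
  have conf_lab : ∀ x ∈ T.nodes, G.lab (conf x) = T.lab x := by
    intro x hx
    rcases List.eq_nil_or_concat' x with rfl | ⟨x, a, rfl⟩
    · rw [conf_nil, hroot]
    · exact (conf_snoc x a hx).2
  -- `φ x` is the sequence of configurations along the path to `x`, that is, a node of the
  -- unwinding. It is injective on the nodes because `T` is minimal.
  let φ : List Υ → List S := fun x => x.inits.tail.map conf
  have φ_nil : φ [] = [] := rfl
  have φ_snoc : ∀ x a, φ (x ++ [a]) = φ x ++ [conf (x ++ [a])] := fun x a =>
    -- By definition `φ` lists the labels along a path in the full tree labeled by `conf`.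
    LTree.tailLabels_snoc (⟨Set.univ, conf, trivial, fun _ _ _ => trivial⟩ : LTree Υ S) x a
  have φ_lst : ∀ x, x ∈ T.nodes → G.lst (φ x) = conf x := by
    intro x _
    rcases List.eq_nil_or_concat' x with rfl | ⟨x, a, rfl⟩
    · rw [conf_nil]; rfl
    · rw [φ_snoc, StrategyTree.lst_snoc]
  have φ_lab : ∀ x ∈ T.nodes, (φ x).map G.lab = T.tailLabels x := by
    intro x
    induction x using List.reverseRecOn with
    | nil => intro _; rfl
    | append_singleton x a ih =>
      intro hx
      rw [φ_snoc, LTree.tailLabels_snoc, List.map_append, ih (T.prefix_closed _ _ hx)]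
      simp [(conf_snoc x a hx).2]
  have φ_inj : ∀ x ∈ T.nodes, ∀ y ∈ T.nodes, φ x = φ y → x = y := by
    intro x hx y hy h
    exact LTree.eq_of_tailLabels hmin hx hy (by rw [← φ_lab x hx, ← φ_lab y hy, h])
  have φ_split : ∀ x ∈ T.nodes, ∀ ν s, φ x = ν ++ [s] →
      ∃ x' a, x = x' ++ [a] ∧ ν = φ x' ∧ s = conf x := by
    intro x hx ν s h
    rcases List.eq_nil_or_concat' x with rfl | ⟨x, a, rfl⟩
    · simp [φ_nil] at h
    · rw [φ_snoc] at h
      obtain ⟨h1, h2⟩ := List.append_inj' h rfl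
      exact ⟨x, a, rfl, h1.symm, by simpa using h2.symm⟩
  let 𝒯 : StrategyTree G env :=
    { nodes := φ '' T.nodes
      root_mem := ⟨[], T.root_mem, rfl⟩
      prefix_closed := by
        rintro ν s ⟨x, hx, h⟩
        obtain ⟨x', a, rfl, rfl, rfl⟩ := φ_split x hx ν s h
        exact ⟨x', T.prefix_closed _ _ hx, rfl⟩
      track := by
        rintro ν ⟨x, hx, rfl⟩
        induction x using List.reverseRecOn with
        | nil => simp [φ_nil]
        | append_singleton x a ih =>
          have hx' := T.prefix_closed _ _ hx
          rw [φ_snoc, ← List.cons_append, List.isChain_append]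
          refine ⟨ih hx', by simp, ?_⟩
          intro c hc c' hc'
          have h1 : c = conf x := by
            rw [← φ_lst x hx']
            simpa [CGS.lst, List.getLast?_cons, List.getLastD_eq_getLast?, eq_comm] using hc
          simp at hc'
          rw [h1, ← hc']
          exact (conf_snoc x a hx).1
      system := by
        rintro ν ⟨x, hx, rfl⟩ hp s hs
        rw [φ_lst x hx] at hp hs
        obtain ⟨y, ⟨hy, a, rfl⟩, hl⟩ := hsys x hx _ (hconf x hx) hp s hs
        obtain ⟨h1, h2⟩ := conf_snoc x a hy
        refine ⟨x ++ [a], hy, ?_⟩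
        rw [φ_snoc, hd _ _ _ h1 hs (h2.trans hl)]
      nonblocking := by
        rintro ν ⟨x, hx, rfl⟩
        obtain ⟨y, hy, a, rfl⟩ := hinf x hx
        exact ⟨_, x ++ [a], hy, φ_snoc x a⟩ }
  have child : ∀ x ∈ T.nodes, ∀ y ∈ T.nodes,
      T.IsChild x y ↔ 𝒯.toLTree.IsChild (φ x) (φ y) := by
    intro x hx y hy
    constructor
    · rintro ⟨_, a, rfl⟩
      exact ⟨⟨_, hy, rfl⟩, _, φ_snoc x a⟩
    · rintro ⟨_, s, h⟩
      obtain ⟨y', a, rfl, h', -⟩ := φ_split y hy _ s h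
      obtain rfl := φ_inj x hx y' (T.prefix_closed _ _ hy) h'
      exact ⟨hy, a, rfl⟩
  refine ⟨𝒯, fun π hπ => ?_, ?_⟩
  · have : ∀ n, ∃ x ∈ T.nodes, φ x = π n := fun n => hπ.mem n
    choose ψ hψ hψ' using this
    obtain ⟨n, hn⟩ := hacc ψ ⟨φ_inj _ (hψ 0) _ T.root_mem ((hψ' 0).trans hπ.1), fun n =>
      (child _ (hψ n) _ (hψ (n + 1))).2 (by rw [hψ', hψ']; exact hπ.2 n)⟩
    refine ⟨n, ?_⟩
    rw [← hn, ← hψ' n, ← conf_lab _ (hψ n), ← φ_lst _ (hψ n)]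
    rfl
  · refine ⟨Equiv.ofBijective (fun x => ⟨φ x.1, x.1, x.2, rfl⟩) ⟨?_, ?_⟩, ?_, ?_⟩
    · rintro ⟨x, hx⟩ ⟨y, hy⟩ h
      exact Subtype.ext (φ_inj x hx y hy (congrArg Subtype.val h))
    · rintro ⟨_, x, hx, rfl⟩
      exact ⟨⟨x, hx⟩, rfl⟩
    · intro x y
      exact child _ x.2 _ y.2
    · rintro ⟨x, hx⟩
      change G.lab (G.lst (φ x)) = _
      rw [φ_lst x hx, conf_lab x hx]

end PushdownGames

namespace PushdownGames

/-! ## Blocks and codes as words over letters -/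

section

variable {C : Type}

/-- `w = s · bl_0 ⋯ bl_t · x · e` with `t ≥ 1`. -/
def LOver (s e : Bas) (Sub : List (Letter C) → Prop) (x : Letter C) (w : List (Letter C)) : Prop :=
  ∃ bs : List (List (Letter C)), 2 ≤ bs.length ∧ (∀ b ∈ bs, Sub b) ∧
    w = .bas s :: (bs.flatten ++ [x, .bas e])

def Letter.bit (v : Bool) : Letter C := .bas (.ofBool v)

def L0 (w : List (Letter C)) : Prop := ∃ v, w = [.bit v]

def L1 (v : Bool) (w : List (Letter C)) : Prop := LOver .start1 .end1 L0 (.bit v) w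

def L2 (v : Bool) (w : List (Letter C)) : Prop :=
  LOver .start2 .end2 (fun b => ∃ v', L1 v' b) (.bit v) w

def L3 (t : Option C × C × Option C) (w : List (Letter C)) : Prop :=
  LOver .start3 .end3 (fun b => ∃ v, L2 v b) (.lam t.1 t.2.1 t.2.2) w

/-- The triples of the word `cs`, which follows `p`. -/
def win : Option C → List C → List (Option C × C × Option C)
  | _, [] => []
  | p, c :: cs => (p, c, cs.head?) :: win (some c) cs

/-- The kind of the head after the word `cs`, unless there are two heads. -/
def heads (kd : C → Kd) (hd : Option Kd) (cs : List C) : Option (Option Kd) :=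
  cs.foldlM (fun hd c => addHead hd (kd c)) hd

def tagBas (b : Bool) : Bas := if b then .r else .l

/-- The code of a word with a head of kind `hd`. -/
def LCode (kd : C → Kd) (b : Bool) (hd : Option Kd) (w : List (Letter C)) : Prop :=
  ∃ (cs : List C) (bs : List (List (Letter C))), heads kd none cs = some hd ∧ hd.isSome = true ∧
    List.Forall₂ L3 (win none cs) bs ∧ w = .bas (tagBas b) :: (bs.flatten ++ [.bas (closing hd)])

/-- The letters within blocks. -/
def Letter.inner : Letter C → Bool
  | bas .all => false
  | bas .ex => false
  | bas .l => false
  | bas .r => false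
  | bas .f => false
  | _ => true

theorem inner_of_over {s e : Bas} {Sub : List (Letter C) → Prop} {x : Letter C}
    {w : List (Letter C)} (h : LOver s e Sub x w) (hs : (Letter.bas s : Letter C).inner = true)
    (he : (Letter.bas e : Letter C).inner = true) (hx : x.inner = true)
    (hS : ∀ b, Sub b → ∀ y ∈ b, y.inner = true) : ∀ y ∈ w, y.inner = true := by
  obtain ⟨bs, -, h, rfl⟩ := h
  intro y hy
  simp only [List.mem_cons, List.mem_append, List.mem_flatten, List.not_mem_nil, or_false] at hy
  rcases hy with rfl | ⟨b, hb, hy⟩ | rfl | rfl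
  · exact hs
  · exact hS b (h b hb) y hy
  · exact hx
  · exact he

theorem Letter.inner_bit (v : Bool) : (Letter.bit v : Letter C).inner = true := by cases v <;> rfl

theorem L1.inner {v : Bool} {w : List (Letter C)} (h : L1 v w) : ∀ y ∈ w, y.inner = true :=
  inner_of_over h rfl rfl (Letter.inner_bit v) fun b ⟨v, hb⟩ y hy => by
    subst hb
    rw [List.mem_singleton.1 hy, Letter.inner_bit]

theorem L2.inner {v : Bool} {w : List (Letter C)} (h : L2 v w) : ∀ y ∈ w, y.inner = true :=
  inner_of_over h rfl rfl (Letter.inner_bit v) fun _ ⟨_, hb⟩ => hb.inner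

theorem L3.inner {t : Option C × C × Option C} {w : List (Letter C)} (h : L3 t w) :
    ∀ y ∈ w, y.inner = true :=
  inner_of_over h rfl rfl rfl fun _ ⟨_, hb⟩ => hb.inner

theorem forall₂_inner {ts : List (Option C × C × Option C)} {bs : List (List (Letter C))}
    (h : List.Forall₂ L3 ts bs) : ∀ y ∈ bs.flatten, y.inner = true := by
  induction h with
  | nil => simp
  | cons h _ ih =>
    intro y hy
    rw [List.flatten_cons, List.mem_append] at hy
    rcases hy with hy | hy
    · exact h.inner y hy
    · exact ih y hy

theorem exists_bits {bs : List (List (Letter C))} (h : ∀ b ∈ bs, L0 b) :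
    ∃ vs : List Bool, bs.flatten = vs.map Letter.bit ∧ vs.length = bs.length := by
  induction bs with
  | nil => exact ⟨[], rfl, rfl⟩
  | cons b bs ih =>
    obtain ⟨v, hv⟩ := h b (by simp)
    obtain ⟨vs, h1, h2⟩ := ih fun b hb => h b (by simp [hb])
    exact ⟨v :: vs, by simp [hv, h1], by simp [h2]⟩

theorem l1_iff {v : Bool} {w : List (Letter C)} : L1 v w ↔ ∃ vs : List Bool, 2 ≤ vs.length ∧
    w = .bas .start1 :: (vs.map Letter.bit ++ [.bit v, .bas .end1]) := by
  constructor
  · rintro ⟨bs, h, h0, rfl⟩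
    obtain ⟨vs, h1, h2⟩ := exists_bits h0
    exact ⟨vs, h2 ▸ h, by rw [h1]⟩
  · rintro ⟨vs, h, rfl⟩
    refine ⟨vs.map fun v => [.bit v], by simpa using h, ?_, ?_⟩
    · intro b hb
      obtain ⟨v, -, rfl⟩ := List.mem_map.1 hb
      exact ⟨v, rfl⟩
    · rw [← List.flatMap_def, ← List.map_eq_flatMap]

end

/-! ## The generation of blocks -/

theorem Bas.toBool_ofBool (v : Bool) : (Bas.ofBool v).toBool = some v := by cases v <;> rfl

theorem val_incr {n : ℕ} (c : Fin (n + 1)) : (incr c).val = min n (c.val + 1) := rfl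

section

variable {C : Type} {G : Phase → List (Letter C) → Prop} {K : List (Letter C) → Prop}

/-- `G p` is the language of the position `p` when `K` is the language after the last 2-block. -/
def IsGen (G : Phase → List (Letter C) → Prop) (K : List (Letter C) → Prop) : Prop :=
  ∀ p ls, G p ls ↔ (p = .end2 2 ∧ K ls) ∨
    ∃ b p' ls', Phase.next p b = some p' ∧ ls = .bas p'.bas :: ls' ∧ G p' ls'

variable (hG : IsGen G K)
include hG

/-- The content of a 1-block is a bit like its 0-blocks, and only the following `end1` tells which
bit was the content. Hence all bits are counted together, up to 3: at least two 0-blocks and the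
content. -/
theorem gen_bit {c2 c1 : Fin 3} {ls : List (Letter C)} : ∀ {c0 : Fin 4} {v : Bool},
    G (.bit c2 c1 c0 v) ls ↔ ∃ (vs : List Bool) (ls' : List (Letter C)),
      ls = vs.map Letter.bit ++ .bas .end1 :: ls' ∧ 3 ≤ c0.val + vs.length ∧
      G (.end1 c2 (incr c1)) ls' := by
  have key : ∀ (ls : List (Letter C)) (c0 : Fin 4) v, G (.bit c2 c1 c0 v) ls ↔
      (c0.val = 3 ∧ ∃ ls', ls = .bas .end1 :: ls' ∧ G (.end1 c2 (incr c1)) ls') ∨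
      ∃ v' ls', ls = .bit v' :: ls' ∧ G (.bit c2 c1 (incr c0) v') ls' := by
    intro ls c0 v
    rw [hG]
    constructor
    · rintro (⟨h, -⟩ | ⟨b, p', ls', h, rfl, h'⟩)
      · cases h
      · simp only [Phase.next] at h
        split at h
        · split at h
          · rename_i h3
            cases h
            exact .inl ⟨by rw [h3]; rfl, ls', rfl, h'⟩
          · cases h
        · obtain ⟨v', _, rfl⟩ := Option.map_eq_some_iff.1 h
          exact .inr ⟨v', ls', rfl, h'⟩
    · rintro (⟨h, ls', rfl, h'⟩ | ⟨v', ls', rfl, h'⟩)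
      · have h3 : c0 = 3 := Fin.ext h
        exact .inr ⟨.end1, _, ls', by simp [Phase.next, h3], rfl, h'⟩
      · refine .inr ⟨.ofBool v', _, ls', ?_, rfl, h'⟩
        simp only [Phase.next, Bas.toBool_ofBool]
        cases v' <;> rfl
  induction ls with
  | nil =>
    intro c0 v
    rw [key]
    simp
  | cons x ls ih =>
    intro c0 v
    rw [key]
    constructor
    · rintro (⟨h, ls', h1, h2⟩ | ⟨v', ls', h1, h2⟩)
      · exact ⟨[], ls', h1, by simp [h], h2⟩
      · cases h1
        obtain ⟨vs, ls', rfl, h3, h4⟩ := ih.1 h2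
        refine ⟨v' :: vs, ls', rfl, ?_, h4⟩
        rw [val_incr] at h3
        rw [List.length_cons]
        omega
    · rintro ⟨vs, ls', h1, h2, h3⟩
      cases vs with
      | nil =>
        refine .inl ⟨?_, ls', h1, h3⟩
        have := c0.isLt
        simp at h2
        omega
      | cons v' vs =>
        cases h1
        refine .inr ⟨v', _, rfl, ih.2 ⟨vs, ls', rfl, ?_, h3⟩⟩
        rw [val_incr]
        rw [List.length_cons] at h2
        omega

theorem gen_start1 {c2 c1 : Fin 3} {ls : List (Letter C)} : G (.start1 c2 c1) ls ↔
    ∃ (v : Bool) (w ls' : List (Letter C)), L1 v (.bas .start1 :: w) ∧ ls = w ++ ls' ∧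
      G (.end1 c2 (incr c1)) ls' := by
  rw [hG]
  constructor
  · rintro (⟨h, -⟩ | ⟨b, p', ls', h, rfl, h'⟩)
    · cases h
    · obtain ⟨v, _, rfl⟩ := Option.map_eq_some_iff.1 h
      obtain ⟨vs, ls'', rfl, h1, h2⟩ := (gen_bit hG).1 h'
      -- The counter starts at 1, for the bit read on leaving `start1`. The last bit of `vs` will be
      -- the content.
      have h1 : 3 ≤ 1 + vs.length := h1
      rcases List.eq_nil_or_concat' vs with rfl | ⟨vs, v', rfl⟩
      · simp at h1
      · refine ⟨v', .bit v :: (vs.map Letter.bit ++ [.bit v', .bas .end1]), ls'',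
          l1_iff.2 ⟨v :: vs, ?_, rfl⟩, ?_, h2⟩
        · simp at h1 ⊢
          omega
        · simp [Phase.bas, Letter.bit]
  · rintro ⟨v, w, ls', h, rfl, h'⟩
    obtain ⟨vs, h1, h2⟩ := l1_iff.1 h
    cases h2
    cases vs with
    | nil => simp at h1
    | cons v' vs =>
      refine .inr ⟨.ofBool v', .bit c2 c1 1 v', vs.map Letter.bit ++ [.bit v, .bas .end1] ++ ls',
        ?_, ?_, (gen_bit hG).2 ⟨vs ++ [v], ls', ?_, ?_, h'⟩⟩
      · simp [Phase.next, Bas.toBool_ofBool]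
      · simp [Phase.bas, Letter.bit]
      · simp
      · change 3 ≤ 1 + _
        simp at h1 ⊢
        omega

/-- After a 1-block either another one is opened or a bit is read as the content of the 2-block;
`start1` and bits are distinct letters, so there is no ambiguity. The induction is on the length of
the word, since each 1-block shortens what remains. -/
theorem gen_end1 {c2 : Fin 3} (ls : List (Letter C)) : ∀ {c1 : Fin 3},
    G (.end1 c2 c1) ls ↔ ∃ (bs : List (List (Letter C))) (v : Bool) (ls' : List (Letter C)),
      (∀ b ∈ bs, ∃ v, L1 v b) ∧ 2 ≤ bs.length + c1.val ∧
      ls = bs.flatten ++ .bit v :: .bas .end2 :: ls' ∧ G (.end2 (incr c2)) ls' := by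
  have bit2 : ∀ v (ls : List (Letter C)), G (.bit2 c2 v) ls ↔
      ∃ ls', ls = .bas .end2 :: ls' ∧ G (.end2 (incr c2)) ls' := by
    intro v ls
    rw [hG]
    constructor
    · rintro (⟨h, -⟩ | ⟨b, p', ls', h, rfl, h'⟩)
      · cases h
      · simp only [Phase.next] at h
        split at h
        · cases h
          exact ⟨ls', rfl, h'⟩
        · cases h
    · rintro ⟨ls', rfl, h'⟩
      exact .inr ⟨.end2, _, ls', rfl, rfl, h'⟩
  have key : ∀ (ls : List (Letter C)) (c1 : Fin 3), G (.end1 c2 c1) ls ↔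
      (∃ v ls', 2 ≤ c1.val ∧ ls = .bit v :: .bas .end2 :: ls' ∧ G (.end2 (incr c2)) ls') ∨
      ∃ v w ls', L1 v w ∧ ls = w ++ ls' ∧ G (.end1 c2 (incr c1)) ls' := by
    intro ls c1
    rw [hG]
    constructor
    · rintro (⟨h, -⟩ | ⟨b, p', ls', h, rfl, h'⟩)
      · cases h
      · simp only [Phase.next] at h
        split at h
        · cases h
          obtain ⟨v, w, ls', h1, rfl, h2⟩ := (gen_start1 hG).1 h'
          exact .inr ⟨v, _, ls', h1, rfl, h2⟩
        · split at h
          · rename_i h3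
            obtain ⟨v, _, rfl⟩ := Option.map_eq_some_iff.1 h
            obtain ⟨ls', rfl, h2⟩ := (bit2 _ _).1 h'
            exact .inl ⟨v, ls', by rw [h3]; rfl, rfl, h2⟩
          · cases h
    · rintro (⟨v, ls', h, rfl, h'⟩ | ⟨v, w, ls', h, rfl, h'⟩)
      · refine .inr ⟨.ofBool v, .bit2 c2 v, _, ?_, rfl, (bit2 _ _).2 ⟨ls', rfl, h'⟩⟩
        have h3 : c1 = 2 := Fin.ext (by have := c1.isLt; change c1.val = 2; omega)
        simp only [Phase.next, Bas.toBool_ofBool, h3]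
        cases v <;> rfl
      · obtain ⟨vs, h1, rfl⟩ := l1_iff.1 h
        exact .inr ⟨.start1, .start1 c2 c1, _, rfl, rfl, (gen_start1 hG).2 ⟨v, _, ls', h, rfl, h'⟩⟩
  have hlen : ∀ {v : Bool} {w : List (Letter C)}, L1 v w → 0 < w.length := by
    rintro v w h
    obtain ⟨vs, h1, rfl⟩ := l1_iff.1 h
    simp
  induction hn : ls.length using Nat.strong_induction_on generalizing ls with
  | _ n ih =>
    intro c1
    rw [key]
    constructor
    · rintro (⟨v, ls', h, rfl, h'⟩ | ⟨v, w, ls', h, rfl, h'⟩)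
      · exact ⟨[], v, ls', by simp, by simpa using h, rfl, h'⟩
      · obtain ⟨bs, v', ls'', h1, h2, rfl, h3⟩ := (ih ls'.length
          (by have := hlen h; rw [List.length_append] at hn; omega) ls' rfl).1 h'
        refine ⟨w :: bs, v', ls'', ?_, ?_, by simp, h3⟩
        · intro b hb
          rcases List.mem_cons.1 hb with rfl | hb
          · exact ⟨v, h⟩
          · exact h1 b hb
        · rw [val_incr] at h2
          rw [List.length_cons]
          omega
    · rintro ⟨bs, v, ls', h1, h2, rfl, h3⟩
      cases bs with
      | nil => exact .inl ⟨v, ls', by simpa using h2, rfl, h3⟩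
      | cons b bs =>
        obtain ⟨v', hb⟩ := h1 b (by simp)
        refine .inr ⟨v', b, bs.flatten ++ .bit v :: .bas .end2 :: ls', hb, by simp, ?_⟩
        refine (ih _ ?_ _ rfl).2 ⟨bs, v, ls', fun b hb => h1 b (by simp [hb]), ?_, rfl, h3⟩
        · have := hlen hb
          simp at hn ⊢
          omega
        · rw [val_incr]
          rw [List.length_cons] at h2
          omega

theorem gen_start2 {c2 : Fin 3} {ls : List (Letter C)} : G (.start2 c2) ls ↔
    ∃ (v : Bool) (w ls' : List (Letter C)), L2 v (.bas .start2 :: w) ∧ ls = w ++ ls' ∧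
      G (.end2 (incr c2)) ls' := by
  rw [hG]
  constructor
  · rintro (⟨h, -⟩ | ⟨b, p', ls', h, rfl, h'⟩)
    · cases h
    · simp only [Phase.next] at h
      split at h
      · cases h
        obtain ⟨v, w, ls'', h1, rfl, h2⟩ := (gen_start1 hG).1 h'
        obtain ⟨bs, v', ls', h3, h4, rfl, h5⟩ := (gen_end1 hG _).1 h2
        refine ⟨v', (.bas .start1 :: w) ++ bs.flatten ++ [.bit v', .bas .end2], ls',
          ⟨(.bas .start1 :: w) :: bs, ?_, ?_, by simp⟩, by simp [Phase.bas], h5⟩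
        · rw [val_incr] at h4
          rw [List.length_cons]
          change 2 ≤ _ + min 2 1 at h4
          omega
        · intro b hb
          rcases List.mem_cons.1 hb with rfl | hb
          · exact ⟨v, h1⟩
          · exact h3 b hb
      · cases h
  · rintro ⟨v, w, ls', ⟨bs, h1, h2, h⟩, rfl, h'⟩
    cases h
    cases bs with
    | nil => simp at h1
    | cons b bs =>
      obtain ⟨v', hb⟩ := h2 b (by simp)
      obtain ⟨vs, h3, rfl⟩ := l1_iff.1 hb
      refine .inr ⟨.start1, .start1 c2 0, _, rfl, rfl, (gen_start1 hG).2 ⟨v', _,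
        bs.flatten ++ .bit v :: .bas .end2 :: ls', hb, ?_, (gen_end1 hG _).2 ⟨bs, v, ls',
          fun b hb => h2 b (by simp [hb]), ?_, rfl, h'⟩⟩⟩
      · simp
      · rw [val_incr]
        rw [List.length_cons] at h1
        change 2 ≤ _ + min 2 1
        omega

/-- The same loop one level higher. After enough 2-blocks the abstract language `K` takes over,
which stands for all that follows the sub-blocks of a 3-block. -/
theorem gen_end2 (ls : List (Letter C)) : ∀ {c2 : Fin 3},
    G (.end2 c2) ls ↔ ∃ (bs : List (List (Letter C))) (ls' : List (Letter C)),
      (∀ b ∈ bs, ∃ v, L2 v b) ∧ 2 ≤ bs.length + c2.val ∧ ls = bs.flatten ++ ls' ∧ K ls' := by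
  have key : ∀ (ls : List (Letter C)) (c2 : Fin 3), G (.end2 c2) ls ↔
      (2 ≤ c2.val ∧ K ls) ∨ ∃ v w ls', L2 v w ∧ ls = w ++ ls' ∧ G (.end2 (incr c2)) ls' := by
    intro ls c2
    rw [hG]
    refine or_congr (and_congr_left' ⟨?_, ?_⟩) ⟨?_, ?_⟩
    · intro h
      cases h
      exact le_refl 2
    · intro h
      have h3 : c2 = 2 := Fin.ext (by have := c2.isLt; change c2.val = 2; omega)
      rw [h3]
    · rintro ⟨b, p', ls', h, rfl, h'⟩
      simp only [Phase.next] at h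
      split at h
      · cases h
        obtain ⟨v, w, ls', h1, rfl, h2⟩ := (gen_start2 hG).1 h'
        exact ⟨v, _, ls', h1, rfl, h2⟩
      · cases h
    · rintro ⟨v, w, ls', h, rfl, h'⟩
      obtain ⟨bs, h1, h2, rfl⟩ := id h
      exact ⟨.start2, .start2 c2, _, rfl, rfl, (gen_start2 hG).2 ⟨v, _, ls', h, rfl, h'⟩⟩
  induction hn : ls.length using Nat.strong_induction_on generalizing ls with
  | _ n ih =>
    intro c2
    rw [key]
    constructor
    · rintro (⟨h, h'⟩ | ⟨v, w, ls', h, rfl, h'⟩)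
      · exact ⟨[], ls, by simp, by simpa using h, rfl, h'⟩
      · obtain ⟨bs, ls'', h1, h2, rfl, h3⟩ := (ih ls'.length
          (by
            obtain ⟨_, _, _, rfl⟩ := h
            simp at hn
            omega) ls' rfl).1 h'
        refine ⟨w :: bs, ls'', ?_, ?_, by simp, h3⟩
        · intro b hb
          rcases List.mem_cons.1 hb with rfl | hb
          · exact ⟨v, h⟩
          · exact h1 b hb
        · rw [val_incr] at h2
          rw [List.length_cons]
          omega
    · rintro ⟨bs, ls', h1, h2, rfl, h3⟩
      cases bs with
      | nil => exact .inl ⟨by simpa using h2, h3⟩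
      | cons b bs =>
        obtain ⟨v', hb⟩ := h1 b (by simp)
        refine .inr ⟨v', b, bs.flatten ++ ls', hb, by simp, ?_⟩
        refine (ih _ ?_ _ rfl).2 ⟨bs, ls', fun b hb => h1 b (by simp [hb]), ?_, rfl, h3⟩
        · obtain ⟨_, _, _, rfl⟩ := hb
          simp at hn ⊢
          omega
        · rw [val_incr]
          rw [List.length_cons] at h2
          omega

theorem gen_start3 {ls : List (Letter C)} : G .start3 ls ↔
    ∃ (bs : List (List (Letter C))) (ls' : List (Letter C)),
      (∀ b ∈ bs, ∃ v, L2 v b) ∧ 2 ≤ bs.length ∧ ls = bs.flatten ++ ls' ∧ K ls' := by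
  rw [hG]
  constructor
  · rintro (⟨h, -⟩ | ⟨b, p', ls', h, rfl, h'⟩)
    · cases h
    · simp only [Phase.next] at h
      split at h
      · cases h
        obtain ⟨v, w, ls'', h1, rfl, h2⟩ := (gen_start2 hG).1 h'
        obtain ⟨bs, ls', h3, h4, rfl, h5⟩ := (gen_end2 hG _).1 h2
        refine ⟨(.bas .start2 :: w) :: bs, ls', ?_, ?_, by simp [Phase.bas], h5⟩
        · intro b hb
          rcases List.mem_cons.1 hb with rfl | hb
          · exact ⟨v, h1⟩
          · exact h3 b hb
        · rw [val_incr] at h4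
          rw [List.length_cons]
          change 2 ≤ _ + min 2 1 at h4
          omega
      · cases h
  · rintro ⟨bs, ls', h1, h2, rfl, h'⟩
    cases bs with
    | nil => simp at h2
    | cons b bs =>
      obtain ⟨v, hb⟩ := h1 b (by simp)
      obtain ⟨bs', h3, h4, rfl⟩ := id hb
      refine .inr ⟨.start2, .start2 0, _, rfl, rfl, (gen_start2 hG).2 ⟨v, _, bs.flatten ++ ls', hb,
        by simp, (gen_end2 hG _).2 ⟨bs, ls', fun b hb => h1 b (by simp [hb]), ?_, rfl, h'⟩⟩⟩
      rw [val_incr]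
      rw [List.length_cons] at h2
      change 2 ≤ _ + min 2 1
      omega

end

end PushdownGames

namespace PushdownGames

/-! ## The generation of codes -/

section

variable {C : Type} {kd : C → Kd}

/-- The words that can be generated from a control state, up to the letter `f`. -/
inductive Gen (kd : C → Kd) : Ctl C → List (Letter C) → Prop
  | nil : Gen kd (.pop .A none (.bas .f)) []
  | cons {q : Ctl C} {a : Act C} {q₁ : Ctl C} {ls : List (Letter C)} :
      q.next kd a = some q₁ → Gen kd q₁ ls → Gen kd q (q₁.letter :: ls)

theorem gen_iff {q : Ctl C} (hq : q.isGen = true) {ls : List (Letter C)} : Gen kd q ls ↔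
    ∃ a q₁ ls', q.next kd a = some q₁ ∧ ls = q₁.letter :: ls' ∧ Gen kd q₁ ls' := by
  constructor
  · intro h
    cases h with
    | nil => cases hq
    | cons h h' => exact ⟨_, _, _, h, rfl, h'⟩
  · rintro ⟨a, q₁, ls', h, rfl, h'⟩
    exact .cons h h'

/-- The triple `t` may be the content of the next block; then `hd'` is the kind of the head. -/
def Exit (kd : C → Kd) (hd : Option Kd) (last : Option (C × C)) (t : Option C × C × Option C)
    (hd' : Option Kd) : Prop :=
  match last with
  | none => t.1 = none ∧ ∃ h, addHead none (kd t.2.1) = some h ∧ commit kd h t.2.2 = some hd'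
  | some (u, s) => t.1 = some u ∧ t.2.1 = s ∧ commit kd hd t.2.2 = some hd'

theorem next_blk {ph : Phase} {fst : Bool} {hd : Option Kd} {last : Option (C × C)} {q : Ctl C} :
    (∃ a, (Ctl.blk ph fst hd last).next kd a = some q) ↔
      (∃ b p', ph.next b = some p' ∧ q = .blk p' fst hd last) ∨
      (ph = .end2 2 ∧ ∃ t hd', Exit kd hd last t hd' ∧ q = .lam fst hd' t.1 t.2.1 t.2.2) := by
  constructor
  · rintro ⟨a, h⟩
    cases a with
    | bas b =>
      obtain ⟨p, e, rfl⟩ : ∃ p, ph.next b = some p ∧ Ctl.blk p fst hd last = q := by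
        rcases last with _ | ⟨u, s⟩ <;> simpa [Ctl.next] using h
      exact .inl ⟨b, p, e, rfl⟩
    | win0 u s =>
      rcases last with _ | ⟨u', s'⟩
      · simp only [Ctl.next] at h
        split at h
        · obtain ⟨hd', e, rfl⟩ := Option.map_eq_some_iff.1 h
          obtain ⟨h1, h2, h3⟩ := Option.bind_eq_some_iff.1 e
          exact .inr ⟨‹_›, (none, u, s), hd', ⟨rfl, h1, h2, h3⟩, rfl⟩
        · simp at h
      · simp [Ctl.next] at h
    | win1 x =>
      rcases last with _ | ⟨u', s'⟩
      · simp [Ctl.next] at h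
      · simp only [Ctl.next] at h
        split at h
        · obtain ⟨hd', e, rfl⟩ := Option.map_eq_some_iff.1 h
          exact .inr ⟨‹_›, (some u', s', x), hd', ⟨rfl, rfl, e⟩, rfl⟩
        · simp at h
    | _ => cases last <;> simp [Ctl.next] at h
  · rintro (⟨b, p', h, rfl⟩ | ⟨rfl, ⟨p, u, s⟩, hd', h, rfl⟩)
    · exact ⟨.bas b, by cases last <;> simp [Ctl.next, h]⟩
    · rcases last with _ | ⟨u', s'⟩
      · obtain ⟨h1, h2, h3, h4⟩ := h
        simp only at h1 h3 h4
        subst h1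
        exact ⟨.win0 u s, by simp [Ctl.next, h3, h4]⟩
      · obtain ⟨h1, h2, h3⟩ := h
        simp only at h1 h2 h3
        subst h1 h2
        exact ⟨.win1 s, by simp [Ctl.next, h3]⟩

/-- Instance of the abstract analysis: the language after the last 2-block begins with a triple
admitted by `Exit` and with `end3`. -/
theorem isGen_blk (kd : C → Kd) (fst : Bool) (hd : Option Kd) (last : Option (C × C)) :
    IsGen (fun ph ls => Gen kd (.blk ph fst hd last) ls) fun ls =>
      ∃ t hd' ls', Exit kd hd last t hd' ∧ ls = .lam t.1 t.2.1 t.2.2 :: .bas .end3 :: ls' ∧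
        Gen kd (.end3 fst hd' t.2.1 t.2.2) ls' := by
  have lam : ∀ {hd' p u s ls}, Gen kd (.lam fst hd' p u s) ls ↔
      ∃ ls', ls = .bas .end3 :: ls' ∧ Gen kd (.end3 fst hd' u s) ls' := by
    intro hd' p u s ls
    rw [gen_iff rfl]
    constructor
    · rintro ⟨a, q₁, ls', h, rfl, h'⟩
      cases a <;> simp [Ctl.next] at h
      obtain ⟨_, rfl⟩ := h
      exact ⟨ls', rfl, h'⟩
    · rintro ⟨ls', rfl, h'⟩
      exact ⟨.bas .end3, _, ls', by simp [Ctl.next], rfl, h'⟩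
  intro ph ls
  refine (gen_iff rfl).trans ?_
  constructor
  · rintro ⟨a, q₁, ls', h, rfl, h'⟩
    rcases next_blk.1 ⟨a, h⟩ with ⟨b, p', e, rfl⟩ | ⟨rfl, t, hd', e, rfl⟩
    · exact .inr ⟨b, p', ls', e, rfl, h'⟩
    · obtain ⟨ls'', rfl, h''⟩ := lam.1 h'
      exact .inl ⟨rfl, t, hd', ls'', e, rfl, h''⟩
  · rintro (⟨rfl, t, hd', ls', h, rfl, h'⟩ | ⟨b, p', ls', h, rfl, h'⟩)
    · obtain ⟨a, ha⟩ := (next_blk (kd := kd)).2 (.inr ⟨rfl, t, hd', h, rfl⟩)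
      exact ⟨a, _, _, ha, rfl, lam.2 ⟨ls', rfl, h'⟩⟩
    · obtain ⟨a, ha⟩ := (next_blk (kd := kd)).2 (.inl ⟨b, p', h, rfl⟩)
      exact ⟨a, _, _, ha, rfl, h'⟩

theorem gen_block {fst : Bool} {hd : Option Kd} {last : Option (C × C)} {ls : List (Letter C)} :
    Gen kd (.blk .start3 fst hd last) ls ↔ ∃ t hd' w ls', L3 t (.bas .start3 :: w) ∧
      Exit kd hd last t hd' ∧ ls = w ++ ls' ∧ Gen kd (.end3 fst hd' t.2.1 t.2.2) ls' := by
  refine (gen_start3 (isGen_blk kd fst hd last)).trans ⟨?_, ?_⟩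
  · rintro ⟨bs, _, h1, h2, rfl, t, hd', ls', h3, rfl, h4⟩
    exact ⟨t, hd', bs.flatten ++ [.lam t.1 t.2.1 t.2.2, .bas .end3], ls', ⟨bs, h2, h1, rfl⟩, h3,
      by simp, h4⟩
  · rintro ⟨t, hd', w, ls', ⟨bs, h2, h1, h⟩, h3, rfl, h4⟩
    cases h
    exact ⟨bs, .lam t.1 t.2.1 t.2.2 :: .bas .end3 :: ls', h1, h2, by simp, t, hd', ls', h3, rfl,
      h4⟩

@[simp] theorem heads_nil (hd : Option Kd) : heads kd hd [] = some hd := rfl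

@[simp] theorem heads_cons (hd : Option Kd) (c : C) (cs : List C) :
    heads kd hd (c :: cs) = (addHead hd (kd c)).bind fun hd' => heads kd hd' cs := rfl

/-- The recorded head runs one letter ahead of the current triple, because the third component
already fixes the next letter. At the end marker there is no such letter, and instead a head must
have occurred. -/
theorem commit_heads {hd hd' : Option Kd} {cs : List C} :
    (∃ h, commit kd hd cs.head? = some h ∧ heads kd h cs.tail = some hd' ∧ hd'.isSome = true) ↔
      heads kd hd cs = some hd' ∧ hd'.isSome = true := by
  cases cs with
  | nil =>
    simp only [List.head?_nil, List.tail_nil, heads_nil, commit, Option.some.injEq]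
    constructor
    · rintro ⟨h, h1, rfl, h2⟩
      split at h1
      · exact ⟨by simpa using h1, h2⟩
      · cases h1
    · rintro ⟨rfl, h⟩
      exact ⟨hd, by simp [h], rfl, h⟩
  | cons c cs =>
    rw [heads_cons, Option.bind_eq_some_iff]
    simp only [List.head?_cons, List.tail_cons, commit]
    constructor
    · rintro ⟨h, h1, h2, h3⟩
      exact ⟨⟨h, h1, h2⟩, h3⟩
    · rintro ⟨⟨h, h1, h2⟩, h3⟩
      exact ⟨h, h1, h2, h3⟩

theorem commit_none {hd hd' : Option Kd} (h : commit kd hd none = some hd') :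
    hd'.isSome = true := by
  simp only [commit] at h
  split at h
  · cases h
    assumption
  · cases h

/-- The control state after the code of a word with a head of kind `hd`. -/
def Ctl.after (fst : Bool) (hd : Option Kd) : Ctl C :=
  if closing hd = .f then pop .A none (.bas .f) else clos (closing hd = .all) fst

theorem Ctl.after_letter (fst : Bool) (hd : Option Kd) :
    (Ctl.after fst hd : Ctl C).letter = .bas (closing hd) := by
  unfold after closing
  split_ifs <;> simp_all [letter]

/-- `cs` is the rest of the configuration, whose first letter `s` has been announced and already
counted in `hd`; therefore only `cs.tail` is scanned for heads. The hypothesis holds for all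
reachable states, since the end marker is announced only after a head. The induction removes one
3-block at a time. -/
theorem gen_end3 {fst : Bool} (ls : List (Letter C)) : ∀ {hd : Option Kd} {u : C} {s : Option C},
    (s = none → hd.isSome = true) →
    (Gen kd (.end3 fst hd u s) ls ↔ ∃ cs bs hd' ls', cs.head? = s ∧
      heads kd hd cs.tail = some hd' ∧ hd'.isSome = true ∧
      List.Forall₂ L3 (win (some u) cs) bs ∧ ls = bs.flatten ++ .bas (closing hd') :: ls' ∧
      Gen kd (.after fst hd') ls') := by
  induction hn : ls.length using Nat.strong_induction_on generalizing ls with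
  | _ n ih =>
    intro hd u s hs
    rw [gen_iff rfl]
    cases s with
    | none =>
      constructor
      · rintro ⟨a, q₁, ls', h, rfl, h'⟩
        have e : q₁ = .after fst hd := by
          cases a <;> simp [Ctl.next] at h
          rw [← h.2, Ctl.after, h.1]
        subst e
        exact ⟨[], [], hd, ls', rfl, rfl, hs rfl, .nil, by rw [Ctl.after_letter]; rfl, h'⟩
      · rintro ⟨cs, bs, hd', ls', h1, h2, h3, h4, rfl, h5⟩
        rw [List.head?_eq_none_iff] at h1
        subst h1
        cases h2
        cases h4
        exact ⟨.bas (closing hd), .after fst hd, ls', by simp [Ctl.next, Ctl.after],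
          by rw [Ctl.after_letter]; rfl, h5⟩
    | some s =>
      constructor
      · rintro ⟨a, q₁, ls', h, rfl, h'⟩
        have e : q₁ = .blk .start3 fst hd (some (u, s)) := by
          cases a <;> simp [Ctl.next] at h
          exact h.2.symm
        subst e
        obtain ⟨⟨p, u', x⟩, hd1, w, ls'', h1, ⟨h2, h3, h4⟩, rfl, h5⟩ := gen_block.1 h'
        simp only at h2 h3 h4 h5
        subst h2 h3
        have hx : x = none → hd1.isSome = true := by
          rintro rfl
          exact commit_none h4
        obtain ⟨cs, bs, hd', ls', rfl, h6, h7, h8, rfl, h9⟩ :=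
          (ih ls''.length (by simp at hn; omega) ls'' rfl hx).1 h5
        refine ⟨u' :: cs, (.bas .start3 :: w) :: bs, hd', ls', rfl, ?_, h7, .cons h1 h8, ?_, h9⟩
        · exact (commit_heads.1 ⟨hd1, h4, h6, h7⟩).1
        · simp [Ctl.letter, Phase.bas]
      · rintro ⟨cs, bs, hd', ls', h1, h2, h3, h4, rfl, h5⟩
        cases cs with
        | nil => cases h1
        | cons c cs =>
          cases h1
          obtain ⟨hd1, h6, h7, h8⟩ := commit_heads.2 ⟨h2, h3⟩
          cases h4 with
          | @cons _ b _ bs hb h4 =>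
          obtain ⟨bs', h9, h10, rfl⟩ := id hb
          refine ⟨.bas .start3, .blk .start3 fst hd (some (u, s)), _, by simp [Ctl.next], rfl,
            gen_block.2 ⟨(some u, s, cs.head?), hd1, _, bs.flatten ++ .bas (closing hd') :: ls',
              hb, ⟨rfl, rfl, h6⟩, ?_, ?_⟩⟩
          · simp
          · refine (ih _ ?_ _ rfl fun h => ?_).2 ⟨cs, bs, hd', ls', rfl, h7, h8, h4, rfl, h5⟩
            · simp at hn ⊢
              omega
            · simp only at h
              rw [List.tail_cons, h] at h6
              exact commit_none h6

theorem gen_tag {b fst : Bool} {ls : List (Letter C)} : Gen kd (.tag b fst) ls ↔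
    ∃ w hd ls', LCode kd b hd (.bas (tagBas b) :: w) ∧ ls = w ++ ls' ∧
      Gen kd (.after fst hd) ls' := by
  rw [gen_iff rfl]
  constructor
  · rintro ⟨a, q₁, ls', h, rfl, h'⟩
    have e : q₁ = .blk .start3 fst none none := by
      cases a <;> simp [Ctl.next] at h
      exact h.2.symm
    subst e
    obtain ⟨⟨p, u, s⟩, hd1, w, ls'', h1, ⟨h2, h0, h3, h4⟩, rfl, h5⟩ := gen_block.1 h'
    simp only at h2 h3 h4 h5
    subst h2
    have hs : s = none → hd1.isSome = true := by
      rintro rfl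
      exact commit_none h4
    obtain ⟨cs, bs, hd', ls', rfl, h6, h7, h8, rfl, h9⟩ := (gen_end3 _ hs).1 h5
    refine ⟨((.bas .start3 :: w) :: bs).flatten ++ [.bas (closing hd')], hd', ls',
      ⟨u :: cs, (.bas .start3 :: w) :: bs, ?_, h7, .cons h1 h8, rfl⟩, ?_, h9⟩
    · rw [heads_cons, h3]
      exact (commit_heads.1 ⟨hd1, h4, h6, h7⟩).1
    · simp [Ctl.letter, Phase.bas]
  · rintro ⟨w, hd, ls', ⟨cs, bs, h1, h2, h3, h⟩, rfl, h4⟩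
    cases h
    cases cs with
    | nil =>
      cases h1
      cases h2
    | cons c cs =>
      rw [heads_cons, Option.bind_eq_some_iff] at h1
      obtain ⟨h0, h5, h6⟩ := h1
      obtain ⟨hd1, h7, h8, h9⟩ := commit_heads.2 ⟨h6, h2⟩
      cases h3 with
      | @cons _ b _ bs hb h3 =>
      obtain ⟨bs', h10, h11, rfl⟩ := id hb
      refine ⟨.bas .start3, .blk .start3 fst none none, _, by simp [Ctl.next], rfl,
        gen_block.2 ⟨(none, c, cs.head?), hd1, _, bs.flatten ++ .bas (closing hd) :: ls',
          hb, ⟨rfl, h0, h5, h7⟩, ?_, ?_⟩⟩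
      · simp
      · refine (gen_end3 _ fun h => ?_).2 ⟨cs, bs, hd, ls', rfl, h8, h9, h3, rfl, h4⟩
        simp only at h
        rw [h] at h7
        exact commit_none h7

/-- A word is an end of a sequence of codes, the last of which is accepting. -/
def LSeq (kd : C → Kd) (ν : List (List (Letter C))) : Prop :=
  (∀ w ∈ ν, ∃ b hd, LCode kd b hd w) ∧ ∃ l, ν.flatten = l ++ [.bas .f] ∧ .bas .f ∉ l

theorem LCode.split {b : Bool} {hd : Option Kd} {w : List (Letter C)} (h : LCode kd b hd w) :
    ∃ w', w = .bas (tagBas b) :: (w' ++ [.bas (closing hd)]) ∧ ∀ y ∈ w', y.inner = true := by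
  obtain ⟨cs, bs, -, -, h, rfl⟩ := h
  exact ⟨_, rfl, forall₂_inner h⟩

theorem LCode.f_not_mem {b : Bool} {hd : Option Kd} {w : List (Letter C)} (h : LCode kd b hd w)
    (hc : closing hd ≠ .f) : (.bas .f : Letter C) ∉ w := by
  obtain ⟨w', rfl, h'⟩ := h.split
  simp only [List.mem_cons, List.mem_append, List.not_mem_nil, or_false, not_or]
  refine ⟨?_, fun h => ?_, fun h => ?_⟩
  · cases b <;> simp [tagBas]
  · exact absurd (h' _ h) (by simp [Letter.inner])
  · exact hc (by simpa [eq_comm] using h)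

/-- Generation stops at the first code closed by `f`, and `f` occurs nowhere within codes. This is
the condition `LSeq`: the only `f` is the last letter. The flag has no influence on the word. -/
theorem gen_seq (ls : List (Letter C)) : ∀ {b fst : Bool}, Gen kd (.tag b fst) ls ↔
    ∃ ν, .bas (tagBas b) :: ls = ν.flatten ∧ LSeq kd ν := by
  have clos : ∀ {b fst : Bool} {ls : List (Letter C)}, Gen kd (.clos b fst) ls ↔
      ∃ b' ls', ls = .bas (tagBas b') :: ls' ∧ Gen kd (.tag b' false) ls' := by
    intro b fst ls
    rw [gen_iff rfl]
    constructor
    · rintro ⟨a, q₁, ls', h, rfl, h'⟩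
      cases a with
      | bas x =>
        cases x <;> simp [Ctl.next] at h <;> subst h
        · exact ⟨false, ls', rfl, h'⟩
        · exact ⟨true, ls', rfl, h'⟩
      | _ => simp [Ctl.next] at h
    · rintro ⟨b', ls', rfl, h'⟩
      exact ⟨.bas (tagBas b'), .tag b' false, ls', by cases b' <;> simp [Ctl.next, tagBas], rfl, h'⟩
  induction hn : ls.length using Nat.strong_induction_on generalizing ls with
  | _ n ih =>
    intro b fst
    rw [gen_tag]
    constructor
    · rintro ⟨w, hd, ls', h1, rfl, h2⟩
      unfold Ctl.after at h2
      split at h2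
      · rename_i hf
        cases h2 with
        | cons h _ => cases h
        | nil =>
          refine ⟨[.bas (tagBas b) :: w], by simp, fun w' hw' => ⟨b, hd, List.mem_singleton.1 hw' ▸ h1⟩, ?_⟩
          obtain ⟨w', h, h'⟩ := h1.split
          rw [h, hf]
          refine ⟨.bas (tagBas b) :: w', by simp, ?_⟩
          simp only [List.mem_cons, not_or]
          refine ⟨?_, fun h => ?_⟩
          · cases b <;> simp [tagBas]
          · exact absurd (h' _ h) (by simp [Letter.inner])
      · rename_i hf
        obtain ⟨b', ls'', rfl, h3⟩ := clos.1 h2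
        obtain ⟨ν, h4, h5, l, h6, h7⟩ := (ih ls''.length (by simp at hn; omega) ls'' rfl).1 h3
        refine ⟨(.bas (tagBas b) :: w) :: ν, by simp [h4], ?_, (.bas (tagBas b) :: w) ++ l,
          by simp [h6], ?_⟩
        · rintro w' hw'
          rcases List.mem_cons.1 hw' with rfl | hw'
          · exact ⟨b, hd, h1⟩
          · exact h5 w' hw'
        · rw [List.mem_append, not_or]
          exact ⟨h1.f_not_mem hf, h7⟩
    · rintro ⟨ν, h1, h2, l, h3, h4⟩
      cases ν with
      | nil => cases h1
      | cons w ν =>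
        obtain ⟨b', hd, hw⟩ := h2 w (by simp)
        obtain ⟨w', rfl, hw'⟩ := hw.split
        have hb : b' = b := by
          simp at h1
          have := h1.1
          cases b <;> cases b' <;> simp_all [tagBas]
        subst hb
        simp at h1
        refine ⟨_, hd, ν.flatten, hw, by rw [h1]; simp, ?_⟩
        -- If no code follows, the first code supplies the final `f`. Otherwise the final `f` lies
        -- in a later code, and the first code cannot be closed by `f`.
        rcases List.eq_nil_or_concat' ν.flatten with e | ⟨v, x, e⟩
        · have hf : closing hd = .f := by
            rw [List.flatten_cons, e] at h3
            simp only [List.append_nil, ← List.cons_append] at h3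
            simpa using (List.append_inj' h3 rfl).2
          rw [Ctl.after, if_pos hf, e]
          exact .nil
        · rw [List.flatten_cons, e, ← List.append_assoc] at h3
          obtain ⟨h5, h6⟩ := List.append_inj' h3 rfl
          have hx : x = .bas .f := by simpa using h6
          subst hx h5
          have hf : closing hd ≠ .f := by
            intro hf
            apply h4
            rw [hf]
            simp
          rw [Ctl.after, if_neg hf]
          cases ν with
          | nil => simp at e
          | cons w₂ ν =>
            obtain ⟨b₂, hd₂, hw₂⟩ := h2 w₂ (by simp)
            obtain ⟨w₂', rfl, -⟩ := hw₂.split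
            refine clos.2 ⟨b₂, _, rfl, (ih _ ?_ _ rfl).2 ⟨_, ?_, fun w hw => h2 w
              (List.mem_cons_of_mem _ hw), v, e, ?_⟩⟩
            · rw [← hn, h1]
              simp
              omega
            · simp
            · rw [List.mem_append, not_or] at h4
              exact h4.2

end

end PushdownGames

namespace PushdownGames

/-! ## Runs of the pushdown system that generate codes -/

section

variable {C : Type} {kd : C → Kd}

def Letter.clos : Letter C → Bool
  | bas .all => true
  | bas .ex => true
  | _ => false

/-- The stack symbols of a word; the flag holds up to the first closing tag. -/
def flagged : Bool → List (Letter C) → List (Sym C)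
  | _, [] => []
  | fl, x :: l => (fl, x) :: flagged (fl && !x.clos) l

theorem flagged_ne_nil {fl : Bool} {x : Letter C} {l : List (Letter C)} :
    flagged fl (x :: l) ≠ [] := by simp [flagged]

theorem flagged_append {w : List (Letter C)} (hw : ∀ x ∈ w, x.clos = false) (fl : Bool)
    (l : List (Letter C)) : flagged fl (w ++ l) = w.map (fl, ·) ++ flagged fl l := by
  induction w with
  | nil => rfl
  | cons x w ih =>
    simp [flagged, hw x (by simp), ih fun x hx => hw x (by simp [hx])]

theorem flagged_false (l : List (Letter C)) : flagged false l = l.map (false, ·) := by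
  induction l with
  | nil => rfl
  | cons x l ih => simp [flagged, ih]

theorem Letter.clos_of_inner {x : Letter C} (h : x.inner = true) : x.clos = false := by
  cases x with
  | bas b => cases b <;> first | rfl | cases h
  | lam => rfl

/-- The control state at the end of an accepting sequence of codes. -/
def Ctl.top : Ctl C := pop .A none (.bas .f)

/-- The flag is dropped exactly when a closing tag is left, in agreement with the recursion of
`flagged`. -/
theorem Ctl.next_spec {q q₁ : Ctl C} {a : Act C} (h : q.next kd a = some q₁) : q.isGen = true ∧
    ((q₁.isGen = true ∧ q₁.fst = (q.fst && !q.letter.clos)) ∨ q₁ = top) := by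
  cases q with
  | tag b fst =>
    cases a <;> simp [next] at h
    rw [← h.2]
    exact ⟨rfl, .inl ⟨rfl, by cases b <;> simp [Ctl.fst, letter, Letter.clos]⟩⟩
  | clos b fst =>
    cases a with
    | bas x =>
      cases x <;> simp [next] at h <;> subst h <;>
        exact ⟨rfl, .inl ⟨rfl, by cases b <;> simp [Ctl.fst, letter, Letter.clos]⟩⟩
    | _ => simp [next] at h
  | blk ph fst hd last =>
    have hc : (blk ph fst hd last : Ctl C).letter.clos = false := by
      cases ph with
      | bit _ _ _ v => cases v <;> rfl
      | bit2 _ v => cases v <;> rfl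
      | _ => rfl
    refine ⟨rfl, .inl ?_⟩
    rcases next_blk.1 ⟨a, h⟩ with ⟨b, p', e, rfl⟩ | ⟨_, t, hd', e, rfl⟩
    · exact ⟨rfl, by simp [Ctl.fst, hc]⟩
    · exact ⟨rfl, by simp [Ctl.fst, hc]⟩
  | lam fst hd p u s =>
    cases a <;> simp [next] at h
    rw [← h.2]
    exact ⟨rfl, .inl ⟨rfl, by simp [Ctl.fst, letter, Letter.clos]⟩⟩
  | end3 fst hd u s =>
    refine ⟨rfl, ?_⟩
    cases s with
    | none =>
      cases a <;> simp [next] at h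
      rw [← h.2]
      split
      · exact .inr rfl
      · exact .inl ⟨rfl, by simp [Ctl.fst, letter, Letter.clos]⟩
    | some s =>
      cases a <;> simp [next] at h
      rw [← h.2]
      exact .inl ⟨rfl, by simp [Ctl.fst, letter, Letter.clos]⟩
  | pop => simp [next] at h
  | sink => simp [next] at h

theorem Ctl.letter_ne_f {q : Ctl C} (h : q.isGen = true) : q.letter ≠ .bas .f := by
  cases q with
  | tag b => cases b <;> simp [letter]
  | clos b => cases b <;> simp [letter]
  | blk ph =>
    cases ph with
    | bit _ _ _ v => cases v <;> simp [letter, Phase.bas, Bas.ofBool]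
    | bit2 _ v => cases v <;> simp [letter, Phase.bas, Bas.ofBool]
    | _ => simp [letter, Phase.bas]
  | lam => simp [letter]
  | end3 => simp [letter]
  | pop => cases h
  | sink => cases h

theorem Ctl.isSys_gen {q : Ctl C} (h : q.isGen = true) (γ : Option (Sym C)) :
    q.isSys γ = true ↔ q.letter = .bas .all := by
  cases q with
  | tag b => cases b <;> simp [letter, isSys]
  | clos b => cases b <;> simp [letter, isSys]
  | blk ph =>
    cases ph with
    | bit _ _ _ v => cases v <;> simp [letter, isSys, Phase.bas, Bas.ofBool]
    | bit2 _ v => cases v <;> simp [letter, isSys, Phase.bas, Bas.ofBool]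
    | _ => simp [letter, isSys, Phase.bas]
  | lam => simp [letter, isSys]
  | end3 => simp [letter, isSys]
  | pop => cases h
  | sink => cases h

end

section

variable {M : ATM}

theorem succ_gen_iff {q : Ctl M.Cell} (hq : q.isGen = true) {l : List (Sym M.Cell)} {c : Conf M} :
    (game M).Succ (q, l) c ↔ ∃ a q₁, q.next M.kd a = some q₁ ∧ c = (q₁, (q.fst, q.letter) :: l) := by
  have hs : ∀ a, q.step M.kd l.head? a =
      (q.next M.kd a).map fun q' => (q', (q.fst, q.letter) :: l.head?.toList) := by
    intro a
    cases q <;> first | rfl | cases hq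
  -- A transition replaces the top, so `step` puts the old top back under the new symbol.
  have hl : l.head?.toList ++ l.tail = l := by cases l <;> rfl
  rw [succ_iff]
  simp only [hs, Option.map_eq_some_iff]
  constructor
  · rintro ⟨a, _, ⟨q₁, h, rfl⟩, rfl⟩
    exact ⟨a, q₁, h, by simp [hl]⟩
  · rintro ⟨a, q₁, h, rfl⟩
    exact ⟨a, _, ⟨q₁, h, rfl⟩, by simp [hl]⟩

abbrev GSteps (c : Conf M) (w : Word M) (c' : Conf M) : Prop :=
  Steps (game M).Succ (game M).lab c w c'

/-- The configuration after a generated sequence of codes. -/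
def topConf (ls : List (Letter M.Cell)) : Conf M :=
  (.top, (flagged true (.bas .l :: ls)).dropLast.reverse)

/-- Each step pushes the letter of the state that is left. The final `f` belongs to the state in
which reading begins and is never pushed, hence `dropLast`. -/
theorem steps_of_gen {q : Ctl M.Cell} {ls : List (Letter M.Cell)} (h : Gen M.kd q ls) :
    ∀ stk, GSteps (q, stk) (ls.map Letter.lbl)
      (.top, (flagged q.fst (q.letter :: ls)).dropLast.reverse ++ stk) := by
  induction h with
  | nil => intro stk; exact .nil _
  | @cons q a q₁ ls h h' ih =>
    intro stk
    obtain ⟨hq, hq₁⟩ := Ctl.next_spec h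
    rw [List.map_cons]
    refine steps_cons.2 ⟨(q₁, (q.fst, q.letter) :: stk), (succ_gen_iff hq).2 ⟨a, q₁, h, rfl⟩, ?_, ?_⟩
    · rcases hq₁ with ⟨hq₁, -⟩ | rfl
      · exact game_lab_gen hq₁ _
      · rw [Ctl.top, game_lab_pop, Letter.mlbl_none]; rfl
    · have e : (flagged q.fst (q.letter :: q₁.letter :: ls)).dropLast.reverse ++ stk =
          (flagged q₁.fst (q₁.letter :: ls)).dropLast.reverse ++ (q.fst, q.letter) :: stk := by
        rw [flagged, List.dropLast_cons_of_ne_nil flagged_ne_nil]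
        rcases hq₁ with ⟨-, e⟩ | rfl
        · simp [e]
        · cases h' with
          | nil => simp [flagged]
          | cons h _ => cases h
      rw [e]
      exact ih _

theorem steps_topConf {ls : List (Letter M.Cell)} (h : Gen M.kd (.tag false true) ls) :
    GSteps (game M).start (ls.map Letter.lbl) (topConf ls) := by
  have := steps_of_gen h []
  rw [List.append_nil] at this
  exact this

theorem start_lab : (game M).lab (game M).start = {Prp.l} := by
  refine (game_lab_gen (q := .tag false true) rfl []).trans rfl

/-- After each finite run from the start, either codes are still generated, or the stack is being
read. -/
theorem steps_start {w : Word M} : ∀ {c : Conf M}, GSteps (game M).start w c →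
    (c.1.isGen = true ∧ ∃ ls, w = ls.map Letter.lbl ∧
      (∀ ls', Gen M.kd c.1 ls' → Gen M.kd (.tag false true) (ls ++ ls'))) ∨
    ∃ ls w', Gen M.kd (.tag false true) ls ∧ w = ls.map Letter.lbl ++ w' ∧
      GSteps (topConf ls) w' c := by
  induction w using List.reverseRecOn with
  | nil =>
    intro c h
    obtain rfl := steps_nil.1 h
    exact .inl ⟨rfl, [], rfl, fun _ h => h⟩
  | append_singleton w a ih =>
    intro c h
    obtain ⟨c₁, h1, h2, h3⟩ := steps_snoc.1 h
    rcases ih h1 with ⟨hg, ls, rfl, h4⟩ | ⟨ls, w', h4, rfl, h5⟩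
    · obtain ⟨q, l⟩ := c₁
      obtain ⟨x, q₁, hn, rfl⟩ := (succ_gen_iff hg).1 h2
      rcases (Ctl.next_spec hn).2 with ⟨hq₁, -⟩ | rfl
      · refine .inl ⟨hq₁, ls ++ [q₁.letter], ?_, fun ls' h => ?_⟩
        · rw [← h3, game_lab_gen hq₁]; simp
        · rw [List.append_assoc]
          exact h4 _ (.cons hn h)
      · have hl : (game M).lab (.top, (q.fst, q.letter) :: l) = Letter.lbl (.bas .f) := by
          rw [Ctl.top, game_lab_pop, Letter.mlbl_none]
        have hG := h4 _ (.cons hn .nil)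
        refine .inr ⟨ls ++ [.bas .f], [], hG, ?_, ?_⟩
        · rw [← h3, hl]; simp
        · have := steps_topConf hG
          rw [← h3, hl] at h
          rw [List.map_append] at this
          -- Two runs with the same labels end in the same configuration, which identifies the stack
          -- without following it.
          have e := steps_det (fun c _ _ => succ_det (c := c)) h this
          rw [e]
          exact .nil _
    · exact .inr ⟨ls, w' ++ [a], h4, by simp, steps_snoc.2 ⟨_, h5, h2, h3⟩⟩

/-! ## Labels of blocks and codes -/

/-- Transfers a list of words over labels to a list of words over letters; the descriptions of
blocks and codes are translated level by level in this way. -/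
theorem exists_map_eq {α β : Type} {f : α → β} {P : List β → Prop} {P' : List α → Prop}
    (h : ∀ w, P w ↔ ∃ w', P' w' ∧ w = w'.map f) {bs : List (List β)} :
    (∀ b ∈ bs, P b) ↔ ∃ bs' : List (List α), (∀ b ∈ bs', P' b) ∧ bs = bs'.map (List.map f) := by
  constructor
  · intro hb
    induction bs with
    | nil => exact ⟨[], by simp, rfl⟩
    | cons b bs ih =>
      obtain ⟨bs', h1, rfl⟩ := ih fun b h => hb b (by simp [h])
      obtain ⟨b', h2, rfl⟩ := (h b).1 (hb b (by simp))
      exact ⟨b' :: bs', by simpa using ⟨h2, h1⟩, rfl⟩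
  · rintro ⟨bs', h1, rfl⟩ b hb
    obtain ⟨b', hb', rfl⟩ := List.mem_map.1 hb
    exact (h _).2 ⟨b', h1 b' hb', rfl⟩

theorem isBlockOver_iff {s e : Bas} {Sub : Word M → Prop} {Sub' : List (Letter M.Cell) → Prop}
    (h : ∀ w, Sub w ↔ ∃ w', Sub' w' ∧ w = w'.map Letter.lbl) {x : Letter M.Cell} {w : Word M} :
    IsBlockOver (Letter.bas s).prp (Letter.bas e).prp Sub x.prp w ↔
      ∃ w', LOver s e Sub' x w' ∧ w = w'.map Letter.lbl := by
  constructor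
  · rintro ⟨bs, h1, h2, rfl⟩
    obtain ⟨bs', h3, rfl⟩ := (exists_map_eq h).1 h2
    exact ⟨_, ⟨bs', by simpa using h1, h3, rfl⟩, by simp [List.map_flatten, Letter.lbl]⟩
  · rintro ⟨_, ⟨bs', h1, h3, rfl⟩, rfl⟩
    exact ⟨bs'.map (List.map Letter.lbl), by simpa using h1, (exists_map_eq h).2 ⟨bs', h3, rfl⟩,
      by simp [List.map_flatten, Letter.lbl]⟩

theorem isBit_iff {p : Prp M} : IsBit p ↔ ∃ v, p = (Letter.bit v).prp := by
  rw [IsBit, Bool.exists_bool]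
  exact Iff.rfl

theorem isBlock0_iff (w : Word M) : IsBlock0 w ↔ ∃ w', L0 w' ∧ w = w'.map Letter.lbl := by
  constructor
  · rintro ⟨b, hb, rfl⟩
    obtain ⟨v, rfl⟩ := isBit_iff.1 hb
    exact ⟨_, ⟨v, rfl⟩, rfl⟩
  · rintro ⟨_, ⟨v, rfl⟩, rfl⟩
    exact ⟨_, isBit_iff.2 ⟨v, rfl⟩, rfl⟩

theorem isBlock1_iff {c : Prp M} {w : Word M} : IsBlock1 c w ↔
    ∃ v w', c = (Letter.bit v).prp ∧ L1 v w' ∧ w = w'.map Letter.lbl := by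
  constructor
  · rintro ⟨hc, h⟩
    obtain ⟨v, rfl⟩ := isBit_iff.1 hc
    obtain ⟨w', h1, h2⟩ := (isBlockOver_iff (s := .start1) (e := .end1) isBlock0_iff).1 h
    exact ⟨v, w', rfl, h1, h2⟩
  · rintro ⟨v, w', rfl, h1, h2⟩
    exact ⟨isBit_iff.2 ⟨v, rfl⟩,
      (isBlockOver_iff (s := .start1) (e := .end1) isBlock0_iff).2 ⟨w', h1, h2⟩⟩

theorem exists_isBlock1_iff (w : Word M) : (∃ c, IsBlock1 c w) ↔
    ∃ w', (∃ v, L1 v w') ∧ w = w'.map Letter.lbl := by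
  constructor
  · rintro ⟨c, h⟩
    obtain ⟨v, w', -, h1, h2⟩ := isBlock1_iff.1 h
    exact ⟨w', ⟨v, h1⟩, h2⟩
  · rintro ⟨w', ⟨v, h1⟩, h2⟩
    exact ⟨_, isBlock1_iff.2 ⟨v, w', rfl, h1, h2⟩⟩

theorem isBlock2_iff {c : Prp M} {w : Word M} : IsBlock2 c w ↔
    ∃ v w', c = (Letter.bit v).prp ∧ L2 v w' ∧ w = w'.map Letter.lbl := by
  constructor
  · rintro ⟨hc, h⟩
    obtain ⟨v, rfl⟩ := isBit_iff.1 hc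
    obtain ⟨w', h1, h2⟩ := (isBlockOver_iff (s := .start2) (e := .end2) exists_isBlock1_iff).1 h
    exact ⟨v, w', rfl, h1, h2⟩
  · rintro ⟨v, w', rfl, h1, h2⟩
    exact ⟨isBit_iff.2 ⟨v, rfl⟩,
      (isBlockOver_iff (s := .start2) (e := .end2) exists_isBlock1_iff).2 ⟨w', h1, h2⟩⟩

theorem exists_isBlock2_iff (w : Word M) : (∃ c, IsBlock2 c w) ↔
    ∃ w', (∃ v, L2 v w') ∧ w = w'.map Letter.lbl := by
  constructor
  · rintro ⟨c, h⟩
    obtain ⟨v, w', -, h1, h2⟩ := isBlock2_iff.1 h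
    exact ⟨w', ⟨v, h1⟩, h2⟩
  · rintro ⟨w', ⟨v, h1⟩, h2⟩
    exact ⟨_, isBlock2_iff.2 ⟨v, w', rfl, h1, h2⟩⟩

theorem isBlock3_iff {t : Option M.Cell × M.Cell × Option M.Cell} {w : Word M} : IsBlock3 t w ↔
    ∃ w', L3 t w' ∧ w = w'.map Letter.lbl :=
  isBlockOver_iff (s := .start3) (e := .end3) (x := .lam t.1 t.2.1 t.2.2) exists_isBlock2_iff

theorem forall₂_isBlock3_iff {ts : List (Option M.Cell × M.Cell × Option M.Cell)} :
    ∀ {bs : List (Word M)}, List.Forall₂ IsBlock3 ts bs ↔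
      ∃ bs' : List (List (Letter M.Cell)), List.Forall₂ L3 ts bs' ∧ bs = bs'.map (List.map Letter.lbl) := by
  induction ts with
  | nil =>
    intro bs
    simp only [List.forall₂_nil_left_iff]
    constructor
    · rintro rfl; exact ⟨[], rfl, rfl⟩
    · rintro ⟨_, rfl, rfl⟩; rfl
  | cons t ts ih =>
    intro bs
    simp only [List.forall₂_cons_left_iff]
    constructor
    · rintro ⟨b, bs, h, h', rfl⟩
      obtain ⟨b', h1, rfl⟩ := isBlock3_iff.1 h
      obtain ⟨bs', h2, rfl⟩ := ih.1 h'
      exact ⟨_, ⟨b', bs', h1, h2, rfl⟩, rfl⟩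
    · rintro ⟨_, ⟨b', bs', h1, h2, rfl⟩, rfl⟩
      exact ⟨_, _, isBlock3_iff.2 ⟨b', h1, rfl⟩, ih.2 ⟨bs', h2, rfl⟩, rfl⟩

theorem windows_eq (cs : List M.Cell) : M.windows cs = win none cs := by
  have key : ∀ p, List.zip (p :: cs.map some) (List.zip cs (cs.tail.map some ++ [none])) =
      win p cs := by
    induction cs with
    | nil => intro p; rfl
    | cons c cs ih =>
      intro p
      cases cs with
      | nil => rfl
      | cons d ds =>
        rw [win, ← ih (some c)]
        rfl
  exact key none

theorem heads_append {C : Type} {kd : C → Kd} (hd : Option Kd) (cs cs' : List C) :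
    heads kd hd (cs ++ cs') = (heads kd hd cs).bind fun h => heads kd h cs' := by
  simp only [heads, List.foldlM_append]
  rfl

theorem heads_inl (hd : Option Kd) (η : List M.Sym) :
    heads M.kd hd (η.map Sum.inl) = some hd := by
  induction η with
  | nil => rfl
  | cons a η ih =>
    rw [List.map_cons, heads_cons]
    exact ih

theorem heads_some {k : Kd} {hd : Option Kd} {cs : List M.Cell}
    (h : heads M.kd (some k) cs = some hd) : hd = some k ∧ ∃ η : List M.Sym, cs = η.map Sum.inl := by
  induction cs with
  | nil => cases h; exact ⟨rfl, [], rfl⟩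
  | cons c cs ih =>
    rw [heads_cons, Option.bind_eq_some_iff] at h
    obtain ⟨h1, h2, h3⟩ := h
    rcases c with a | ⟨q, a⟩
    · cases h2
      obtain ⟨rfl, η, rfl⟩ := ih h3
      exact ⟨rfl, a :: η, rfl⟩
    · have := M.stateKd_ne_sym q
      simp [addHead, ATM.kd, this] at h2

/-- A word is a configuration when it contains exactly one head: `heads` refuses a second one, and
`isSome` demands the first. -/
theorem isConfig_iff {hd : Option Kd} {cs : List M.Cell} :
    (∃ q, M.IsConfig q cs ∧ hd = some (M.stateKd q)) ↔
      heads M.kd none cs = some hd ∧ hd.isSome = true := by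
  constructor
  · rintro ⟨q, ⟨η, η', σ, rfl⟩, rfl⟩
    have := M.stateKd_ne_sym q
    simp [heads_append, heads_inl, heads_cons, addHead, ATM.kd, this]
  · rintro ⟨h, h'⟩
    induction cs with
    | nil => cases h; cases h'
    | cons c cs ih =>
      rw [heads_cons, Option.bind_eq_some_iff] at h
      obtain ⟨h1, h2, h3⟩ := h
      rcases c with a | ⟨q, a⟩
      · cases h2
        obtain ⟨q, ⟨η, η', σ, rfl⟩, rfl⟩ := ih h3
        exact ⟨q, ⟨a :: η, η', σ, rfl⟩, rfl⟩
      · have := M.stateKd_ne_sym q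
        simp only [addHead, ATM.kd, if_neg this, if_true, Option.some.injEq] at h2
        subst h2
        obtain ⟨rfl, η, rfl⟩ := heads_some h3
        exact ⟨q, ⟨[], η, a, rfl⟩, rfl⟩

theorem closing_prp (q : M.State) :
    closingTag q = (Letter.bas (closing (some (M.stateKd q)))).prp := by
  classical
  unfold closingTag closing ATM.stateKd
  split_ifs <;> simp_all <;> rfl

theorem isConfigCode_iff (w : Word M) : IsConfigCode w ↔
    ∃ w', (∃ b hd, LCode M.kd b hd w') ∧ w = w'.map Letter.lbl := by
  constructor
  · rintro ⟨q, cs, tag, bs, h1, h2, h3, rfl⟩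
    obtain ⟨h4, h5⟩ := isConfig_iff.1 ⟨q, h1, rfl⟩
    rw [windows_eq] at h3
    obtain ⟨bs', h6, rfl⟩ := forall₂_isBlock3_iff.1 h3
    obtain ⟨b, rfl⟩ : ∃ b, tag = (Letter.bas (tagBas b)).prp := by
      rcases h2 with rfl | rfl
      · exact ⟨false, rfl⟩
      · exact ⟨true, rfl⟩
    refine ⟨_, ⟨b, _, cs, bs', h4, h5, h6, rfl⟩, ?_⟩
    simp [List.map_flatten, closing_prp, Letter.lbl]
  · rintro ⟨_, ⟨b, hd, cs, bs', h4, h5, h6, rfl⟩, rfl⟩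
    obtain ⟨q, h1, rfl⟩ := isConfig_iff.2 ⟨h4, h5⟩
    refine ⟨q, cs, (Letter.bas (tagBas b)).prp, bs'.map (List.map Letter.lbl), h1, ?_, ?_, ?_⟩
    · cases b
      · exact .inl rfl
      · exact .inr rfl
    · rw [windows_eq]
      exact forall₂_isBlock3_iff.2 ⟨bs', h6, rfl⟩
    · simp [List.map_flatten, closing_prp, Letter.lbl]

theorem isCodeSeq_iff {ν : List (Word M)} : IsCodeSeq ν ↔
    ∃ ν' : List (List (Letter M.Cell)), (∀ w ∈ ν', ∃ b hd, LCode M.kd b hd w) ∧ ν = ν'.map (List.map Letter.lbl) :=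
  exists_map_eq isConfigCode_iff

end

end PushdownGames

namespace PushdownGames

/-! ## The modes while the stack is read -/

section

variable {C : Type}

/-- The modes in a simple check-tree go from `md` to `md''` while the symbols in `l` are popped,
where the symbol above `r` is marked by `m r.length`. -/
def Trace (m : ℕ → Option Mark) : Mode → List (Sym C) → Mode → Prop
  | md, [], md'' => md'' = md
  | md, y :: l, md'' => ∃ md', md.next .other y.1 y.2.cls (m l.length) = some md' ∧ Trace m md' l md''

theorem Trace.congr {m m' : ℕ → Option Mark} {l : List (Sym C)} (h : ∀ n < l.length, m n = m' n) :
    ∀ {md md'' : Mode}, Trace m md l md'' ↔ Trace m' md l md'' := by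
  induction l with
  | nil => intro md md''; exact Iff.rfl
  | cons y l ih =>
    intro md md''
    simp only [Trace]
    rw [h l.length (by simp)]
    refine exists_congr fun md' => and_congr_right fun _ => ih fun n hn => h n ?_
    exact hn.trans (by simp)

/-- No position of the part `w`, which begins at `o`, is marked. -/
def Unmarked (m : ℕ → Option Mark) (o : ℕ) (w : List (Sym C)) : Prop :=
  ∀ i < w.length, m (o + i) = none

/-- In the part `w`, which begins at `o`, exactly the position `o + n` is marked; it carries the
content of a 3-block. -/
def MarkedAt (m : ℕ → Option Mark) (k : Mark) (o : ℕ) (w : List (Sym C)) (n : ℕ) : Prop :=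
  (∃ y b, w[n]? = some y ∧ y.2.cls = .win b) ∧
    ∀ i < w.length, m (o + i) = if i = n then some k else none

variable {m : ℕ → Option Mark} {k : Mark} {o : ℕ}

theorem unmarked_append {w w' : List (Sym C)} :
    Unmarked m o (w ++ w') ↔ Unmarked m o w ∧ Unmarked m (o + w.length) w' := by
  constructor
  · intro h
    refine ⟨fun i hi => h i (by simp; omega), fun i hi => ?_⟩
    rw [Nat.add_assoc]
    exact h _ (by simp; omega)
  · rintro ⟨h, h'⟩ i hi
    by_cases hw : i < w.length
    · exact h i hw
    · have := h' (i - w.length) (by simp at hi; omega)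
      rwa [Nat.add_assoc, Nat.add_sub_cancel' (by omega)] at this

theorem unmarked_cons {y : Sym C} {w : List (Sym C)} :
    Unmarked m o (y :: w) ↔ m o = none ∧ Unmarked m (o + 1) w := by
  rw [← List.singleton_append, unmarked_append]
  refine and_congr ⟨fun h => h 0 (by simp), fun h i hi => ?_⟩ Iff.rfl
  simp at hi
  simpa [hi] using h

theorem exists_markedAt_append {w w' : List (Sym C)} :
    (∃ n, MarkedAt m k o (w ++ w') n) ↔
      ((∃ n, MarkedAt m k o w n) ∧ Unmarked m (o + w.length) w') ∨
        (Unmarked m o w ∧ ∃ n, MarkedAt m k (o + w.length) w' n) := by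
  constructor
  · rintro ⟨n, ⟨y, b, h1, h2⟩, h⟩
    by_cases hn : n < w.length
    · left
      rw [List.getElem?_append_left hn] at h1
      refine ⟨⟨n, ⟨y, b, h1, h2⟩, fun i hi => h i (by simp; omega)⟩, fun i hi => ?_⟩
      rw [Nat.add_assoc, h _ (by simp; omega), if_neg (by omega)]
    · right
      rw [List.getElem?_append_right (by omega)] at h1
      refine ⟨fun i hi => ?_, n - w.length, ⟨y, b, h1, h2⟩, fun i hi => ?_⟩
      · rw [h _ (by simp; omega), if_neg (by omega)]
      · rw [Nat.add_assoc, h _ (by simp; omega)]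
        exact if_congr (by omega) rfl rfl
  · rintro (⟨⟨n, ⟨y, b, h1, h2⟩, h⟩, h'⟩ | ⟨h', n, ⟨y, b, h1, h2⟩, h⟩)
    · have hn : n < w.length := (List.getElem?_eq_some_iff.1 h1).1
      refine ⟨n, ⟨y, b, by rwa [List.getElem?_append_left hn], h2⟩, fun i hi => ?_⟩
      by_cases hw : i < w.length
      · exact h i hw
      · have := h' (i - w.length) (by simp at hi; omega)
        rw [Nat.add_assoc, Nat.add_sub_cancel' (by omega)] at this
        rw [this, if_neg (by omega)]
    · refine ⟨w.length + n, ⟨y, b, ?_, h2⟩, fun i hi => ?_⟩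
      · rw [List.getElem?_append_right (by omega), Nat.add_sub_cancel_left]
        exact h1
      · by_cases hw : i < w.length
        · rw [h' i hw, if_neg (by omega)]
        · have := h (i - w.length) (by simp at hi; omega)
          rw [Nat.add_assoc, Nat.add_sub_cancel' (by omega)] at this
          rw [this]
          exact if_congr (by omega) rfl rfl

theorem exists_markedAt_singleton {y : Sym C} :
    (∃ n, MarkedAt m k o [y] n) ↔ (∃ b, y.2.cls = .win b) ∧ m o = some k := by
  constructor
  · rintro ⟨n, ⟨y', b, h1, h2⟩, h⟩
    have hn := (List.getElem?_eq_some_iff.1 h1).1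
    have h0 : n = 0 := by simp at hn; omega
    subst h0
    cases h1
    exact ⟨⟨b, h2⟩, by simpa using h 0 (by simp)⟩
  · rintro ⟨⟨b, h⟩, h'⟩
    refine ⟨0, ⟨y, b, rfl, h⟩, fun i hi => ?_⟩
    have h0 : i = 0 := by simp at hi; omega
    subst h0
    simpa using h'

/-- In the mode `md` no mark is possible at `y`. -/
def Fixed (md : Mode) (y : Sym C) : Prop :=
  ∀ mk md', md.next .other y.1 y.2.cls mk = some md' ↔ mk = none ∧ md' = md

/-- In the mode `md` the mark `k` at `y` is possible, and leads to `md₂`. -/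
def Choice (md : Mode) (k : Mark) (md₂ : Mode) (y : Sym C) : Prop :=
  ∀ mk md', md.next .other y.1 y.2.cls mk = some md' ↔
    (mk = none ∧ md' = md) ∨ (mk = some k ∧ md' = md₂)

/-- In the mode `md` the mark `k` at `y` is necessary, and leads to `md₂`. -/
def Forced (md : Mode) (k : Mark) (md₂ : Mode) (y : Sym C) : Prop :=
  ∀ mk md', md.next .other y.1 y.2.cls mk = some md' ↔ mk = some k ∧ md' = md₂

theorem fixed_of_plain {md : Mode} {y : Sym C} (h1 : y.2.cls ≠ .tag)
    (h2 : ∀ b, y.2.cls ≠ .win b) : Fixed md y := by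
  intro mk md'
  generalize y.2.cls = c at h1 h2
  cases c <;> first | exact absurd rfl h1 | exact absurd rfl (h2 _) |
    (cases md <;> simp [Mode.next, eq_comm])

theorem fixed_B {y : Sym C} (h1 : y.2.cls ≠ .tag) : Fixed .B y := by
  intro mk md'
  generalize y.2.cls = c at h1
  cases c <;> first | exact absurd rfl h1 | simp [Mode.next, eq_comm]

theorem fixed_D (y : Sym C) : Fixed .D y := by
  intro mk md'
  generalize y.2.cls = c
  cases c <;> simp [Mode.next, eq_comm]

theorem fixed_A {y : Sym C} (h : y.2.cls = .tag) : Fixed .A y := by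
  intro mk md'
  rw [h]
  simp [Mode.next, eq_comm]

theorem choice_A {y : Sym C} {b : Bool} (h : y.2.cls = .win b) (hb : ¬ (y.1 = true ∧ b = true)) :
    Choice .A .check3 .B y := by
  intro mk md'
  rw [h]
  have h1 : Mode.next .A .other y.1 (.win b) none = some .A := by
    simp only [Mode.next]
    rw [if_neg (by simp), if_pos ⟨trivial, hb⟩]
  have h2 : Mode.next .A .other y.1 (.win b) (some .check3) = some .B := by simp [Mode.next]
  rcases mk with _ | mk
  · rw [h1]
    simp [eq_comm]
  · by_cases hk : mk = .check3
    · subst hk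
      rw [h2]
      simp [eq_comm]
    · simp [Mode.next, hk]

theorem forced_A {y : Sym C} (h : y.2.cls = .win true) (hb : y.1 = true) :
    Forced .A .check3 .B y := by
  intro mk md'
  rw [h, hb]
  rcases mk with _ | mk
  · simp [Mode.next]
  · cases mk <;> simp [Mode.next, eq_comm]

theorem choice_C {y : Sym C} (h : y.2.cls = .win false) : Choice .C .checkHat3 .D y := by
  intro mk md'
  rw [h]
  rcases mk with _ | mk
  · have h1 : Mode.next .C .other y.1 (.win false) none = some .C := by simp [Mode.next]
    simp [h1, eq_comm]
  · cases mk <;> simp [Mode.next, eq_comm]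

theorem forced_C {y : Sym C} (h : y.2.cls = .win true) : Forced .C .checkHat3 .D y := by
  intro mk md'
  rw [h]
  rcases mk with _ | mk
  · simp [Mode.next]
  · cases mk <;> simp [Mode.next, eq_comm]

theorem unmarked_nil (o : ℕ) : Unmarked m o ([] : List (Sym C)) := by simp [Unmarked]

theorem unmarked_snoc {y : Sym C} {w : List (Sym C)} :
    Unmarked m o (w ++ [y]) ↔ Unmarked m o w ∧ m (o + w.length) = none := by
  rw [unmarked_append, unmarked_cons, and_iff_left (unmarked_nil _)]

theorem exists_markedAt_snoc {y : Sym C} {w : List (Sym C)} :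
    (∃ n, MarkedAt m k o (w ++ [y]) n) ↔
      ((∃ n, MarkedAt m k o w n) ∧ m (o + w.length) = none) ∨
        (Unmarked m o w ∧ (∃ b, y.2.cls = .win b) ∧ m (o + w.length) = some k) := by
  rw [exists_markedAt_append, exists_markedAt_singleton, unmarked_cons,
    and_iff_left (unmarked_nil _)]

theorem exists_markedAt_cons {y : Sym C} {w : List (Sym C)} :
    (∃ n, MarkedAt m k o (y :: w) n) ↔
      (((∃ b, y.2.cls = .win b) ∧ m o = some k) ∧ Unmarked m (o + 1) w) ∨
        (m o = none ∧ ∃ n, MarkedAt m k (o + 1) w n) := by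
  rw [← List.singleton_append, exists_markedAt_append, exists_markedAt_singleton, unmarked_cons,
    and_iff_left (unmarked_nil _)]
  rfl

theorem trace_cons_forced {md md₂ md'' : Mode} {y : Sym C} {l : List (Sym C)}
    (h : Forced md k md₂ y) :
    Trace m md (y :: l) md'' ↔ m l.length = some k ∧ Trace m md₂ l md'' := by
  rw [Trace]
  constructor
  · rintro ⟨md', h1, h2⟩
    obtain ⟨h1, rfl⟩ := (h _ _).1 h1
    exact ⟨h1, h2⟩
  · rintro ⟨h1, h2⟩
    exact ⟨md₂, (h _ _).2 ⟨h1, rfl⟩, h2⟩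

theorem trace_cons_none {md md₂ md'' : Mode} {y : Sym C} {l : List (Sym C)}
    (h : ∀ mk md', md.next .other y.1 y.2.cls mk = some md' ↔ mk = none ∧ md' = md₂) :
    Trace m md (y :: l) md'' ↔ m l.length = none ∧ Trace m md₂ l md'' := by
  rw [Trace]
  constructor
  · rintro ⟨md', h1, h2⟩
    obtain ⟨h1, rfl⟩ := (h _ _).1 h1
    exact ⟨h1, h2⟩
  · rintro ⟨h1, h2⟩
    exact ⟨md₂, (h _ _).2 ⟨h1, rfl⟩, h2⟩

theorem trace_cons_choice {md md₂ md'' : Mode} {y : Sym C} {l : List (Sym C)}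
    (h : Choice md k md₂ y) :
    Trace m md (y :: l) md'' ↔ (m l.length = none ∧ Trace m md l md'') ∨
      (m l.length = some k ∧ Trace m md₂ l md'') := by
  rw [Trace]
  constructor
  · rintro ⟨md', h1, h2⟩
    rcases (h _ _).1 h1 with ⟨h1', rfl⟩ | ⟨h1', rfl⟩
    · exact .inl ⟨h1', h2⟩
    · exact .inr ⟨h1', h2⟩
  · rintro (⟨h1, h2⟩ | ⟨h1, h2⟩)
    · exact ⟨md, (h _ _).2 (.inl ⟨h1, rfl⟩), h2⟩
    · exact ⟨md₂, (h _ _).2 (.inr ⟨h1, rfl⟩), h2⟩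

theorem trace_fixed {md md'' : Mode} {r : List (Sym C)} {w : List (Sym C)}
    (h : ∀ y ∈ w, Fixed md y) :
    Trace m md (w.reverse ++ r) md'' ↔ Unmarked m r.length w ∧ Trace m md r md'' := by
  induction w using List.reverseRecOn with
  | nil => simp [Unmarked]
  | append_singleton w y ih =>
    rw [List.reverse_append, List.reverse_singleton, List.singleton_append, List.cons_append,
      trace_cons_none (h y (by simp)), ih fun y hy => h y (by simp [hy]), unmarked_snoc,
      List.length_append, List.length_reverse, Nat.add_comm w.length]
    tauto

/-- The part `w` is read from its end. Either no mark is set, or a mark is set at one triple, and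
from then on no further choice exists. -/
theorem trace_choice {md md₂ md'' : Mode} {r : List (Sym C)} {w : List (Sym C)}
    (h : ∀ y ∈ w, Fixed md₂ y ∧ ((Fixed md y ∧ ∀ b, y.2.cls ≠ .win b) ∨
      (Choice md k md₂ y ∧ ∃ b, y.2.cls = .win b))) :
    Trace m md (w.reverse ++ r) md'' ↔ (Unmarked m r.length w ∧ Trace m md r md'') ∨
      ((∃ n, MarkedAt m k r.length w n) ∧ Trace m md₂ r md'') := by
  induction w using List.reverseRecOn with
  | nil => simp [Unmarked, MarkedAt]
  | append_singleton w y ih =>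
    have ih := ih fun y hy => h y (by simp [hy])
    have hf : Trace m md₂ (w.reverse ++ r) md'' ↔ _ :=
      trace_fixed fun y hy => (h y (by simp [hy])).1
    have hy := (h y (by simp)).2
    rw [List.reverse_append, List.reverse_singleton, List.singleton_append, List.cons_append,
      unmarked_snoc, exists_markedAt_snoc, Nat.add_comm r.length]
    have e : (w.reverse ++ r).length = w.length + r.length := by simp
    rcases hy with ⟨hy, hw⟩ | ⟨hy, hw⟩
    · rw [trace_cons_none hy, ih, e]
      constructor
      · rintro ⟨a, ⟨u, x⟩ | ⟨k, x⟩⟩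
        · exact .inl ⟨⟨u, a⟩, x⟩
        · exact .inr ⟨.inl ⟨k, a⟩, x⟩
      · rintro (⟨⟨u, a⟩, x⟩ | ⟨⟨k, a⟩ | ⟨-, ⟨b, h⟩, -⟩, x⟩)
        · exact ⟨a, .inl ⟨u, x⟩⟩
        · exact ⟨a, .inr ⟨k, x⟩⟩
        · exact absurd h (hw b)
    · rw [trace_cons_choice hy, ih, hf, e]
      constructor
      · rintro (⟨a, ⟨u, x⟩ | ⟨k, x⟩⟩ | ⟨a, u, x⟩)
        · exact .inl ⟨⟨u, a⟩, x⟩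
        · exact .inr ⟨.inl ⟨k, a⟩, x⟩
        · exact .inr ⟨.inr ⟨u, hw, a⟩, x⟩
      · rintro (⟨⟨u, a⟩, x⟩ | ⟨⟨k, a⟩ | ⟨u, -, a⟩, x⟩)
        · exact .inl ⟨a, .inl ⟨u, x⟩⟩
        · exact .inl ⟨a, .inr ⟨k, x⟩⟩
        · exact .inr ⟨a, u, x⟩

/-- `w` has the form of a code with flag `fl`. -/
def IsSeg (fl : Bool) (w : List (Sym C)) : Prop :=
  ∃ t pre x post, w = t :: (pre ++ x :: post) ∧ (∀ y ∈ w, y.1 = fl) ∧ t.2.cls = .tag ∧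
    (∀ y ∈ pre, y.2.cls ≠ .tag ∧ ∀ b, y.2.cls ≠ .win b) ∧ x.2.cls = .win true ∧
    ∀ y ∈ post, y.2.cls ≠ .tag ∧ y.2.cls ≠ .win true

variable {r : List (Sym C)} {md'' : Mode}

theorem not_win {y : Sym C} (h : y.2.cls = .tag) : ¬ ∃ b, y.2.cls = .win b := by
  rintro ⟨b, hb⟩
  rw [h] at hb
  cases hb

/-- A code other than the first may stay unmarked, and then mode `A` goes on to the preceding code.
If `check3` is set, the opening tag, which is read last, turns `B` into `C`. -/
theorem trace_seg_false {w : List (Sym C)} (hw : IsSeg false w) :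
    Trace m .A (w.reverse ++ r) md'' ↔ (Unmarked m r.length w ∧ Trace m .A r md'') ∨
      ((∃ n, MarkedAt m .check3 r.length w n) ∧ Trace m .C r md'') := by
  obtain ⟨t, pre, x, post, rfl, hfl, ht, hpre, hx, hpost⟩ := hw
  have hB : ∀ mk md', Mode.next .B .other t.1 t.2.cls mk = some md' ↔ mk = none ∧ md' = .C := by
    intro mk md'
    rw [ht]
    simp [Mode.next, eq_comm]
  rw [List.reverse_cons, List.append_assoc, List.singleton_append,
    trace_choice (k := .check3) (md₂ := .B), trace_cons_none (fixed_A ht), trace_cons_none hB,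
    unmarked_cons, exists_markedAt_cons, List.length_cons]
  · constructor
    · rintro (⟨u, a, x⟩ | ⟨k, a, y⟩)
      · exact .inl ⟨⟨a, u⟩, x⟩
      · exact .inr ⟨.inr ⟨a, k⟩, y⟩
    · rintro (⟨⟨a, u⟩, x⟩ | ⟨⟨⟨h, -⟩, -⟩ | ⟨a, k⟩, y⟩)
      · exact .inl ⟨u, a, x⟩
      · exact absurd h (not_win ht)
      · exact .inr ⟨k, a, y⟩
  · intro y hy
    have h1 : y.2.cls ≠ .tag := by
      simp only [List.mem_append, List.mem_cons] at hy
      rcases hy with hy | rfl | hy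
      · exact (hpre y hy).1
      · simp [hx]
      · exact (hpost y hy).1
    refine ⟨fixed_B h1, ?_⟩
    by_cases hb : ∃ b, y.2.cls = .win b
    · obtain ⟨b, hb⟩ := hb
      exact .inr ⟨choice_A hb (by simp [hfl y (List.mem_cons_of_mem _ hy)]), b, hb⟩
    · have hb' : ∀ b, y.2.cls ≠ .win b := fun b h => hb ⟨b, h⟩
      exact .inl ⟨fixed_of_plain h1 hb', hb'⟩

/-- In a code in which a mark is due, exactly one mark is set. -/
theorem trace_seg_forced {md md₂ md₃ : Mode} {fl : Bool} {w : List (Sym C)} (hw : IsSeg fl w)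
    (h1 : ∀ y ∈ w, y.2.cls ≠ .tag → (∀ b, y.2.cls ≠ .win b) → Fixed md y)
    (h2 : ∀ y ∈ w, y.2.cls = .win false → Choice md k md₂ y)
    (h3 : ∀ y ∈ w, y.2.cls = .win true → Forced md k md₂ y)
    (h4 : ∀ y ∈ w, y.2.cls ≠ .tag → Fixed md₂ y)
    (h5 : ∀ y ∈ w, y.2.cls = .tag → ∀ mk md', md₂.next .other y.1 y.2.cls mk = some md' ↔
      mk = none ∧ md' = md₃) :
    Trace m md (w.reverse ++ r) md'' ↔
      (∃ n, MarkedAt m k r.length w n) ∧ Trace m md₃ r md'' := by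
  -- `post` is read before `x`, and it offers free choices. At `x` the mark is set if it was not set
  -- before; after `x` no triple of this code remains.
  obtain ⟨t, pre, x, post, rfl, hfl, ht, hpre, hx, hpost⟩ := hw
  have hxt : x.2.cls ≠ .tag := by simp [hx]
  have hxb : ∃ b, x.2.cls = .win b := ⟨_, hx⟩
  have ht' := not_win ht
  have hp : ¬ ∃ n, MarkedAt m k (r.length + 1) pre n := by
    rintro ⟨n, ⟨y, b, hy, hb⟩, -⟩
    exact (hpre y (List.mem_of_getElem? hy)).2 b hb
  have hpre' : Trace m md₂ (pre.reverse ++ t :: r) md'' ↔ _ :=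
    trace_fixed fun y hy => h4 y (by simp [hy]) (hpre y hy).1
  have e1 : (pre.reverse ++ t :: r).length = r.length + 1 + pre.length := by simp; omega
  rw [List.reverse_cons, List.reverse_append, List.reverse_cons, List.append_assoc,
    List.append_assoc, List.append_assoc, List.singleton_append, List.singleton_append,
    trace_choice (k := k) (md₂ := md₂), trace_cons_forced (h3 x (by simp) hx),
    trace_cons_none (h4 x (by simp) hxt), hpre', trace_cons_none (h5 t (by simp) ht),
    exists_markedAt_cons, exists_markedAt_append, exists_markedAt_cons, List.length_cons, e1,
    List.length_cons]
  · constructor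
    · rintro (⟨u, a, u', b, z⟩ | ⟨k, a, u', b, z⟩)
      · exact ⟨.inr ⟨b, .inr ⟨u', .inl ⟨⟨hxb, a⟩, u⟩⟩⟩, z⟩
      · exact ⟨.inr ⟨b, .inr ⟨u', .inr ⟨a, k⟩⟩⟩, z⟩
    · rintro ⟨⟨⟨h, -⟩, -⟩ | ⟨b, ⟨h, -⟩ | ⟨u', ⟨⟨-, a⟩, u⟩ | ⟨a, k⟩⟩⟩, z⟩
      · exact absurd h ht'
      · exact absurd h hp
      · exact .inl ⟨u, a, u', b, z⟩
      · exact .inr ⟨k, a, u', b, z⟩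
  · intro y hy
    have hy' : y ∈ t :: (pre ++ x :: post) := by simp [hy]
    obtain ⟨hy1, hy2⟩ := hpost y hy
    refine ⟨h4 y hy' hy1, ?_⟩
    by_cases hb : ∃ b, y.2.cls = .win b
    · obtain ⟨b, hb⟩ := hb
      cases b with
      | false => exact .inr ⟨h2 y hy' hb, _, hb⟩
      | true => exact absurd hb hy2
    · have hb' : ∀ b, y.2.cls ≠ .win b := fun b h => hb ⟨b, h⟩
      exact .inl ⟨h1 y hy' hy1 hb', hb'⟩

theorem trace_seg_true {w : List (Sym C)} (hw : IsSeg true w) :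
    Trace m .A (w.reverse ++ r) md'' ↔
      (∃ n, MarkedAt m .check3 r.length w n) ∧ Trace m .C r md'' := by
  have hfl : ∀ y ∈ w, y.1 = true := by
    obtain ⟨_, _, _, _, rfl, h, _⟩ := hw
    exact h
  refine trace_seg_forced hw (md₂ := .B) (fun y _ => fixed_of_plain)
    (fun y _ h => choice_A h (by simp))
    (fun y hy h => forced_A h (hfl y hy)) (fun y _ => fixed_B) fun y _ h mk md' => ?_
  rw [h]
  simp [Mode.next, eq_comm]

theorem trace_seg_C {fl : Bool} {w : List (Sym C)} (hw : IsSeg fl w) :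
    Trace m .C (w.reverse ++ r) md'' ↔
      (∃ n, MarkedAt m .checkHat3 r.length w n) ∧ Trace m .D r md'' :=
  trace_seg_forced hw (fun _ _ => fixed_of_plain) (fun _ _ => choice_C)
    (fun _ _ => forced_C) (fun y _ _ => fixed_D y) fun y _ _ => fixed_D y

/-! ## Traces over sequences of codes -/

/-- All parts have the form of codes, where the flag holds for the first one. -/
def IsSegs (S : List (List (Sym C))) : Prop :=
  ∀ S₁ w S₂, S = S₁ ++ w :: S₂ → IsSeg S₁.isEmpty w

theorem IsSegs.left {S S' : List (List (Sym C))} (h : IsSegs (S ++ S')) : IsSegs S :=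
  fun S₁ w S₂ e => h S₁ w (S₂ ++ S') (by simp [e])

/-- The marks `check3` and `checkHat3` are placed at contents of 3-blocks, `check3` in a part `w`
of `S` and `checkHat3` in the part before `w`, if any. -/
def IsMarked (m : ℕ → Option Mark) (S : List (List (Sym C))) : Prop :=
  ∃ S₁ w S₂, S = S₁ ++ w :: S₂ ∧ (∃ n, MarkedAt m .check3 S₁.flatten.length w n) ∧
    Unmarked m (S₁ ++ [w]).flatten.length S₂.flatten ∧
    (S₁ = [] ∨ ∃ S₀ w', S₁ = S₀ ++ [w'] ∧ (∃ n, MarkedAt m .checkHat3 S₀.flatten.length w' n) ∧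
      Unmarked m 0 S₀.flatten)

/-- If nothing lies below, `check3` was in the first code and no second mark is due. Otherwise the
next code read gets `checkHat3`, and mode `D` allows no mark after it. -/
theorem trace_C {S : List (List (Sym C))} (hS : IsSegs S) :
    (∃ md', Trace m .C S.flatten.reverse md') ↔
      (S = [] ∨ ∃ S₀ w', S = S₀ ++ [w'] ∧ (∃ n, MarkedAt m .checkHat3 S₀.flatten.length w' n) ∧
        Unmarked m 0 S₀.flatten) := by
  rcases List.eq_nil_or_concat' S with rfl | ⟨S₀, w, rfl⟩
  · simp [Trace]
  · rw [List.flatten_append, List.flatten_singleton, List.reverse_append]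
    simp only [trace_seg_C (hS S₀ w [] rfl), List.length_reverse, exists_and_left]
    have : (∃ md', Trace m .D S₀.flatten.reverse md') ↔ Unmarked m 0 S₀.flatten := by
      have h := fun md' => trace_fixed (m := m) (md := .D) (md'' := md') (r := [])
        (w := S₀.flatten) fun y _ => fixed_D y
      simp only [List.append_nil] at h
      simp only [h, exists_and_left]
      simp [Trace]
    rw [this]
    constructor
    · rintro ⟨h1, h2⟩
      exact .inr ⟨S₀, w, rfl, h1, h2⟩
    · rintro (h | ⟨S₁, w', h, h1, h2⟩)
      · simp at h
      · obtain ⟨rfl, h'⟩ := List.append_inj' h rfl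
        cases h'
        exact ⟨h1, h2⟩

/-- Induction from the last code backwards: a code is either passed over or marked, and the first
code, where the flag holds, has to be marked if none was marked before. -/
theorem trace_A {S : List (List (Sym C))} (hS : IsSegs S) (h0 : S ≠ []) :
    (∃ md', Trace m .A S.flatten.reverse md') ↔ IsMarked m S := by
  induction S using List.reverseRecOn with
  | nil => exact absurd rfl h0
  | append_singleton S w ih =>
    have hw := hS S w [] rfl
    have hC := trace_C (m := m) hS.left
    rw [List.flatten_append, List.flatten_singleton, List.reverse_append]
    have last : ((∃ n, MarkedAt m .check3 S.flatten.length w n) ∧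
        ∃ md', Trace m .C S.flatten.reverse md') → IsMarked m (S ++ [w]) := by
      rintro ⟨h1, h2⟩
      exact ⟨S, w, [], rfl, h1, by simp [Unmarked], hC.1 h2⟩
    have split : IsMarked m (S ++ [w]) → (Unmarked m S.flatten.length w ∧ IsMarked m S) ∨
        ((∃ n, MarkedAt m .check3 S.flatten.length w n) ∧
          ∃ md', Trace m .C S.flatten.reverse md') := by
      rintro ⟨S₁, w₁, S₂, h, h1, h2, h3⟩
      rcases List.eq_nil_or_concat' S₂ with rfl | ⟨S₂, w₂, rfl⟩
      · obtain ⟨rfl, h'⟩ := List.append_inj' h rfl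
        cases h'
        exact .inr ⟨h1, hC.2 h3⟩
      · rw [← List.cons_append, ← List.append_assoc] at h
        obtain ⟨rfl, h'⟩ := List.append_inj' h rfl
        cases h'
        rw [List.flatten_append (L₁ := S₂), unmarked_append] at h2
        refine .inl ⟨?_, S₁, w₁, S₂, rfl, h1, h2.1, h3⟩
        have := h2.2
        simpa [Nat.add_assoc] using this
    by_cases hS0 : S = []
    · subst hS0
      simp only [trace_seg_true hw, exists_and_left, List.length_reverse]
      constructor
      · exact last
      · intro h
        rcases split h with ⟨-, S₁, _, S₂, h, -⟩ | h
        · simp at h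
        · exact h
    · have hw' : IsSeg false w := by
        cases S with
        | nil => exact absurd rfl hS0
        | cons => exact hw
      simp only [trace_seg_false hw', exists_or, exists_and_left, List.length_reverse,
        ih hS.left hS0]
      constructor
      · rintro (⟨h1, S₁, w₁, S₂, rfl, h2, h3, h4⟩ | h)
        · refine ⟨S₁, w₁, S₂ ++ [w], by simp, h2, ?_, h4⟩
          rw [List.flatten_append (L₁ := S₂), unmarked_append]
          refine ⟨h3, ?_⟩
          simpa [Nat.add_assoc] using h1
        · exact last h
      · exact split

end

end PushdownGames

namespace PushdownGames

/-! ## The stack after a sequence of codes -/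

section

variable {C : Type} {kd : C → Kd}

/-- The stack symbols of a sequence of codes. -/
def segs : List (List (Letter C)) → List (List (Sym C))
  | [] => []
  | w :: ν => w.map (true, ·) :: ν.map (List.map (false, ·))

theorem segs_map_snd (ν : List (List (Letter C))) : (segs ν).map (List.map Prod.snd) = ν := by
  cases ν with
  | nil => rfl
  | cons w ν => simp [segs, Function.comp_def]

/-- The first closing tag `all` or `ex` ends the first code and switches the flag off for all later
symbols. -/
theorem LSeq.flagged {ν : List (List (Letter C))} (h : LSeq kd ν) :
    flagged true ν.flatten = (segs ν).flatten := by
  obtain ⟨h, l, hl, hf⟩ := h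
  cases ν with
  | nil => rfl
  | cons w ν =>
    obtain ⟨b, hd, hw⟩ := h w (by simp)
    obtain ⟨w', rfl, hw'⟩ := hw.split
    have h1 : ∀ x ∈ Letter.bas (tagBas b) :: w', x.clos = false := by
      intro x hx
      rcases List.mem_cons.1 hx with rfl | hx
      · cases b <;> rfl
      · exact Letter.clos_of_inner (hw' x hx)
    have e : ((Letter.bas (tagBas b) :: (w' ++ [.bas (closing hd)])) :: ν).flatten =
        (Letter.bas (tagBas b) :: w') ++ .bas (closing hd) :: ν.flatten := by simp
    rw [e, flagged_append h1, PushdownGames.flagged]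
    have e2 : PushdownGames.flagged (true && !(Letter.bas (closing hd) : Letter C).clos)
        ν.flatten = (ν.map (List.map (false, ·))).flatten := by
      -- The tag `f` does not switch the flag off, but no code follows it: the only `f` is the last
      -- letter.
      by_cases hc : closing hd = .f
      · rw [e, hc] at hl
        rcases List.eq_nil_or_concat' ν.flatten with hn | ⟨v, x, hn⟩
        · rw [← List.map_flatten, hn]
          rfl
        · rw [hn, ← List.cons_append, ← List.append_assoc] at hl
          obtain ⟨rfl, -⟩ := List.append_inj' hl rfl
          simp at hf
      · have : (Letter.bas (closing hd) : Letter C).clos = true := by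
          unfold closing at hc ⊢
          split_ifs at hc ⊢ <;> first | rfl | exact absurd rfl hc
        rw [this, ← List.map_flatten]
        exact flagged_false _
    rw [e2]
    simp [segs]

theorem cls_of_inner {x : Letter C} (h : x.inner = true) : x.cls ≠ .tag := by
  cases x with
  | bas b => cases b <;> first | cases h; done | simp [Letter.cls]
  | lam => simp [Letter.cls]

theorem bas_of_over {s e : Bas} {Sub : List (Letter C) → Prop} {x : Letter C}
    {w : List (Letter C)} (h : LOver s e Sub x w) (hx : ∃ b, x = .bas b)
    (hS : ∀ b, Sub b → ∀ y ∈ b, ∃ c, y = .bas c) : ∀ y ∈ w, ∃ c, y = .bas c := by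
  obtain ⟨bs, -, h, rfl⟩ := h
  intro y hy
  simp only [List.mem_cons, List.mem_append, List.mem_flatten, List.not_mem_nil, or_false] at hy
  rcases hy with rfl | ⟨b, hb, hy⟩ | rfl | rfl
  · exact ⟨_, rfl⟩
  · exact hS b (h b hb) y hy
  · exact hx
  · exact ⟨_, rfl⟩

theorem L1.bas {v : Bool} {w : List (Letter C)} (h : L1 v w) : ∀ y ∈ w, ∃ c, y = .bas c :=
  bas_of_over h ⟨_, rfl⟩ fun b ⟨v, hb⟩ y hy => by
    subst hb
    exact ⟨_, List.mem_singleton.1 hy⟩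

theorem L2.bas {v : Bool} {w : List (Letter C)} (h : L2 v w) : ∀ y ∈ w, ∃ c, y = .bas c :=
  bas_of_over h ⟨_, rfl⟩ fun _ ⟨_, hb⟩ => hb.bas

theorem cls_bas_ne_win (c : Bas) (b : Bool) : (Letter.bas c : Letter C).cls ≠ .win b := by
  cases c <;> simp [Letter.cls]

theorem flatten_l2_bas {bs : List (List (Letter C))} (h : ∀ b ∈ bs, ∃ v, L2 v b) :
    ∀ y ∈ bs.flatten, ∃ c, y = .bas c := by
  intro y hy
  obtain ⟨b, hb, hy⟩ := List.mem_flatten.1 hy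
  obtain ⟨v, hv⟩ := h b hb
  exact hv.bas y hy

theorem L3.cls {t : Option C × C × Option C} {w : List (Letter C)} (h : L3 t w)
    (ht : t.1.isSome = true) : ∀ y ∈ w, y.cls ≠ .win true := by
  obtain ⟨bs, -, h, rfl⟩ := h
  intro y hy
  simp only [List.mem_cons, List.mem_append, List.not_mem_nil, or_false] at hy
  rcases hy with rfl | hy | rfl | rfl
  · simp [Letter.cls]
  · obtain ⟨c, rfl⟩ := flatten_l2_bas h y hy
    exact cls_bas_ne_win _ _
  · simpa [Letter.cls] using Option.isSome_iff_ne_none.1 ht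
  · simp [Letter.cls]

theorem forall₂_cls {c : C} {cs : List C} {bs : List (List (Letter C))}
    (h : List.Forall₂ L3 (win (some c) cs) bs) : ∀ y ∈ bs.flatten, y.cls ≠ .win true := by
  induction cs generalizing c bs with
  | nil =>
    cases h
    simp
  | cons d cs ih =>
    cases h with
    | cons h1 h2 =>
      intro y hy
      rw [List.flatten_cons, List.mem_append] at hy
      rcases hy with hy | hy
      · exact h1.cls rfl y hy
      · exact ih h2 y hy

theorem cls_closing (hd : Option Kd) : (Letter.bas (closing hd) : Letter C).cls = .other := by
  unfold closing
  split_ifs <;> rfl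

/-- Within a code only the first triple has the end marker as its left component. It is the triple
that allows the reader to recognise its last chance. -/
theorem LCode.isSeg {b : Bool} {hd : Option Kd} {w : List (Letter C)} (h : LCode kd b hd w)
    (fl : Bool) : IsSeg fl (w.map (fl, ·)) := by
  obtain ⟨cs, bs, h1, h2, h3, rfl⟩ := h
  cases cs with
  | nil => cases h1; cases h2
  | cons c cs =>
    cases h3 with
    | @cons _ b₀ _ bs hb h3 =>
    obtain ⟨bs₀, -, h4, rfl⟩ := id hb
    refine ⟨(fl, .bas (tagBas b)), (.bas .start3 :: bs₀.flatten).map (fl, ·),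
      (fl, .lam none c cs.head?), (.bas .end3 :: (bs.flatten ++ [.bas (closing hd)])).map (fl, ·),
      by simp, ?_, by cases b <;> rfl, ?_, rfl, ?_⟩
    · intro y hy
      obtain ⟨x, -, rfl⟩ := List.mem_map.1 hy
      rfl
    · intro y hy
      obtain ⟨x, hx, rfl⟩ := List.mem_map.1 hy
      have hx' : ∃ c, x = .bas c := by
        rcases List.mem_cons.1 hx with rfl | hx
        · exact ⟨_, rfl⟩
        · exact flatten_l2_bas h4 x hx
      refine ⟨cls_of_inner (hb.inner x ?_), ?_⟩
      · rcases List.mem_cons.1 hx with rfl | hx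
        · simp
        · simp [hx]
      · obtain ⟨c, rfl⟩ := hx'
        exact cls_bas_ne_win c
    · intro y hy
      obtain ⟨x, hx, rfl⟩ := List.mem_map.1 hy
      simp only [List.mem_cons, List.mem_append, List.not_mem_nil, or_false] at hx
      rcases hx with rfl | hx | rfl
      · simp [Letter.cls]
      · exact ⟨cls_of_inner (forall₂_inner h3 x hx), forall₂_cls h3 x hx⟩
      · simp [cls_closing]

theorem LSeq.isSegs {ν : List (List (Letter C))} (h : LSeq kd ν) : IsSegs (segs ν) := by
  intro S₁ w S₂ e
  cases ν with
  | nil => simp [segs] at e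
  | cons w₀ ν =>
    cases S₁ with
    | nil =>
      cases e
      obtain ⟨b, hd, hw⟩ := h.1 w₀ (by simp)
      exact hw.isSeg true
    | cons s S₁ =>
      have : w ∈ ν.map (List.map (false, ·)) := by
        simp only [segs, List.cons_append, List.cons.injEq] at e
        rw [e.2]
        simp
      obtain ⟨w', hw', rfl⟩ := List.mem_map.1 this
      obtain ⟨b, hd, hw⟩ := h.1 w' (by simp [hw'])
      exact hw.isSeg false

theorem LSeq.ne_nil {ν : List (List (Letter C))} (h : LSeq kd ν) : segs ν ≠ [] := by
  obtain ⟨-, l, h, -⟩ := h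
  cases ν with
  | nil => simp at h
  | cons => simp [segs]

end

/-! ## Marks -/

section

variable {M : ATM}

/-- The mark at the position `n`, if `check3` is at `i` and `checkHat3` is at `j`. -/
def markAt (i : ℕ) (j : Option ℕ) (n : ℕ) : Option Mark :=
  if n = i then some .check3 else if some n = j then some .checkHat3 else none

/-- The labels of the letters in `S`. -/
def lbls (S : List (List (Sym M.Cell))) : List (Word M) :=
  S.map (List.map fun y => y.2.lbl)

theorem lbls_flatten (S : List (List (Sym M.Cell))) :
    (lbls S).flatten = S.flatten.map fun y => y.2.lbl := by
  rw [lbls, List.map_flatten]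

theorem lbls_segs (ν : List (List (Letter M.Cell))) :
    lbls (segs ν) = ν.map (List.map Letter.lbl) := by
  conv_rhs => rw [← segs_map_snd ν]
  simp [lbls, Function.comp_def]

theorem isContentPos_iff {S : List (List (Sym M.Cell))} {i : ℕ} :
    IsContentPos (lbls S) i ↔ ∃ y b, S.flatten[i]? = some y ∧ y.2.cls = .win b := by
  unfold IsContentPos
  rw [lbls_flatten, List.getElem?_map]
  constructor
  · rintro ⟨p, u, s, h⟩
    obtain ⟨y, h1, h2⟩ := Option.map_eq_some_iff.1 h
    have h3 : y.2 = .lam p u s := Letter.lbl_injective h2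
    exact ⟨y, p.isNone, h1, by rw [h3]; rfl⟩
  · rintro ⟨⟨fl, x⟩, b, h1, h2⟩
    cases x with
    | bas c => exact absurd h2 (cls_bas_ne_win c b)
    | lam p u s => exact ⟨p, u, s, by rw [h1]; rfl⟩

theorem inCode_iff {S : List (List (Sym M.Cell))} {k i : ℕ} : InCode (lbls S) k i ↔
    ∃ S₁ w S₂ n, S = S₁ ++ w :: S₂ ∧ S₁.length = k ∧ n < w.length ∧ i = S₁.flatten.length + n := by
  have e : ∀ k, ((lbls S).take k).flatten.length = (S.take k).flatten.length := by
    intro k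
    rw [lbls, ← List.map_take, ← List.map_flatten, List.length_map]
  unfold InCode
  rw [e, e]
  constructor
  · rintro ⟨h1, h2⟩
    by_cases hk : k < S.length
    · refine ⟨S.take k, S[k], S.drop (k + 1), i - (S.take k).flatten.length, ?_, by simp; omega, ?_,
        by omega⟩
      · rw [List.cons_getElem_drop_succ, List.take_append_drop]
      · rw [← List.take_concat_get' S k hk, List.flatten_append, List.length_append,
          List.flatten_singleton] at h2
        omega
    · rw [List.take_of_length_le (by omega)] at h1 h2
      omega
  · rintro ⟨S₁, w, S₂, n, rfl, rfl, h, rfl⟩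
    have e : S₁ ++ w :: S₂ = (S₁ ++ [w]) ++ S₂ := by simp
    have e' : S₁.length + 1 = (S₁ ++ [w]).length := by simp
    have h1 : (S₁ ++ w :: S₂).take S₁.length = S₁ := List.take_left
    have h2 : (S₁ ++ w :: S₂).take (S₁.length + 1) = S₁ ++ [w] := by
      rw [e, e']
      exact List.take_left
    have h3 : (S₁ ++ [w]).flatten.length = S₁.flatten.length + w.length := by simp
    rw [h1, h2]
    omega

theorem IsMarking.ne {ν : List (Word M)} {i : ℕ} {j : Option ℕ} (h : IsMarking ν i j) :
    j ≠ some i := by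
  rcases h.2 with ⟨-, rfl⟩ | ⟨k, i', h1, rfl, -, h2⟩
  · simp
  · rintro ⟨⟩
    have := h1.1
    have := h2.2
    omega

/-- Translates between the decomposition into codes, which the induction over modes produces, and
positions in the whole word. The marked triples lie in different codes, so the order of the tests in
`markAt` does not matter. -/
theorem isMarked_iff {S : List (List (Sym M.Cell))} {m : ℕ → Option Mark} :
    IsMarked m S ↔ ∃ i j, IsMarking (lbls S) i j ∧ ∀ n < S.flatten.length, m n = markAt i j n := by
  have pos : ∀ {S₁ w S₂} {n : ℕ} {y : Sym M.Cell} {b}, S = S₁ ++ w :: S₂ → w[n]? = some y →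
      y.2.cls = .win b → IsContentPos (lbls S) (S₁.flatten.length + n) := by
    intro S₁ w S₂ n y b hS hy hb
    refine isContentPos_iff.2 ⟨y, b, ?_, hb⟩
    rw [hS, List.flatten_append, List.getElem?_append_right (by omega), Nat.add_sub_cancel_left,
      List.flatten_cons, List.getElem?_append_left (List.getElem?_eq_some_iff.1 hy).1]
    exact hy
  have pos' : ∀ {S₁ w S₂} {n : ℕ}, S = S₁ ++ w :: S₂ → n < w.length →
      IsContentPos (lbls S) (S₁.flatten.length + n) → ∃ y b, w[n]? = some y ∧ y.2.cls = .win b := by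
    intro S₁ w S₂ n hS hn h
    obtain ⟨y, b, hy, hb⟩ := isContentPos_iff.1 h
    rw [hS, List.flatten_append, List.getElem?_append_right (by omega), Nat.add_sub_cancel_left,
      List.flatten_cons, List.getElem?_append_left hn] at hy
    exact ⟨y, b, hy, hb⟩
  constructor
  · rintro ⟨S₁, w, S₂, hS, ⟨n, ⟨y, b, h1, h2⟩, h3⟩, h4, h5⟩
    have hn : n < w.length := (List.getElem?_eq_some_iff.1 h1).1
    have hi : InCode (lbls S) S₁.length (S₁.flatten.length + n) :=
      inCode_iff.2 ⟨S₁, w, S₂, n, hS, rfl, hn, rfl⟩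
    have hL : S.flatten.length = S₁.flatten.length + w.length + S₂.flatten.length := by
      simp [hS]; omega
    -- From the code of `check3` on, the second mark plays no role, as its position is smaller.
    have high : ∀ j : Option ℕ, (∀ i, j = some i → i < S₁.flatten.length) →
        ∀ n' < S.flatten.length, S₁.flatten.length ≤ n' →
          m n' = markAt (S₁.flatten.length + n) j n' := by
      intro j hj n' hn' hle
      have hj' : some n' ≠ j := fun e => absurd (hj n' e.symm) (by omega)
      rw [markAt, if_neg hj']
      by_cases hw : n' < S₁.flatten.length + w.length
      · have := h3 (n' - S₁.flatten.length) (by omega)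
        rw [Nat.add_sub_cancel' hle] at this
        rw [this]
        exact if_congr (by omega) rfl rfl
      · have e : (S₁ ++ [w]).flatten.length = S₁.flatten.length + w.length := by simp
        have := h4 (n' - (S₁ ++ [w]).flatten.length) (by omega)
        rw [Nat.add_sub_cancel' (by omega)] at this
        rw [this, if_neg (by omega)]
    rcases h5 with rfl | ⟨S₀, w', rfl, ⟨n', ⟨y', b', h6, h7⟩, h8⟩, h9⟩
    · exact ⟨_, none, ⟨pos hS h1 h2, .inl ⟨hi, rfl⟩⟩, fun n' hn' =>
        high none (by simp) n' hn' (by simp)⟩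
    · have hn' : n' < w'.length := (List.getElem?_eq_some_iff.1 h6).1
      have hS' : S = S₀ ++ w' :: (w :: S₂) := by simp [hS]
      have hlen : (S₀ ++ [w']).flatten.length = S₀.flatten.length + w'.length := by simp
      refine ⟨_, some (S₀.flatten.length + n'), ⟨pos hS h1 h2, .inr ⟨S₀.length, _, ?_, rfl,
        pos hS' h6 h7, inCode_iff.2 ⟨S₀, w', _, n', hS', rfl, hn', rfl⟩⟩⟩, fun a ha => ?_⟩
      · simpa using hi
      · by_cases hle : (S₀ ++ [w']).flatten.length ≤ a
        · refine high _ ?_ a ha hle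
          intro i hi
          cases hi
          omega
        · rw [markAt, if_neg (by omega)]
          by_cases h0 : a < S₀.flatten.length
          · have := h9 a h0
            rw [Nat.zero_add] at this
            rw [this, if_neg]
            intro e
            cases e
            omega
          · have := h8 (a - S₀.flatten.length) (by omega)
            rw [Nat.add_sub_cancel' (by omega)] at this
            rw [this]
            refine if_congr ⟨fun h => ?_, fun h => ?_⟩ rfl rfl
            · congr 1; omega
            · cases h; omega
  · rintro ⟨i, j, ⟨h1, h2⟩, h3⟩
    have main : ∀ S₁ w S₂ n, S = S₁ ++ w :: S₂ → n < w.length → i = S₁.flatten.length + n →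
        (∀ a, j = some a → a < S₁.flatten.length) →
        (∃ n, MarkedAt m .check3 S₁.flatten.length w n) ∧
          Unmarked m (S₁ ++ [w]).flatten.length S₂.flatten := by
      rintro S₁ w S₂ n hS hn rfl hj
      have hL : S.flatten.length = S₁.flatten.length + w.length + S₂.flatten.length := by
        simp [hS]; omega
      refine ⟨⟨n, pos' hS hn h1, fun a ha => ?_⟩, fun a ha => ?_⟩
      · rw [h3 _ (by omega), markAt, if_neg (c := some _ = j)]
        · exact if_congr (by omega) rfl rfl
        · intro e
          exact absurd (hj _ e.symm) (by omega)
      · have e : (S₁ ++ [w]).flatten.length = S₁.flatten.length + w.length := by simp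
        rw [e, h3 _ (by omega), markAt, if_neg (by omega), if_neg]
        intro e
        exact absurd (hj _ e.symm) (by omega)
    rcases h2 with ⟨hc, rfl⟩ | ⟨k, i', hc, rfl, hp, hc'⟩
    · obtain ⟨S₁, w, S₂, n, hS, hk, hn, hi⟩ := inCode_iff.1 hc
      obtain rfl := List.length_eq_zero_iff.1 hk
      obtain ⟨h4, h5⟩ := main [] w S₂ n hS hn hi (by simp)
      exact ⟨[], w, S₂, hS, h4, h5, .inl rfl⟩
    · obtain ⟨S₁, w, S₂, n, hS, hk, hn, hi⟩ := inCode_iff.1 hc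
      obtain ⟨S₀, w', S₂', n', hS', hk', hn', rfl⟩ := inCode_iff.1 hc'
      rcases List.eq_nil_or_concat' S₁ with rfl | ⟨S₁, w₁, rfl⟩
      · simp at hk
      · have e : S₁ ++ w₁ :: (w :: S₂) = S₀ ++ w' :: S₂' := by
          rw [← hS', hS]; simp
        obtain ⟨rfl, e'⟩ := List.append_inj e (by simp at hk; omega)
        cases e'
        have hlen : (S₁ ++ [w']).flatten.length = S₁.flatten.length + w'.length := by simp
        obtain ⟨h4, h5⟩ := main _ w S₂ n hS hn hi (by
          intro a ha
          cases ha
          omega)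
        refine ⟨_, w, S₂, hS, h4, h5, .inr ⟨S₁, w', rfl, ⟨n', pos' hS' hn' hp, fun a ha => ?_⟩,
          fun a ha => ?_⟩⟩
        · have hL : S.flatten.length ≥ S₁.flatten.length + w'.length := by simp [hS']
          rw [h3 _ (by omega), markAt, if_neg (by omega)]
          refine if_congr ⟨fun h => ?_, fun h => ?_⟩ rfl rfl
          · simp at h; omega
          · congr 1; omega
        · have hL : S.flatten.length ≥ S₁.flatten.length + w'.length := by simp [hS']
          rw [Nat.zero_add, h3 _ (by omega), markAt, if_neg (by omega), if_neg]
          intro e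
          cases e
          omega

/-- The labels of the symbols of a stack with marks. -/
def marked (m : ℕ → Option Mark) : List (Sym M.Cell) → Word M
  | [] => []
  | y :: l => y.2.mlbl (m l.length) :: marked m l

theorem marked_congr {m m' : ℕ → Option Mark} {l : List (Sym M.Cell)}
    (h : ∀ n < l.length, m n = m' n) : marked m l = marked m' l := by
  induction l with
  | nil => rfl
  | cons y l ih =>
    rw [marked, marked, h _ (by simp), ih fun n hn => h n (hn.trans (by simp))]

theorem marked_eq (m : ℕ → Option Mark) (l : List (Sym M.Cell)) :
    marked m l.reverse = (l.mapIdx fun n y => y.2.mlbl (m n)).reverse := by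
  induction l using List.reverseRecOn with
  | nil => rfl
  | append_singleton l y ih =>
    rw [List.reverse_append, List.reverse_singleton, List.singleton_append, marked, ih,
      List.mapIdx_concat, List.reverse_append]
    simp

theorem mlbl_markAt (x : Letter M.Cell) {i n : ℕ} {j : Option ℕ} (h : j ≠ some i) :
    x.mlbl (markAt i j n) =
      x.lbl ∪ {p | p = .check3 ∧ n = i} ∪ {p | p = .checkHat3 ∧ some n = j} := by
  ext p
  simp only [Letter.mlbl, Letter.lbl, markAt, Set.mem_setOf_eq, Set.mem_union, Set.mem_singleton_iff]
  by_cases h1 : n = i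
  · subst h1
    simp [h.symm, Mark.prp]
  · by_cases h2 : some n = j
    · simp [h1, h2, Mark.prp]
    · simp [h1, h2]

theorem markedReverse_eq {S : List (List (Sym M.Cell))} {i : ℕ} {j : Option ℕ} (h : j ≠ some i) :
    markedReverse (lbls S) i j = padOmega (marked (markAt i j) S.flatten.reverse) := by
  rw [markedReverse, marked_eq, lbls_flatten]
  congr 2
  apply List.ext_getElem?
  intro n
  simp [-List.map_flatten, List.getElem?_mapIdx, Function.comp_def, mlbl_markAt _ h]

end

end PushdownGames

namespace PushdownGames

/-! ## Runs in which the stack is read -/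

section

variable {M : ATM} {md : Mode} {mk : Option Mark} {x : Letter M.Cell} {l : List (Sym M.Cell)}
  {c : Conf M}

theorem succ_pop_final (h : md.isFinal x.cls = true) :
    (game M).Succ (.pop md mk x, l) c ↔ c = (.sink true, l) := by
  have hl : l.head?.toList ++ l.tail = l := by cases l <;> rfl
  rw [succ_iff]
  constructor
  · rintro ⟨a, r, hr, rfl⟩
    cases a <;> simp [Ctl.step, h] at hr
    rw [← hr]
    simp [hl]
  · rintro rfl
    exact ⟨.one, (.sink true, l.head?.toList), by simp [Ctl.step, h], by simp [hl]⟩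

theorem succ_pop_nil (h : md.isFinal x.cls = false) :
    (game M).Succ (.pop md mk x, []) c ↔ c = (.sink (!md.isSimple), []) := by
  rw [succ_iff]
  constructor
  · rintro ⟨a, r, hr, rfl⟩
    cases a <;> simp [Ctl.step, h] at hr
    rw [← hr]
    rfl
  · rintro rfl
    exact ⟨.one, (.sink (!md.isSimple), []), by simp [Ctl.step, h], rfl⟩

theorem succ_pop_cons (h : md.isFinal x.cls = false) {y : Sym M.Cell} :
    (game M).Succ (.pop md mk x, y :: l) c ↔ ∃ m md', md.next x.cls y.1 y.2.cls m = some md' ∧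
      c = (.pop md' m y.2, l) := by
  rw [succ_iff]
  constructor
  · rintro ⟨a, r, hr, rfl⟩
    cases a with
    | mark m =>
      simp [Ctl.step, h] at hr
      obtain ⟨md', h', rfl⟩ := hr
      exact ⟨m, md', h', rfl⟩
    | _ => simp [Ctl.step, h] at hr
  · rintro ⟨m, md', h', rfl⟩
    exact ⟨.mark m, (.pop md' m y.2, []), by simp [Ctl.step, h, h'], rfl⟩

theorem succ_sink {b : Bool} : (game M).Succ (.sink b, l) c ↔ c = (.sink b, l) := by
  have hl : l.head?.toList ++ l.tail = l := by cases l <;> rfl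
  rw [succ_iff]
  constructor
  · rintro ⟨a, r, hr, rfl⟩
    cases a <;> simp [Ctl.step] at hr
    rw [← hr]
    simp [hl]
  · rintro rfl
    exact ⟨.one, (.sink b, l.head?.toList), rfl, by simp [hl]⟩

/-- The configurations in simple check-trees. -/
def Simple (c : Conf M) : Prop :=
  match c.1 with
  | .pop md _ _ => md.isSimple = true
  | .sink b => b = false
  | _ => False

def SSucc (c c' : Conf M) : Prop := (game M).Succ c c' ∧ Simple c'

/-- The infinite sequence that begins with `w` and goes on with `L`. -/
def app {A : Type} : List A → (ℕ → A) → ℕ → A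
  | [], L => L
  | a :: w, L => fun n => n.casesOn a (app w L)

theorem app_append {A : Type} (w w' : List A) (L : ℕ → A) : app (w ++ w') L = app w (app w' L) := by
  induction w with
  | nil => rfl
  | cons a w ih => rw [List.cons_append, app, ih]; rfl

theorem padOmega_eq (w : Word M) : padOmega w = app w fun _ => ∅ := by
  induction w with
  | nil => rfl
  | cons a w ih =>
    funext n
    cases n with
    | zero => rfl
    | succ n =>
      change padOmega w n = _
      rw [ih]
      rfl

theorem lrun_iff' {S A : Type} {R : S → S → Prop} {lab : S → A} {c : S} {L : ℕ → A} :
    LRun R lab c L ↔ ∃ c' L', R c c' ∧ LRun R lab c' L' ∧ L = app [lab c] L' := by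
  rw [lrun_iff]
  constructor
  · rintro ⟨h, c', h1, h2⟩
    refine ⟨c', _, h1, h2, funext fun n => ?_⟩
    cases n with
    | zero => exact h
    | succ n => rfl
  · rintro ⟨c', L', h1, h2, rfl⟩
    exact ⟨rfl, c', h1, h2⟩

theorem lrun_sink {R : Conf M → Conf M → Prop} {b : Bool}
    (h : ∀ c, R (.sink b, l) c ↔ c = (.sink b, l)) {L : ℕ → Set (Prp M)} :
    LRun R (game M).lab (.sink b, l) L ↔ L = fun _ => ∅ := by
  constructor
  · rintro ⟨cs, h0, h1, h2⟩
    have : ∀ n, cs n = (.sink b, l) := by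
      intro n
      induction n with
      | zero => exact h0
      | succ n ih =>
        have := h1 n
        rw [ih, h] at this
        exact this
    funext n
    rw [← h2, this, game_lab_sink]
  · rintro rfl
    exact ⟨fun _ => (.sink b, l), rfl, fun _ => (h _).2 rfl, fun _ => game_lab_sink _ _⟩

theorem isFinal_simple (h : md.isSimple = true) (x : Cls) : md.isFinal x = false := by
  cases md <;> first | cases h; done | simp [Mode.isFinal]

/-- A mode stops being simple only by the mark `check2` right after `end2`. With `other` as the
preceding class exactly these steps disappear. -/
theorem next_simple (h : md.isSimple = true) {x : Cls} {fl : Bool} {y : Cls} {m : Option Mark}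
    {md' : Mode} : (md.next x fl y m = some md' ∧ md'.isSimple = true) ↔
      md.next .other fl y m = some md' := by
  cases y with
  | bit =>
    cases md with
    | E => cases h
    | F => cases h
    | _ =>
      rcases m with _ | m
      · simp only [Mode.next, if_true, Option.some.injEq]
        refine ⟨fun h => h.1, fun h => ⟨h, ?_⟩⟩
        subst h
        rfl
      · simp only [Mode.next, reduceCtorEq, and_false, if_false, iff_false]
        split_ifs
        · rintro ⟨h1, h2⟩
          cases h1
          cases h2
        · rintro ⟨h1, -⟩
          cases h1
  | win b =>
    cases md with
    | E => cases h
    | F => cases h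
    | _ =>
      simp only [Mode.next]
      refine ⟨fun h => h.1, fun h => ⟨h, ?_⟩⟩
      split_ifs at h <;> cases h <;> rfl
  | _ =>
    cases md with
    | E => cases h
    | F => cases h
    | _ =>
      simp only [Mode.next]
      refine ⟨fun h => h.1, fun h => ⟨h, ?_⟩⟩
      split_ifs at h
      cases h
      rfl

theorem ssucc_pop_cons (h : md.isSimple = true) {y : Sym M.Cell} :
    SSucc (.pop md mk x, y :: l) c ↔ ∃ m md', md.next .other y.1 y.2.cls m = some md' ∧
      c = (.pop md' m y.2, l) := by
  unfold SSucc
  rw [succ_pop_cons (isFinal_simple h _)]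
  constructor
  · rintro ⟨⟨m, md', h1, rfl⟩, h2⟩
    exact ⟨m, md', (next_simple h).1 ⟨h1, h2⟩, rfl⟩
  · rintro ⟨m, md', h1, rfl⟩
    obtain ⟨h2, h3⟩ := (next_simple (x := x.cls) h).2 h1
    exact ⟨⟨m, md', h2, rfl⟩, h3⟩

/-- The labels of simple runs. -/
theorem srun_iff (h : md.isSimple = true) {L : ℕ → Set (Prp M)} :
    LRun SSucc (game M).lab (.pop md mk x, l) L ↔
      ∃ m md', Trace m md l md' ∧ L = padOmega (x.mlbl mk :: marked m l) := by
  induction l generalizing md mk x L with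
  | nil =>
    rw [lrun_iff']
    constructor
    · rintro ⟨c', L', ⟨h1, -⟩, h2, rfl⟩
      rw [succ_pop_nil (isFinal_simple h _), h] at h1
      subst h1
      rw [lrun_sink] at h2
      · subst h2
        exact ⟨fun _ => none, md, rfl, by rw [padOmega_eq, game_lab_pop]; rfl⟩
      · intro c
        exact ⟨fun h => succ_sink.1 h.1, by rintro rfl; exact ⟨succ_sink.2 rfl, rfl⟩⟩
    · rintro ⟨m, md', -, rfl⟩
      refine ⟨(.sink false, []), fun _ => ∅, ⟨(succ_pop_nil (isFinal_simple h _)).2 (by rw [h]; rfl),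
        rfl⟩, (lrun_sink fun c => ?_).2 rfl, by rw [padOmega_eq, game_lab_pop]; rfl⟩
      exact ⟨fun h => succ_sink.1 h.1, by rintro rfl; exact ⟨succ_sink.2 rfl, rfl⟩⟩
  | cons y l ih =>
    rw [lrun_iff']
    constructor
    · rintro ⟨c', L', h1, h2, rfl⟩
      obtain ⟨m₀, md₁, h3, rfl⟩ := (ssucc_pop_cons h).1 h1
      obtain ⟨m, md', h4, rfl⟩ := (ih ((next_simple (x := .other) h).2 h3).2).1 h2
      -- Marks are indexed by the number of symbols below. The index `l.length` is not used by the
      -- remaining run, so the mark of the current symbol can be entered there.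
      have hm : ∀ n < l.length, m n = Function.update m l.length m₀ n := fun n hn => by
        rw [Function.update_of_ne hn.ne]
      refine ⟨Function.update m l.length m₀, md', ⟨md₁, by rw [Function.update_self]; exact h3,
        (Trace.congr hm).1 h4⟩, ?_⟩
      rw [marked, Function.update_self, ← marked_congr hm, game_lab_pop, padOmega_eq, padOmega_eq]
      rfl
    · rintro ⟨m, md'', ⟨md', h1, h2⟩, rfl⟩
      refine ⟨(.pop md' (m l.length) y.2, l), padOmega (y.2.mlbl (m l.length) :: marked m l),
        (ssucc_pop_cons h).2 ⟨_, _, h1, rfl⟩, (ih ((next_simple (x := .other) h).2 h1).2).2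
          ⟨m, md'', h2, rfl⟩, ?_⟩
      rw [marked, game_lab_pop, padOmega_eq, padOmega_eq]
      rfl

variable {ν : List (List (Letter M.Cell))} {ls : List (Letter M.Cell)}

/-- The last letter `f` is shown by the control state and is missing on the stack. When it is put
back on top, the reversed sequence of codes is complete. -/
theorem LSeq.topConf (h : LSeq M.kd ν) (hl : .bas .l :: ls = ν.flatten) :
    ∃ fl, (segs ν).flatten.reverse = (fl, .bas .f) :: (topConf ls).2 := by
  obtain ⟨-, v, h1, -⟩ := id h
  have e : (PushdownGames.topConf ls).2 = (segs ν).flatten.dropLast.reverse := by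
    rw [← h.flagged, ← hl]
    rfl
  have e2 : (segs ν).flatten.map Prod.snd = v ++ [.bas .f] := by
    rw [List.map_flatten, segs_map_snd, h1]
  rcases List.eq_nil_or_concat' (segs ν).flatten with h2 | ⟨w, y, h2⟩
  · rw [h2] at e2
    simp at e2
  · rw [h2, List.map_append] at e2
    obtain ⟨-, h3⟩ := List.append_inj' e2 rfl
    refine ⟨y.1, ?_⟩
    rw [e, h2, List.dropLast_concat, List.reverse_append]
    have : y.2 = .bas .f := by simpa using h3
    rw [← this]
    rfl

/-- The labels of the simple runs that read the whole stack. -/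
theorem srun_topConf (h : LSeq M.kd ν) (hl : .bas .l :: ls = ν.flatten) {L : ℕ → Set (Prp M)} :
    LRun SSucc (game M).lab (topConf ls) L ↔ ∃ i j, IsMarking (lbls (segs ν)) i j ∧
      L = markedReverse (lbls (segs ν)) i j := by
  obtain ⟨fl, e⟩ := h.topConf hl
  have e1 : topConf ls = (.pop .A none (.bas .f), (topConf ls).2) := rfl
  rw [e1, srun_iff rfl]
  set W := (topConf ls).2
  -- Traces over the whole sequence also pass the initial `f`, which admits no mark and keeps the
  -- mode.
  have hf : ∀ m md', Trace m .A ((fl, .bas .f) :: W) md' ↔ m W.length = none ∧ Trace m .A W md' :=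
    fun m md' => trace_cons_none (fixed_of_plain (by simp [Letter.cls]) (by simp [Letter.cls]))
  have hA := fun m => trace_A (m := m) h.isSegs h.ne_nil
  rw [e] at hA
  have hlen : (segs ν).flatten.length = W.length + 1 := by
    rw [← List.length_reverse, e, List.length_cons]
  constructor
  · rintro ⟨m, md', h1, rfl⟩
    have hm : ∀ n < W.length, m n = Function.update m W.length none n := fun n hn => by
      rw [Function.update_of_ne hn.ne]
    obtain ⟨i, j, h2, h3⟩ := isMarked_iff.1 ((hA (Function.update m W.length none)).1
      ⟨md', (hf _ _).2 ⟨Function.update_self .., (Trace.congr hm).1 h1⟩⟩)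
    refine ⟨i, j, h2, ?_⟩
    rw [markedReverse_eq h2.ne, e, marked, ← h3 _ (by omega), Function.update_self, marked_congr hm]
    congr 2
    exact marked_congr fun n hn => h3 n (by omega)
  · rintro ⟨i, j, h1, rfl⟩
    obtain ⟨md', h2⟩ := (hA (markAt i j)).2 (isMarked_iff.2 ⟨i, j, h1, fun _ _ => rfl⟩)
    obtain ⟨h3, h4⟩ := (hf _ _).1 h2
    refine ⟨markAt i j, md', h4, ?_⟩
    rw [markedReverse_eq h1.ne, e, marked, h3]

/-! ## Runs in check 2-block-trees -/

abbrev GRun (c : Conf M) (L : ℕ → Set (Prp M)) : Prop := LRun (game M).Succ (game M).lab c L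

theorem grun_pop_cons (h : md.isFinal x.cls = false) {y : Sym M.Cell} {L : ℕ → Set (Prp M)} :
    GRun (.pop md mk x, y :: l) L ↔ ∃ m md' L', md.next x.cls y.1 y.2.cls m = some md' ∧
      GRun (.pop md' m y.2, l) L' ∧ L = app [x.mlbl mk] L' := by
  unfold GRun
  rw [lrun_iff', game_lab_pop]
  simp only [succ_pop_cons h]
  constructor
  · rintro ⟨_, L', ⟨m, md', h1, rfl⟩, h2, h3⟩
    exact ⟨m, md', L', h1, h2, h3⟩
  · rintro ⟨m, md', L', h1, h2, h3⟩
    exact ⟨_, L', ⟨m, md', h1, rfl⟩, h2, h3⟩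

theorem grun_forced (h : md.isFinal x.cls = false) {y : Sym M.Cell} {L : ℕ → Set (Prp M)}
    (hn : ∀ m md', md.next x.cls y.1 y.2.cls m = some md' ↔ m = none ∧ md' = md) :
    GRun (.pop md mk x, y :: l) L ↔
      ∃ L', GRun (.pop md none y.2, l) L' ∧ L = app [x.mlbl mk] L' := by
  rw [grun_pop_cons h]
  constructor
  · rintro ⟨m, md', L', h1, h2, h3⟩
    obtain ⟨rfl, rfl⟩ := (hn _ _).1 h1
    exact ⟨L', h2, h3⟩
  · rintro ⟨L', h2, h3⟩
    exact ⟨none, md, L', (hn _ _).2 ⟨rfl, rfl⟩, h2, h3⟩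

theorem grun_final (h : md.isFinal x.cls = true) {L : ℕ → Set (Prp M)} :
    GRun (.pop md mk x, l) L ↔ L = app [x.mlbl mk] fun _ => ∅ := by
  unfold GRun
  rw [lrun_iff', game_lab_pop]
  simp only [succ_pop_final h]
  have := fun L => lrun_sink (M := M) (l := l) (R := (game M).Succ) (b := true) (L := L)
    fun c => succ_sink
  constructor
  · rintro ⟨_, L', rfl, h1, h2⟩
    rw [h2, (this L').1 h1]
  · rintro rfl
    exact ⟨_, _, rfl, (this _).2 rfl, rfl⟩

theorem cls_bit (v : Bool) : (Letter.bit v : Letter M.Cell).cls = .bit := by cases v <;> rfl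

theorem nextF (x : Cls) (fl : Bool) (y : Cls) (m : Option Mark) (md' : Mode) :
    Mode.next .F x fl y m = some md' ↔ m = none ∧ md' = .F := by
  cases y <;> simp [Mode.next, eq_comm]

theorem nextE {x : Cls} (fl : Bool) {y : Cls} (m : Option Mark) (md' : Mode)
    (h : y ≠ .bit ∨ x ≠ .end1) : Mode.next .E x fl y m = some md' ↔ m = none ∧ md' = .E := by
  cases y <;> simp [Mode.next, eq_comm]
  rcases h with h | h
  · exact absurd rfl h
  · rcases m with _ | m <;> simp [h, eq_comm]

/-- In mode `E` a mark is possible only directly after `end1`, and in mode `F` never. From the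
content of a 1-block down to its `start1` the run is therefore deterministic. -/
theorem grun_bits (hmd : md = .E ∨ md = .F) {u : List (Letter M.Cell)}
    (hu : ∀ y ∈ u, y.cls = .bit) {rest : List (Letter M.Cell)}
    {L : ℕ → Set (Prp M)} (hx : x.cls = .bit) (hl : l.map Prod.snd = u ++ .bas .start1 :: rest) :
    GRun (.pop md mk x, l) L ↔ ∃ L', GRun (.pop md none (.bas .start1), l.drop (u.length + 1)) L' ∧
      L = app (x.mlbl mk :: u.map Letter.lbl) L' := by
  have hf : md.isFinal x.cls = false := by
    rw [hx]
    rcases hmd with rfl | rfl <;> simp [Mode.isFinal]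
  induction u generalizing l x mk L with
  | nil =>
    obtain ⟨y, l', rfl, h1, h2⟩ := List.map_eq_cons_iff.1 hl
    rw [grun_forced hf, h1]
    · rfl
    · intro m md'
      rcases hmd with rfl | rfl
      · exact nextE _ _ _ (.inr (by simp [hx]))
      · exact nextF ..
  | cons z u ih =>
    obtain ⟨y, l₁, rfl, h1, h2⟩ := List.map_eq_cons_iff.1 hl
    have hy : y.2.cls = .bit := by rw [h1]; exact hu z (by simp)
    have hf' : md.isFinal y.2.cls = false := by
      rw [hy]
      rcases hmd with rfl | rfl <;> simp [Mode.isFinal]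
    rw [grun_forced hf]
    · simp only [ih (fun y hy => hu y (by simp [hy])) hy h2 hf']
      constructor
      · rintro ⟨_, ⟨L', h3, rfl⟩, rfl⟩
        refine ⟨L', h3, ?_⟩
        rw [h1, ← app_append, Letter.mlbl_none]
        rfl
      · rintro ⟨L', h3, rfl⟩
        refine ⟨_, ⟨L', h3, rfl⟩, ?_⟩
        rw [h1, ← app_append, Letter.mlbl_none]
        rfl
    · intro m md'
      rcases hmd with rfl | rfl
      · exact nextE _ _ _ (.inr (by simp [hx]))
      · exact nextF ..

theorem nextE_bit (fl : Bool) (m : Option Mark) (md' : Mode) :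
    Mode.next .E .end1 fl .bit m = some md' ↔
      m = none ∧ md' = .E ∨ m = some .check1 ∧ md' = .F := by
  rcases m with _ | m
  · simp [Mode.next, eq_comm]
  · cases m <;> simp [Mode.next, eq_comm]

/-- The labels of the runs that read the 1-blocks `bs` of a 2-block in its check 2-block-tree. -/
theorem grun_E {bs : List (List (Letter M.Cell))} (hbs : ∀ b ∈ bs, ∃ v, L1 v b)
    {rest : List (Letter M.Cell)} {L : ℕ → Set (Prp M)} (hx : x.cls = .bit ∨ x.cls = .start1)
    (hl : l.map Prod.snd = bs.flatten.reverse ++ .bas .start2 :: rest) :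
    GRun (.pop .E mk x, l) L ↔
      L = app (x.mlbl mk :: (bs.flatten.reverse ++ [Letter.bas Bas.start2]).map Letter.lbl) (fun _ => ∅) ∨
      ∃ bs₁ bs₂ u v, bs = bs₁ ++ [u ++ [.bit v, .bas .end1]] ++ bs₂ ∧
        L = app (x.mlbl mk :: ((bs₂.flatten.reverse ++ [.bas .end1]).map Letter.lbl ++
          (Letter.bit v).mlbl (some .check1) :: u.reverse.map Letter.lbl)) fun _ => ∅ := by
  have hf : Mode.isFinal .E x.cls = false := by
    rcases hx with h | h <;> simp [Mode.isFinal, h]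
  induction bs using List.reverseRecOn generalizing l x mk L with
  | nil =>
    obtain ⟨y, l', rfl, h1, h2⟩ := List.map_eq_cons_iff.1 hl
    have hy : y.2.cls = .start2 := by rw [h1]; rfl
    rw [grun_forced hf fun m md' => nextE _ _ _ (.inl (by simp [hy]))]
    have : ∀ L, GRun (.pop .E none y.2, l') L ↔ _ := fun L =>
      grun_final (by simp [Mode.isFinal, hy])
    simp only [this]
    constructor
    · rintro ⟨_, rfl, rfl⟩
      left
      rw [h1, ← app_append, Letter.mlbl_none]
      rfl
    · rintro (rfl | ⟨bs₁, bs₂, u, v, h, -⟩)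
      · refine ⟨_, rfl, ?_⟩
        rw [h1, ← app_append, Letter.mlbl_none]
        rfl
      · simp at h
  | append_singleton bs b ih =>
    obtain ⟨v, hv⟩ := hbs b (by simp)
    obtain ⟨vs, -, rfl⟩ := l1_iff.1 hv
    have e1 : (bs ++ [Letter.bas Bas.start1 :: (vs.map Letter.bit ++ [Letter.bit v, Letter.bas Bas.end1])]).flatten.reverse
        = Letter.bas Bas.end1 :: Letter.bit v :: ((vs.map Letter.bit).reverse ++
          .bas .start1 :: bs.flatten.reverse) := by simp [-List.map_flatten]
    rw [e1] at hl ⊢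
    obtain ⟨y, l₁, rfl, h1, h2⟩ := List.map_eq_cons_iff.1 hl
    have h2' : l₁.map Prod.snd = .bit v :: ((vs.map Letter.bit).reverse ++
      .bas .start1 :: (bs.flatten.reverse ++ .bas .start2 :: rest)) := by rw [h2]; simp
    obtain ⟨y', l₂, rfl, h3, h4⟩ := List.map_eq_cons_iff.1 h2'
    have hy : y.2.cls = .end1 := by rw [h1]; rfl
    have hy' : y'.2.cls = .bit := by rw [h3]; exact cls_bit v
    have hu : ∀ z ∈ (vs.map (Letter.bit (C := M.Cell))).reverse, z.cls = .bit := by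
      intro z hz
      obtain ⟨v', -, rfl⟩ := List.mem_map.1 (List.mem_reverse.1 hz)
      exact cls_bit v'
    have h5 : (l₂.drop ((vs.map (Letter.bit (C := M.Cell))).reverse.length + 1)).map Prod.snd =
        bs.flatten.reverse ++ .bas .start2 :: rest := by
      rw [List.map_drop, h4, List.append_cons, List.drop_left']
      simp
    have hE := fun L => grun_bits (mk := none) (L := L) (.inl rfl) hu hy' h4
    have hF := fun L => grun_bits (mk := some .check1) (L := L) (.inr rfl) hu hy' h4
    have hF' := fun L => grun_final (M := M) (md := .F) (mk := none) (x := .bas .start1)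
      (l := l₂.drop ((vs.map (Letter.bit (C := M.Cell))).reverse.length + 1)) (L := L) rfl
    have ih' := fun L => ih (mk := none) (L := L) (fun b hb => hbs b (by simp [hb]))
      (x := .bas .start1) (.inr rfl) h5 rfl
    rw [grun_forced hf fun m md' => nextE _ _ _ (.inl (by simp [hy]))]
    -- The only choice in a 1-block: after `end1` its content is marked or not. With the mark, mode
    -- `F` ends the run at the next `start1`.
    have hstep : ∀ L, GRun (.pop .E none y.2, y' :: l₂) L ↔
        ∃ L', (GRun (.pop .E none y'.2, l₂) L' ∨ GRun (.pop .F (some .check1) y'.2, l₂) L') ∧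
          L = app [y.2.lbl] L' := by
      intro L
      rw [grun_pop_cons (by simp [Mode.isFinal, hy])]
      simp only [hy, hy', nextE_bit, Letter.mlbl_none]
      constructor
      · rintro ⟨m, md', L', ⟨rfl, rfl⟩ | ⟨rfl, rfl⟩, h6, h7⟩
        · exact ⟨L', .inl h6, h7⟩
        · exact ⟨L', .inr h6, h7⟩
      · rintro ⟨L', h6 | h6, h7⟩
        · exact ⟨_, _, L', .inl ⟨rfl, rfl⟩, h6, h7⟩
        · exact ⟨_, _, L', .inr ⟨rfl, rfl⟩, h6, h7⟩
    rw [h1, h3] at hstep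
    rw [h3] at hE hF
    rw [h1]
    simp only [hstep, hE, hF, hF', ih', Letter.mlbl_none]
    constructor
    · rintro ⟨_, ⟨_, ⟨_, rfl | ⟨bs₁, bs₂, u, v', rfl, rfl⟩, rfl⟩ | ⟨_, rfl, rfl⟩, rfl⟩, rfl⟩
      · left
        simp only [← app_append]
        congr 1
        simp [-List.map_flatten]
      · right
        refine ⟨bs₁, bs₂ ++ [_], u, v', List.append_assoc .., ?_⟩
        simp only [← app_append]
        congr 1
        simp [-List.map_flatten]
      · right
        refine ⟨bs, [], .bas .start1 :: vs.map .bit, v, by simp, ?_⟩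
        simp only [← app_append]
        congr 1
        simp [-List.map_flatten]
    · rintro (rfl | ⟨bs₁, bs₂, u, v', h6, rfl⟩)
      · refine ⟨_, ⟨_, .inl ⟨_, .inl rfl, rfl⟩, rfl⟩, ?_⟩
        simp only [← app_append]
        congr 1
        simp [-List.map_flatten]
      -- If nothing follows the marked 1-block, it is the block just read; otherwise the mark comes
      -- later in the run.
      · rcases List.eq_nil_or_concat' bs₂ with rfl | ⟨bs₂, b, rfl⟩
        · rw [List.append_nil] at h6
          obtain ⟨rfl, h7⟩ := List.append_inj' h6 rfl
          have h7' : (Letter.bas Bas.start1 :: vs.map Letter.bit) ++ [.bit v, .bas .end1] =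
            u ++ [.bit v', .bas .end1] := by simpa using h7
          obtain ⟨rfl, h8⟩ := List.append_inj' h7' rfl
          have h9 : (Letter.bit v : Letter M.Cell) = .bit v' := by simpa using h8
          refine ⟨_, ⟨_, .inr ⟨_, rfl, rfl⟩, rfl⟩, ?_⟩
          simp only [← app_append, h9]
          congr 1
          simp [-List.map_flatten]
        · rw [← List.append_assoc] at h6
          obtain ⟨rfl, h7⟩ := List.append_inj' h6 rfl
          have h7' : Letter.bas Bas.start1 :: (vs.map Letter.bit ++ [.bit v, .bas .end1]) = b := by
            simpa using h7
          subst h7'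
          refine ⟨_, ⟨_, .inl ⟨_, .inr ⟨bs₁, bs₂, u, v', rfl, rfl⟩, rfl⟩, rfl⟩, ?_⟩
          simp only [← app_append]
          congr 1
          simp [-List.map_flatten]

end

end PushdownGames

/-! ### Branches of check 2-block-trees as runs -/

namespace PushdownGames

section

variable {M : ATM} {md : Mode} {mk : Option Mark} {x : Letter M.Cell} {l : List (Sym M.Cell)}
  {c : Conf M}

theorem Letter.mlbl_some (x : Letter M.Cell) (k : Mark) : x.mlbl (some k) = {x.prp, k.prp} := by
  ext p
  simp [mlbl]

/-- The runs that leave a simple check-tree at an `{end2}`-node yield the branches of the check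
2-block-tree. -/
theorem check_runs {v : Bool} {w : List (Letter M.Cell)} (hw : L2 v w) {y : Sym M.Cell}
    {rest : List (Letter M.Cell)}
    (e : .bas .end2 :: y.2 :: l.map Prod.snd = w.reverse ++ rest) {L : ℕ → Set (Prp M)} :
    IsCheckTwoBranch (w.map Letter.lbl) L ↔
      ∃ L', GRun (.pop .E (some .check2) y.2, l) L' ∧ L = app [{Prp.end2}] L' := by
  have key : ∀ (bs : List (List (Letter M.Cell))) (v : Bool),
      w = .bas .start2 :: (bs.flatten ++ [.bit v, .bas .end2]) →
      y.2 = .bit v ∧ l.map Prod.snd = bs.flatten.reverse ++ .bas .start2 :: rest := by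
    rintro bs v rfl
    simpa [-List.map_flatten] using e
  have hx : ∀ v, (Letter.bit v : Letter M.Cell).cls = .bit := cls_bit
  constructor
  · rintro ⟨bs, c, hc, h2, hbs, e1, h⟩
    obtain ⟨bs, hbs', rfl⟩ := (exists_map_eq exists_isBlock1_iff).1 hbs
    clear hbs
    obtain ⟨v, rfl⟩ := isBit_iff.1 hc
    have e2 : w = .bas .start2 :: (bs.flatten ++ [.bit v, .bas .end2]) := by
      apply Letter.lbl_injective.list_map
      rw [e1, ← List.map_flatten]
      simp [-List.map_flatten]
      and_intros <;> rfl
    obtain ⟨e3, e4⟩ := key bs v e2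
    rw [e3]
    rcases h with rfl | ⟨bs₁, bs₂, u, c', h3, rfl⟩
    · refine ⟨_, (grun_E hbs' (.inl (hx v)) e4).2 (.inl rfl), ?_⟩
      rw [padOmega_eq, ← app_append, ← List.map_flatten, Letter.mlbl_some]
      congr 1
      simp [-List.map_flatten]
      and_intros <;> rfl
    · obtain ⟨bs', bs₂, rfl, h4, rfl⟩ := List.map_eq_append_iff.1 h3
      obtain ⟨bs₁, bs', rfl, rfl, h5⟩ := List.map_eq_append_iff.1 h4
      obtain ⟨b, h6, h7⟩ := List.map_eq_singleton_iff.1 h5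
      subst h6
      obtain ⟨u, b', rfl, rfl, h8⟩ := List.map_eq_append_iff.1 h7
      -- Every 1-block ends with its content and `end1`. A comparison of the last two letters shows
      -- that the marked letter is the content.
      obtain ⟨v', hv'⟩ := hbs' (u ++ b') (by simp)
      obtain ⟨vs, -, h9⟩ := l1_iff.1 hv'
      have hlen : b'.length = 2 := by simpa using congrArg List.length h8
      have h10 : u ++ b' = (.bas .start1 :: vs.map .bit) ++ [.bit v', .bas .end1] := by
        rw [h9, List.cons_append]
      obtain ⟨-, rfl⟩ := List.append_inj' h10 (by simp [hlen])
      have hc' : c' = (Letter.bit v').prp := by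
        have : (Letter.bit v').lbl = {c'} := by simpa using (List.cons.inj h8).1
        exact (Set.singleton_eq_singleton_iff.1 this).symm
      subst hc'
      refine ⟨_, (grun_E hbs' (.inl (hx v)) e4).2 (.inr ⟨bs₁, bs₂, u, v', rfl, rfl⟩), ?_⟩
      rw [padOmega_eq, ← app_append, ← List.map_flatten, Letter.mlbl_some, Letter.mlbl_some]
      congr 1
      simp [-List.map_flatten]
      and_intros <;> rfl
  · rintro ⟨L', h, rfl⟩
    obtain ⟨bs, h2, hbs, e2⟩ := hw
    obtain ⟨e3, e4⟩ := key bs v e2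
    rw [e3] at h
    refine ⟨bs.map (List.map Letter.lbl), (Letter.bit v).prp, isBit_iff.2 ⟨v, rfl⟩, by simpa using h2,
      (exists_map_eq exists_isBlock1_iff).2 ⟨bs, hbs, rfl⟩, ?_, ?_⟩
    · rw [e2, ← List.map_flatten]
      simp [-List.map_flatten]
      and_intros <;> rfl
    · rcases (grun_E hbs (.inl (hx v)) e4).1 h with rfl | ⟨bs₁, bs₂, u, v', rfl, rfl⟩
      · left
        rw [padOmega_eq, ← app_append, ← List.map_flatten, Letter.mlbl_some]
        congr 1
        simp [-List.map_flatten]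
        and_intros <;> rfl
      · right
        refine ⟨bs₁.map (List.map Letter.lbl), bs₂.map (List.map Letter.lbl), u.map Letter.lbl,
          (Letter.bit v').prp, ?_, ?_⟩
        · simp [-List.map_flatten]
          and_intros <;> rfl
        · rw [padOmega_eq, ← app_append, ← List.map_flatten, Letter.mlbl_some, Letter.mlbl_some]
          congr 1
          simp [-List.map_flatten]
          and_intros <;> rfl

end

end PushdownGames

namespace PushdownGames

/-! ## The letters next to a letter in a sequence of codes -/

section

variable {C : Type}

/-- In `l` each triple is followed by `end3`, and each `end2` ends a 2-block. -/
def WellFormed (l : List (Letter C)) : Prop :=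
  ∀ p a q, l = p ++ a :: q →
    ((∃ b, a.cls = .win b) → ∃ q', q = .bas .end3 :: q') ∧
    (a = .bas .end2 → ∃ p' v w, L2 v w ∧ p ++ [a] = p' ++ w)

/-- Both conditions are local: the letter after a triple and the 2-block before an `end2` lie in the
same part. -/
theorem WellFormed.append {l l' : List (Letter C)} (h : WellFormed l) (h' : WellFormed l') :
    WellFormed (l ++ l') := by
  intro p a q e
  rcases List.append_eq_append_iff.1 e with ⟨r, rfl, e1⟩ | ⟨r, rfl, e1⟩
  · obtain ⟨h1, h2⟩ := h' r a q e1
    refine ⟨h1, fun ha => ?_⟩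
    obtain ⟨p', v, w, h3, h4⟩ := h2 ha
    exact ⟨l ++ p', v, w, h3, by rw [List.append_assoc, h4, List.append_assoc]⟩
  · rcases r with _ | ⟨b, r⟩
    · obtain ⟨h1, h2⟩ := h' [] a q (by simpa using e1.symm)
      refine ⟨h1, fun ha => ?_⟩
      obtain ⟨p', v, w, h3, h4⟩ := h2 ha
      exact ⟨p ++ p', v, w, h3, by simpa using h4⟩
    · obtain ⟨rfl, rfl⟩ := List.cons.inj e1
      obtain ⟨h1, h2⟩ := h p a r rfl
      refine ⟨fun ha => ?_, h2⟩
      obtain ⟨q', rfl⟩ := h1 ha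
      exact ⟨_, rfl⟩

theorem WellFormed.flatten {ls : List (List (Letter C))} (h : ∀ l ∈ ls, WellFormed l) :
    WellFormed ls.flatten := by
  induction ls with
  | nil => intro p a q e; simp at e
  | cons l ls ih =>
    rw [List.flatten_cons]
    exact (h l (by simp)).append (ih fun l hl => h l (by simp [hl]))

theorem wellFormed_of_plain {l : List (Letter C)}
    (h : ∀ a ∈ l, (∀ b, a.cls ≠ .win b) ∧ a ≠ .bas .end2) : WellFormed l := by
  rintro p a q rfl
  obtain ⟨h1, h2⟩ := h a (by simp)
  exact ⟨fun ⟨b, hb⟩ => absurd hb (h1 b), fun ha => absurd ha h2⟩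

theorem wellFormed_bas {b : Bas} (h : b ≠ .end2) : WellFormed [(Letter.bas b : Letter C)] := by
  apply wellFormed_of_plain
  intro a ha
  rw [List.mem_singleton.1 ha]
  exact ⟨cls_bas_ne_win b, by simpa using h⟩

theorem L1.ne_end2 {v : Bool} {w : List (Letter C)} (h : L1 v w) : ∀ a ∈ w, a ≠ .bas .end2 := by
  obtain ⟨vs, -, rfl⟩ := l1_iff.1 h
  intro a ha
  simp only [List.mem_cons, List.mem_append, List.mem_map, List.not_mem_nil, or_false] at ha
  rcases ha with rfl | ⟨v, -, rfl⟩ | rfl | rfl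
  · simp
  · cases v <;> simp [Letter.bit, Bas.ofBool]
  · cases v <;> simp [Letter.bit, Bas.ofBool]
  · simp

/-- 1-blocks do not contain `end2`, so it occurs only at the end of the 2-block. -/
theorem L2.wellFormed {v : Bool} {w : List (Letter C)} (h : L2 v w) : WellFormed w := by
  obtain ⟨bs, h1, h2, e⟩ := id h
  intro p a q e'
  refine ⟨fun ⟨b, hb⟩ => ?_, fun ha => ?_⟩
  · obtain ⟨c, rfl⟩ := h.bas a (by rw [e']; simp)
    exact absurd hb (cls_bas_ne_win c b)
  · rcases List.eq_nil_or_concat' q with rfl | ⟨q, b, rfl⟩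
    · exact ⟨[], v, w, h, e'.symm⟩
    · have hmem : a ∈ (.bas .start2 :: (bs.flatten ++ [.bit v]) : List (Letter C)) := by
        have : p ++ a :: q ++ [b] = (.bas .start2 :: (bs.flatten ++ [.bit v])) ++ [.bas .end2] := by
          rw [List.append_assoc, List.cons_append, ← e', e]
          simp
        rw [← (List.append_inj' this rfl).1]
        simp
      simp only [List.mem_cons, List.mem_append, List.mem_flatten, List.not_mem_nil, or_false] at hmem
      rcases hmem with rfl | ⟨b, hb, hb'⟩ | rfl
      · cases ha
      · obtain ⟨v, hv⟩ := h2 b hb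
        exact absurd ha (hv.ne_end2 a hb')
      · cases v <;> cases ha

theorem L3.wellFormed {t : Option C × C × Option C} {w : List (Letter C)} (h : L3 t w) :
    WellFormed w := by
  obtain ⟨bs, -, h2, rfl⟩ := h
  refine (wellFormed_bas (b := .start3) (by simp)).append (.append (.flatten fun l hl => ?_) ?_)
  · obtain ⟨v, hv⟩ := h2 l hl
    exact hv.wellFormed
  · rintro p a q e
    rcases p with _ | ⟨b, p⟩
    · obtain ⟨rfl, rfl⟩ := List.cons.inj e
      exact ⟨fun _ => ⟨[], rfl⟩, fun h => by cases h⟩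
    · have e' := (List.cons.inj e).2
      rcases p with _ | ⟨b', p⟩
      · obtain ⟨rfl, rfl⟩ := List.cons.inj e'
        exact ⟨fun ⟨b, hb⟩ => absurd hb (cls_bas_ne_win _ b), fun h => by cases h⟩
      · simp at e'

variable {kd : C → Kd}

theorem LCode.wellFormed {b : Bool} {hd : Option Kd} {w : List (Letter C)} (h : LCode kd b hd w) :
    WellFormed w := by
  obtain ⟨cs, bs, -, -, h, rfl⟩ := h
  refine (wellFormed_bas (b := tagBas b) (by cases b <;> simp [tagBas])).append
    (.append (.flatten ?_) (wellFormed_bas (by unfold closing; split_ifs <;> simp)))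
  generalize PushdownGames.win none cs = ts at h
  induction h with
  | nil => simp
  | cons h1 _ ih =>
    intro l hl
    rcases List.mem_cons.1 hl with rfl | hl
    · exact h1.wellFormed
    · exact ih l hl

theorem LSeq.wellFormed {ν : List (List (Letter C))} (h : LSeq kd ν) : WellFormed ν.flatten :=
  .flatten fun w hw => by
    obtain ⟨b, hd, h1⟩ := h.1 w hw
    exact h1.wellFormed

/-- The symbol carries the first triple of the first code. -/
def IsFirst (y : Sym C) : Prop := y.1 = true ∧ y.2.cls = .win true

/-- The first triple of the first code is the leftmost triple of all. Later triples of this code do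
not have the end marker on the left, and later codes do not have the flag. -/
theorem IsSegs.exists_first {S : List (List (Sym C))} (h : IsSegs S) (hS : S ≠ []) :
    ∃ u x v, S.flatten = u ++ x :: v ∧ (∀ z ∈ u, ∀ b, z.2.cls ≠ .win b) ∧ IsFirst x ∧
      ∀ z ∈ v, ¬ IsFirst z := by
  obtain ⟨w, S, rfl⟩ := List.exists_cons_of_ne_nil hS
  obtain ⟨t, pre, x, post, e, h1, h2, h3, h4, h5⟩ := h [] w S rfl
  refine ⟨t :: pre, x, post ++ S.flatten, by rw [List.flatten_cons, e]; simp, ?_,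
    ⟨h1 x (by rw [e]; simp), h4⟩, ?_⟩
  · intro z hz b hb
    rcases List.mem_cons.1 hz with rfl | hz
    · rw [h2] at hb
      cases hb
    · exact (h3 z hz).2 b hb
  · rintro z hz ⟨hz1, hz2⟩
    rcases List.mem_append.1 hz with hz | hz
    · exact (h5 z hz).2 hz2
    · obtain ⟨w', hw', hz'⟩ := List.mem_flatten.1 hz
      obtain ⟨S₁, S₂, rfl⟩ := List.append_of_mem hw'
      obtain ⟨-, -, -, -, -, h6, -⟩ := h (w :: S₁) w' S₂ rfl
      have := h6 z hz'
      rw [hz1] at this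
      cases this

/-- Justifies the forced mark in mode `A`: the leftmost triple is read last, and at every other
triple the mark can still be postponed. -/
theorem IsSegs.win_iff {S : List (List (Sym C))} (h : IsSegs S) (hS : S ≠ []) {a l : List (Sym C)}
    {y : Sym C} (e : S.flatten.reverse = a ++ y :: l) {b : Bool} (hy : y.2.cls = .win b) :
    (∃ z ∈ l, ∃ b, z.2.cls = .win b) ↔ ¬ IsFirst y := by
  obtain ⟨u, x, v, e1, h1, h2, h3⟩ := h.exists_first hS
  have e2 : l.reverse ++ y :: a.reverse = u ++ x :: v := by
    rw [← e1, ← List.reverse_reverse S.flatten, e]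
    simp
  rcases List.append_eq_append_iff.1 e2 with ⟨r, rfl, e3⟩ | ⟨r, e3, e4⟩
  · rcases r with _ | ⟨z, r⟩
    · obtain ⟨rfl, -⟩ := List.cons.inj e3
      refine ⟨?_, fun h => absurd h2 h⟩
      rintro ⟨z, hz, b, hb⟩
      exact absurd hb (h1 z (by simpa using hz) b)
    · obtain ⟨rfl, -⟩ := List.cons.inj e3
      exact absurd hy (h1 y (by simp) b)
  · rcases r with _ | ⟨z, r⟩
    · obtain ⟨rfl, -⟩ := List.cons.inj e4
      refine ⟨?_, fun h => absurd h2 h⟩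
      rintro ⟨z, hz, b, hb⟩
      exact absurd hb (h1 z (by rw [List.append_nil] at e3; rw [← e3]; simpa using hz) b)
    · obtain ⟨rfl, rfl⟩ := List.cons.inj e4
      refine ⟨fun _ => h3 y (by simp), fun _ => ⟨x, ?_, true, h2.2⟩⟩
      rw [← List.mem_reverse, e3]
      simp

end

end PushdownGames

namespace PushdownGames

/-! ## Configurations in which the stack is read -/

section

variable {M : ATM} {md : Mode} {mk : Option Mark} {x : Letter M.Cell} {l : List (Sym M.Cell)}
  {c c' : Conf M} {F : List (Sym M.Cell)} {n : ℕ}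

/-- The configuration `c` occurs after `n` steps when `F` is read. -/
def At (F : List (Sym M.Cell)) (n : ℕ) (c : Conf M) : Prop :=
  (∃ b, c.1 = .sink b) ∨ ∃ md mk x fl l, c = (.pop md mk x, l) ∧ F.drop n = (fl, x) :: l ∧
    (mk = none ∨ x.cls = .bit ∨ ∃ b, x.cls = .win b)

theorem next_some {md md' : Mode} {x : Cls} {fl : Bool} {y : Cls} {k : Mark}
    (h : md.next x fl y (some k) = some md') : y = .bit ∨ ∃ b, y = .win b := by
  cases y with
  | bit => exact .inl rfl
  | win b => exact .inr ⟨b, rfl⟩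
  | _ => cases md <;> simp [Mode.next] at h

theorem At.succ (h : At F n c) (hs : (game M).Succ c c') : At F (n + 1) c' := by
  rcases h with ⟨b, hb⟩ | ⟨md, mk, x, fl, l, rfl, h1, -⟩
  · obtain ⟨q, l⟩ := c
    change q = _ at hb
    subst hb
    rw [succ_sink] at hs
    exact .inl ⟨b, by rw [hs]⟩
  · by_cases hf : md.isFinal x.cls = true
    · rw [succ_pop_final hf] at hs
      exact .inl ⟨true, by rw [hs]⟩
    · rw [Bool.not_eq_true] at hf
      cases l with
      | nil =>
        rw [succ_pop_nil hf] at hs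
        exact .inl ⟨_, by rw [hs]⟩
      | cons y l =>
        obtain ⟨m, md', h2, rfl⟩ := (succ_pop_cons hf).1 hs
        refine .inr ⟨md', m, y.2, y.1, l, rfl, ?_, ?_⟩
        · rw [← List.drop_drop, h1]
          rfl
        -- Only bits and triples can be marked. The last clause of `At` thus guarantees that nodes
        -- with the letters `end2` and `end3` carry no mark.
        · rcases m with _ | m
          · exact .inl rfl
          · exact .inr (next_some h2)

theorem At.steps {w : Word M} (hs : GSteps c w c') : ∀ {n}, At F n c → At F (n + w.length) c' := by
  induction hs with
  | nil => exact fun h => h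
  | cons h1 _ ih =>
    intro n h
    have := ih (h.succ h1)
    rwa [Nat.add_assoc, Nat.add_comm 1] at this

variable {ν : List (List (Letter M.Cell))} {ls : List (Letter M.Cell)}

/-- The content of the stack, in the order in which it is read, together with the letter that is
on top of it. -/
def content (ν : List (List (Letter M.Cell))) : List (Sym M.Cell) := (segs ν).flatten.reverse

theorem content_map (ν : List (List (Letter M.Cell))) :
    (content ν).map (fun y => y.2.lbl) = (ν.map (List.map Letter.lbl)).flatten.reverse := by
  rw [content, List.map_reverse, ← lbls_flatten, lbls_segs]

theorem content_map_snd (ν : List (List (Letter M.Cell))) :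
    (content ν).map Prod.snd = ν.flatten.reverse := by
  rw [content, List.map_reverse, List.map_flatten, segs_map_snd]

theorem content_drop {r : List (Sym M.Cell)} (e : (content ν).drop n = r) :
    ν.flatten = (r.map Prod.snd).reverse ++ (((content ν).take n).map Prod.snd).reverse := by
  rw [← List.reverse_append, ← List.map_append, ← e, List.take_append_drop, content_map_snd,
    List.reverse_reverse]

theorem steps_at (h : LSeq M.kd ν) (hl : .bas .l :: ls = ν.flatten) {w : Word M}
    (hs : GSteps (topConf ls) w c) : At (content ν) w.length c := by
  obtain ⟨fl, e⟩ := h.topConf hl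
  have := At.steps (F := content ν) (n := 0) hs
    (.inr ⟨.A, none, .bas .f, fl, (topConf ls).2, rfl, e, .inl rfl⟩)
  rwa [Nat.zero_add] at this

theorem content_win (h : LSeq M.kd ν) {a y : Sym M.Cell} (e : (content ν).drop n = a :: y :: l)
    {b : Bool} (hy : y.2.cls = .win b) : a.2 = .bas .end3 := by
  have e1 : ν.flatten = (l.map Prod.snd).reverse ++ y.2 ::
      (a.2 :: ((content ν).take n |>.map Prod.snd).reverse) := by
    rw [content_drop e]
    simp
  obtain ⟨q, hq⟩ := (h.wellFormed _ _ _ e1).1 ⟨b, hy⟩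
  exact (List.cons.inj hq).1

/-- The modes look only at the classes of two adjacent symbols. This ensures that behind each `end2`
that is read there is a complete 2-block on the stack. -/
theorem content_end2 (h : LSeq M.kd ν) {a : Sym M.Cell} (e : (content ν).drop n = a :: l)
    (ha : a.2 = .bas .end2) : ∃ y l' v w rest, l = y :: l' ∧ y.2.cls = .bit ∧ L2 v w ∧
      .bas .end2 :: y.2 :: l'.map Prod.snd = w.reverse ++ rest := by
  have e1 : ν.flatten = (l.map Prod.snd).reverse ++ a.2 ::
      ((content ν).take n |>.map Prod.snd).reverse := by
    rw [content_drop e]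
    simp
  obtain ⟨p', v, w, hw, h1⟩ := (h.wellFormed _ _ _ e1).2 ha
  have h2 : .bas .end2 :: l.map Prod.snd = w.reverse ++ p'.reverse := by
    rw [← List.reverse_append, ← h1, ha]
    simp
  obtain ⟨bs, -, -, rfl⟩ := id hw
  cases l with
  | nil => simp [-List.map_flatten] at h2
  | cons y l' =>
    refine ⟨y, l', v, _, p'.reverse, rfl, ?_, hw, h2⟩
    have : y.2 = .bit v := by
      simp [-List.map_flatten] at h2
      exact h2.1
    rw [this]
    exact cls_bit v

theorem content_isFirst (h : LSeq M.kd ν) {a : List (Sym M.Cell)} {y : Sym M.Cell}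
    (e : content ν = a ++ y :: l) {b : Bool} (hy : y.2.cls = .win b) :
    (∃ z ∈ l, ∃ b, z.2.cls = .win b) ↔ ¬ IsFirst y :=
  h.isSegs.win_iff h.ne_nil e hy

/-- Marks do not occur in the labels before the mode `A` is left. -/
theorem steps_modeA (h : LSeq M.kd ν) (hl : .bas .l :: ls = ν.flatten) {w : Word M}
    {mk : Option Mark} (hs : GSteps (topConf ls) w (.pop .A mk x, l)) :
    mk = none ∧ ∃ a y, content ν = a ++ y :: l ∧ a.length = w.length ∧ y.2 = x ∧
      {Prp.f} :: w = (a ++ [y]).map fun y => y.2.lbl := by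
  induction w using List.reverseRecOn generalizing mk x l with
  | nil =>
    obtain ⟨fl, e⟩ := h.topConf hl
    cases steps_nil.1 hs
    exact ⟨rfl, [], (fl, .bas .f), e, rfl, rfl, rfl⟩
  | append_singleton w a ih =>
    obtain ⟨c₁, h1, h2, h3⟩ := steps_snoc.1 hs
    rcases steps_at h hl h1 with ⟨b, hb⟩ | ⟨md, mk₁, x₁, fl, l₁, rfl, h4, -⟩
    · obtain ⟨q, l⟩ := c₁
      change q = _ at hb
      subst hb
      rw [succ_sink] at h2
      cases h2
    · by_cases hf : md.isFinal x₁.cls = true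
      · rw [succ_pop_final hf] at h2
        cases h2
      · rw [Bool.not_eq_true] at hf
        cases l₁ with
        | nil =>
          rw [succ_pop_nil hf] at h2
          cases h2
        | cons y l₁ =>
          obtain ⟨m, md', h5, h6⟩ := (succ_pop_cons hf).1 h2
          obtain ⟨rfl, rfl, rfl, rfl⟩ : md' = .A ∧ m = mk ∧ y.2 = x ∧ l₁ = l := by
            simp only [Prod.mk.injEq, Ctl.pop.injEq] at h6
            exact ⟨h6.1.1.symm, h6.1.2.1.symm, h6.1.2.2.symm, h6.2.symm⟩
          obtain ⟨rfl, rfl⟩ : md = .A ∧ m = none := by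
            generalize y.2.cls = cl at h5
            rcases m with _ | m
            · cases md <;> cases cl <;> simp [Mode.next] at h5 <;> simp
            · cases md <;> cases cl <;> simp [Mode.next] at h5
          obtain ⟨-, a', y', h7, h8, h9, h10⟩ := ih h1
          refine ⟨rfl, a' ++ [y'], y, by rw [h7]; simp, by simp [h8], rfl, ?_⟩
          rw [← List.cons_append, h10, ← h3, game_lab_pop, Letter.mlbl_none]
          exact (List.map_append (l₂ := [y])).symm

/-! ## Successors in simple check-trees -/

theorem cls_eq_end2 : x.cls = .end2 ↔ x = .bas .end2 := by
  cases x with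
  | bas b => cases b <;> simp [Letter.cls]
  | lam => simp [Letter.cls]

theorem cls_eq_win {b : Bool} (h : x.cls = .win b) : ∃ p u s, x = .lam p u s := by
  cases x with
  | bas b => exact absurd h (cls_bas_ne_win _ _)
  | lam p u s => exact ⟨p, u, s, rfl⟩

/-- The modes `E` and `F` lead only to each other and to the sink with flag `true`; a run that has
left the simple part never returns. -/
theorem simple_of_succ (hc : (∃ b, c.1 = .sink b) ∨ ∃ md mk x, c.1 = .pop md mk x)
    (hs : (game M).Succ c c') (h : Simple c') : Simple c := by
  obtain ⟨q, l⟩ := c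
  rcases hc with ⟨b, rfl : q = _⟩ | ⟨md, mk, x, rfl : q = _⟩
  · rw [succ_sink] at hs
    rwa [hs] at h
  · by_contra hmd
    have hmd' : md.isSimple = false := by simpa [Simple] using hmd
    by_cases hf : md.isFinal x.cls = true
    · rw [succ_pop_final hf] at hs
      rw [hs] at h
      cases h
    · rw [Bool.not_eq_true] at hf
      cases l with
      | nil =>
        rw [succ_pop_nil hf] at hs
        rw [hs, hmd'] at h
        cases h
      | cons y l =>
        obtain ⟨m, md', h5, rfl⟩ := (succ_pop_cons hf).1 hs
        have h' : md'.isSimple = true := h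
        generalize y.2.cls = cl at h5
        cases md <;> first | cases hmd'; done | skip
        all_goals
          cases cl <;> simp [Mode.next] at h5
          all_goals first
            | (rw [← h5.2] at h'; cases h'; done)
            | (split_ifs at h5 <;> cases h5 <;> cases h')

/-- The simple part is left only by the mark `check2` at the content of a 2-block. -/
theorem simple_succ_cases (h : Simple c) (hs : (game M).Succ c c') : Simple c' ∨
    ∃ md mk y l, c = (.pop md mk (.bas .end2), y :: l) ∧ md.isSimple = true ∧ y.2.cls = .bit ∧
      c' = (.pop .E (some .check2) y.2, l) := by
  obtain ⟨q, l⟩ := c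
  cases q with
  | sink b =>
    rw [succ_sink] at hs
    rw [hs]
    exact .inl h
  | pop md mk x =>
    have hmd : md.isSimple = true := h
    cases l with
    | nil =>
      rw [succ_pop_nil (isFinal_simple hmd _), hmd] at hs
      rw [hs]
      exact .inl rfl
    | cons y l =>
      obtain ⟨m, md', h5, rfl⟩ := (succ_pop_cons (isFinal_simple hmd _)).1 hs
      by_cases hm : md'.isSimple = true
      · exact .inl hm
      · have key : x.cls = .end2 ∧ y.2.cls = .bit ∧ md' = .E ∧ m = some .check2 := by
          generalize y.2.cls = cl at h5
          rcases m with _ | m <;> cases md <;> first | cases hmd; done | skip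
          all_goals
            cases cl <;> simp [Mode.next] at h5
            all_goals first
              | (rw [← h5] at hm; exact absurd rfl hm)
              | (rw [← h5.2] at hm; exact absurd rfl hm)
              | exact ⟨h5.1.2, rfl, h5.2.symm, by rw [h5.1.1]⟩
        obtain ⟨h6, h7, rfl, rfl⟩ := key
        exact .inr ⟨md, mk, y, l, by rw [cls_eq_end2.1 h6], hmd, h7, rfl⟩
  | _ => cases h

variable {y : Sym M.Cell}

theorem succ_end2 (hmd : md.isSimple = true) (hy : y.2.cls = .bit) :
    (game M).Succ (.pop md mk (.bas .end2), y :: l) c ↔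
      c = (.pop md none y.2, l) ∨ c = (.pop .E (some .check2) y.2, l) := by
  rw [succ_pop_cons (isFinal_simple hmd _)]
  have key : ∀ m md', md.next (Letter.bas Bas.end2 : Letter M.Cell).cls y.1 y.2.cls m = some md' ↔
      m = none ∧ md' = md ∨ m = some .check2 ∧ md' = .E := by
    intro m md'
    rw [hy]
    rcases m with _ | m
    · cases md <;> first | cases hmd; done | simp [Mode.next, Letter.cls, eq_comm]
    · cases md <;> first | cases hmd; done | cases m <;> simp [Mode.next, Letter.cls, eq_comm]
  simp only [key]
  constructor
  · rintro ⟨m, md', ⟨rfl, rfl⟩ | ⟨rfl, rfl⟩, rfl⟩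
    · exact .inl rfl
    · exact .inr rfl
  · rintro (rfl | rfl)
    · exact ⟨_, _, .inl ⟨rfl, rfl⟩, rfl⟩
    · exact ⟨_, _, .inr ⟨rfl, rfl⟩, rfl⟩

theorem isSys_end2 (hmd : md.isSimple = true) (hy : y.2.cls = .bit) :
    (Ctl.pop md mk (.bas .end2 : Letter M.Cell)).isSys (y :: l).head? = true := by
  change md.isSys _ y.1 y.2.cls = true
  rw [hy]
  cases md <;> first | cases hmd; done | rfl

/-- The configurations controlled by the system while the stack is read. -/
theorem isSys_pop (h : (Ctl.pop md mk x).isSys l.head? = true) : ∃ y l', l = y :: l' ∧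
    ((md = .A ∧ (∃ b, y.2.cls = .win b) ∧ ¬ IsFirst y) ∨
      (md.isSimple = true ∧ x = .bas .end2 ∧ y.2.cls = .bit)) := by
  cases l with
  | nil => cases h
  | cons y l =>
    refine ⟨y, l, rfl, ?_⟩
    change md.isSys _ y.1 y.2.cls = true at h
    unfold IsFirst
    rw [← cls_eq_end2]
    generalize y.2.cls = cl at h
    generalize x.cls = cx at h
    generalize y.1 = fl at h
    cases md <;> cases cl <;> simp [Mode.isSys, Mode.isSimple] at h ⊢
    all_goals first | exact h | (rintro rfl; simpa using h)

/-- The unmarked successor is missing exactly at the last chance for a due mark: at the first triple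
of the first code in mode `A`, and at the first triple of a code in mode `C`. -/
theorem succ_window (hmd : md.isSimple = true) {b : Bool} (hy : y.2.cls = .win b) :
    (game M).Succ (.pop md mk x, y :: l) c ↔
      (c = (.pop md none y.2, l) ∧ ¬ (md = .A ∧ IsFirst y) ∧ ¬ (md = .C ∧ b = true)) ∨
      (c = (.pop .B (some .check3) y.2, l) ∧ md = .A) ∨
      (c = (.pop .D (some .checkHat3) y.2, l) ∧ md = .C) := by
  have key : ∀ m md', md.next x.cls y.1 y.2.cls m = some md' ↔
      (m = none ∧ md' = md ∧ ¬ (md = .A ∧ IsFirst y) ∧ ¬ (md = .C ∧ b = true)) ∨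
      (m = some .check3 ∧ md' = .B ∧ md = .A) ∨ (m = some .checkHat3 ∧ md' = .D ∧ md = .C) := by
    intro m md'
    unfold IsFirst
    rw [hy]
    generalize y.1 = fl
    cases md with
    | E => cases hmd
    | F => cases hmd
    | _ =>
      rcases m with _ | m
      · simp [Mode.next, eq_comm, and_comm]
      · cases m <;> simp [Mode.next, eq_comm]
  rw [succ_pop_cons (isFinal_simple hmd _)]
  simp only [key]
  constructor
  · rintro ⟨m, md', ⟨rfl, rfl, h⟩ | ⟨rfl, rfl, h⟩ | ⟨rfl, rfl, h⟩, rfl⟩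
    · exact .inl ⟨rfl, h⟩
    · exact .inr (.inl ⟨rfl, h⟩)
    · exact .inr (.inr ⟨rfl, h⟩)
  · rintro (⟨rfl, h⟩ | ⟨rfl, h⟩ | ⟨rfl, h⟩)
    · exact ⟨_, _, .inl ⟨rfl, rfl, h⟩, rfl⟩
    · exact ⟨_, _, .inr (.inl ⟨rfl, rfl, h⟩), rfl⟩
    · exact ⟨_, _, .inr (.inr ⟨rfl, rfl, h⟩), rfl⟩

/-- Elsewhere the successor is unique. -/
theorem succ_plain (h1 : ¬ ∃ b, y.2.cls = .win b)
    (h2 : ¬ (md.isSimple = true ∧ x = .bas .end2 ∧ y.2.cls = .bit))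
    (h3 : ¬ (md = .E ∧ x.cls = .end1 ∧ y.2.cls = .bit)) {c c' : Conf M}
    (hc : (game M).Succ (.pop md mk x, y :: l) c) (hc' : (game M).Succ (.pop md mk x, y :: l) c') :
    c' = c := by
  by_cases hf : md.isFinal x.cls = true
  · rw [succ_pop_final hf] at hc hc'
    rw [hc, hc']
  · rw [Bool.not_eq_true] at hf
    obtain ⟨m, md', h5, rfl⟩ := (succ_pop_cons hf).1 hc
    obtain ⟨m', md'', h6, rfl⟩ := (succ_pop_cons hf).1 hc'
    have key : ∀ m md', md.next x.cls y.1 y.2.cls m = some md' → m = none := by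
      intro m md' h
      rw [← cls_eq_end2] at h2
      by_contra hm
      obtain ⟨k, rfl⟩ := Option.ne_none_iff_exists'.1 hm
      rcases next_some h with h' | h'
      · rw [h'] at h h2 h3
        cases md <;> simp [Mode.next, Mode.isSimple] at h h2 h3
        all_goals first | exact h2 h.1.2 | exact h3 h.1.2
      · exact h1 h'
    obtain rfl := key _ _ h5
    obtain rfl := key _ _ h6
    rw [h5] at h6
    cases h6
    rfl

end

end PushdownGames

namespace PushdownGames

/-! ## Strategies are check-trees -/

section

variable {M : ATM} {Υ : Type}

/-- `cf` assigns configurations to the nodes of `U`, in the way of an environment strategy. -/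
structure Follows (U : LTree Υ (Set (Prp M))) (cf : List Υ → Conf M) (c₀ : Conf M) : Prop where
  root : cf [] = c₀
  lab : ∀ z ∈ U.nodes, U.lab z = (game M).lab (cf z)
  succ : ∀ x y, U.IsChild x y → (game M).Succ (cf x) (cf y)
  inf : U.IsInfinite
  min : U.IsMinimal
  sys : ∀ x ∈ U.nodes, (cf x).1.isSys (cf x).2.head? = true → ∀ c, (game M).Succ (cf x) c →
    ∃ y, U.IsChild x y ∧ cf y = c

variable {U : LTree Υ (Set (Prp M))} {cf : List Υ → Conf M} {c₀ : Conf M}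

theorem Follows.steps (hU : Follows U cf c₀) {z : List Υ} (hz : z ∈ U.nodes) :
    GSteps c₀ (U.tailLabels z) (cf z) := by
  induction z using List.reverseRecOn with
  | nil =>
    rw [hU.root]
    exact .nil _
  | append_singleton z a ih =>
    rw [LTree.tailLabels_snoc]
    exact steps_snoc.2 ⟨_, ih (U.prefix_closed z a hz), hU.succ _ _ ⟨hz, a, rfl⟩,
      (hU.lab _ hz).symm⟩

theorem Follows.eq_of_conf (hU : Follows U cf c₀) {x y z : List Υ} (hy : U.IsChild x y)
    (hz : U.IsChild x z) (h : cf y = cf z) : y = z :=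
  hU.min x y z hy hz (by rw [hU.lab _ hy.1, hU.lab _ hz.1, h])

/-- The part of `U` whose configurations belong to simple check-trees. -/
def simpleTree (U : LTree Υ (Set (Prp M))) (cf : List Υ → Conf M) (h₀ : Simple (cf []))
    (h : ∀ x a, x ++ [a] ∈ U.nodes → Simple (cf (x ++ [a])) → Simple (cf x)) :
    LTree Υ (Set (Prp M)) where
  nodes := {z | z ∈ U.nodes ∧ Simple (cf z)}
  lab := U.lab
  root_mem := ⟨U.root_mem, h₀⟩
  prefix_closed x a hx := ⟨U.prefix_closed x a hx.1, h x a hx.1 hx.2⟩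

variable {md : Mode} {mk : Option Mark} {x' : Letter M.Cell} {l : List (Sym M.Cell)} {y' : Sym M.Cell}

theorem isSys_window {b : Bool} (hy : y'.2.cls = .win b) (hf : ¬ IsFirst y') :
    (Ctl.pop .A mk x').isSys (y' :: l).head? = true := by
  change Mode.isSys .A _ y'.1 y'.2.cls = true
  unfold IsFirst at hf
  rw [hy] at hf ⊢
  generalize y'.1 = fl at hf ⊢
  cases fl <;> cases b <;> simp [Mode.isSys] at hf ⊢

/-- In mode `A` every configuration with several successors belongs to the system, so nothing has
been pruned. Elsewhere the unique successor survives because the tree is infinite. -/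
theorem Follows.exists_child_modeA (hU : Follows U cf c₀) {z : List Υ} (hz : z ∈ U.nodes)
    (hc : cf z = (.pop .A mk x', y' :: l)) {c : Conf M} (hs : (game M).Succ (cf z) c) :
    ∃ z', U.IsChild z z' ∧ cf z' = c := by
  by_cases hsys : (cf z).1.isSys (cf z).2.head? = true
  · exact hU.sys z hz hsys c hs
  · obtain ⟨z', hz'⟩ := hU.inf z hz
    have hs' := hU.succ z z' hz'
    refine ⟨z', hz', ?_⟩
    rw [hc] at hs hs' hsys
    by_cases hy : ∃ b, y'.2.cls = .win b
    · obtain ⟨b, hb⟩ := hy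
      have hf : IsFirst y' := by
        by_contra hf
        exact hsys (isSys_window hb hf)
      have key : ∀ c, (game M).Succ (.pop .A mk x', y' :: l) c →
          c = (.pop .B (some .check3) y'.2, l) := by
        intro c h
        rcases (succ_window rfl hb).1 h with ⟨-, h1, -⟩ | ⟨h1, -⟩ | ⟨-, h1⟩
        · exact absurd ⟨rfl, hf⟩ h1
        · exact h1
        · cases h1
      rw [key _ hs, key _ hs']
    · refine succ_plain hy ?_ (by simp) hs hs'
      rintro ⟨h1, rfl, h2⟩
      exact hsys (isSys_end2 h1 h2)

theorem marked_getElem? (m : ℕ → Option Mark) (a : List (Sym M.Cell)) :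
    (marked m (a ++ y' :: l))[a.length]? = some (y'.2.mlbl (m l.length)) := by
  induction a with
  | nil => rfl
  | cons z a ih => exact ih

variable {ν : List (List (Letter M.Cell))} {ls : List (Letter M.Cell)}

theorem markedReverse_at {a : List (Sym M.Cell)} (e : content ν = a ++ y' :: l) {i : ℕ} {j : Option ℕ}
    (hj : j ≠ some i) : markedReverse (lbls (segs ν)) i j a.length =
      y'.2.mlbl (markAt i j l.length) := by
  rw [markedReverse_eq hj, padOmega]
  change ((marked _ (content ν))[a.length]?).getD ∅ = _
  rw [e, marked_getElem?]
  rfl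

/-- The stack is read backwards, so a position in the sequence of codes equals the number of symbols
that lie below it. -/
theorem isContentPos_content {i : ℕ} : IsContentPos (lbls (segs ν)) i ↔
    ∃ a y l b, content ν = a ++ y :: l ∧ y.2.cls = .win b ∧ l.length = i := by
  rw [isContentPos_iff]
  constructor
  · rintro ⟨y, b, h1, h2⟩
    obtain ⟨hi, h3⟩ := List.getElem?_eq_some_iff.1 h1
    refine ⟨((segs ν).flatten.drop (i + 1)).reverse, y, ((segs ν).flatten.take i).reverse, b, ?_, h2,
      by rw [List.length_reverse, List.length_take]; omega⟩
    rw [content]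
    conv_lhs => rw [← List.take_append_drop i (segs ν).flatten, List.drop_eq_getElem_cons hi, h3]
    simp [-List.map_flatten]
  · rintro ⟨a, y, l, b, h1, h2, rfl⟩
    refine ⟨y, b, ?_, h2⟩
    have : (segs ν).flatten = l.reverse ++ y :: a.reverse := by
      rw [← List.reverse_reverse (segs ν).flatten]
      change (content ν).reverse = _
      rw [h1]
      simp
    rw [this, List.getElem?_append_right (by simp)]
    simp

section

variable (h : LSeq M.kd ν) (hl : .bas .l :: ls = ν.flatten) (hU : Follows U cf (topConf ls))
include h hl hU

theorem Follows.at {z : List Υ} (hz : z ∈ U.nodes) : At (content ν) z.length (cf z) := by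
  have := steps_at h hl (hU.steps hz)
  rwa [LTree.length_tailLabels] at this

theorem Follows.simple_of_child {x y : List Υ} (hc : U.IsChild x y) (hy : Simple (cf y)) :
    Simple (cf x) := by
  have hx : x ∈ U.nodes := by
    obtain ⟨h1, a, rfl⟩ := hc
    exact U.prefix_closed x a h1
  refine simple_of_succ ?_ (hU.succ x y hc) hy
  rcases hU.at h hl hx with h1 | ⟨md, mk, x', -, l, h1, -⟩
  · exact .inl h1
  · exact .inr ⟨md, mk, x', by rw [h1]⟩

/-- A non-simple child occurs only at an `end2` node. The system controls this node, so the unmarked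
child is present too. -/
theorem Follows.exists_simple_child {z : List Υ} (hz : z ∈ U.nodes) (hs : Simple (cf z)) :
    ∃ z', U.IsChild z z' ∧ Simple (cf z') := by
  obtain ⟨z', hz'⟩ := hU.inf z hz
  rcases simple_succ_cases hs (hU.succ z z' hz') with h1 | ⟨md, mk, y, l, h1, h2, h3, -⟩
  · exact ⟨z', hz', h1⟩
  · obtain ⟨u, hu, e⟩ := hU.sys z hz (by rw [h1]; exact isSys_end2 h2 h3) (.pop md none y.2, l)
      (by rw [h1]; exact (succ_end2 h2 h3).2 (.inl rfl))
    exact ⟨u, hu, by rw [e]; exact h2⟩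

/-- The mark `check3` can be postponed as long as there is a triple below. -/
theorem Follows.exists_modeA {p l : List (Sym M.Cell)} {z : Sym M.Cell} (e : content ν = p ++ z :: l)
    (hl' : ∃ y ∈ l, ∃ b, y.2.cls = .win b) :
    ∃ u ∈ U.nodes, u.length = p.length ∧ cf u = (.pop .A none z.2, l) := by
  induction p using List.reverseRecOn generalizing z l with
  | nil =>
    obtain ⟨fl, e'⟩ := h.topConf hl
    have : z :: l = (fl, .bas .f) :: (topConf ls).2 := by rw [← e']; exact e.symm
    obtain ⟨rfl, rfl⟩ := List.cons.inj this
    exact ⟨[], U.root_mem, rfl, hU.root⟩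
  | append_singleton p z' ih =>
    obtain ⟨y, hy, hb⟩ := hl'
    have e1 : content ν = p ++ z' :: z :: l := by rw [e]; simp
    obtain ⟨u, hu, h1, h2⟩ := ih e1 ⟨y, by simp [hy], hb⟩
    have hs : (game M).Succ (cf u) (.pop .A none z.2, l) := by
      rw [h2]
      by_cases hw : ∃ b, z.2.cls = .win b
      · obtain ⟨b, hw⟩ := hw
        exact (succ_window rfl hw).2 (.inl ⟨rfl, fun hf =>
          (content_isFirst h e hw).1 ⟨y, hy, hb⟩ hf.2, fun hf => by cases hf.1⟩)
      · refine (succ_pop_cons (isFinal_simple rfl _)).2 ⟨none, .A, ?_, rfl⟩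
        generalize z.2.cls = cl at hw
        cases cl <;> first | exact absurd ⟨_, rfl⟩ hw | simp [Mode.next]
    obtain ⟨u', hu', h3⟩ := hU.exists_child_modeA hu h2 hs
    refine ⟨u', hu'.1, ?_, h3⟩
    obtain ⟨-, a, rfl⟩ := hu'
    simp [h1]

omit hU in
theorem content_ne_nil {a : List (Sym M.Cell)} {y : Sym M.Cell} (e : content ν = a ++ y :: l)
    {b : Bool} (hy : y.2.cls = .win b) : a ≠ [] := by
  rintro rfl
  obtain ⟨fl, e'⟩ := h.topConf hl
  have : y :: l = (fl, .bas .f) :: (topConf ls).2 := by rw [← e']; exact e.symm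
  obtain ⟨rfl, -⟩ := List.cons.inj this
  cases hy

/-- Two distinct simple successors differ in a mark at a triple. -/
theorem Follows.tagBranching {x : List Υ} (hx : x ∈ U.nodes) (hs : Simple (cf x))
    {N : Set (List Υ)} (hN : ∀ y, U.IsChild x y → Simple (cf y) → y ∈ N) {y z : List Υ}
    (hy : U.IsChild x y) (hz : U.IsChild x z) (hys : Simple (cf y)) (hzs : Simple (cf z))
    (hyz : y ≠ z) : U.lab x = {.end3} ∧ ∃ p u s y z, ∃ tag, (tag = .check3 ∨ tag = .checkHat3) ∧
      (U.IsChild x y ∧ y ∈ N) ∧ (U.IsChild x z ∧ z ∈ N) ∧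
      U.lab y = {.lam p u s} ∧ U.lab z = {.lam p u s, tag} ∧
      ∀ w, U.IsChild x w → w = y ∨ w = z := by
  have hne : cf y ≠ cf z := fun e => hyz (hU.eq_of_conf hy hz e)
  have h1 := hU.succ x y hy
  have h2 := hU.succ x z hz
  have hlab := hU.lab x hx
  have hch : ∀ w, U.IsChild x w → (game M).Succ (cf x) (cf w) := hU.succ x
  rcases hU.at h hl hx with ⟨b, hb⟩ | ⟨md, mk, x', fl, l, e, e1, hmk⟩
  · have e : cf x = (.sink b, (cf x).2) := Prod.ext hb rfl
    rw [e, succ_sink] at h1 h2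
    exact absurd (h1.trans h2.symm) hne
  · rw [e] at h1 h2 hs hlab
    have hmd : md.isSimple = true := hs
    cases l with
    | nil =>
      rw [succ_pop_nil (isFinal_simple hmd _)] at h1 h2
      exact absurd (h1.trans h2.symm) hne
    | cons a l =>
      by_cases hw : ∃ b, a.2.cls = .win b
      · obtain ⟨b, hb⟩ := hw
        obtain rfl : x' = .bas .end3 := content_win h e1 hb
        obtain rfl : mk = none := by
          rcases hmk with h3 | h3 | ⟨b, h3⟩
          · exact h3
          · cases h3
          · cases h3
        refine ⟨by rw [hlab, game_lab_pop, Letter.mlbl_none]; rfl, ?_⟩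
        obtain ⟨p, u, s, hp⟩ := cls_eq_win hb
        have key : ∀ {k : Mark} {md' : Mode} {y z : List Υ},
            (k = .check3 ∨ k = .checkHat3) → U.IsChild x y → U.IsChild x z → Simple (cf y) →
            Simple (cf z) →
            cf y = (.pop md none a.2, l) → cf z = (.pop md' (some k) a.2, l) →
            (∀ c, (game M).Succ (cf x) c → c = (.pop md none a.2, l) ∨
              c = (.pop md' (some k) a.2, l)) → _ :=
          fun {k md' y z} hk hy hz hys hzs ey ez hc =>
            (⟨p, u, s, y, z, k.prp, by rcases hk with rfl | rfl; exacts [.inl rfl, .inr rfl],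
              ⟨hy, hN y hy hys⟩, ⟨hz, hN z hz hzs⟩,
              by rw [hU.lab _ hy.1, ey, game_lab_pop, hp, Letter.mlbl_none]; rfl,
              by rw [hU.lab _ hz.1, ez, game_lab_pop, hp, Letter.mlbl_some]; rfl,
              fun w hw => (hc _ (hch w hw)).imp (fun e => hU.eq_of_conf hw hy (e.trans ey.symm))
                (fun e => hU.eq_of_conf hw hz (e.trans ez.symm))⟩ :
              ∃ p u s y z, ∃ tag, (tag = .check3 ∨ tag = .checkHat3) ∧
                (U.IsChild x y ∧ y ∈ N) ∧ (U.IsChild x z ∧ z ∈ N) ∧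
                U.lab y = {.lam p u s} ∧ U.lab z = {.lam p u s, tag} ∧
                ∀ w, U.IsChild x w → w = y ∨ w = z)
        have kA : md = .A → ∀ c, (game M).Succ (cf x) c → c = (.pop md none a.2, l) ∨
            c = (.pop .B (some .check3) a.2, l) := by
          rintro rfl c hc'
          rw [e] at hc'
          rcases (succ_window hmd hb).1 hc' with ⟨h3, -⟩ | ⟨h3, -⟩ | ⟨-, h3⟩
          · exact .inl h3
          · exact .inr h3
          · cases h3
        have kC : md = .C → ∀ c, (game M).Succ (cf x) c → c = (.pop md none a.2, l) ∨
            c = (.pop .D (some .checkHat3) a.2, l) := by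
          rintro rfl c hc'
          rw [e] at hc'
          rcases (succ_window hmd hb).1 hc' with ⟨h3, -⟩ | ⟨-, h3⟩ | ⟨h3, -⟩
          · exact .inl h3
          · cases h3
          · exact .inr h3
        rcases (succ_window hmd hb).1 h1 with ⟨h3, -⟩ | ⟨h3, h5⟩ | ⟨h3, h5⟩ <;>
          rcases (succ_window hmd hb).1 h2 with ⟨h4, -⟩ | ⟨h4, h6⟩ | ⟨h4, h6⟩
        · exact absurd (h3.trans h4.symm) hne
        · exact key (.inl rfl) hy hz hys hzs h3 h4 (kA h6)
        · exact key (.inr rfl) hy hz hys hzs h3 h4 (kC h6)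
        · exact key (.inl rfl) hz hy hzs hys h4 h3 (kA h5)
        · exact absurd (h3.trans h4.symm) hne
        · rw [h5] at h6
          cases h6
        · exact key (.inr rfl) hz hy hzs hys h4 h3 (kC h5)
        · rw [h5] at h6
          cases h6
        · exact absurd (h3.trans h4.symm) hne
      -- Where no triple follows, there is only one simple successor: at `end2` the other one is not
      -- simple, and elsewhere the successor is unique.
      · by_cases he : md.isSimple = true ∧ x' = .bas .end2 ∧ a.2.cls = .bit
        · obtain ⟨-, rfl, he⟩ := he
          have hE : ∀ c, (game M).Succ (.pop md mk (.bas .end2), a :: l) c → Simple c →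
              c = (.pop md none a.2, l) := by
            intro c h3 h4
            rcases (succ_end2 hmd he).1 h3 with h5 | h5
            · exact h5
            · rw [h5] at h4
              cases h4
          exact absurd ((hE _ h1 hys).trans (hE _ h2 hzs).symm) hne
        · exact absurd (succ_plain hw he (by rintro ⟨rfl, -⟩; cases hmd) h2 h1) hne

end

end

end PushdownGames

/-! ### The check-tree read off from a strategy -/

namespace PushdownGames

section

variable {M : ATM} {Υ : Type} {U : LTree Υ (Set (Prp M))} {cf : List Υ → Conf M}
  {md : Mode} {mk : Option Mark} {x' : Letter M.Cell} {l : List (Sym M.Cell)} {y' : Sym M.Cell}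
  {ν : List (List (Letter M.Cell))} {ls : List (Letter M.Cell)}

theorem isChild_of_subtreeWithout {T : LTree Υ (Set (Prp M))} {N : Set (List Υ)} {x : List Υ}
    {hx : x ∈ T.nodes} {y z : List Υ} (hc : (T.subtreeWithout N x hx).IsChild y z) :
    T.IsChild (x ++ y) (x ++ z) := by
  obtain ⟨h1, a, rfl⟩ := hc
  exact ⟨h1.1, a, by simp⟩

section

variable (h : LSeq M.kd ν) (hl : .bas .l :: ls = ν.flatten) (hU : Follows U cf (topConf ls))
include h hl hU

theorem Follows.simple_root : Simple (cf []) := by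
  rw [hU.root]
  exact rfl

/-- The simple check-tree of a strategy. -/
abbrev Follows.simple : LTree Υ (Set (Prp M)) :=
  simpleTree U cf (hU.simple_root h hl) fun _ a hx hs => hU.simple_of_child h hl ⟨hx, a, rfl⟩ hs

theorem Follows.simple_isChild {x y : List Υ} :
    (hU.simple h hl).IsChild x y ↔ U.IsChild x y ∧ Simple (cf y) := by
  constructor
  · rintro ⟨⟨h1, h2⟩, a, h3⟩
    exact ⟨⟨h1, a, h3⟩, h2⟩
  · rintro ⟨⟨h1, a, h3⟩, h2⟩
    exact ⟨⟨h1, h2⟩, a, h3⟩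

theorem Follows.simple_isInfinite : (hU.simple h hl).IsInfinite := by
  rintro x ⟨hx, hs⟩
  obtain ⟨y, hy⟩ := hU.exists_simple_child h hl hx hs
  exact ⟨y, (hU.simple_isChild h hl).2 hy⟩

theorem Follows.simple_marking {π : ℕ → List Υ} (hπ : (hU.simple h hl).IsPath π) :
    ∃ i j, IsMarking (lbls (segs ν)) i j ∧
      (fun d => U.lab (π d)) = markedReverse (lbls (segs ν)) i j := by
  refine (srun_topConf h hl).1 ⟨fun n => cf (π n), ?_, fun n => ?_, fun n => ?_⟩
  · exact (congrArg cf hπ.1).trans hU.root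
  · obtain ⟨h1, h2⟩ := (hU.simple_isChild h hl).1 (hπ.2 n)
    exact ⟨hU.succ _ _ h1, h2⟩
  · exact (hU.lab _ (hπ.mem n).1).symm

/-- Each 3-block gets `check3` on some path because the system controls mode `A`: the unmarked
choices can be followed down to the node before its content, and there the mark is a successor. -/
theorem Follows.isSimpleCheckTree : IsSimpleCheckTree (ν.map (List.map Letter.lbl)) (hU.simple h hl) := by
  rw [← lbls_segs]
  refine ⟨fun x y z hy hz => hU.min x y z ((hU.simple_isChild h hl).1 hy).1
    ((hU.simple_isChild h hl).1 hz).1, hU.simple_isInfinite h hl, fun π hπ => ?_, fun i hi => ?_, ?_⟩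
  · obtain ⟨i, j, h1, h2⟩ := hU.simple_marking h hl hπ
    exact ⟨i, j, h1, congrFun h2⟩
  · obtain ⟨a, y, l, b, e, hy, rfl⟩ := isContentPos_content.1 hi
    obtain ⟨a, z, rfl⟩ := (List.eq_nil_or_concat' a).resolve_left (content_ne_nil h hl e hy)
    obtain ⟨u, hu, h1, h2⟩ := hU.exists_modeA h hl (p := a) (z := z) (l := y :: l) (by rw [e]; simp)
      ⟨y, by simp, b, hy⟩
    obtain ⟨u', hu', h3⟩ := hU.exists_child_modeA hu h2 (c := (.pop .B (some .check3) y.2, l))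
      (by rw [h2]; exact (succ_window rfl hy).2 (.inr (.inl ⟨rfl, rfl⟩)))
    have hS : u' ∈ (hU.simple h hl).nodes := ⟨hu'.1, by rw [h3]; exact rfl⟩
    obtain ⟨π, hπ, h4⟩ := (hU.simple_isInfinite h hl).exists_path hS
    obtain ⟨i, j, h5, h6⟩ := hU.simple_marking h hl hπ
    have hlen : u'.length = (a ++ [z]).length := by
      obtain ⟨-, b, rfl⟩ := hu'
      simp [h1]
    have h7 := congrFun h6 u'.length
    rw [hlen, markedReverse_at e h5.ne, ← hlen, h4, hU.lab _ hu'.1, h3, game_lab_pop] at h7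
    obtain ⟨-, h8⟩ := Letter.mlbl_inj.1 h7
    -- On the path through `u'` the mark `check3` sits at this node, and a path carries this mark
    -- only at its position `i`.
    obtain rfl : l.length = i := by
      unfold markAt at h8
      by_contra hi
      rw [if_neg hi] at h8
      split_ifs at h8
      cases h8
    exact ⟨π, j, hπ, h5, congrFun h6⟩
  · rintro x ⟨hx, hs⟩ ⟨y, z, hy, hz, hyz⟩
    rw [hU.simple_isChild h hl] at hy hz
    obtain ⟨h1, p, u, s, y, z, tag, htag, ⟨hy, hy'⟩, ⟨hz, hz'⟩, h2, h3, h4⟩ :=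
      hU.tagBranching h hl hx hs (N := {w | Simple (cf w)}) (fun _ _ h => h) hy.1 hz.1 hy.2 hz.2 hyz
    have h5 : IsTagBranching (hU.simple h hl) tag x :=
      ⟨h1, p, u, s, y, z, (hU.simple_isChild h hl).2 ⟨hy, hy'⟩, (hU.simple_isChild h hl).2 ⟨hz, hz'⟩,
        h2, h3, fun w hw => h4 w ((hU.simple_isChild h hl).1 hw).1⟩
    rcases htag with rfl | rfl
    · exact .inl h5
    · exact .inr h5

theorem Follows.conf_end2 {x : List Υ} (hx : x ∈ U.nodes) (hlab : U.lab x = {.end2}) :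
    ∃ md y l v w rest, cf x = (.pop md none (.bas .end2), y :: l) ∧ y.2.cls = .bit ∧ L2 v w ∧
      .bas .end2 :: y.2 :: l.map Prod.snd = w.reverse ++ rest ∧
      ((ν.map (List.map Letter.lbl)).flatten.reverse.drop x.length =
        (w.reverse ++ rest).map Letter.lbl) := by
  rw [hU.lab x hx] at hlab
  rcases hU.at h hl hx with ⟨b, hb⟩ | ⟨md, mk, x', fl, l, e, e1, -⟩
  · have e : cf x = (.sink b, (cf x).2) := Prod.ext hb rfl
    rw [e, game_lab_sink] at hlab
    exact absurd hlab.symm (Set.singleton_ne_empty _)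
  · rw [e, game_lab_pop] at hlab
    have : x'.mlbl mk = (Letter.bas Bas.end2 : Letter M.Cell).mlbl none := by
      rw [hlab, Letter.mlbl_none]
      rfl
    obtain ⟨rfl, rfl⟩ := Letter.mlbl_inj.1 this
    obtain ⟨y, l, v, w, rest, rfl, hy, hw, h1⟩ := content_end2 h e1 rfl
    refine ⟨md, y, l, v, w, rest, e, hy, hw, h1, ?_⟩
    rw [← content_map, ← List.map_drop, e1, ← h1]
    simp

/-- The nodes outside the simple part lie below the `check2` children of `end2` nodes. Such a child
exists because the system controls these nodes, and it is unique by minimality. What the environment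
keeps below it is a nonempty part of the runs described by `check_runs`. -/
theorem Follows.isCheckTree : IsCheckTree (ν.map (List.map Letter.lbl)) U := by
  refine ⟨hU.min, hU.simple h hl, hU.isSimpleCheckTree h hl, fun x hx => rfl, ?_, ?_⟩
  · rintro x ⟨hx, hs⟩ hlab y hy
    refine ⟨hy.1, ?_⟩
    rcases simple_succ_cases hs (hU.succ x y hy) with h1 | ⟨md, mk, z, l, h1, -, h2, -⟩
    · exact h1
    · exfalso
      rcases hU.at h hl hx with ⟨b, hb⟩ | ⟨md', mk', x', fl, l', e, e1, h3⟩
      · rw [h1] at hb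
        cases hb
      · rw [h1] at e
        simp only [Prod.mk.injEq, Ctl.pop.injEq] at e
        obtain ⟨⟨rfl, rfl, rfl⟩, rfl⟩ := e
        obtain rfl : mk = none := by
          rcases h3 with h4 | h4 | ⟨b, h4⟩
          · exact h4
          · cases h4
          · cases h4
        apply hlab
        change U.lab x = _
        rw [hU.lab x hx, h1, game_lab_pop, Letter.mlbl_none]
        rfl
  · rintro x ⟨hx, hs⟩
    refine ⟨hx, fun hlab => ?_⟩
    obtain ⟨md, y, l, v, w, rest, e, hy, hw, h1, h2⟩ := hU.conf_end2 h hl hx hlab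
    have hmd : md.isSimple = true := by rw [e] at hs; exact hs
    have hsucc : ∀ c, (game M).Succ (cf x) c ↔
        c = (.pop md none y.2, l) ∨ c = (.pop .E (some .check2) y.2, l) := fun c => by
      rw [e]
      exact succ_end2 hmd hy
    obtain ⟨u, hu, hu'⟩ := hU.sys x hx (by rw [e]; exact isSys_end2 hmd hy) _
      ((hsucc _).2 (.inr rfl))
    have hout : ∀ u, U.IsChild x u → u ∉ (hU.simple h hl).nodes →
        cf u = (.pop .E (some .check2) y.2, l) := by
      intro u hu hn
      rcases (hsucc _).1 (hU.succ x u hu) with h3 | h3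
      · refine absurd ?_ hn
        refine ⟨hu.1, ?_⟩
        rw [h3]
        exact hmd
      · exact h3
    have hu'' : u ∉ (hU.simple h hl).nodes := by
      rintro ⟨-, h3⟩
      rw [hu'] at h3
      cases h3
    refine ⟨⟨u, ⟨hu, hu''⟩, fun z hz => hU.eq_of_conf hz.1 hu ((hout z hz.1 hz.2).trans hu'.symm)⟩,
      w.map Letter.lbl, (Letter.bit v).prp, isBlock2_iff.2 ⟨v, w, rfl, hw, rfl⟩, ?_, ?_, ?_, ?_⟩
    · rw [h2, List.map_append, List.map_reverse]
      exact List.prefix_append _ _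
    · intro a b c hb hc hlab'
      exact List.append_cancel_left (hU.min (x ++ a) (x ++ b) (x ++ c)
        (isChild_of_subtreeWithout hb) (isChild_of_subtreeWithout hc) hlab')
    · rintro z ⟨hz, hz'⟩
      cases z with
      | nil =>
        obtain ⟨hu1, a, rfl⟩ := hu
        refine ⟨[a], ⟨hu1, ?_⟩, a, rfl⟩
        rintro b z' e'
        cases e'
        exact hu''
      | cons a z =>
        obtain ⟨_, hz1, b, rfl⟩ := hU.inf _ hz
        refine ⟨a :: z ++ [b], ⟨by rw [← List.append_assoc]; exact hz1, ?_⟩, b, rfl⟩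
        rintro b' z' e'
        cases e'
        exact hz' a z rfl
    · intro π hπ
      have hch : ∀ n, U.IsChild (x ++ π n) (x ++ π (n + 1)) := fun n =>
        isChild_of_subtreeWithout (hπ.2 n)
      have h0 : x ++ π 0 = x := by rw [hπ.1, List.append_nil]
      have h1' : cf (x ++ π 1) = (.pop .E (some .check2) y.2, l) := by
        have h3 := hch 0
        rw [h0] at h3
        refine hout _ h3 ?_
        obtain ⟨h4, a, h5⟩ := hπ.2 0
        rw [hπ.1] at h5
        rw [h5]
        exact h4.2 a [] h5
      refine (check_runs hw h1).2 ⟨fun n => U.lab (x ++ π (n + 1)),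
        ⟨fun n => cf (x ++ π (n + 1)), h1', fun n => hU.succ _ _ (hch (n + 1)),
          fun n => (hU.lab _ (hch n).1).symm⟩, ?_⟩
      funext d
      cases d with
      | zero =>
        change U.lab (x ++ π 0) = _
        rw [h0]
        exact hlab
      | succ d => rfl

end

end

end PushdownGames

/-! ### Accepting strategy trees are extended tree-codes -/

namespace PushdownGames

section

variable {M : ATM} {Υ : Type} {U : LTree Υ (Set (Prp M))} {cf : List Υ → Conf M} {c₀ : Conf M}

theorem StrategyTree.follows (𝒯 : StrategyTree (game M) Agent.env) :
    Follows 𝒯.toLTree (game M).lst (game M).start where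
  root := rfl
  lab _ _ := rfl
  succ _ _ h := 𝒯.succ_of_isChild h
  inf := 𝒯.isInfinite
  min := 𝒯.isMinimal fun _ _ _ => succ_det
  sys x hx h c hc := ⟨x ++ [c], ⟨𝒯.system x hx ((passive_env_iff _).2 h) c hc, c, rfl⟩,
    StrategyTree.lst_snoc ..⟩

/-- The initial configuration is a parameter of `Follows` so that check-subtrees, which begin at a
full stack, are covered. -/
theorem Follows.subtree (hU : Follows U cf c₀) {x : List Υ} (hx : x ∈ U.nodes) :
    Follows (U.subtree x hx) (fun z => cf (x ++ z)) (cf x) where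
  root := by rw [List.append_nil]
  lab z hz := hU.lab _ hz
  succ y z h := hU.succ _ _ ((LTree.subtree_isChild hx).1 h)
  inf z hz := by
    obtain ⟨_, h, a, rfl⟩ := hU.inf (x ++ z) hz
    rw [List.append_assoc] at h
    exact ⟨z ++ [a], h, a, rfl⟩
  min a b c hb hc h := List.append_cancel_left (hU.min _ _ _ ((LTree.subtree_isChild hx).1 hb)
    ((LTree.subtree_isChild hx).1 hc) h)
  sys z hz h c hc := by
    obtain ⟨_, ⟨h1, a, rfl⟩, h2⟩ := hU.sys (x ++ z) hz h c hc
    rw [List.append_assoc] at h1 h2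
    exact ⟨z ++ [a], ⟨h1, a, rfl⟩, h2⟩

theorem gsteps_det {c c₁ c₂ : Conf M} {w : Word M} (h₁ : GSteps c w c₁) (h₂ : GSteps c w c₂) :
    c₁ = c₂ :=
  steps_det (R := (game M).Succ) (fun _ _ _ a b e => succ_det a b e) h₁ h₂

theorem topConf_lab (ls : List (Letter M.Cell)) : (game M).lab (topConf ls) = {Prp.f} :=
  (game_lab_pop ..).trans (Letter.mlbl_none _)

/-- At each node, either codes are still generated, or the stack is being read. -/
theorem Follows.node_cases (hU : Follows U cf (game M).start) {x : List Υ} (hx : x ∈ U.nodes) :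
    ((cf x).1.isGen = true ∧ U.lab x ≠ {.f}) ∨ ∃ y z ls ν, x = y ++ z ∧ U.lab y = {.f} ∧
      .bas .l :: ls = ν.flatten ∧ LSeq M.kd ν ∧ U.tailLabels y = ls.map Letter.lbl ∧
      cf y = topConf ls := by
  rcases steps_start (hU.steps hx) with ⟨h1, -⟩ | ⟨ls, w', h1, h2, h3⟩
  · refine .inl ⟨h1, fun h => Ctl.letter_ne_f h1 ?_⟩
    rw [hU.lab x hx] at h
    exact Letter.lbl_inj.1 ((game_lab_gen h1 (cf x).2).symm.trans h)
  · right
    have hlen : ls.length ≤ x.length := by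
      rw [← U.length_tailLabels x, h2]
      simp
    obtain ⟨y, z, rfl, hy⟩ : ∃ y z, x = y ++ z ∧ y.length = ls.length :=
      ⟨x.take ls.length, x.drop ls.length, (List.take_append_drop ..).symm, by
        rw [List.length_take]; omega⟩
    have hyU : y ∈ U.nodes := LTree.mem_of_append z hx
    have h4 : U.tailLabels y = ls.map Letter.lbl := by
      rw [LTree.tailLabels_append U hyU] at h2
      exact (List.append_inj h2 (by
        rw [LTree.length_tailLabels, List.length_map, hy])).1
    have h5 := hU.steps hyU
    rw [h4] at h5
    -- The labels up to `y` form a complete generated word, so by determinism reading begins at `y`.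
    have h6 := gsteps_det h5 (steps_topConf h1)
    obtain ⟨ν, hν, h7⟩ := (gen_seq ls).1 h1
    exact ⟨y, z, ls, ν, rfl, by rw [hU.lab y hyU, h6, topConf_lab], hν, h7, h4, h6⟩

/-- The part of a tree up to the first `{f}`-nodes. -/
def upper (U : LTree Υ (Set (Prp M))) : LTree Υ (Set (Prp M)) where
  nodes := {x | x ∈ U.nodes ∧ ∀ y z, x = y ++ z → z ≠ [] → U.lab y ≠ {.f}}
  lab := U.lab
  root_mem := ⟨U.root_mem, fun y z h hz => absurd (List.append_eq_nil_iff.1 h.symm).2 hz⟩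
  prefix_closed x a h := ⟨U.prefix_closed x a h.1, fun y z e hz =>
    h.2 y (z ++ [a]) (by rw [e, List.append_assoc]) (by simp)⟩

theorem upper_isChild {x y : List Υ} : (upper U).IsChild x y ↔
    x ∈ (upper U).nodes ∧ U.lab x ≠ {.f} ∧ U.IsChild x y := by
  constructor
  · rintro ⟨h, a, rfl⟩
    exact ⟨(upper U).prefix_closed x a h, h.2 x [a] rfl (by simp), h.1, a, rfl⟩
  · rintro ⟨h1, h2, h3, a, rfl⟩
    refine ⟨⟨h3, fun y z e hz => ?_⟩, a, rfl⟩
    obtain ⟨z, b, rfl⟩ := (List.eq_nil_or_concat' z).resolve_left hz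
    rw [← List.append_assoc] at e
    obtain ⟨rfl, -⟩ := List.append_inj' e rfl
    by_cases hz' : z = []
    · subst hz'
      rw [List.append_nil] at h2
      exact h2
    · exact h1.2 y z rfl hz'

theorem upper_isLeaf (hU : U.IsInfinite) {x : List Υ} (hx : x ∈ (upper U).nodes) :
    (upper U).IsLeaf x ↔ U.lab x = {.f} := by
  constructor
  · rintro ⟨-, h⟩
    by_contra hf
    obtain ⟨y, hy⟩ := hU x hx.1
    exact h y (upper_isChild.2 ⟨hx, hf, hy⟩)
  · intro hf
    exact ⟨hx, fun y hy => (upper_isChild.1 hy).2.1 hf⟩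

theorem Follows.upper_leaf (hU : Follows U cf (game M).start) {x : List Υ}
    (hx : x ∈ (upper U).nodes) (hf : U.lab x = {.f}) : ∃ ls ν, .bas .l :: ls = ν.flatten ∧
      LSeq M.kd ν ∧ (ν.map (List.map Letter.lbl)).flatten = U.pathLabels x ∧ cf x = topConf ls := by
  rcases hU.node_cases hx.1 with ⟨-, h⟩ | ⟨y, z, ls, ν, rfl, h1, h2, h3, h4, h5⟩
  · exact absurd hf h
  · obtain rfl : z = [] := by
      by_contra hz
      exact hx.2 y z rfl hz h1
    rw [List.append_nil] at hf ⊢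
    refine ⟨ls, ν, h2, h3, ?_, h5⟩
    rw [← List.map_flatten, ← h2, LTree.pathLabels_eq, h4, hU.lab _ U.root_mem, hU.root, start_lab]
    rfl

/-- Finiteness follows from König's lemma: an infinite path in the upper part would avoid `f`,
contrary to acceptance. At an `all` node both children are present because the system controls it.
-/
theorem Follows.isTreeCode (hU : Follows U cf (game M).start) (hacc : IsAccepting U)
    (hfin : ∀ x, {y | U.IsChild x y}.Finite) : IsTreeCode (upper U) := by
  refine ⟨LTree.finite_of_forall_not_isPath (fun x _ => (hfin x).subset fun y hy =>
      (upper_isChild.1 hy).2.2) fun π hπ => ?_, fun x y z hy hz => hU.min x y z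
      (upper_isChild.1 hy).2.2 (upper_isChild.1 hz).2.2, ?_, fun x hx => ?_, fun x hx => ?_,
      fun x hx hlab => ?_⟩
  · obtain ⟨n, hn⟩ := hacc π ⟨hπ.1, fun n => (upper_isChild.1 (hπ.2 n)).2.2⟩
    exact (upper_isChild.1 (hπ.2 n)).2.1 hn
  · exact (hU.lab _ U.root_mem).trans (by rw [hU.root, start_lab])
  · obtain ⟨ls, ν, -, h1, h2, -⟩ := hU.upper_leaf hx.1 ((upper_isLeaf hU.inf hx.1).1 hx)
    exact ⟨_, isCodeSeq_iff.2 ⟨ν, h1.1, rfl⟩, h2⟩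
  · exact (upper_isLeaf hU.inf hx).symm
  · have hlab' : U.lab x = {.all} := hlab
    have hf : U.lab x ≠ {.f} := by rw [hlab']; simp
    rcases hU.node_cases hx.1 with ⟨hg, -⟩ | ⟨y, z, ls, ν, rfl, h1, -⟩
    · have hl : (cf x).1.letter = .bas .all := by
        rw [hU.lab x hx.1] at hlab'
        exact Letter.lbl_inj.1 ((game_lab_gen hg (cf x).2).symm.trans hlab')
      have hsys := (Ctl.isSys_gen hg (cf x).2.head?).2 hl
      obtain ⟨fst, hq⟩ : ∃ fst, (cf x).1 = .clos true fst := by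
        generalize (cf x).1 = q at hsys hg
        cases q with
        | clos b fst =>
          obtain rfl : b = true := hsys
          exact ⟨fst, rfl⟩
        | pop => cases hg
        | _ => cases hsys
      have hs : ∀ c, (game M).Succ (cf x) c ↔ _ := fun c => succ_gen_iff (l := (cf x).2) hg (c := c)
      have hs' : ∀ c, (game M).Succ (cf x) c ↔ ∃ b, c = (.tag b false, (fst, .bas .all) :: (cf x).2) := by
        intro c
        rw [hs c, hq]
        constructor
        · rintro ⟨a, q₁, h1, rfl⟩
          cases a <;> simp [Ctl.next] at h1
          split_ifs at h1 <;> cases h1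
          · exact ⟨false, rfl⟩
          · exact ⟨true, rfl⟩
        · rintro ⟨b, rfl⟩
          cases b
          · exact ⟨.bas .l, _, rfl, rfl⟩
          · exact ⟨.bas .r, _, rfl, rfl⟩
      obtain ⟨y, hy, ey⟩ := hU.sys x hx.1 hsys _ ((hs' _).2 ⟨false, rfl⟩)
      obtain ⟨z, hz, ez⟩ := hU.sys x hx.1 hsys _ ((hs' _).2 ⟨true, rfl⟩)
      refine ⟨y, z, upper_isChild.2 ⟨hx, hf, hy⟩, upper_isChild.2 ⟨hx, hf, hz⟩, ?_, ?_, fun w hw => ?_⟩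
      · refine (hU.lab y hy.1).trans ?_
        rw [ey]
        exact game_lab_gen (q := .tag false false) rfl _
      · refine (hU.lab z hz.1).trans ?_
        rw [ez]
        exact game_lab_gen (q := .tag true false) rfl _
      · have hw' := (upper_isChild.1 hw).2.2
        obtain ⟨b, hb⟩ := (hs' _).1 (hU.succ x w hw')
        cases b
        · exact .inl (hU.eq_of_conf hw' hy (hb.trans ey.symm))
        · exact .inr (hU.eq_of_conf hw' hz (hb.trans ez.symm))
    · by_cases hz : z = []
      · subst hz
        rw [List.append_nil] at hf
        exact absurd h1 hf
      · exact absurd h1 (hx.2 y z rfl hz)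

/-- Accepting strategy trees are extended tree-codes. -/
theorem Follows.isExtendedTreeCode (hU : Follows U cf (game M).start) (hacc : IsAccepting U)
    (hfin : ∀ x, {y | U.IsChild x y}.Finite) : IsExtendedTreeCode U := by
  refine ⟨hU.min, upper U, hU.isTreeCode hacc hfin, fun _ _ => rfl, fun x hx hl y hy => ?_,
    fun x hx => ⟨hx.1, fun hl => ?_⟩⟩
  · rw [upper_isLeaf hU.inf hx] at hl
    exact (upper_isChild.2 ⟨hx, hl, hy⟩).1
  · obtain ⟨ls, ν, h1, h2, h3, h4⟩ := hU.upper_leaf hx ((upper_isLeaf hU.inf hx).1 hl)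
    have hU' := hU.subtree hx.1
    rw [h4] at hU'
    exact ⟨_, isCodeSeq_iff.2 ⟨ν, h2.1, rfl⟩, h3, hU'.isCheckTree h2 h1⟩

end

end PushdownGames

namespace PushdownGames

/-! ## Check-trees are strategies -/

theorem LTree.tailLabels_congr {Υ A : Type} {T T' : LTree Υ A} {x : List Υ} (hx : x ∈ T'.nodes)
    (h : ∀ x ∈ T'.nodes, T.lab x = T'.lab x) : T.tailLabels x = T'.tailLabels x := by
  induction x using List.reverseRecOn with
  | nil => rfl
  | append_singleton x a ih =>
    rw [tailLabels_snoc, tailLabels_snoc, ih (T'.prefix_closed x a hx), h _ hx]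

section

variable {M : ATM} {Υ : Type}

/-- The node `x`, which is reached from `c₀`, has the successors of a node of a strategy tree. -/
def Closed (U : LTree Υ (Set (Prp M))) (c₀ : Conf M) (x : List Υ) : Prop :=
  (∃ y, U.IsChild x y) ∧ ∃ c, GSteps c₀ (U.tailLabels x) c ∧
    (c.1.isSys c.2.head? = true → ∀ c', (game M).Succ c c' →
      ∃ y, U.IsChild x y ∧ U.lab y = (game M).lab c')

variable {U T : LTree Υ (Set (Prp M))} {ν : List (List (Letter M.Cell))} {ls : List (Letter M.Cell)}
  {x : List Υ} {c : Conf M}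

theorem IsMarking.lt {ν : List (Word M)} {i k : ℕ} {j : Option ℕ} (h : IsMarking ν i j)
    (hj : j = some k) : k < i := by
  rcases h.2 with ⟨-, rfl⟩ | ⟨k', i', h1, rfl, -, h2⟩
  · cases hj
  · cases hj
    exact h2.2.trans_le h1.1

section

variable (h : LSeq M.kd ν) (hl : .bas .l :: ls = ν.flatten)
include h hl

/-- The label of the successor in mode `A` below which the triple at `i` gets the mark. -/
theorem exists_child_of_modeA (hT : IsSimpleCheckTree (ν.map (List.map Letter.lbl)) T)
    (hx : x ∈ T.nodes) {a l l₂ a₂ : List (Sym M.Cell)} {y₀ y y₂ : Sym M.Cell}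
    (e : content ν = a ++ y₀ :: y :: l) (hlen : a.length = x.length)
    (hlab : {Prp.f} :: T.tailLabels x = (a ++ [y₀]).map fun y => y.2.lbl)
    (e₂ : content ν = a₂ ++ y₂ :: l₂) {b : Bool} (hy₂ : y₂.2.cls = .win b)
    (hle : l₂.length ≤ l.length) :
    ∃ z, T.IsChild x z ∧ T.lab z =
      y.2.mlbl (if l.length = l₂.length then some .check3 else none) := by
  obtain ⟨hmin, -, -, h2, -⟩ := hT
  rw [← lbls_segs] at h2
  obtain ⟨π, j, hπ, hm, hL⟩ := h2 _ (isContentPos_content.2 ⟨a₂, y₂, l₂, b, e₂, hy₂, rfl⟩)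
  -- The mark `checkHat3` lies strictly below `check3`, so at these heights only `check3` can occur.
  have hmark : ∀ n, l.length ≤ n → markAt l₂.length j n =
      if n = l₂.length then some .check3 else none := by
    intro n hn
    unfold markAt
    congr 1
    rw [if_neg]
    intro hj
    have := hm.lt hj.symm
    omega
  -- The path that marks the chosen triple has no marks so far. It shares its labels with the path
  -- to `x`, and by minimality it passes through `x`.
  have hpre : T.tailLabels (π x.length) = T.tailLabels x := by
    suffices hsuf : ({Prp.f} : Set (Prp M)) :: T.tailLabels (π x.length) =
        {Prp.f} :: T.tailLabels x from (List.cons.inj hsuf).2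
    rw [hlab, hπ.tailLabels]
    have h0 : T.lab (π 0) = {Prp.f} := by
      obtain ⟨fl, e'⟩ := h.topConf hl
      have e' : content ν = [] ++ (fl, .bas .f) :: (topConf ls).2 := e'
      have e3 : (topConf ls).2.length + 1 = a.length + (l.length + 2) := by
        have := congrArg List.length (e'.symm.trans e)
        simpa using this
      have := hL 0
      rw [show 0 = ([] : List (Sym M.Cell)).length from rfl, markedReverse_at e' hm.ne,
        hmark _ (by omega), if_neg (by omega), Letter.mlbl_none] at this
      exact this
    rw [← h0]
    have : (T.lab (π 0) :: (List.range x.length).map fun k => T.lab (π (k + 1))) =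
        (List.range (x.length + 1)).map fun k => T.lab (π k) := by
      rw [List.range_succ_eq_map]
      simp [Function.comp_def]
    rw [this]
    apply List.ext_getElem
    · simp [hlen]
    · intro d hd hd'
      rw [List.getElem_map, List.getElem_range, List.getElem_map, hL]
      have hd'' : d < (a ++ [y₀]).length := by simpa using hd'
      have e4 : content ν = (a ++ [y₀]).take d ++ (a ++ [y₀])[d] ::
          ((a ++ [y₀]).drop (d + 1) ++ y :: l) := by
        rw [← List.cons_append, ← List.append_assoc, List.getElem_cons_drop, List.take_append_drop, e]
        simp
      have e5 : ((a ++ [y₀]).take d).length = d := by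
        rw [List.length_take]
        omega
      have := markedReverse_at e4 hm.ne
      rw [e5] at this
      rw [this, hmark, if_neg, Letter.mlbl_none]
      all_goals
        simp only [List.length_append, List.length_cons]
        omega
  have hnode := LTree.eq_of_tailLabels hmin (hπ.mem _) hx hpre
  refine ⟨π (x.length + 1), ?_, ?_⟩
  · have := hπ.2 x.length
    rwa [hnode] at this
  · have e6 : content ν = (a ++ [y₀]) ++ y :: l := by rw [e]; simp
    have := markedReverse_at e6 hm.ne
    rw [hL, ← hmark _ le_rfl, ← this]
    simp [hlen]

/-- The runs along a simple check-tree. -/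
theorem exists_simple_run (hT : IsSimpleCheckTree (ν.map (List.map Letter.lbl)) T)
    (hx : x ∈ T.nodes) : ∃ c, GSteps (topConf ls) (T.tailLabels x) c ∧ Simple c ∧
      (game M).lab c = T.lab x ∧
      ∃ y c', T.IsChild x y ∧ (game M).Succ c c' ∧ Simple c' ∧ (game M).lab c' = T.lab y := by
  obtain ⟨π, hπ, e⟩ := hT.2.1.exists_path hx
  obtain ⟨i, j, hm, hL⟩ := hT.2.2.1 π hπ
  rw [← lbls_segs] at hm hL
  obtain ⟨cs, h0, h1, h2⟩ := (srun_topConf h hl).2 ⟨i, j, hm, rfl⟩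
  have h2' : ∀ n, (game M).lab (cs n) = T.lab (π n) := fun n => (h2 n).trans (hL n).symm
  have hs : ∀ n, Simple (cs n) := by
    intro n
    cases n with
    | zero =>
      rw [h0]
      exact rfl
    | succ n => exact (h1 n).2
  have h3 := steps_of_seq (fun n => (h1 n).1) h2' x.length
  rw [h0, ← hπ.tailLabels, e] at h3
  refine ⟨cs x.length, h3, hs _, by rw [h2', e], π (x.length + 1), cs (x.length + 1), ?_, (h1 _).1,
    hs _, h2' _⟩
  have := hπ.2 x.length
  rwa [e] at this

end

/-- Outside the simple part all choices, namely those of `check1`, belong to the environment. -/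
theorem not_isSys_of_not_simple {F : List (Sym M.Cell)} {n : ℕ} (h : At F n c) (hs : ¬ Simple c) :
    ¬ c.1.isSys c.2.head? = true := by
  intro hsys
  rcases h with ⟨b, hb⟩ | ⟨md, mk, x, fl, l, rfl, -⟩
  · rw [hb] at hsys
    cases hsys
  · obtain ⟨y, l', rfl, ⟨rfl, -⟩ | ⟨h1, -⟩⟩ := isSys_pop hsys
    · exact hs rfl
    · exact hs h1

section

variable (h : LSeq M.kd ν) (hl : .bas .l :: ls = ν.flatten)
include h hl

/-- The runs along a partial check 2-block-tree. -/
theorem exists_check_run {V : LTree Υ (Set (Prp M))} {bl : Word M} {p : Prp M}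
    (hbl : IsBlock2 p bl) {n : ℕ}
    (hpre : bl.reverse <+: (ν.map (List.map Letter.lbl)).flatten.reverse.drop n)
    (hV : IsPartialCheckTwoTree bl V) {w : Word M} {md : Mode} {y : Sym M.Cell}
    {l : List (Sym M.Cell)} {mk : Option Mark}
    (hs : GSteps (topConf ls) w (.pop md mk (.bas .end2), y :: l)) (hw : w.length = n)
    (hmd : md.isSimple = true) (hy : y.2.cls = .bit)
    {v : List Υ} (hv : v ∈ V.nodes) (hne : v ≠ []) :
    ∃ c, GSteps (topConf ls) (w ++ V.tailLabels v) c ∧ ¬ Simple c ∧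
      ∃ a v', v = a :: v' ∧ V.lab [a] = y.2.mlbl (some .check2) := by
  obtain ⟨π, hπ, e⟩ := hV.2.1.exists_path hv
  obtain ⟨vb, w', rfl, hw', rfl⟩ := isBlock2_iff.1 hbl
  -- The labels that remain after depth `n` are those of the stack, and distinct letters have
  -- distinct labels. So the reversed 2-block lies on the stack, beginning with the present `end2`.
  obtain ⟨rest, e1⟩ : ∃ rest, .bas .end2 :: y.2 :: l.map Prod.snd = w'.reverse ++ rest := by
    rcases steps_at h hl hs with ⟨b, hb⟩ | ⟨md', mk', x', fl, l', h1, h2, -⟩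
    · cases hb
    · simp only [Prod.mk.injEq, Ctl.pop.injEq] at h1
      obtain ⟨⟨rfl, rfl, rfl⟩, rfl⟩ := h1
      obtain ⟨r, hr⟩ := hpre
      rw [← content_map, ← List.map_drop, ← hw, h2, ← List.map_reverse] at hr
      have e2 : ((fl, .bas .end2) :: y :: l).map (fun y : Sym M.Cell => y.2.lbl) =
          ((.bas .end2 :: y.2 :: l.map Prod.snd).map Letter.lbl) := by simp
      rw [e2] at hr
      obtain ⟨l₁, l₂, h3, h4, -⟩ := List.map_eq_append_iff.1 hr.symm
      have := Letter.lbl_injective.list_map h4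
      subst this
      exact ⟨l₂, h3⟩
  obtain ⟨L', ⟨cs, h0, h1, h2⟩, h3⟩ := (check_runs hw' e1).1 (hV.2.2 π hπ)
  have h4 : ∀ n, (game M).lab (cs n) = V.lab (π (n + 1)) := fun n =>
    (h2 n).trans (congrFun h3 (n + 1)).symm
  have hsucc : (game M).Succ (.pop md mk (.bas .end2), y :: l) (cs 0) := by
    rw [h0]
    exact (succ_end2 hmd hy).2 (.inr rfl)
  have hst : ∀ n, GSteps (topConf ls) (w ++ V.tailLabels (π (n + 1))) (cs n) := by
    intro n
    induction n with
    | zero =>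
      refine steps_append.2 ⟨_, hs, ?_⟩
      rw [hπ.tailLabels]
      exact steps_cons.2 ⟨_, hsucc, h4 0, .nil _⟩
    | succ n ih =>
      rw [hπ.tailLabels] at ih ⊢
      rw [List.range_succ, List.map_append, ← List.append_assoc]
      exact steps_snoc.2 ⟨_, ih, h1 n, h4 (n + 1)⟩
  -- The run begins in mode `E`, and the simple part cannot be entered again.
  have hns : ∀ n, ¬ Simple (cs n) := by
    intro n
    induction n with
    | zero =>
      rw [h0]
      intro h
      cases h
    | succ n ih =>
      refine fun hc => ih (simple_of_succ ?_ (h1 n) hc)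
      rcases steps_at h hl (hst n) with h5 | ⟨md, mk, x', -, l, h5, -⟩
      · exact .inl h5
      · exact .inr ⟨md, mk, x', by rw [h5]⟩
  obtain ⟨a, v, rfl⟩ := List.exists_cons_of_ne_nil hne
  have h5 := hst v.length
  rw [show v.length + 1 = (a :: v).length from rfl, e] at h5
  refine ⟨_, h5, hns _, a, v, rfl, ?_⟩
  have h6 : π 1 = [a] := by
    have h7 := hπ.prefix_of_le (m := 1) (n := (a :: v).length) (by simp)
    rw [e] at h7
    have h8 := hπ.length 1
    obtain ⟨b, hb⟩ := List.length_eq_one_iff.1 h8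
    rw [hb] at h7 ⊢
    rw [(List.cons_prefix_cons.1 h7).1]
  rw [← h6, ← h4 0, h0, game_lab_pop]

end

end

end PushdownGames

/-! ### Completeness of check-trees at the nodes of the system -/

namespace PushdownGames

section

variable {M : ATM} {Υ : Type} {U : LTree Υ (Set (Prp M))} {ν : List (List (Letter M.Cell))}
  {ls : List (Letter M.Cell)} {x : List Υ} {c : Conf M}

variable (h : LSeq M.kd ν) (hl : .bas .l :: ls = ν.flatten)
include h hl

theorem end2_conf {w : Word M} (hs : GSteps (topConf ls) w c) (hc : Simple c)
    (hlab : (game M).lab c = {.end2}) : ∃ md y l, c = (.pop md none (.bas .end2), y :: l) ∧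
      md.isSimple = true ∧ y.2.cls = .bit := by
  rcases steps_at h hl hs with ⟨b, hb⟩ | ⟨md, mk, x', fl, l, rfl, e1, -⟩
  · have e : c = (.sink b, c.2) := Prod.ext hb rfl
    rw [e, game_lab_sink] at hlab
    exact absurd hlab.symm (Set.singleton_ne_empty _)
  · rw [game_lab_pop] at hlab
    have : x'.mlbl mk = (Letter.bas Bas.end2 : Letter M.Cell).mlbl none := by
      rw [hlab, Letter.mlbl_none]
      rfl
    obtain ⟨rfl, rfl⟩ := Letter.mlbl_inj.1 this
    obtain ⟨y, l, v, w, rest, rfl, hy, hw, h1⟩ := content_end2 h e1 rfl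
    exact ⟨md, y, l, rfl, hc, hy⟩

/-- The demand that every 3-block be marked on some path supplies both children at a triple in mode
`A`: one path marks this triple, and a path that marks a lower triple passes it unmarked. At an
`end2` node one child comes from the simple check-tree and the other from the added partial check
2-block-tree. -/
theorem IsCheckTree.closed (hU : IsCheckTree (ν.map (List.map Letter.lbl)) U) (hx : x ∈ U.nodes) :
    Closed U (topConf ls) x := by
  obtain ⟨hmin, T, hT, hlab, hin, hend⟩ := hU
  have hsub : ∀ z ∈ T.nodes, z ∈ U.nodes := fun z hz => (hend z hz).1
  have hch : ∀ y z, T.IsChild y z → U.IsChild y z := fun y z hz => ⟨hsub z hz.1, hz.2⟩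
  have htail : ∀ z ∈ T.nodes, U.tailLabels z = T.tailLabels z := fun z hz =>
    LTree.tailLabels_congr hz hlab
  have hcases : x ∈ T.nodes ∨ ∃ v v', x = v ++ v' ∧ v' ≠ [] ∧ ∃ (hv : v ∈ T.nodes),
      T.lab v = {.end2} ∧ v' ∈ (U.subtreeWithout T.nodes v (hsub v hv)).nodes := by
    induction x using List.reverseRecOn with
    | nil => exact .inl T.root_mem
    | append_singleton z a ih =>
      rcases ih (U.prefix_closed z a hx) with hz | ⟨v, v', rfl, hne, hv, h1, h2⟩
      · by_cases hza : z ++ [a] ∈ T.nodes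
        · exact .inl hza
        · refine .inr ⟨z, [a], rfl, by simp, hz, ?_, hx, ?_⟩
          · by_contra hz'
            exact hza (hin z hz hz' _ ⟨hx, a, rfl⟩)
          · rintro b z' e
            cases e
            exact hza
      · refine .inr ⟨v, v' ++ [a], by simp, by simp, hv, h1, ?_, ?_⟩
        · rw [← List.append_assoc]
          exact hx
        · obtain ⟨b, v', rfl⟩ := List.exists_cons_of_ne_nil hne
          rintro b' z' e
          cases e
          exact h2.2 b v' rfl
  rcases hcases with hxT | ⟨v, v', rfl, hne, hv, h1, h2⟩
  · obtain ⟨c, hs, hc, hclab, y, c₁, hy, hc1, hc1s, hylab⟩ := exists_simple_run h hl hT hxT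
    rw [← htail x hxT] at hs
    refine ⟨⟨y, hch x y hy⟩, c, hs, fun hsys c' hc' => ?_⟩
    rcases steps_at h hl hs with ⟨b, hb⟩ | ⟨md, mk, x', fl, l, rfl, e1, hmk⟩
    · rw [hb] at hsys
      cases hsys
    · obtain ⟨z, l, rfl, ⟨rfl, ⟨b, hb⟩, hf⟩ | ⟨hmd, rfl, hz⟩⟩ := isSys_pop hsys
      · obtain ⟨rfl, a, y₀, e2, h3, -, h4⟩ := steps_modeA h hl hs
        rw [htail x hxT] at h4 h3
        rw [LTree.length_tailLabels] at h3
        have e3 : content ν = (a ++ [y₀]) ++ z :: l := by rw [e2]; simp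
        have main : ∀ m, (m = none ∨ m = some .check3) →
            ∃ y, T.IsChild x y ∧ T.lab y = z.2.mlbl m := by
          rintro m (rfl | rfl)
          -- The system controls the node, so this is not the leftmost triple and some triple `u`
          -- lies below. The path that marks `u` leaves the present triple unmarked.
          · obtain ⟨u, hu, b', hb'⟩ := (content_isFirst h e3 hb).2 hf
            obtain ⟨l₁, l₂, rfl⟩ := List.append_of_mem hu
            obtain ⟨y, hy, hy'⟩ := exists_child_of_modeA h hl hT hxT e2 h3 h4
              (a₂ := a ++ [y₀] ++ z :: l₁) (y₂ := u) (l₂ := l₂) (by rw [e3]; simp) hb' (by simp; omega)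
            rw [if_neg (by simp; omega)] at hy'
            exact ⟨y, hy, hy'⟩
          · obtain ⟨y, hy, hy'⟩ := exists_child_of_modeA h hl hT hxT e2 h3 h4 e3 hb le_rfl
            rw [if_pos rfl] at hy'
            exact ⟨y, hy, hy'⟩
        rcases (succ_window rfl hb).1 hc' with ⟨rfl, -⟩ | ⟨rfl, -⟩ | ⟨-, h5⟩
        · obtain ⟨y, hy, hy'⟩ := main none (.inl rfl)
          exact ⟨y, hch x y hy, by rw [hlab y hy.1, hy', game_lab_pop]⟩
        · obtain ⟨y, hy, hy'⟩ := main (some .check3) (.inr rfl)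
          exact ⟨y, hch x y hy, by rw [hlab y hy.1, hy', game_lab_pop]⟩
        · cases h5
      · obtain rfl : mk = none := by
          rcases hmk with h3 | h3 | ⟨b, h3⟩
          · exact h3
          · cases h3
          · cases h3
        rcases (succ_end2 hmd hz).1 hc' with rfl | rfl
        -- The child in the simple check-tree must be the unmarked one, since the other successor is
        -- not simple.
        · rcases (succ_end2 hmd hz).1 hc1 with rfl | rfl
          · exact ⟨y, hch x y hy, by rw [hlab y hy.1, hylab]⟩
          · cases hc1s
        · have hx2 : T.lab x = {.end2} := by
            rw [← hclab, game_lab_pop, Letter.mlbl_none]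
            rfl
          obtain ⟨hxU, hend'⟩ := hend x hxT
          obtain ⟨-, bl, p, hbl, hpre, hV⟩ := hend' hx2
          obtain ⟨u, ⟨hu, a, e⟩⟩ := hV.2.1 [] (LTree.root_mem _)
          obtain ⟨-, -, -, a', v', e', hlab'⟩ := exists_check_run h hl hbl hpre hV hs
            (U.length_tailLabels x) hmd hz hu (by rw [e]; simp)
          rw [e] at e'
          obtain ⟨rfl, -⟩ := List.cons.inj e'
          rw [e] at hu
          refine ⟨x ++ [a], ⟨hu.1, a, rfl⟩, ?_⟩
          rw [game_lab_pop]
          exact hlab'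
  · obtain ⟨c, hs, hc, hclab, -⟩ := exists_simple_run h hl hT hv
    rw [← htail v hv] at hs
    rw [h1] at hclab
    obtain ⟨md, y, l, rfl, hmd, hy⟩ := end2_conf h hl hs hc hclab
    obtain ⟨hvU, hend'⟩ := hend v hv
    obtain ⟨-, bl, p, hbl, hpre, hV⟩ := hend' h1
    obtain ⟨c', hs', hc', -⟩ := exists_check_run h hl hbl hpre hV hs
      (U.length_tailLabels v) hmd hy h2 hne
    obtain ⟨u, hu⟩ := hV.2.1 v' h2
    refine ⟨⟨v ++ u, isChild_of_subtreeWithout hu⟩, c', ?_, fun hsys =>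
      absurd hsys (not_isSys_of_not_simple (steps_at h hl hs') hc')⟩
    rw [LTree.tailLabels_append U (hsub v hv)]
    exact hs'

end

end PushdownGames

namespace PushdownGames

/-! ## Extended tree-codes are strategies -/

theorem LTree.exists_leaf {Υ A : Type} {T : LTree Υ A} (hT : T.nodes.Finite) {x : List Υ}
    (hx : x ∈ T.nodes) : ∃ r, T.IsLeaf (x ++ r) := by
  obtain ⟨_, ⟨h1, r, rfl⟩, h2⟩ := Set.exists_max_image {z | z ∈ T.nodes ∧ x <+: z} List.length
    (hT.subset fun z hz => hz.1) ⟨x, hx, List.prefix_rfl⟩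
  refine ⟨r, h1, fun y hy => ?_⟩
  obtain ⟨hy, a, rfl⟩ := hy
  have := h2 _ ⟨hy, (List.prefix_append x r).trans (List.prefix_append _ _)⟩
  simp at this

theorem LTree.mem_pathLabels {Υ A : Type} {T : LTree Υ A} {x : List Υ} {a : A} :
    a ∈ T.pathLabels x ↔ ∃ y, y <+: x ∧ T.lab y = a := by
  simp [pathLabels]

theorem LTree.pathLabels_snoc {Υ A : Type} {T : LTree Υ A} (x : List Υ) (a : Υ) :
    T.pathLabels (x ++ [a]) = T.pathLabels x ++ [T.lab (x ++ [a])] := by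
  rw [pathLabels_eq, pathLabels_eq, tailLabels_snoc, List.cons_append]

section

variable {M : ATM} {Υ : Type} {T T₀ : LTree Υ (Set (Prp M))} {x : List Υ}

theorem LTree.not_isLeaf_of_append {z : List Υ} (h : x ++ z ∈ T.nodes) (hz : z ≠ []) :
    ¬ T.IsLeaf x := by
  obtain ⟨a, z, rfl⟩ := List.exists_cons_of_ne_nil hz
  intro hl
  rw [List.append_cons] at h
  exact hl.2 _ (isChild_snoc.2 (mem_of_append z h))

/-- The codes on the path to a leaf of a tree-code. -/
theorem IsTreeCode.leaf (hT : IsTreeCode T₀) (hx : T₀.IsLeaf x)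
    {ν : List (Word M)} (hν : IsCodeSeq ν) (e : ν.flatten = T₀.pathLabels x) :
    ∃ ls ν', ν = ν'.map (List.map Letter.lbl) ∧ .bas .l :: ls = ν'.flatten ∧ LSeq M.kd ν' ∧
      T₀.tailLabels x = ls.map Letter.lbl := by
  obtain ⟨-, -, hroot, -, hleaf, -⟩ := hT
  obtain ⟨ν', h1, rfl⟩ := isCodeSeq_iff.1 hν
  rw [← List.map_flatten] at e
  have e' := e
  rw [LTree.pathLabels_eq, hroot] at e'
  obtain ⟨a, ls, h2, h3, h4⟩ := List.map_eq_cons_iff.1 e'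
  obtain rfl : a = .bas .l := Letter.lbl_inj.1 h3
  refine ⟨ls, ν', rfl, h2.symm, ⟨h1, ?_⟩, h4.symm⟩
  have hf := (hleaf x hx.1).2 hx
  rcases List.eq_nil_or_concat' x with rfl | ⟨x, b, rfl⟩
  · rw [hroot] at hf
    simp at hf
  · rw [LTree.pathLabels_snoc, hf] at e
    obtain ⟨l, l', h5, h6, h7⟩ := List.map_eq_append_iff.1 e
    obtain ⟨c, rfl, h8⟩ := List.map_eq_singleton_iff.1 h7
    obtain rfl : c = .bas .f := Letter.lbl_inj.1 h8
    -- An earlier `f` would belong to a proper prefix of the leaf, but in a tree-code only leaves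
    -- are labeled by `f`.
    refine ⟨l, h5, fun hmem => ?_⟩
    have : ({Prp.f} : Set (Prp M)) ∈ T₀.pathLabels x := by
      rw [← h6]
      exact List.mem_map_of_mem hmem
    obtain ⟨y, ⟨z, rfl⟩, hy'⟩ := LTree.mem_pathLabels.1 this
    have hmem' : y ++ (z ++ [b]) ∈ T₀.nodes := by
      rw [← List.append_assoc]
      exact hx.1
    exact LTree.not_isLeaf_of_append hmem' (by simp)
      ((hleaf y (LTree.mem_of_append _ hmem')).1 hy')

/-- The path is prolonged to a leaf, where the complete run is known, and this run is cut at `x`.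
Reading cannot have begun yet, since an `f` would then occur before the leaf. -/
theorem IsTreeCode.exists_conf (hT : IsTreeCode T₀) (hx : x ∈ T₀.nodes) (hl : ¬ T₀.IsLeaf x) :
    ∃ c, GSteps (game M).start (T₀.tailLabels x) c ∧ c.1.isGen = true ∧
      (game M).lab c = T₀.lab x := by
  obtain ⟨r, hr⟩ := LTree.exists_leaf hT.1 hx
  have hne : r ≠ [] := by
    rintro rfl
    rw [List.append_nil] at hr
    exact hl hr
  obtain ⟨μ, hμ, e⟩ := hT.2.2.2.1 _ hr
  obtain ⟨ls, ν, -, h1, h2, h3⟩ := hT.leaf hr hμ e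
  have h4 := steps_topConf ((gen_seq ls).2 ⟨ν, h1, h2⟩)
  rw [← h3, LTree.tailLabels_append T₀ hx] at h4
  obtain ⟨c, h5, -⟩ := steps_append.1 h4
  have hlab : (game M).lab c = T₀.lab x := by
    rcases List.eq_nil_or_concat' x with rfl | ⟨x, b, rfl⟩
    · obtain rfl := steps_nil.1 h5
      rw [start_lab, hT.2.2.1]
    · rw [LTree.tailLabels_snoc] at h5
      obtain ⟨-, -, -, h6⟩ := steps_snoc.1 h5
      exact h6
  refine ⟨c, h5, ?_, hlab⟩
  rcases steps_start h5 with ⟨h6, -⟩ | ⟨ls', w', h6, h7, -⟩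
  · exact h6
  · exfalso
    obtain ⟨ν', h8, -, u', h9, -⟩ := (gen_seq ls').1 h6
    obtain ⟨-, u, h10, h11⟩ := h2
    rw [LTree.tailLabels_append T₀ hx, h7, List.append_assoc] at h3
    obtain ⟨l₁, l₂, rfl, h12, h13⟩ := List.map_eq_append_iff.1 h3.symm
    obtain rfl := Letter.lbl_injective.list_map h12
    have hl₂ : l₂ ≠ [] := by
      rintro rfl
      have := congrArg List.length h13
      simp only [List.map_nil, List.length_nil, List.length_append, LTree.length_tailLabels] at this
      exact hne (List.length_eq_zero_iff.1 (by omega))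
    obtain ⟨l₂, a, rfl⟩ := (List.eq_nil_or_concat' l₂).resolve_left hl₂
    rw [← h1, ← List.append_assoc, ← List.cons_append] at h10
    obtain ⟨rfl, -⟩ := List.append_inj' h10 rfl
    have h14 : Letter.bas Bas.l :: l₁ = u' ++ [.bas .f] := h8.trans h9
    apply h11
    rw [← List.cons_append, h14]
    simp

/-- Every node satisfies the local condition `Closed`: inside the tree-code by the clause on `all`
nodes, and below its leaves because check-trees satisfy it. Determinism turns the local conditions
into a strategy. -/
theorem IsExtendedTreeCode.exists_strategyTree (hT : IsExtendedTreeCode T) :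
    ∃ 𝒯 : StrategyTree (game M) Agent.env, IsAccepting 𝒯.toLTree ∧ T.Iso 𝒯.toLTree := by
  obtain ⟨hmin, T₀, hT₀, hlab, hin, hend⟩ := hT
  have hsub : ∀ z ∈ T₀.nodes, z ∈ T.nodes := fun z hz => (hend z hz).1
  have hch : ∀ y z, T₀.IsChild y z → T.IsChild y z := fun y z hz => ⟨hsub z hz.1, hz.2⟩
  have htail : ∀ z ∈ T₀.nodes, T.tailLabels z = T₀.tailLabels z := fun z hz =>
    LTree.tailLabels_congr hz hlab
  have hcases : ∀ x ∈ T.nodes, (x ∈ T₀.nodes ∧ ¬ T₀.IsLeaf x) ∨ ∃ y z, x = y ++ z ∧ T₀.IsLeaf y := by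
    intro x hx
    induction x using List.reverseRecOn with
    | nil =>
      by_cases h : T₀.IsLeaf []
      · exact .inr ⟨[], [], rfl, h⟩
      · exact .inl ⟨T₀.root_mem, h⟩
    | append_singleton x a ih =>
      rcases ih (T.prefix_closed x a hx) with ⟨h1, h2⟩ | ⟨y, z, rfl, h1⟩
      · have h3 := hin x h1 h2 _ ⟨hx, a, rfl⟩
        by_cases h : T₀.IsLeaf (x ++ [a])
        · exact .inr ⟨x ++ [a], [], by simp, h⟩
        · exact .inl ⟨h3, h⟩
      · exact .inr ⟨y, z ++ [a], by simp, h1⟩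
  have hclosed : ∀ x ∈ T.nodes, Closed T (game M).start x := by
    intro x hx
    rcases hcases x hx with ⟨h1, h2⟩ | ⟨y, z, rfl, h1⟩
    · obtain ⟨c, h3, h4, h5⟩ := hT₀.exists_conf h1 h2
      rw [← htail x h1] at h3
      have hc : ∃ y, T₀.IsChild x y := by
        by_contra hc
        exact h2 ⟨h1, not_exists.1 hc⟩
      obtain ⟨y, hy⟩ := hc
      refine ⟨⟨y, hch x y hy⟩, c, h3, fun hsys c' hc' => ?_⟩
      have h6 := (Ctl.isSys_gen h4 _).1 hsys
      have h7 : T₀.lab x = {.all} := by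
        rw [← h5]
        exact (game_lab_gen h4 c.2).trans (by rw [h6]; rfl)
      obtain ⟨y, z, hy, hz, hyl, hzl, -⟩ := hT₀.2.2.2.2.2 x h1 h7
      obtain ⟨q, l⟩ := c
      obtain ⟨a, q₁, h8, rfl⟩ := (succ_gen_iff h4).1 hc'
      have h9 : ∃ b, q₁ = .tag b false := by
        cases q with
        | clos b fst =>
          cases a <;> simp [Ctl.next] at h8
          split_ifs at h8 <;> cases h8
          · exact ⟨_, rfl⟩
          · exact ⟨_, rfl⟩
        | pop => cases h4
        | _ => cases hsys
      obtain ⟨b, rfl⟩ := h9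
      cases b
      · refine ⟨y, hch x y hy, ?_⟩
        rw [hlab y hy.1, hyl]
        exact (game_lab_gen (q := .tag false false) rfl _).symm
      · refine ⟨z, hch x z hz, ?_⟩
        rw [hlab z hz.1, hzl]
        exact (game_lab_gen (q := .tag true false) rfl _).symm
    · obtain ⟨hyT, h2⟩ := hend y h1.1
      obtain ⟨μ, hμ, e, hU⟩ := h2 h1
      obtain ⟨ls, ν, rfl, h3, h4, h5⟩ := hT₀.leaf h1 hμ e
      obtain ⟨⟨u, hu⟩, c, h6, h7⟩ := hU.closed h4 h3 hx
      have h8 : GSteps (game M).start (T.tailLabels y) (topConf ls) := by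
        rw [htail y h1.1, h5]
        exact steps_topConf ((gen_seq ls).2 ⟨ν, h3, h4⟩)
      refine ⟨⟨y ++ u, (LTree.subtree_isChild hyT).1 hu⟩, c, ?_, fun hsys c' hc' => ?_⟩
      · rw [LTree.tailLabels_append T hyT]
        exact steps_append.2 ⟨_, h8, h6⟩
      · obtain ⟨v, hv, hv'⟩ := h7 hsys c' hc'
        exact ⟨y ++ v, (LTree.subtree_isChild hyT).1 hv, hv'⟩
  refine PushdownGames.exists_strategyTree (fun _ _ _ a b e => succ_det a b e) T hmin
    (fun x hx => (hclosed x hx).1) ?_ (fun x hx => ?_) (fun x hx c hc hp c' hc' => ?_) {Prp.f}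
    fun π hπ => ?_
  · rw [start_lab, hlab [] T₀.root_mem, hT₀.2.2.1]
  · obtain ⟨-, c, h1, -⟩ := hclosed x hx
    exact ⟨c, h1⟩
  · obtain ⟨-, c₁, h1, h2⟩ := hclosed x hx
    obtain rfl := gsteps_det h1 hc
    exact h2 ((passive_env_iff _).1 hp) c' hc'
  -- A path that avoids `f` never passes a leaf of the tree-code, so it would stay in this finite
  -- tree forever.
  · by_contra! hf
    have hmem : ∀ n, π n ∈ T₀.nodes := by
      intro n
      induction n with
      | zero =>
        rw [hπ.1]
        exact T₀.root_mem
      | succ n ih =>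
        refine hin _ ih (fun hl => hf n ?_) _ (hπ.2 n)
        rw [hlab _ ih]
        exact (hT₀.2.2.2.2.1 _ ih).2 hl
    refine (Set.infinite_of_injective_forall_mem (f := π) (fun m n e => ?_) hmem) hT₀.1
    rw [← hπ.length m, ← hπ.length n, e]

end

end PushdownGames

namespace PushdownGames

/-! ## The nodes controlled by the system -/

section

variable {M : ATM} {Υ : Type} {U : LTree Υ (Set (Prp M))} {cf : List Υ → Conf M} {c₀ : Conf M}
  {ν : List (List (Letter M.Cell))} {x : List Υ} {n : ℕ}

/-- System nodes keep all their successors, so they branch visibly, by `check3` or at `end2`.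
Branchings of the environment look different: they are due to `checkHat3`, or to `check1` after
`end1`. Outside the simple modes an `end2` has only one successor. -/
theorem Follows.isSys_iff (h : LSeq M.kd ν) (hU : Follows U cf c₀) (hx : x ∈ U.nodes)
    (hat : At (content ν) n (cf x)) : (cf x).1.isSys (cf x).2.head? = true ↔
      IsTagBranching U .check3 x ∨ (U.lab x = {.end2} ∧ U.IsBranching x) := by
  have hlab := hU.lab x hx
  have hsucc : ∀ y, U.IsChild x y → (game M).Succ (cf x) (cf y) := hU.succ x
  have hsys := hU.sys x hx
  rcases hat with ⟨b, hb⟩ | ⟨md, mk, x', fl, l, e, e1, hmk⟩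
  · have e : cf x = (.sink b, (cf x).2) := Prod.ext hb rfl
    refine ⟨fun h => ?_, ?_⟩
    · rw [e] at h
      cases h
    · rw [hlab, e, game_lab_sink]
      rintro (⟨h1, -⟩ | ⟨h1, -⟩)
      · rw [hlab, e, game_lab_sink] at h1
        exact absurd h1.symm (Set.singleton_ne_empty _)
      · exact absurd h1.symm (Set.singleton_ne_empty _)
  · rw [e] at hlab hsucc hsys ⊢
    rw [game_lab_pop] at hlab
    constructor
    · intro h1
      obtain ⟨y, l, rfl, ⟨rfl, ⟨b, hb⟩, hf⟩ | ⟨hmd, rfl, hy⟩⟩ := isSys_pop h1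
      · left
        obtain rfl : x' = .bas .end3 := content_win h e1 hb
        obtain rfl : mk = none := by
          rcases hmk with h3 | h3 | ⟨b, h3⟩
          · exact h3
          · cases h3
          · cases h3
        have hs := fun c => succ_window (M := M) (md := .A) (mk := none) (x := .bas .end3) (l := l)
          (c := c) rfl hb
        obtain ⟨u, hu, hu'⟩ := hsys h1 _ ((hs _).2 (.inl ⟨rfl, fun h => hf h.2, fun h => by cases h.1⟩))
        obtain ⟨v, hv, hv'⟩ := hsys h1 _ ((hs _).2 (.inr (.inl ⟨rfl, rfl⟩)))
        obtain ⟨p, u₁, s, hp⟩ := cls_eq_win hb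
        refine ⟨by rw [hlab, Letter.mlbl_none]; rfl, p, u₁, s, u, v, hu, hv, ?_, ?_, fun w hw => ?_⟩
        · rw [hU.lab _ hu.1, hu', game_lab_pop, hp, Letter.mlbl_none]
          rfl
        · rw [hU.lab _ hv.1, hv', game_lab_pop, hp, Letter.mlbl_some]
          rfl
        · rcases (hs _).1 (hsucc w hw) with ⟨h2, -⟩ | ⟨h2, -⟩ | ⟨-, h2⟩
          · exact .inl (hU.eq_of_conf hw hu (h2.trans hu'.symm))
          · exact .inr (hU.eq_of_conf hw hv (h2.trans hv'.symm))
          · cases h2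
      · right
        obtain rfl : mk = none := by
          rcases hmk with h3 | h3 | ⟨b, h3⟩
          · exact h3
          · cases h3
          · cases h3
        obtain ⟨u, hu, hu'⟩ := hsys h1 _ ((succ_end2 hmd hy).2 (.inl rfl))
        obtain ⟨v, hv, hv'⟩ := hsys h1 _ ((succ_end2 hmd hy).2 (.inr rfl))
        refine ⟨by rw [hlab, Letter.mlbl_none]; rfl, u, v, hu, hv, ?_⟩
        rintro rfl
        rw [hu'] at hv'
        cases hv'
    · rintro (⟨-, p, u, s, y, z, hy, hz, hyl, hzl, -⟩ | ⟨h1, u, v, hu, hv, huv⟩)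
      · have h2 := hsucc y hy
        have h3 := hsucc z hz
        rw [hU.lab y hy.1] at hyl
        rw [hU.lab z hz.1] at hzl
        by_cases hf : md.isFinal x'.cls = true
        · rw [succ_pop_final hf] at h2
          rw [h2, game_lab_sink] at hyl
          exact absurd hyl.symm (Set.singleton_ne_empty _)
        · rw [Bool.not_eq_true] at hf
          cases l with
          | nil =>
            rw [succ_pop_nil hf] at h2
            rw [h2, game_lab_sink] at hyl
            exact absurd hyl.symm (Set.singleton_ne_empty _)
          | cons a l =>
            obtain ⟨m, md₁, h4, h5⟩ := (succ_pop_cons hf).1 h2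
            obtain ⟨m', md₂, h6, h7⟩ := (succ_pop_cons hf).1 h3
            rw [h5, game_lab_pop] at hyl
            rw [h7, game_lab_pop] at hzl
            have hyl' : a.2.mlbl m = (Letter.lam p u s).mlbl none := by
              rw [hyl, Letter.mlbl_none]
              rfl
            have hzl' : a.2.mlbl m' = (Letter.lam p u s).mlbl (some .check3) := by
              rw [hzl, Letter.mlbl_some]
              rfl
            obtain ⟨ha, rfl⟩ := Letter.mlbl_inj.1 hyl'
            obtain ⟨-, rfl⟩ := Letter.mlbl_inj.1 hzl'
            have hb : a.2.cls = .win p.isNone := by rw [ha]; rfl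
            obtain rfl : md = .A := by
              rw [hb] at h6
              cases md <;> simp [Mode.next] at h6
              rfl
            -- The two labels show that the mode is `A`. At the first triple of the first code the
            -- unmarked child could not exist.
            refine isSys_window hb ?_
            rintro ⟨hf1, hf2⟩
            rw [hf1, hf2] at h4
            simp [Mode.next] at h4
      · have : x'.mlbl mk = (Letter.bas Bas.end2 : Letter M.Cell).mlbl none := by
          rw [← hlab, h1, Letter.mlbl_none]
          rfl
        obtain ⟨rfl, rfl⟩ := Letter.mlbl_inj.1 this
        obtain ⟨y, l, -, -, -, rfl, hy, -⟩ := content_end2 h e1 rfl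
        by_cases hmd : md.isSimple = true
        · exact isSys_end2 hmd hy
        · refine absurd (hU.eq_of_conf hv hu ?_) huv.symm
          refine succ_plain ?_ (fun h => hmd h.1) ?_ (hsucc u hu) (hsucc v hv)
          · rintro ⟨b, hb⟩
            rw [hy] at hb
            cases hb
          · rintro ⟨-, h2, -⟩
            cases h2

theorem Follows.at_of_inCheckSubtree (hU : Follows U cf (game M).start)
    (hx : InCheckSubtree U x) : ∃ ν n, LSeq M.kd ν ∧ At (content ν) n (cf x) := by
  obtain ⟨hx, y, ⟨t, rfl⟩, hy⟩ := hx
  rcases hU.node_cases (LTree.mem_of_append t hx) with ⟨-, h⟩ | ⟨y, z, ls, ν, rfl, -, h2, h3, -, h5⟩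
  · exact absurd hy h
  · rw [List.append_assoc] at hx
    have hU' := hU.subtree (LTree.mem_of_append _ hx)
    rw [h5] at hU'
    have := hU'.at h3 h2 (z := z ++ t) hx
    rw [List.append_assoc]
    exact ⟨ν, _, h3, this⟩

end

end PushdownGames

theorem mainTheorem7 :
    ∃ build : ATM → Table,
      Nonempty (Turing.TM2ComputableInPolyTime ATM.write Table.write build) ∧
      ∀ M : ATM, ∃ (Ac Q Γ : Type) (_ : Finite Ac) (_ : Finite Q) (_ : Finite Γ)
        (S : PMS (Prp M) Agent Ac Q Γ),
        Describes (build M) S ∧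
        S.toCGS.IsOpen Agent.env ∧
        ((∀ 𝒯 : StrategyTree S.toCGS Agent.env, IsAccepting 𝒯.toLTree →
            IsExtendedTreeCode 𝒯.toLTree) ∧
          ∀ (Υ : Type) (T : LTree Υ (Set (Prp M))), IsExtendedTreeCode T →
            ∃ 𝒯 : StrategyTree S.toCGS Agent.env, IsAccepting 𝒯.toLTree ∧ T.Iso 𝒯.toLTree) ∧
        ∀ 𝒯 : StrategyTree S.toCGS Agent.env, IsAccepting 𝒯.toLTree →
          ∀ x : 𝒯.nodes, InCheckSubtree 𝒯.toLTree x →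
            (𝒯.toCGS.ControlledBy Agent.sys x ↔
              IsTagBranching 𝒯.toLTree Prp.check3 x ∨
                (𝒯.toLTree.lab x = {Prp.end2} ∧ 𝒯.toLTree.IsBranching x)) := by
  obtain ⟨build, h₁, h₂⟩ := exists_describes
  refine ⟨build, h₁, fun M => ⟨_, _, _, inferInstance, inferInstance, inferInstance, pms M, h₂ M,
    game_isOpen M, ⟨fun 𝒯 h𝒯 => 𝒯.follows.isExtendedTreeCode h𝒯 𝒯.finite_children,
      fun Υ T hT => hT.exists_strategyTree⟩, fun 𝒯 _ x hx => ?_⟩⟩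
  obtain ⟨ν, n, h₃, h₄⟩ := 𝒯.follows.at_of_inCheckSubtree hx
  exact (𝒯.controlledBy_sys_iff x).trans (𝒯.follows.isSys_iff h₃ hx.1 h₄)
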